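/- **Setting.** Let $\mathbf k$ be a commutative ring with unit and $Q$ a quiver with vertex set $I$. Let $\overline Q=Q\sqcup Q^*$ be its double, where $e^*:j\to i$ for $e:i\to j$, and put $(e^*)^*:=e$. Write $a_s,a_t$ for the source and target of an arrow $a$. Put $\omega(e,e^*)=-\omega(e^*,e)=1$ for $e\in Q$, and $\omega(a,b)=0$ if $a\ne b^*$. **Paths and necklaces.** Let $P$ be the free $\mathbf k$-module on the paths in $\overline Q$ (including the trivial path at each vertex), and $L=P/[P,P]$ the free $\mathbf k$-module on the cyclic paths (closed paths up to rotation). With $x\wedge y=x\otimes y-y\otimes x$, define $$\delta_{p,rt}(a_1\cdots a_n)=\sum_{i<j}-\omega(a_i,a_j)\,(a_i)_t a_{i+1}\cdots a_{j-1}\otimes (a_1)_s a_1\cdots a_{i-1}a_{j+1}\cdots a_n,$$ $$\delta_{or}([a_1\cdots a_n])=\sum_{i<j}\omega(a_i,a_j)\,[(a_j)_t a_{j+1}\cdots a_n a_1\cdots a_{i-1}]\wedge[(a_i)_t a_{i+1}\cdots a_{j-1}].$$ A *cut* $H$ of a path $X=a_1\cdots a_n$ is a set of pairs (chords) $(i,j)$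 with $i<j$ and $\{a_i,a_j\}=\{e,e^*\}$ for some $e\in Q$, all indices occurring being distinct, and no two chords crossing ($i<i'<j<j'$). It is *simple* if no two chords are nested ($i<i'<j'<j$). Put $\varepsilon_H=\prod_{(i,j)\in H}-\omega(a_i,a_j)$. Draw the chords as disjoint arcs above a horizontal line carrying $a_1,\dots,a_n$ from left to right. The faces are the unbounded face and, for each chord $c$, the face immediately below $c$. The arrows on the boundary of a face that are not ends of chords form, in order, a path: $X_{H,0}$ (starting at $(a_1)_s$) for the unbounded face, and $X_{H,c}$ (starting at $(a_i)_t$) for the face below $c=(i,j)$. On $\operatorname{Sym}P$ let $\Delta$ be the algebra homomorphism with $$\Delta(X)=X\otimes1+\sum_{H\ \text{simple}}\varepsilon_H\Big(\prod_{c\in H}X_{H,c}\Big)\otimes X_{H,0}$$ for paths $X$, and let the counit be the algebra homomorphism vanishing on $P$. **Trees.** All trees are finite. $\Phi_{rt}$ assigns to a rooted tree the set of structures consisting of a cyclic ordering of the edges at each vertex (ribbon structure), a corner at the root (a linear ordering of the edges at the root obtained from the cyclic one by choosing an initial edge), an orientation of all edges, and a labelling of the vertices by paths in $\overline Q$. $\Phi_{or}$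 assigns to an oriented tree the set of ribbon structures together with a labelling of the vertices by cyclic paths in $\overline Q$. $\mathcal T_{rt}(\Phi_{rt})$ and $\mathcal T_{or}(\Phi_{or})$ are the free $\mathbf k$-modules on the isomorphism classes of pairs $(T,s)$. Structures restrict to subtrees; the root of a subtree is its vertex closest to the root of $T$, and if this vertex is not the root of $T$, the new corner is obtained by taking the edge leading towards the root of $T$ as initial edge (and then deleting it). Define $$\rho(T,s)=\sum_{e}(T_e^1,s|_{T_e^1})\otimes(T_e^2,s|_{T_e^2}),\qquad \rho_O^{ss}(T,s)=\sum_e (T_e^1,s|_{T_e^1})\wedge(T_e^2,s|_{T_e^2}),$$ where $T\setminus e=T_e^1\sqcup T_e^2$ and $T_e^2$ contains the root (rooted case), resp. $e$ points from $T_e^1$ to $T_e^2$ (oriented case). A cut $H\subset E(T)$ of a rooted tree is *simple* if each path starting at the root contains at most one edge of $H$; then $T_{H,0}$ is the component of $T\setminus H$ containing the root and $T_{H,e}$ the component at the far end of $e\in H$. The Connes–Kreimer coproduct on $\operatorname{Sym}\mathcal T_{rt}(\Phi_{rt})$ is the algebra homomorphism with $$\Delta(T,s)=(T,s)\otimes1+\sum_{H\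 \text{simple}}\Big(\prod_{e\in H}(T_{H,e},s|_{T_{H,e}})\Big)\otimes(T_{H,0},s|_{T_{H,0}}),$$ and the counit is the algebra homomorphism vanishing on $\mathcal T_{rt}(\Phi_{rt})$. **The maps.** For a cut $H$ of a path $X$, let $T_H$ be the tree whose vertices are the faces, with one edge across each chord, and whose root is the unbounded face. Its structure $s_H$ is as follows. The edges at a face are ordered cyclically by the left-to-right order in which the boundary chords of the face are first met, and at the root this order is the corner. The edge across a chord $(i,j)$ points into the face below the chord if $a_i\in Q$ and out of it if $a_i\in Q^*$. The face below a chord $c$ is labelled by $X_{H,c}$ and the unbounded face by $X_{H,0}$. If $X$ is closed, let $(T_{H,or},s_{H,or})$ be obtained from it by forgetting the root and the corner and replacing the labels by their cyclic paths. Put $$\eta_{rt}(X)=\sum_{\text{cuts }H}\varepsilon_H\,(T_H,s_H),\qquad \eta_{or}([X])=\sum_{\text{cuts }H}(T_{H,or},s_{H,or}).$$ **Theorem.** The formulas for $\delta_{or}$ and $\eta_{or}$ do not depend on the initial edge chosen for a cyclic path, and those for $\rho$, $\rho_O^{ss}$ and $\Delta$ on trees depend only on the isomorphism class of $(T,s)$.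 Moreover: 1. $(P,\delta_{p,rt})$ and $(\mathcal T_{rt}(\Phi_{rt}),\rho)$ are (left) pre-Lie coalgebras, and the linear extension of $\eta_{rt}$ is an injective homomorphism $(P,\delta_{p,rt})\to(\mathcal T_{rt}(\Phi_{rt}),\rho)$ of pre-Lie coalgebras. 2. $(L,\delta_{or})$ and $(\mathcal T_{or}(\Phi_{or}),\rho_O^{ss})$ are Lie coalgebras, and the linear extension of $\eta_{or}$ is an injective homomorphism $(L,\delta_{or})\to(\mathcal T_{or}(\Phi_{or}),\rho_O^{ss})$ of Lie coalgebras. 3. $\operatorname{Sym}P$ and $\operatorname{Sym}\mathcal T_{rt}(\Phi_{rt})$ are commutative Hopf algebras with the above coproducts and counits, and the multiplicative extension of $\eta_{rt}$ is an injective homomorphism $\operatorname{Sym}P\to\operatorname{Sym}\mathcal T_{rt}(\Phi_{rt})$ of Hopf algebras. -/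

import Mathlib

namespace Necklaces

open scoped TensorProduct

noncomputable section

/-! ### Paths in the double quiver -/

/-- The arrows of the double quiver `Q ⊔ Q*`: `Sum.inl e` is the arrow `e` of `Q`, and
`Sum.inr e` is its reverse `e*`. -/
abbrev Arrow (I : Type*) [Quiver I] := Quiver.Total I ⊕ Quiver.Total I

section Paths

variable {I : Type*} [Quiver I]

/-- The source of an arrow of the double quiver. -/
def Arrow.src (a : Arrow I) : I := Sum.elim (fun e => e.left) (fun e => e.right) a

/-- The target of an arrow of the double quiver. -/
def Arrow.tgt (a : Arrow I) : I := Sum.elim (fun e => e.right) (fun e => e.left) a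

/-- The involution `e ↦ e*`, `e* ↦ e`. -/
def Arrow.star (a : Arrow I) : Arrow I := Sum.swap a

open Classical in
/-- `ω(e, e*) = 1` and `ω(e*, e) = -1` for an arrow `e` of `Q`; `ω(a, b) = 0` if `a ≠ b*`. -/
def omega (a b : Arrow I) : ℤ := if a = Arrow.star b then (if a.isLeft then 1 else -1) else 0

/-- `IsPath i l`: the arrows of the list `l` are composable, the first one starting at `i`. -/
def IsPath : I → List (Arrow I) → Prop
  | _, [] => True
  | i, a :: l => Arrow.src a = i ∧ IsPath (Arrow.tgt a) l

/-- The vertex at which the word `l`, begun at `i`, ends. -/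
def endVertex : I → List (Arrow I) → I
  | i, [] => i
  | _, a :: l => endVertex (Arrow.tgt a) l

variable (I) in
/-- Paths in the double quiver, including the trivial path at every vertex. -/
@[ext] structure QPath where
  start : I
  arrows : List (Arrow I)
  isPath : IsPath start arrows

theorem isPath_append (i : I) (l l' : List (Arrow I)) :
    IsPath i (l ++ l') ↔ IsPath i l ∧ IsPath (endVertex i l) l' := by
  induction l generalizing i with
  | nil => simp [IsPath, endVertex]
  | cons a l ih => simp [IsPath, endVertex, ih, and_assoc]

theorem endVertex_append (i : I) (l l' : List (Arrow I)) :
    endVertex i (l ++ l') = endVertex (endVertex i l) l' := by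
  induction l generalizing i with
  | nil => simp [endVertex]
  | cons a l ih => simp [endVertex, ih]

namespace QPath

/-- The length `n` of the path `a_1 ⋯ a_n`. Positions are numbered `0, …, n - 1` below. -/
def length (X : QPath I) : ℕ := X.arrows.length

/-- The vertex reached after the first `m` arrows: it is the target of the arrow in
position `m - 1` and the source of the arrow in position `m`. -/
def vert (X : QPath I) (m : ℕ) : I := endVertex X.start (X.arrows.take m)

/-- A path is closed if it ends where it begins. -/
def IsClosed (X : QPath I) : Prop := endVertex X.start X.arrows = X.start

/-- The value `ω(a_i, a_j)` for the arrows in positions `i` and `j`. -/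
def om (X : QPath I) (c : ℕ × ℕ) : ℤ :=
  if h : c.1 < X.arrows.length ∧ c.2 < X.arrows.length then
    omega (X.arrows[c.1]'h.1) (X.arrows[c.2]'h.2) else 0

/-- A chord of a path: positions `i < j` such that `{a_i, a_j} = {e, e*}` for some arrow `e`
of the quiver. -/
def IsChord (X : QPath I) (c : ℕ × ℕ) : Prop :=
  c.1 < c.2 ∧ ∃ a, X.arrows[c.1]? = some a ∧ X.arrows[c.2]? = some (Arrow.star a)

theorem src_tgt (X : QPath I) {m : ℕ} {a : Arrow I} (h : X.arrows[m]? = some a) :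
    Arrow.src a = X.vert m ∧ X.vert (m + 1) = Arrow.tgt a := by
  obtain ⟨hm, rfl⟩ := List.getElem?_eq_some_iff.1 h
  have h1 := X.isPath
  rw [← List.take_append_drop m X.arrows, isPath_append, List.drop_eq_getElem_cons hm] at h1
  refine ⟨h1.2.1, ?_⟩
  rw [vert, ← List.take_append_getElem hm, endVertex_append]
  rfl

theorem IsChord.lt_length {X : QPath I} {c : ℕ × ℕ} (h : X.IsChord c) :
    c.1 < X.length ∧ c.2 < X.length := by
  obtain ⟨h1, a, ha, hb⟩ := h
  exact ⟨(List.getElem?_eq_some_iff.1 ha).1, (List.getElem?_eq_some_iff.1 hb).1⟩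

theorem IsChord.vert_eq {X : QPath I} {c : ℕ × ℕ} (h : X.IsChord c) :
    X.vert (c.2 + 1) = X.vert c.1 ∧ X.vert c.2 = X.vert (c.1 + 1) := by
  obtain ⟨h1, a, ha, hb⟩ := h
  have h2 := X.src_tgt ha
  have h3 := X.src_tgt hb
  refine ⟨h3.2.trans (Eq.trans ?_ h2.1), (h3.1.symm.trans (Eq.trans ?_ h2.2.symm))⟩ <;>
    rcases a with a | a <;> rfl

theorem isPath_drop (X : QPath I) (m : ℕ) : IsPath (X.vert m) (X.arrows.drop m) := by
  have h1 := X.isPath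
  rw [← List.take_append_drop m X.arrows, isPath_append] at h1
  exact h1.2

theorem isPath_take (X : QPath I) (m : ℕ) : IsPath X.start (X.arrows.take m) := by
  have h1 := X.isPath
  rw [← List.take_append_drop m X.arrows, isPath_append] at h1
  exact h1.1

/-- For a chord `(i, j)`, the path `(a_i)_t a_{i+1} ⋯ a_{j-1}`. -/
def inner (X : QPath I) (c : ℕ × ℕ) : QPath I where
  start := X.vert (c.1 + 1)
  arrows := (X.arrows.take c.2).drop (c.1 + 1)
  isPath := by
    by_cases h : c.1 + 1 ≤ c.2
    · have := isPath_drop ⟨X.start, X.arrows.take c.2, X.isPath_take c.2⟩ (c.1 + 1)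
      simpa [vert, List.take_take, h] using this
    · rw [List.drop_eq_nil_of_le (by simp; omega)]
      trivial

/-- For a chord `(i, j)`, the path `(a_1)_s a_1 ⋯ a_{i-1} a_{j+1} ⋯ a_n`. -/
def outer (X : QPath I) (c : ℕ × ℕ) (h : X.IsChord c) : QPath I where
  start := X.start
  arrows := X.arrows.take c.1 ++ X.arrows.drop (c.2 + 1)
  isPath := by
    rw [isPath_append]
    refine ⟨X.isPath_take _, ?_⟩
    have := X.isPath_drop (c.2 + 1)
    rwa [h.vert_eq.1] at this

theorem inner_isClosed {X : QPath I} {c : ℕ × ℕ} (h : X.IsChord c) : (X.inner c).IsClosed := by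
  have h1 : X.vert c.2 = X.vert (c.1 + 1) := h.vert_eq.2
  have h2 : c.1 + 1 ≤ c.2 := h.1
  unfold IsClosed inner
  simp only
  rw [← h1]
  conv_rhs => rw [vert, ← List.take_append_drop (c.1 + 1) (X.arrows.take c.2), endVertex_append,
    List.take_take, min_eq_left h2]
  rw [h1]
  rfl

theorem outer_isClosed {X : QPath I} {c : ℕ × ℕ} (h : X.IsChord c) (hX : X.IsClosed) :
    (X.outer c h).IsClosed := by
  unfold IsClosed outer
  simp only
  have h1 : endVertex X.start (X.arrows.take (c.2 + 1)) = endVertex X.start (X.arrows.take c.1) :=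
    h.vert_eq.1
  rw [endVertex_append, ← h1, ← endVertex_append, List.take_append_drop]
  exact hX

/-! ### Cuts and the paths they produce -/

/-- A cut of a path: a set of pairwise disjoint, pairwise non-crossing chords. -/
structure IsCut (X : QPath I) (H : Finset (ℕ × ℕ)) : Prop where
  chord : ∀ c ∈ H, X.IsChord c
  distinct : ∀ c ∈ H, ∀ d ∈ H, c ≠ d → c.1 ≠ d.1 ∧ c.1 ≠ d.2 ∧ c.2 ≠ d.2
  noncrossing : ∀ c ∈ H, ∀ d ∈ H, ¬ (c.1 < d.1 ∧ d.1 < c.2 ∧ c.2 < d.2)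

/-- A cut is simple if no chord of it lies inside another one. -/
def IsSimple (H : Finset (ℕ × ℕ)) : Prop :=
  ∀ c ∈ H, ∀ d ∈ H, ¬ (c.1 < d.1 ∧ d.2 < c.2)

open Classical in
/-- The finite set of all cuts of a path. -/
def cuts (X : QPath I) : Finset (Finset (ℕ × ℕ)) :=
  ((Finset.range X.length ×ˢ Finset.range X.length).powerset).filter (fun H => X.IsCut H)

open Classical in
/-- The finite set of all chords of a path. -/
def chords (X : QPath I) : Finset (ℕ × ℕ) :=
  (Finset.range X.length ×ˢ Finset.range X.length).filter (fun c => X.IsChord c)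

theorem mem_cuts {X : QPath I} {H : Finset (ℕ × ℕ)} : H ∈ X.cuts ↔ X.IsCut H := by
  classical
  rw [cuts, Finset.mem_filter, Finset.mem_powerset, and_iff_right_iff_imp]
  intro h c hc
  have := (h.chord c hc).lt_length
  simp [this.1, this.2]

theorem mem_chords {X : QPath I} {c : ℕ × ℕ} : c ∈ X.chords ↔ X.IsChord c := by
  classical
  rw [chords, Finset.mem_filter, and_iff_right_iff_imp]
  intro h
  simp [h.lt_length.1, h.lt_length.2]

/-- The sign `ε_H = ∏ -ω(a_i, a_j)`, the product over the chords `(i, j)` of `H`. -/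
def eps (X : QPath I) (H : Finset (ℕ × ℕ)) : ℤ := ∏ c ∈ H, -X.om c

/-- The faces of the chord diagram of `H` (chords drawn as arcs above the line, which carries the
word from left to right): the unbounded face `none`, and for each chord `c` the face `some c`
immediately below `c`. -/
abbrev Face (H : Finset (ℕ × ℕ)) : Type := Option {c : ℕ × ℕ // c ∈ H}

/-- The face `v` lies in the region under the chord of `u`, and below the chord of `v` itself (every
bounded face lies in this sense under the unbounded one). -/
def Encl (H : Finset (ℕ × ℕ)) : Face H → Face H → Prop
  | _, none => False
  | none, some _ => True
  | some d, some c => d.1.1 < c.1.1 ∧ c.1.2 < d.1.2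

/-- The position `m` lies under the chord of the face (no condition for the unbounded face). -/
def Below (H : Finset (ℕ × ℕ)) : Face H → ℕ → Prop
  | none, _ => True
  | some c, m => c.1.1 < m ∧ m < c.1.2

/-- The arrow in position `m` is on the boundary of the face `u` and is not an end of a chord:
it lies under the chord of `u`, but neither under nor at the end of a chord inside that one. -/
def InFace (H : Finset (ℕ × ℕ)) (u : Face H) (m : ℕ) : Prop :=
  Below H u m ∧ ∀ d : {c : ℕ × ℕ // c ∈ H}, Encl H u (some d) → ¬ (d.1.1 ≤ m ∧ m ≤ d.1.2)

open Classical in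
/-- The arrows, in order, that lie on the boundary of the face `u`, among the first `m` ones. -/
def faceWordUpTo (X : QPath I) (H : Finset (ℕ × ℕ)) (u : Face H) (m : ℕ) : List (Arrow I) :=
  (List.range m).filterMap (fun p => if InFace H u p then X.arrows[p]? else none)

/-- The arrows, in order, that lie on the boundary of the face `u`. -/
def faceWord (X : QPath I) (H : Finset (ℕ × ℕ)) (u : Face H) : List (Arrow I) :=
  X.faceWordUpTo H u X.length

/-- The first vertex of the path in a face: the start of the path for the unbounded face,
and the target `(a_i)_t` for the face below the chord `(i, j)`. -/
def faceStart (X : QPath I) (H : Finset (ℕ × ℕ)) : Face H → I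
  | none => X.start
  | some c => X.vert (c.1.1 + 1)

theorem faceWordUpTo_succ (X : QPath I) (H : Finset (ℕ × ℕ)) (u : Face H) (m : ℕ) :
    X.faceWordUpTo H u (m + 1) = X.faceWordUpTo H u m ∨
      (InFace H u m ∧ ∃ a, X.arrows[m]? = some a ∧
        X.faceWordUpTo H u (m + 1) = X.faceWordUpTo H u m ++ [a]) := by
  classical
  by_cases h : InFace H u m
  · cases ha : X.arrows[m]? with
    | none => left; simp [faceWordUpTo, List.range_succ, h, ha]
    | some a => right; exact ⟨h, a, rfl, by simp [faceWordUpTo, List.range_succ, h, ha]⟩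
  · left; simp [faceWordUpTo, List.range_succ, h]

theorem faceWordUpTo_eq (X : QPath I) (H : Finset (ℕ × ℕ)) (u : Face H) {m m' : ℕ} (h : m ≤ m')
    (hm : ∀ p, m ≤ p → p < m' → ¬ InFace H u p) :
    X.faceWordUpTo H u m' = X.faceWordUpTo H u m := by
  induction m', h using Nat.le_induction with
  | base => rfl
  | succ q hq ih =>
    rcases X.faceWordUpTo_succ H u q with h | ⟨h, -⟩
    · rw [h, ih (fun p h1 h2 => hm p h1 (by omega))]
    · exact absurd h (hm q hq (by omega))

/-- The position at which the face begins. -/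
def faceLo (H : Finset (ℕ × ℕ)) : Face H → ℕ
  | none => 0
  | some c => c.1.1 + 1

theorem faceWordUpTo_spec {X : QPath I} {H : Finset (ℕ × ℕ)} (hH : X.IsCut H) (u : Face H)
    (m : ℕ) (hlo : faceLo H u ≤ m) (hm : m ≤ X.length) (hhi : ∀ c, u = some c → m ≤ c.1.2)
    (hgood : ∀ d : {c : ℕ × ℕ // c ∈ H}, Encl H u (some d) → ¬ (d.1.1 < m ∧ m ≤ d.1.2)) :
    IsPath (X.faceStart H u) (X.faceWordUpTo H u m) ∧
      endVertex (X.faceStart H u) (X.faceWordUpTo H u m) = X.vert m := by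
  induction m using Nat.strong_induction_on with
  | _ m ih =>
  rcases hlo.eq_or_lt with h | h
  · have h0 : X.faceWordUpTo H u m = [] := by
      have := X.faceWordUpTo_eq H u (Nat.zero_le m) (fun p _ hp hin => by
        rcases u with _ | c
        · simp [faceLo] at h; omega
        · have := hin.1.1; simp only [faceLo] at h; omega)
      rw [this]; rfl
    rw [h0]
    refine ⟨trivial, ?_⟩
    rcases u with _ | c
    · simp only [faceLo] at h; subst h; rfl
    · simp only [faceLo] at h; subst h; rfl
  · obtain ⟨q, rfl⟩ : ∃ q, m = q + 1 := ⟨m - 1, by omega⟩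
    by_cases hin : InFace H u q
    · obtain ⟨ih1, ih2⟩ := ih q (by omega) (by omega) (by omega)
        (fun c hc => by have := hhi c hc; omega)
        (fun d hd h => hin.2 d hd ⟨by omega, by omega⟩)
      have hq : X.arrows[q]? = some (X.arrows[q]'hm) := List.getElem?_eq_getElem hm
      have h1 := X.src_tgt hq
      have h2 : X.faceWordUpTo H u (q + 1) = X.faceWordUpTo H u q ++ [X.arrows[q]'hm] := by
        classical
        simp [faceWordUpTo, List.range_succ, hin, hq]
      rw [h2, isPath_append, endVertex_append, ih2]
      exact ⟨⟨ih1, h1.1, trivial⟩, h1.2.symm⟩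
    · have hb : Below H u q := by
        rcases u with _ | c
        · trivial
        · have := hhi c rfl
          simp only [faceLo] at h
          exact ⟨by omega, by omega⟩
      have : ∃ d : {c : ℕ × ℕ // c ∈ H}, Encl H u (some d) ∧ d.1.1 ≤ q ∧ q ≤ d.1.2 := by
        by_contra hcon
        exact hin ⟨hb, fun d hd hdq => hcon ⟨d, hd, hdq⟩⟩
      obtain ⟨d, hd, hd1, hd2⟩ := this
      have hdq : d.1.2 = q := by
        by_contra hne
        exact hgood d hd ⟨by omega, by omega⟩
      have hch := hH.chord d.1 d.2
      have hlt := hch.1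
      have hlo' : faceLo H u ≤ d.1.1 := by
        rcases u with _ | c
        · exact Nat.zero_le _
        · exact hd.1
      obtain ⟨ih1, ih2⟩ := ih d.1.1 (by omega) hlo' (by omega)
        (fun c hc => by have := hhi c hc; omega)
        (fun d' hd' h => by
          by_cases hdd : d' = d
          · subst hdd; omega
          · have h1 := hH.distinct d'.1 d'.2 d.1 d.2 (fun h => hdd (Subtype.ext h))
            have h1' := hH.distinct d.1 d.2 d'.1 d'.2 (fun h => hdd (Subtype.ext h.symm))
            by_cases h2 : d.1.2 < d'.1.2
            · exact hgood d' hd' ⟨by omega, by omega⟩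
            · exact hH.noncrossing d'.1 d'.2 d.1 d.2 ⟨h.1, by omega, by omega⟩)
      have he : X.faceWordUpTo H u (q + 1) = X.faceWordUpTo H u d.1.1 := by
        refine X.faceWordUpTo_eq H u (by omega) (fun p hp1 hp2 hpin => ?_)
        exact hpin.2 d hd ⟨hp1, by omega⟩
      rw [he, ih2, ← hdq, hch.vert_eq.1]
      exact ⟨ih1, rfl⟩

/-- The position at which the face ends. -/
def faceHi (X : QPath I) (H : Finset (ℕ × ℕ)) : Face H → ℕ
  | none => X.length
  | some c => c.1.2

theorem faceWord_spec {X : QPath I} {H : Finset (ℕ × ℕ)} (hH : X.IsCut H) (u : Face H) :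
    IsPath (X.faceStart H u) (X.faceWord H u) ∧
      endVertex (X.faceStart H u) (X.faceWord H u) = X.vert (X.faceHi H u) := by
  rcases u with _ | c
  · refine faceWordUpTo_spec hH none X.length (Nat.zero_le _) le_rfl (fun c hc => by cases hc) ?_
    intro d _ h
    have := (hH.chord d.1 d.2).lt_length
    omega
  · have hc := hH.chord c.1 c.2
    have hl := hc.lt_length
    have hlt := hc.1
    have h1 := faceWordUpTo_spec hH (some c) c.1.2 hlt hl.2.le
      (fun c' hc' => by cases hc'; exact le_rfl)
      (fun d hd h => by
        have := hd.2
        omega)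
    have h2 : X.faceWord H (some c) = X.faceWordUpTo H (some c) c.1.2 :=
      X.faceWordUpTo_eq H _ hl.2.le (fun p hp _ hin => by have := hin.1.2; omega)
    rw [h2]
    exact h1

/-- The path in the face `u` that remains after the cut `H`: it is `X_{H,0}` for the unbounded
face `none`, and `X_{H,c}` for the face `some c` below the chord `c`. -/
def facePath (X : QPath I) (H : Finset (ℕ × ℕ)) (hH : X.IsCut H) (u : Face H) : QPath I where
  start := X.faceStart H u
  arrows := X.faceWord H u
  isPath := (faceWord_spec hH u).1

theorem facePath_isClosed {X : QPath I} {H : Finset (ℕ × ℕ)} (hH : X.IsCut H) (hX : X.IsClosed)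
    (u : Face H) : (X.facePath H hH u).IsClosed := by
  refine (faceWord_spec hH u).2.trans ?_
  rcases u with _ | c
  · refine Eq.trans ?_ hX
    simp [vert, faceHi, length]
  · exact (hH.chord c.1 c.2).vert_eq.2

end QPath

/-! ### Necklaces -/

variable (I) in
/-- Closed paths in the double quiver. -/
abbrev ClosedPath := {X : QPath I // X.IsClosed}

/-- Two closed paths are equivalent if they differ by a cyclic rotation (a trivial path is
equivalent only to itself). -/
instance necklaceSetoid : Setoid (ClosedPath I) where
  r X Y := X.1.arrows.IsRotated Y.1.arrows ∧ (X.1.arrows = [] → X.1.start = Y.1.start)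
  iseqv :=
    { refl := fun X => ⟨List.IsRotated.refl _, fun _ => rfl⟩
      symm := fun {X Y} h => ⟨h.1.symm, fun h0 => (h.2 (by
        have := h.1; rw [h0] at this; exact List.isRotated_nil_iff.1 this)).symm⟩
      trans := fun {X Y Z} h h' => ⟨h.1.trans h'.1, fun h0 => (h.2 h0).trans (h'.2 (by
        have := h.1; rw [h0] at this; exact (List.isRotated_nil_iff'.1 this).symm))⟩ }

variable (I) in
/-- Cyclic paths ("necklaces") in the double quiver: closed paths without their initial edge. -/
def Necklace := Quotient (necklaceSetoid (I := I))

/-- The cyclic path of a closed path. -/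
def Necklace.of (X : QPath I) (h : X.IsClosed) : Necklace I := Quotient.mk _ ⟨X, h⟩

end Paths

/-! ### Circular orders and corners -/

section Orders

variable {α β : Type*}

/-- The circular order induced on a subset. -/
@[reducible] def circComap (f : α → β) (hf : Function.Injective f) (C : CircularOrder β) :
    CircularOrder α where
  btw a b c := C.btw (f a) (f b) (f c)
  sbtw a b c := C.sbtw (f a) (f b) (f c)
  btw_refl a := C.btw_refl _
  btw_cyclic_left h := C.btw_cyclic_left h
  sbtw_iff_btw_not_btw := C.sbtw_iff_btw_not_btw
  sbtw_trans_left h h' := C.sbtw_trans_left h h'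
  btw_antisymm h h' := by
    rcases C.btw_antisymm h h' with h | h | h
    · exact Or.inl (hf h)
    · exact Or.inr (Or.inl (hf h))
    · exact Or.inr (Or.inr (hf h))
  btw_total a b c := C.btw_total _ _ _

/-- The linear order induced on a subset. -/
@[reducible] def linComap (f : α → β) (hf : Function.Injective f) (L : LinearOrder β) :
    LinearOrder α := LinearOrder.lift' f hf

/-- The linear order `L` is a corner of the circular order `C`: it is obtained from `C` by
choosing an initial element. -/
def IsCorner (C : CircularOrder α) (L : LinearOrder α) : Prop :=
  ∀ a b c : α, C.btw a b c ↔
    (L.le a b ∧ L.le b c) ∨ (L.le b c ∧ L.le c a) ∨ (L.le c a ∧ L.le a b)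

open Classical in
/-- The linear order obtained from a circular order by choosing the initial element `p`. -/
@[reducible] def cutAt (C : CircularOrder α) (p : α) : LinearOrder α where
  le a b := a = p ∨ (b ≠ p ∧ C.btw p a b)
  le_refl a := by
    by_cases h : a = p
    · exact Or.inl h
    · exact Or.inr ⟨h, btw_refl_right p a⟩
  le_trans a b c h h' := by
    rcases h with h | ⟨hb, h⟩
    · exact Or.inl h
    rcases h' with h' | ⟨hc, h'⟩
    · exact absurd h' hb
    by_cases ha : a = p
    · exact Or.inl ha
    refine Or.inr ⟨hc, ?_⟩
    by_cases hab : a = b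
    · subst hab; exact h'
    by_cases hbc : b = c
    · subst hbc; exact h
    have h1 : sbtw p a b := sbtw_of_btw_not_btw h (fun h2 => by
      rcases btw_antisymm h h2 with h3 | h3 | h3
      exacts [ha h3.symm, hab h3, hb h3])
    have h2 : sbtw p b c := sbtw_of_btw_not_btw h' (fun h2 => by
      rcases btw_antisymm h' h2 with h3 | h3 | h3
      exacts [hb h3.symm, hbc h3, hc h3])
    exact ((h1.cyclic_left.trans_left h2.cyclic_left).cyclic_right).btw
  le_antisymm a b h h' := by
    rcases h with h | ⟨hb, h⟩ <;> rcases h' with h' | ⟨ha, h'⟩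
    · exact h.trans h'.symm
    · exact absurd h ha
    · exact absurd h' hb
    · rcases btw_antisymm h h'.cyclic_left with h3 | h3 | h3
      exacts [absurd h3.symm ha, h3, absurd h3 hb]
  le_total a b := by
    by_cases ha : a = p
    · exact Or.inl (Or.inl ha)
    by_cases hb : b = p
    · exact Or.inr (Or.inl hb)
    rcases btw_total p a b with h | h
    · exact Or.inl (Or.inr ⟨hb, h⟩)
    · exact Or.inr (Or.inr ⟨ha, h.cyclic_right⟩)
  toDecidableLE := Classical.decRel _

theorem isCorner_of_imp (C : CircularOrder α) (L : LinearOrder α)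
    (h : ∀ a b c, L.le a b → L.le b c → C.btw a b c) : IsCorner C L := by
  have key : ∀ a b c : α, (L.le a b ∧ L.le b c) ∨ (L.le b c ∧ L.le c a) ∨ (L.le c a ∧ L.le a b) →
      C.btw a b c := by
    rintro a b c (⟨h1, h2⟩ | ⟨h1, h2⟩ | ⟨h1, h2⟩)
    · exact h _ _ _ h1 h2
    · exact (h _ _ _ h1 h2).cyclic_right
    · exact (h _ _ _ h1 h2).cyclic_left
  refine fun a b c => ⟨fun hb => ?_, key a b c⟩
  by_contra hcon
  have h2 : C.btw c b a := by
    apply key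
    rcases L.le_total a b with h1 | h1 <;> rcases L.le_total b c with h2 | h2 <;>
      rcases L.le_total c a with h3 | h3 <;> tauto
  apply hcon
  rcases btw_antisymm hb h2 with rfl | rfl | rfl
  · rcases L.le_total a c with h3 | h3
    · exact Or.inl ⟨L.le_refl _, h3⟩
    · exact Or.inr (Or.inr ⟨h3, L.le_refl _⟩)
  · rcases L.le_total a b with h3 | h3
    · exact Or.inl ⟨h3, L.le_refl _⟩
    · exact Or.inr (Or.inl ⟨L.le_refl _, h3⟩)
  · rcases L.le_total c b with h3 | h3
    · exact Or.inr (Or.inr ⟨L.le_refl _, h3⟩)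
    · exact Or.inr (Or.inl ⟨h3, L.le_refl _⟩)

theorem isCorner_cutAt (C : CircularOrder α) (p : α) : IsCorner C (cutAt C p) := by
  apply isCorner_of_imp
  rintro a b c (rfl | ⟨hb, h⟩) (rfl | ⟨hc, h'⟩)
  · exact btw_refl_left b c
  · exact h'
  · exact absurd rfl hb
  · by_cases ha : a = p
    · subst ha; exact h'
    by_cases hab : a = b
    · subst hab; exact btw_refl_left _ _
    by_cases hbc : b = c
    · subst hbc; exact btw_refl_right _ _
    have h1 : sbtw p a b := sbtw_of_btw_not_btw h (fun h2 => by
      rcases btw_antisymm h h2 with h3 | h3 | h3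
      exacts [ha h3.symm, hab h3, hb h3])
    have h2 : sbtw p b c := sbtw_of_btw_not_btw h' (fun h2 => by
      rcases btw_antisymm h' h2 with h3 | h3 | h3
      exacts [hb h3.symm, hbc h3, hc h3])
    exact (h2.cyclic_right.trans_left h1).cyclic_left.btw

theorem IsCorner.comap {C : CircularOrder β} {L : LinearOrder β} (h : IsCorner C L)
    (f : α → β) (hf : Function.Injective f) : IsCorner (circComap f hf C) (linComap f hf L) :=
  fun a b c => h (f a) (f b) (f c)

end Orders

/-! ### Rooted trees, oriented trees, and their structures -/

/-- A finite rooted tree. -/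
structure RootedTree where
  V : Type
  [fin : Finite V]
  graph : SimpleGraph V
  isTree : graph.IsTree
  root : V

/-- An orientation of all edges of a graph: `arr v w` means that there is an edge which points
from `v` to `w`. -/
structure EdgeOrientation {V : Type} (G : SimpleGraph V) where
  arr : V → V → Prop
  adj_of_arr : ∀ {v w}, arr v w → G.Adj v w
  arr_or_arr : ∀ {v w}, G.Adj v w → arr v w ∨ arr w v
  asymm : ∀ {v w}, arr v w → ¬ arr w v

/-- A finite oriented tree. -/
structure OrientedTree where
  V : Type
  [fin : Finite V]
  graph : SimpleGraph V
  isTree : graph.IsTree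
  orient : EdgeOrientation graph

attribute [instance] RootedTree.fin OrientedTree.fin

/-- A ribbon graph structure: a cyclic ordering of the edges incident with each vertex. In a tree
an edge at `v` is determined by its other end, so that this orders the neighbours of `v`. -/
abbrev Ribbon {V : Type} (G : SimpleGraph V) := ∀ v : V, CircularOrder (G.neighborSet v)

/-- The graph obtained from the connected component of `w` after deleting the edges in `H`. -/
abbrev compGraph {V : Type} (G : SimpleGraph V) (H : Set (Sym2 V)) (w : V) :
    SimpleGraph {v : V // (G.deleteEdges H).Reachable w v} :=
  (G.deleteEdges H).comap Subtype.val

theorem compGraph_isTree {V : Type} {G : SimpleGraph V} (hG : G.IsTree) (H : Set (Sym2 V))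
    (w : V) : (compGraph G H w).IsTree := by
  have hw : ∀ v : V, ∀ p : (G.deleteEdges H).Walk w v,
      (compGraph G H w).Reachable ⟨w, .refl w⟩ ⟨v, ⟨p⟩⟩ := by
    intro v p
    induction p using SimpleGraph.Walk.concatRec with
    | Hnil => exact .refl _
    | Hconcat q h ih =>
      refine ih.trans (SimpleGraph.Adj.reachable ?_)
      exact h
  have hac : (compGraph G H w).IsAcyclic :=
    (hG.isAcyclic.anti (G.deleteEdges_le H)).comap
      (SimpleGraph.Embedding.comap (Function.Embedding.subtype _) _).toHom
      Subtype.val_injective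
  have hcon : (compGraph G H w).Connected := by
    refine (SimpleGraph.connected_iff_exists_forall_reachable _).2 ⟨⟨w, .refl w⟩, ?_⟩
    rintro ⟨v, hv⟩
    exact hv.elim (fun p => hw v p)
  exact ⟨hcon, hac⟩

/-- The inclusion of the neighbours of a vertex in a component into its neighbours in `G`. -/
def compNbr {V : Type} (G : SimpleGraph V) (H : Set (Sym2 V)) (w : V)
    (v : {v : V // (G.deleteEdges H).Reachable w v}) (x : (compGraph G H w).neighborSet v) :
    G.neighborSet v.1 :=
  ⟨x.1.1, G.deleteEdges_le H x.2⟩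

theorem compNbr_injective {V : Type} (G : SimpleGraph V) (H : Set (Sym2 V)) (w : V)
    (v : {v : V // (G.deleteEdges H).Reachable w v}) :
    Function.Injective (compNbr G H w v) :=
  fun _ _ h => Subtype.ext (Subtype.ext (congrArg (fun z : G.neighborSet v.1 => z.1) h))

/-- The restriction of a ribbon structure to a component. -/
@[reducible] def Ribbon.restrict {V : Type} {G : SimpleGraph V} (r : Ribbon G) (H : Set (Sym2 V)) (w : V) :
    Ribbon (compGraph G H w) :=
  fun v => circComap (compNbr G H w v) (compNbr_injective G H w v) (r v.1)

/-- The restriction of an orientation to a component. -/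
def EdgeOrientation.restrict {V : Type} {G : SimpleGraph V} (o : EdgeOrientation G)
    (H : Set (Sym2 V)) (w : V) : EdgeOrientation (compGraph G H w) where
  arr v v' := o.arr v.1 v'.1 ∧ (compGraph G H w).Adj v v'
  adj_of_arr h := h.2
  arr_or_arr h := (o.arr_or_arr (G.deleteEdges_le H h)).imp (⟨·, h⟩) (⟨·, h.symm⟩)
  asymm h h' := o.asymm h.1 h'.1

/-- The component of `w` of the tree `T` with the edges in `H` deleted, with root `w`. -/
def RootedTree.comp (T : RootedTree) (H : Set (Sym2 T.V)) (w : T.V) : RootedTree where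
  V := {v : T.V // (T.graph.deleteEdges H).Reachable w v}
  graph := compGraph T.graph H w
  isTree := compGraph_isTree T.isTree H w
  root := ⟨w, .refl w⟩

/-- The component of `w` of the tree `T` with the edges in `H` deleted. -/
def OrientedTree.comp (T : OrientedTree) (H : Set (Sym2 T.V)) (w : T.V) : OrientedTree where
  V := {v : T.V // (T.graph.deleteEdges H).Reachable w v}
  graph := compGraph T.graph H w
  isTree := compGraph_isTree T.isTree H w
  orient := T.orient.restrict H w

section Structures

variable (I : Type*) [Quiver I]

/-- The rooted tree-structure `Φ_rt`: a ribbon graph structure with a corner at the root, an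
orientation of all edges, and a labelling of the vertices by paths. -/
structure PhiRt (T : RootedTree) where
  ribbon : Ribbon T.graph
  corner : LinearOrder (T.graph.neighborSet T.root)
  isCorner : IsCorner (ribbon T.root) corner
  orient : EdgeOrientation T.graph
  label : T.V → QPath I

/-- The oriented tree-structure `Φ_or`: a ribbon graph structure and a labelling of the vertices
by cyclic paths. -/
structure PhiOr (T : OrientedTree) where
  ribbon : Ribbon T.graph
  label : T.V → Necklace I

/-- Pairs `(T, s)` of a rooted tree `T` and `s ∈ Φ_rt(T)`. -/
abbrev RTree := Σ T : RootedTree, PhiRt I T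

/-- Pairs `(T, s)` of an oriented tree `T` and `s ∈ Φ_or(T)`. -/
abbrev OTree := Σ T : OrientedTree, PhiOr I T

variable {I}

/-- A vertex `v` other than the root has a parent: the next vertex on the path to the root. -/
theorem RootedTree.exists_parent (T : RootedTree) (v : T.V) (hv : v ≠ T.root) :
    ∃ p : T.graph.neighborSet v, ∃ q : T.graph.Walk p.1 T.root, (q.cons p.2).IsPath := by
  obtain ⟨q, hq, -⟩ := T.isTree.existsUnique_path v T.root
  cases q with
  | nil => exact absurd rfl hv
  | cons h q => exact ⟨⟨_, h⟩, q, hq⟩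

/-- The parent of a vertex other than the root. -/
def RootedTree.parent (T : RootedTree) (v : T.V) (hv : v ≠ T.root) : T.graph.neighborSet v :=
  (T.exists_parent v hv).choose

open Classical in
/-- The linear ordering of the edges at each vertex of a rooted tree with ribbon structure and
corner: it is given by the corner at the root; at any other vertex, the initial edge is the one
which leads towards the root. -/
@[reducible] def PhiRt.linOrd {T : RootedTree} (s : PhiRt I T) (v : T.V) :
    LinearOrder (T.graph.neighborSet v) :=
  if h : v = T.root then cast (by rw [h]) s.corner else cutAt (s.ribbon v) (T.parent v h)

theorem PhiRt.isCorner_linOrd {T : RootedTree} (s : PhiRt I T) (v : T.V) :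
    IsCorner (s.ribbon v) (s.linOrd v) := by
  unfold linOrd
  split
  · next h => subst h; exact s.isCorner
  · exact isCorner_cutAt _ _

/-- The restriction of an element of `Φ_rt(T)` to a component `T.comp H w`, where `w` is the
vertex of the component closest to the root of `T`. -/
def PhiRt.restrict {T : RootedTree} (s : PhiRt I T) (H : Set (Sym2 T.V)) (w : T.V) :
    PhiRt I (T.comp H w) where
  ribbon := s.ribbon.restrict H w
  corner := linComap (compNbr T.graph H w ⟨w, .refl w⟩) (compNbr_injective T.graph H w ⟨w, .refl w⟩)
    (s.linOrd w)
  isCorner := (s.isCorner_linOrd w).comap _ _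
  orient := s.orient.restrict H w
  label v := s.label v.1

/-- The restriction of an element of `Φ_or(T)` to a component. -/
def PhiOr.restrict {T : OrientedTree} (s : PhiOr I T) (H : Set (Sym2 T.V)) (w : T.V) :
    PhiOr I (T.comp H w) where
  ribbon := s.ribbon.restrict H w
  label v := s.label v.1

/-- The component of `w`, with the restricted structure. -/
def RTree.comp (X : RTree I) (H : Set (Sym2 X.1.V)) (w : X.1.V) : RTree I :=
  ⟨X.1.comp H w, X.2.restrict H w⟩

/-- The component of `w`, with the restricted structure. -/
def OTree.comp (X : OTree I) (H : Set (Sym2 X.1.V)) (w : X.1.V) : OTree I :=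
  ⟨X.1.comp H w, X.2.restrict H w⟩

/-- An isomorphism of graphs carries one ribbon structure to the other. -/
def Ribbon.Compat {V V' : Type} {G : SimpleGraph V} {G' : SimpleGraph V'} (f : G ≃g G')
    (r : Ribbon G) (r' : Ribbon G') : Prop :=
  ∀ (v : V) (a b c : G.neighborSet v), (r v).btw a b c ↔
    (r' (f v)).btw (f.mapNeighborSet v a) (f.mapNeighborSet v b) (f.mapNeighborSet v c)

/-- An isomorphism of pairs `(T, s)`, rooted case. -/
structure RTree.IsIso (X Y : RTree I) (f : X.1.graph ≃g Y.1.graph) : Prop where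
  root : f X.1.root = Y.1.root
  ribbon : Ribbon.Compat f X.2.ribbon Y.2.ribbon
  corner : ∀ (a b : X.1.graph.neighborSet X.1.root) (a' b' : Y.1.graph.neighborSet Y.1.root),
    f a.1 = a'.1 → f b.1 = b'.1 → (X.2.corner.le a b ↔ Y.2.corner.le a' b')
  orient : ∀ v w, X.2.orient.arr v w ↔ Y.2.orient.arr (f v) (f w)
  label : ∀ v, X.2.label v = Y.2.label (f v)

/-- An isomorphism of pairs `(T, s)`, oriented case. -/
structure OTree.IsIso (X Y : OTree I) (f : X.1.graph ≃g Y.1.graph) : Prop where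
  orient : ∀ v w, X.1.orient.arr v w ↔ Y.1.orient.arr (f v) (f w)
  ribbon : Ribbon.Compat f X.2.ribbon Y.2.ribbon
  label : ∀ v, X.2.label v = Y.2.label (f v)

theorem Ribbon.Compat.symm {V V' : Type} {G : SimpleGraph V} {G' : SimpleGraph V'} {f : G ≃g G'}
    {r : Ribbon G} {r' : Ribbon G'} (h : Ribbon.Compat f r r') : Ribbon.Compat f.symm r' r := by
  intro v
  obtain ⟨v, rfl⟩ := f.surjective v
  intro a b c
  have key : ∀ u : V, ∀ hu : f v = f u, ∀ a b c : G'.neighborSet (f u),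
      (r' (f u)).btw a b c ↔ (r u).btw ⟨f.symm a.1, by simpa using f.symm.map_adj_iff.2 a.2⟩
        ⟨f.symm b.1, by simpa using f.symm.map_adj_iff.2 b.2⟩
        ⟨f.symm c.1, by simpa using f.symm.map_adj_iff.2 c.2⟩ := by
    intro u _ a b c
    rw [h u]
    have e : ∀ (x : G'.neighborSet (f u)) hx, f.mapNeighborSet u ⟨f.symm x.1, hx⟩ = x :=
      fun x hx => Subtype.ext (f.apply_symm_apply x.1)
    rw [e, e, e]
  have key2 : ∀ (u : V) (hu : u = v) (a b c : V) ha hb hc ha' hb' hc',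
      (r u).btw ⟨a, ha⟩ ⟨b, hb⟩ ⟨c, hc⟩ ↔ (r v).btw ⟨a, ha'⟩ ⟨b, hb'⟩ ⟨c, hc'⟩ := by
    rintro u rfl a b c _ _ _ _ _ _
    exact Iff.rfl
  refine (key v rfl a b c).trans ?_
  exact (key2 _ (f.symm_apply_apply v) _ _ _ _ _ _ _ _ _).symm

theorem Ribbon.Compat.trans {V V' V'' : Type} {G : SimpleGraph V} {G' : SimpleGraph V'}
    {G'' : SimpleGraph V''} {f : G ≃g G'} {f' : G' ≃g G''}
    {r : Ribbon G} {r' : Ribbon G'} {r'' : Ribbon G''} (h : Ribbon.Compat f r r')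
    (h' : Ribbon.Compat f' r' r'') : Ribbon.Compat (f.trans f') r r'' :=
  fun v a b c => (h v a b c).trans (h' _ _ _ _)

/-- The isomorphism relation on pairs `(T, s)`, rooted case. -/
instance rtreeSetoid : Setoid (RTree I) where
  r X Y := ∃ f, RTree.IsIso X Y f
  iseqv :=
    { refl := fun X => ⟨.refl, rfl, fun _ _ _ _ => Iff.rfl, fun a b a' b' h h' => by
        obtain rfl : a = a' := Subtype.ext h
        obtain rfl : b = b' := Subtype.ext h'
        exact Iff.rfl, fun _ _ => Iff.rfl, fun _ => rfl⟩
      symm := fun {X Y} ⟨f, h⟩ => ⟨f.symm, by rw [← h.root]; simp, h.ribbon.symm,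
        fun a b a' b' ha hb => (h.corner a' b' a b (by rw [← ha]; simp) (by rw [← hb]; simp)).symm,
        fun v w => by rw [h.orient]; simp, fun v => by rw [h.label]; simp⟩
      trans := fun {X Y Z} ⟨f, h⟩ ⟨g, h'⟩ => ⟨f.trans g, by
          rw [← h'.root, ← h.root]; rfl, h.ribbon.trans h'.ribbon,
        fun a b a' b' ha hb => by
          have hadj : ∀ x : X.1.graph.neighborSet X.1.root, Y.1.graph.Adj Y.1.root (f x.1) :=
            fun x => by rw [← h.root]; exact f.map_adj_iff.2 x.2
          exact (h.corner a b ⟨f a.1, hadj a⟩ ⟨f b.1, hadj b⟩ rfl rfl).trans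
            (h'.corner _ _ a' b' ha hb),
        fun v w => (h.orient v w).trans (h'.orient _ _),
        fun v => (h.label v).trans (h'.label _)⟩ }

/-- The isomorphism relation on pairs `(T, s)`, oriented case. -/
instance otreeSetoid : Setoid (OTree I) where
  r X Y := ∃ f, OTree.IsIso X Y f
  iseqv :=
    { refl := fun X => ⟨.refl, fun _ _ => Iff.rfl, fun _ _ _ _ => Iff.rfl, fun _ => rfl⟩
      symm := fun {X Y} ⟨f, h⟩ => ⟨f.symm, fun v w => by rw [h.orient]; simp, h.ribbon.symm,
        fun v => by rw [h.label]; simp⟩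
      trans := fun {X Y Z} ⟨f, h⟩ ⟨g, h'⟩ => ⟨f.trans g,
        fun v w => (h.orient v w).trans (h'.orient _ _), h.ribbon.trans h'.ribbon,
        fun v => (h.label v).trans (h'.label _)⟩ }

variable (I) in
/-- Isomorphism classes of pairs `(T, s)` with `s ∈ Φ_rt(T)`. -/
def RTreeClass := Quotient (rtreeSetoid (I := I))

variable (I) in
/-- Isomorphism classes of pairs `(T, s)` with `s ∈ Φ_or(T)`. -/
def OTreeClass := Quotient (otreeSetoid (I := I))

end Structures

/-! ### Algebraic structures defined by comultiplications -/

section Coalgebras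

variable {k : Type*} [CommRing k] {M N A B : Type*} [AddCommGroup M] [Module k M]
  [AddCommGroup N] [Module k N] [CommRing A] [Algebra k A] [CommRing B] [Algebra k B]

/-- `(δ ⊗ 1) δ`. -/
def iterLeft (δ : M →ₗ[k] M ⊗[k] M) : M →ₗ[k] M ⊗[k] (M ⊗[k] M) :=
  (TensorProduct.assoc k M M M).toLinearMap ∘ₗ δ.rTensor M ∘ₗ δ

/-- `(1 ⊗ δ) δ`. -/
def iterRight (δ : M →ₗ[k] M ⊗[k] M) : M →ₗ[k] M ⊗[k] (M ⊗[k] M) :=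
  δ.lTensor M ∘ₗ δ

/-- Left pre-Lie coalgebras: `(Id - τ_(12)) (δ ⊗ 1 - 1 ⊗ δ) δ = 0`. -/
def IsPreLieCoalgebra (δ : M →ₗ[k] M ⊗[k] M) : Prop :=
  (LinearMap.id - (TensorProduct.leftComm k M M M).toLinearMap) ∘ₗ
    (iterLeft δ - iterRight δ) = 0

/-- The cyclic permutation `x ⊗ y ⊗ z ↦ y ⊗ z ⊗ x`. -/
def cyc (k M : Type*) [CommRing k] [AddCommGroup M] [Module k M] :
    M ⊗[k] (M ⊗[k] M) →ₗ[k] M ⊗[k] (M ⊗[k] M) :=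
  (TensorProduct.assoc k M M M).toLinearMap ∘ₗ (TensorProduct.comm k M (M ⊗[k] M)).toLinearMap

/-- Lie coalgebras: the cobracket takes its values in the span of the elements
`x ∧ y = x ⊗ y - y ⊗ x`, and satisfies the co-Jacobi identity. -/
structure IsLieCoalgebra (δ : M →ₗ[k] M ⊗[k] M) : Prop where
  skew : ∀ x, δ x ∈ Submodule.span k (Set.range (fun p : M × M => p.1 ⊗ₜ[k] p.2 - p.2 ⊗ₜ[k] p.1))
  coJacobi : (LinearMap.id + cyc k M + cyc k M ∘ₗ cyc k M) ∘ₗ iterLeft δ = 0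

/-- Homomorphisms of (pre-)Lie coalgebras. -/
def IsCoalgHom (δ : M →ₗ[k] M ⊗[k] M) (δ' : N →ₗ[k] N ⊗[k] N) (f : M →ₗ[k] N) : Prop :=
  TensorProduct.map f f ∘ₗ δ = δ' ∘ₗ f

/-- Hopf algebras with comultiplication `Δ`, counit `ε` and antipode `S` on an algebra `A`. -/
structure IsHopfAlgebra (Δ : A →ₐ[k] A ⊗[k] A) (ε : A →ₐ[k] k) (S : A →ₗ[k] A) : Prop where
  coassoc : (Algebra.TensorProduct.assoc k k k A A A).toAlgHom.comp
      ((Algebra.TensorProduct.map Δ (.id k A)).comp Δ)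
      = (Algebra.TensorProduct.map (.id k A) Δ).comp Δ
  counit_left : (Algebra.TensorProduct.map ε (.id k A)).comp Δ
      = (Algebra.TensorProduct.lid k A).symm
  counit_right : (Algebra.TensorProduct.map (.id k A) ε).comp Δ
      = (Algebra.TensorProduct.rid k k A).symm
  antipode_left : LinearMap.mul' k A ∘ₗ S.rTensor A ∘ₗ Δ.toLinearMap
      = Algebra.linearMap k A ∘ₗ ε.toLinearMap
  antipode_right : LinearMap.mul' k A ∘ₗ S.lTensor A ∘ₗ Δ.toLinearMap
      = Algebra.linearMap k A ∘ₗ ε.toLinearMap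

/-- The data in `IsHopfAlgebra` are a Hopf algebra in the sense of Mathlib. -/
@[reducible] def IsHopfAlgebra.toHopfAlgebra {Δ : A →ₐ[k] A ⊗[k] A} {ε : A →ₐ[k] k}
    {S : A →ₗ[k] A} (h : IsHopfAlgebra Δ ε S) : HopfAlgebra k A where
  toBialgebra := Bialgebra.ofAlgHom Δ ε h.coassoc h.counit_left h.counit_right
  antipode := S
  mul_antipode_rTensor_comul := h.antipode_left
  mul_antipode_lTensor_comul := h.antipode_right

/-- Homomorphisms of Hopf algebras: algebra homomorphisms compatible with comultiplications,
counits and antipodes. -/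
structure IsHopfHom (Δ : A →ₐ[k] A ⊗[k] A) (ε : A →ₐ[k] k) (S : A →ₗ[k] A)
    (Δ' : B →ₐ[k] B ⊗[k] B) (ε' : B →ₐ[k] k) (S' : B →ₗ[k] B) (f : A →ₐ[k] B) : Prop where
  comul : (Algebra.TensorProduct.map f f).comp Δ = Δ'.comp f
  counit : ε'.comp f = ε
  antipode : f.toLinearMap ∘ₗ S = S' ∘ₗ f.toLinearMap

end Coalgebras

/-! ### The comultiplications on trees -/

section TreeComul

instance (T : RootedTree) : Fintype T.graph.edgeSet := Fintype.ofFinite _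

instance (T : OrientedTree) : Fintype {p : T.V × T.V // T.orient.arr p.1 p.2} :=
  Fintype.ofFinite _

/-- The edge `e` lies on the path from the root to `v`. -/
def RootedTree.Sep (T : RootedTree) (e : T.graph.edgeSet) (v : T.V) : Prop :=
  ¬ (T.graph.deleteEdges {e.1}).Reachable T.root v

theorem RootedTree.exists_far (T : RootedTree) (e : T.graph.edgeSet) :
    ∃ v, v ∈ e.1 ∧ T.Sep e v := by
  obtain ⟨e, he⟩ := e
  induction e using Sym2.ind with
  | _ x y =>
  by_contra hcon
  have h : ∀ v, v ∈ s(x, y) → (T.graph.deleteEdges {s(x, y)}).Reachable T.root v := fun v hv => by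
    by_contra h
    exact hcon ⟨v, hv, h⟩
  have hb := SimpleGraph.isAcyclic_iff_forall_adj_isBridge.1 T.isTree.isAcyclic he
  rw [SimpleGraph.isBridge_iff] at hb
  exact hb ((h x (by simp)).symm.trans (h y (by simp)))

/-- The end of the edge `e` that is farther from the root. -/
def RootedTree.far (T : RootedTree) (e : T.graph.edgeSet) : T.V := (T.exists_far e).choose

/-- A cut `H` of a rooted tree is simple if every path which starts at the root contains at most
one edge of `H`. -/
def RootedTree.IsSimpleCut (T : RootedTree) (H : Finset T.graph.edgeSet) : Prop :=
  ∀ v, ∀ e ∈ H, ∀ e' ∈ H, T.Sep e v → T.Sep e' v → e = e'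

/-- The set of edges in the cut `H`, as a set of unordered pairs of vertices. -/
def RootedTree.edges (T : RootedTree) (H : Finset T.graph.edgeSet) : Set (Sym2 T.V) :=
  Subtype.val '' (H : Set T.graph.edgeSet)

variable (k : Type*) [CommRing k] (I : Type*) [Quiver I]

/-- The free module `P` spanned by the paths in the double quiver. -/
abbrev PathModule := QPath I →₀ k

/-- The free module `L` spanned by the cyclic paths in the double quiver. -/
abbrev NecklaceModule := Necklace I →₀ k

/-- The free module spanned by isomorphism classes of rooted trees with `Φ_rt`-structure. -/
abbrev TRt := RTreeClass I →₀ k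

/-- The free module spanned by isomorphism classes of oriented trees with `Φ_or`-structure. -/
abbrev TOr := OTreeClass I →₀ k

variable {I}

/-- The basis element of a path. -/
def QPath.el (X : QPath I) : PathModule k I := Finsupp.single X 1

/-- The basis element of a cyclic path. -/
def Necklace.el (X : Necklace I) : NecklaceModule k I := Finsupp.single X 1

/-- The basis element of the isomorphism class of `(T, s)`. -/
def RTree.el (X : RTree I) : TRt k I := Finsupp.single (Quotient.mk _ X) 1

/-- The basis element of the isomorphism class of `(T, s)`. -/
def OTree.el (X : OTree I) : TOr k I := Finsupp.single (Quotient.mk _ X) 1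

/-- `ρ(T, s) = ∑_e T_e^1 ⊗ T_e^2`, where `T_e^2` contains the root. -/
def rhoRtFun (X : RTree I) : TRt k I ⊗[k] TRt k I :=
  ∑ e : X.1.graph.edgeSet,
    (X.comp {e.1} (X.1.far e)).el k ⊗ₜ[k] (X.comp {e.1} X.1.root).el k

/-- `∑_e (T_e^1 ⊗ T_e^2 - T_e^2 ⊗ T_e^1)`, where the edge `e` points from `T_e^1` to `T_e^2`. -/
def rhoOrFun (X : OTree I) : TOr k I ⊗[k] TOr k I :=
  ∑ p : {p : X.1.V × X.1.V // X.1.orient.arr p.1 p.2},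
    ((X.comp {s(p.1.1, p.1.2)} p.1.1).el k ⊗ₜ[k] (X.comp {s(p.1.1, p.1.2)} p.1.2).el k -
      (X.comp {s(p.1.1, p.1.2)} p.1.2).el k ⊗ₜ[k] (X.comp {s(p.1.1, p.1.2)} p.1.1).el k)

open Classical in
/-- `Δ(T, s) = (T, s) ⊗ 1 + ∑_H ∏_{e ∈ H} T_{H,e} ⊗ T_{H,0}`, over all simple cuts `H`. -/
def comulRtFun (X : RTree I) :
    SymmetricAlgebra k (TRt k I) ⊗[k] SymmetricAlgebra k (TRt k I) :=
  SymmetricAlgebra.ι k _ (X.el k) ⊗ₜ[k] 1 +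
    ∑ H : {H : Finset X.1.graph.edgeSet // X.1.IsSimpleCut H},
      (∏ e ∈ H.1, SymmetricAlgebra.ι k _ ((X.comp (X.1.edges H.1) (X.1.far e)).el k)) ⊗ₜ[k]
        SymmetricAlgebra.ι k _ ((X.comp (X.1.edges H.1) X.1.root).el k)

variable (I)

/-- The pre-Lie comultiplication `ρ` on rooted trees with `Φ_rt`-structure. (Basis elements are
isomorphism classes; the value is given by the formula for any representative.) -/
def rhoRt : TRt k I →ₗ[k] TRt k I ⊗[k] TRt k I :=
  Finsupp.linearCombination k (fun c : RTreeClass I => rhoRtFun k c.out)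

/-- The Lie cobracket on oriented trees with `Φ_or`-structure. -/
def rhoOr : TOr k I →ₗ[k] TOr k I ⊗[k] TOr k I :=
  Finsupp.linearCombination k (fun c : OTreeClass I => rhoOrFun k c.out)

/-- The Connes-Kreimer comultiplication on polynomials in rooted trees with `Φ_rt`-structure. -/
def comulRt : SymmetricAlgebra k (TRt k I) →ₐ[k]
    SymmetricAlgebra k (TRt k I) ⊗[k] SymmetricAlgebra k (TRt k I) :=
  SymmetricAlgebra.lift (Finsupp.linearCombination k (fun c : RTreeClass I => comulRtFun k c.out))

end TreeComul

/-! ### The comultiplications on paths and necklaces -/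

section PathComul

variable (k : Type*) [CommRing k] {I : Type*} [Quiver I]

/-- `δ(a_1 ⋯ a_n) = ∑_{i<j} -ω(a_i, a_j) (a_i)_t a_{i+1} ⋯ a_{j-1} ⊗
(a_1)_s a_1 ⋯ a_{i-1} a_{j+1} ⋯ a_n`; the terms with `ω(a_i, a_j) = 0` are omitted. -/
def deltaRtFun (X : QPath I) : PathModule k I ⊗[k] PathModule k I :=
  ∑ c : {c // c ∈ X.chords}, ((-X.om c.1 : ℤ) : k) •
    ((X.inner c.1).el k ⊗ₜ[k] (X.outer c.1 (QPath.mem_chords.1 c.2)).el k)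

/-- The necklace `[(a_i)_t a_{i+1} ⋯ a_{j-1}]`. -/
def QPath.innerN (X : QPath I) (c : {c // c ∈ X.chords}) : Necklace I :=
  Necklace.of (X.inner c.1) (QPath.inner_isClosed (QPath.mem_chords.1 c.2))

/-- The necklace `[(a_j)_t a_{j+1} ⋯ a_n a_1 ⋯ a_{i-1}] = [a_1 ⋯ a_{i-1} a_{j+1} ⋯ a_n]`. -/
def QPath.outerN (X : QPath I) (hX : X.IsClosed) (c : {c // c ∈ X.chords}) : Necklace I :=
  Necklace.of (X.outer c.1 (QPath.mem_chords.1 c.2)) (QPath.outer_isClosed _ hX)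

/-- `δ([a_1 ⋯ a_n]) = ∑_{i<j} ω(a_i, a_j) [(a_j)_t a_{j+1} ⋯ a_{i-1}] ∧ [(a_i)_t a_{i+1} ⋯ a_{j-1}]`,
where `x ∧ y = x ⊗ y - y ⊗ x`; the terms with `ω(a_i, a_j) = 0` are omitted. -/
def deltaOrFun (X : QPath I) (hX : X.IsClosed) : NecklaceModule k I ⊗[k] NecklaceModule k I :=
  ∑ c : {c // c ∈ X.chords}, ((X.om c.1 : ℤ) : k) •
    ((X.outerN hX c).el k ⊗ₜ[k] (X.innerN c).el k - (X.innerN c).el k ⊗ₜ[k] (X.outerN hX c).el k)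

open Classical in
/-- `Δ(X) = X ⊗ 1 + ∑_H ε_H ∏_{c ∈ H} X_{H,c} ⊗ X_{H,0}`, over all simple cuts `H` of the path. -/
def comulPFun (X : QPath I) :
    SymmetricAlgebra k (PathModule k I) ⊗[k] SymmetricAlgebra k (PathModule k I) :=
  SymmetricAlgebra.ι k _ (X.el k) ⊗ₜ[k] 1 +
    ∑ H : {H // H ∈ X.cuts.filter (fun H => QPath.IsSimple H)}, ((X.eps H.1 : ℤ) : k) •
      ((∏ c : {c // c ∈ H.1}, SymmetricAlgebra.ι k _ ((X.facePath H.1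
          (QPath.mem_cuts.1 (Finset.mem_filter.1 H.2).1) (some c)).el k)) ⊗ₜ[k]
        SymmetricAlgebra.ι k _ ((X.facePath H.1
          (QPath.mem_cuts.1 (Finset.mem_filter.1 H.2).1) none).el k))

variable (I)

/-- The pre-Lie comultiplication `δ_{p,rt}` on `P`. -/
def deltaRt : PathModule k I →ₗ[k] PathModule k I ⊗[k] PathModule k I :=
  Finsupp.linearCombination k (fun X : QPath I => deltaRtFun k X)

/-- The Lie cobracket `δ_or` on `L`. (The value on a cyclic path is given by the formula for any
choice of initial edge.) -/
def deltaOr : NecklaceModule k I →ₗ[k] NecklaceModule k I ⊗[k] NecklaceModule k I :=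
  Finsupp.linearCombination k (fun c : Necklace I => deltaOrFun k c.out.1 c.out.2)

/-- The comultiplication `Δ` on `Sym P`. -/
def comulP : SymmetricAlgebra k (PathModule k I) →ₐ[k]
    SymmetricAlgebra k (PathModule k I) ⊗[k] SymmetricAlgebra k (PathModule k I) :=
  SymmetricAlgebra.lift (Finsupp.linearCombination k (fun X : QPath I => comulPFun k X))

/-- The counit on a symmetric algebra which vanishes on the generators. -/
def symCounit (M : Type*) [AddCommGroup M] [Module k M] : SymmetricAlgebra k M →ₐ[k] k :=
  SymmetricAlgebra.lift (0 : M →ₗ[k] k)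

end PathComul

/-! ### Dual trees of chord diagrams -/

section Dual

variable {I : Type*} [Quiver I]

namespace QPath

/-- The face `v` lies immediately below the face `u`: they are separated by the chord of `v`. -/
def Imm (H : Finset (ℕ × ℕ)) (u v : Face H) : Prop :=
  Encl H u v ∧ ∀ w, ¬ (Encl H u w ∧ Encl H w v)

/-- The left end of the chord of a face (shifted by one; zero for the unbounded face). -/
def pos (H : Finset (ℕ × ℕ)) : Face H → ℕ
  | none => 0
  | some c => c.1.1 + 1

theorem Encl.pos_lt {H : Finset (ℕ × ℕ)} {u v : Face H} (h : Encl H u v) : pos H u < pos H v := by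
  rcases u with _ | u <;> rcases v with _ | v
  · exact h.elim
  · exact Nat.succ_pos _
  · exact h.elim
  · exact Nat.succ_lt_succ h.1

/-- The dual graph of the chord diagram: its vertices are the faces, and two faces are joined by
an edge when a chord separates them. -/
def dualGraph (H : Finset (ℕ × ℕ)) : SimpleGraph (Face H) where
  Adj u v := Imm H u v ∨ Imm H v u
  symm := ⟨fun _ _ h => h.symm⟩
  loopless := ⟨fun _ h => h.elim (fun h => h.1.pos_lt.ne rfl) (fun h => h.1.pos_lt.ne rfl)⟩

theorem pos_injective {X : QPath I} {H : Finset (ℕ × ℕ)} (hH : X.IsCut H) :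
    Function.Injective (pos H) := by
  rintro (_ | u) (_ | v) h
  · rfl
  · simp [pos] at h
  · simp [pos] at h
  · by_contra hne
    refine (hH.distinct u.1 u.2 v.1 v.2 (fun h' => hne (congrArg some (Subtype.ext h')))).1 ?_
    simpa [pos] using h

theorem Encl.chain {X : QPath I} {H : Finset (ℕ × ℕ)} (hH : X.IsCut H) {u v w : Face H}
    (hu : Encl H u w) (hv : Encl H v w) (h : pos H u < pos H v) : Encl H u v := by
  rcases w with _ | w
  · rcases u with _ | u <;> exact hu.elim
  rcases v with _ | v
  · simp [pos] at h
  rcases u with _ | u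
  · trivial
  have h1 : u.1.1 < v.1.1 := Nat.lt_of_succ_lt_succ h
  have hw := (hH.chord w.1 w.2).1
  have h2 := hH.noncrossing u.1 u.2 v.1 v.2
  have h3 := hH.distinct u.1 u.2 v.1 v.2 (fun h => by rw [h] at h1; exact h1.ne rfl)
  have h4 := hu.1; have h5 := hu.2; have h6 := hv.1; have h7 := hv.2
  refine ⟨h1, ?_⟩
  by_contra h8
  exact h2 ⟨h1, by omega, by omega⟩

theorem exists_imm (H : Finset (ℕ × ℕ)) (v : Face H) (hv : v ≠ none) : ∃ u, Imm H u v := by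
  classical
  obtain ⟨u, hu, hmax⟩ := Finset.exists_max_image
    ((Finset.univ : Finset (Face H)).filter (fun u => Encl H u v)) (pos H)
    ⟨none, by rcases v with _ | v; exacts [absurd rfl hv, Finset.mem_filter.2 ⟨Finset.mem_univ _, trivial⟩]⟩
  refine ⟨u, (Finset.mem_filter.1 hu).2, fun w hw => ?_⟩
  have := hmax w (by simp [hw.2])
  have := hw.1.pos_lt
  omega

theorem imm_unique {X : QPath I} {H : Finset (ℕ × ℕ)} (hH : X.IsCut H) {u u' v : Face H}
    (h : Imm H u v) (h' : Imm H u' v) : u = u' := by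
  rcases lt_trichotomy (pos H u) (pos H u') with h1 | h1 | h1
  · exact absurd ⟨Encl.chain hH h.1 h'.1 h1, h'.1⟩ (h.2 u')
  · exact pos_injective hH h1
  · exact absurd ⟨Encl.chain hH h'.1 h.1 h1, h.1⟩ (h'.2 u)

theorem dualGraph_isTree {X : QPath I} {H : Finset (ℕ × ℕ)} (hH : X.IsCut H) :
    (dualGraph H).IsTree := by
  classical
  have hreach : ∀ n, ∀ v : Face H, pos H v = n → (dualGraph H).Reachable none v := by
    intro n
    induction n using Nat.strong_induction_on with
    | _ n ih =>
    intro v hv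
    by_cases h : v = none
    · rw [h]
    · obtain ⟨u, hu⟩ := exists_imm H v h
      have hadj : (dualGraph H).Adj u v := Or.inl hu
      exact (ih (pos H u) (hv ▸ hu.1.pos_lt) u rfl).trans hadj.reachable
  have hcon : (dualGraph H).Connected :=
    (SimpleGraph.connected_iff_exists_forall_reachable _).2 ⟨none, fun v => hreach _ v rfl⟩
  refine SimpleGraph.isTree_iff_connected_and_card.2 ⟨hcon, le_antisymm ?_ ?_⟩
  · have hpar : ∀ c : {c // c ∈ H}, ∃ u, Imm H u (some c) := fun c => exists_imm H _ (by simp)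
    choose par hpar using hpar
    have hsurj : ∀ e : (dualGraph H).edgeSet, ∃ c : {c // c ∈ H}, s(par c, some c) = e.1 := by
      rintro ⟨e, he⟩
      induction e using Sym2.ind with
      | _ x y =>
      rcases (he : Imm H x y ∨ Imm H y x) with h | h
      · rcases y with _ | y
        · rcases x with _ | x <;> exact h.1.elim
        · exact ⟨y, by rw [imm_unique hH (hpar y) h]⟩
      · rcases x with _ | x
        · rcases y with _ | y <;> exact h.1.elim
        · exact ⟨x, by rw [imm_unique hH (hpar x) h, Sym2.eq_swap]⟩
    choose f hf using hsurj
    have hinj : Function.Injective f := fun e e' h => Subtype.ext (by rw [← hf e, ← hf e', h])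
    have := Nat.card_le_card_of_injective f hinj
    rw [Finite.card_option]
    omega
  · exact hcon.card_vert_le_card_edgeSet_add_one

/-- The left end of the chord of the face carries an arrow of the quiver itself. -/
def LeftInQ (X : QPath I) (H : Finset (ℕ × ℕ)) : Face H → Prop
  | none => False
  | some c => ∃ e, X.arrows[c.1.1]? = some (Sum.inl e)

/-- The orientation of the dual tree. The chord `(i, j)` is oriented from `i` to `j` if `a_i` is
in the quiver, and from `j` to `i` otherwise; the edge `e` which crosses the chord `f` is oriented
so that `e ∧ f` is positive. As the chords are drawn above the line, `e` points into the face
below the chord in the first case, and out of it in the second. -/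
def dualOrient (X : QPath I) (H : Finset (ℕ × ℕ)) : EdgeOrientation (dualGraph H) where
  arr u v := (Imm H u v ∧ X.LeftInQ H v) ∨ (Imm H v u ∧ ¬ X.LeftInQ H u)
  adj_of_arr h := h.imp And.left And.left
  arr_or_arr {u v} h := by
    rcases h with h | h
    · by_cases h' : X.LeftInQ H v
      · exact Or.inl (Or.inl ⟨h, h'⟩)
      · exact Or.inr (Or.inr ⟨h, h'⟩)
    · by_cases h' : X.LeftInQ H u
      · exact Or.inr (Or.inl ⟨h, h'⟩)
      · exact Or.inl (Or.inr ⟨h, h'⟩)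
  asymm {u v} h h' := by
    rcases h with h | h <;> rcases h' with h' | h'
    · exact absurd (h.1.1.pos_lt.trans h'.1.1.pos_lt) (lt_irrefl _)
    · exact h'.2 h.2
    · exact h.2 h'.2
    · exact absurd (h.1.1.pos_lt.trans h'.1.1.pos_lt) (lt_irrefl _)

theorem nbrPos_injective {X : QPath I} {H : Finset (ℕ × ℕ)} (hH : X.IsCut H) (v : Face H) :
    Function.Injective (fun x : (dualGraph H).neighborSet v => pos H x.1) :=
  fun _ _ h => Subtype.ext (pos_injective hH h)

/-- The ribbon structure of the dual tree: the neighbours of a face in the order in which, going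
from left to right, the chords on the boundary of the face are first met (for a bounded face, the
first one is its own chord, leading to the face above it), considered as a cyclic order. -/
@[reducible] def dualRibbon (X : QPath I) (H : Finset (ℕ × ℕ)) (hH : X.IsCut H) :
    Ribbon (dualGraph H) :=
  fun v => circComap (fun x : (dualGraph H).neighborSet v => pos H x.1) (nbrPos_injective hH v)
    (LinearOrder.toCircularOrder ℕ)

/-- The dual rooted tree `T_H`; its root is the unbounded face. -/
def dualRooted (X : QPath I) (H : Finset (ℕ × ℕ)) (hH : X.IsCut H) : RootedTree where
  V := Face H
  graph := dualGraph H
  isTree := dualGraph_isTree hH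
  root := none

/-- The dual rooted tree with its structure, `(T_H, s_H)`. -/
def dualR (X : QPath I) (H : Finset (ℕ × ℕ)) (hH : X.IsCut H) : RTree I :=
  ⟨X.dualRooted H hH,
    { ribbon := X.dualRibbon H hH
      corner := linComap (fun x : (dualGraph H).neighborSet none => pos H x.1)
        (nbrPos_injective hH none) inferInstance
      isCorner := IsCorner.comap (fun _ _ _ => Iff.rfl) _ _
      orient := X.dualOrient H
      label := X.facePath H hH }⟩

/-- The dual oriented tree `T_{H,or}`. -/
def dualOriented (X : QPath I) (H : Finset (ℕ × ℕ)) (hH : X.IsCut H) : OrientedTree where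
  V := Face H
  graph := dualGraph H
  isTree := dualGraph_isTree hH
  orient := X.dualOrient H

/-- The dual oriented tree with its structure, `(T_{H,or}, s_{H,or})`. -/
def dualO (X : QPath I) (hX : X.IsClosed) (H : Finset (ℕ × ℕ)) (hH : X.IsCut H) : OTree I :=
  ⟨X.dualOriented H hH,
    { ribbon := X.dualRibbon H hH
      label := fun u => Necklace.of (X.facePath H hH u) (facePath_isClosed hH hX u) }⟩

end QPath

end Dual

section Eta

variable (k : Type*) [CommRing k] {I : Type*} [Quiver I]

/-- `η_rt(X) = ∑_H ε_H (T_H, s_H)`, over all cuts `H` of the path `X`. -/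
def etaRtFun (X : QPath I) : TRt k I :=
  ∑ H : {H // H ∈ X.cuts}, ((X.eps H.1 : ℤ) : k) • (X.dualR H.1 (QPath.mem_cuts.1 H.2)).el k

/-- `η_or([X]) = ∑_H (T_{H,or}, s_{H,or})`, over all cuts `H` of the closed path `X`. -/
def etaOrFun (X : QPath I) (hX : X.IsClosed) : TOr k I :=
  ∑ H : {H // H ∈ X.cuts}, (X.dualO hX H.1 (QPath.mem_cuts.1 H.2)).el k

variable (I)

/-- The linear map `η_rt : P → T_rt(Φ_rt)`. -/
def etaRt : PathModule k I →ₗ[k] TRt k I :=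
  Finsupp.linearCombination k (fun X : QPath I => etaRtFun k X)

/-- The linear map `η_or : L → T_or(Φ_or)`. (The value on a cyclic path is given by the formula
for any choice of initial edge.) -/
def etaOr : NecklaceModule k I →ₗ[k] TOr k I :=
  Finsupp.linearCombination k (fun c : Necklace I => etaOrFun k c.out.1 c.out.2)

/-- The multiplicative extension `Sym P → Sym T_rt(Φ_rt)` of `η_rt`. -/
def symEtaRt : SymmetricAlgebra k (PathModule k I) →ₐ[k] SymmetricAlgebra k (TRt k I) :=
  SymmetricAlgebra.lift (SymmetricAlgebra.ι k (TRt k I) ∘ₗ etaRt k I)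

end Eta

end

end Necklaces

/-! Everything rests on one recursion. Read a word from its first letter `a`. Either `a` is
unmatched and joins the label of the unbounded face, or the word is `a u a* v` and the dual tree
arises from a dual tree of `v` by attaching a dual tree of `u` as the first branch at the root.
Planar rooted trees are built by the same operation (`PlanarTree.graft`). Hence the sum over all
cuts of a word (`wordSum`), over its simple cuts (`simpleSum`) and over the simple cuts of a tree
(`PlanarTree.cutSum`) are recursive linear functionals, and identities between them are inductions
in which the first edge or chord is either cut or kept. `RTree.sum_isSimpleCut`, `sum_wordSign_mul`
and `sum_isSimple_wordSign` identify these recursions with the sums over actual cuts.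

Two identities carry the Hopf statement. `PlanarTree.cutSum_conv` is the coassociativity of the
Connes-Kreimer comultiplication. `wordSum_cutSum` is the compatibility of η_rt with the
comultiplications: a cut `H` of a word together with a simple cut of `T_H`, that is, a subset of
pairwise unnested chords of `H`, amounts to a simple cut of the word together with cuts of all the
words which it produces, and the signs multiply. Only the empty cut has a dual tree with one vertex,
so reading off the label of one-vertex trees is a left inverse of η_rt. It splits the multiplicative
extension as well, and therefore coassociativity on `Sym P` is inherited from trees. The antipodes
are constructed by recursion on size, since a nonempty cut has smaller pieces.

The pre-Lie statement is the linear part of the Hopf statement. Apart from `X ⊗ 1`, the terms of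
`Δ(X)` are linear in the right hand factor; projecting the left hand factor to its part of degree
one keeps exactly the cuts with a single chord or edge, which gives `δ_{p,rt}` and `ρ`. The
projection fails to commute with the comultiplications only by symmetric tensors
(`IsLinPart.comm_sub_linComul`), and with coassociativity this is the pre-Lie identity.

The Lie statement is a quotient of the antisymmetrized pre-Lie statement. Forgetting the root, with
the sign `(-1)^m` for `m` edges pointing away from the root, is a surjective homomorphism `toOr`
onto oriented trees, and closing up paths is a surjective homomorphism `toNecklace` onto necklaces.
On dual trees this sign is `ε_H`, so η_or, which has no signs, completes the square
(`etaOr_toNecklace`), and the co-Jacobi identities and the homomorphism property descend.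
Independence of the initial edge is proved for η_or by rotating a closed path by one letter: on a
circle the chord diagram stays the same, and merely the unbounded face and the face below the chord
of the first letter change places (`dualO_rotate`). For `δ_or` it follows from the formula
`deltaOrFun_eq`, which expresses it through η_or. -/

namespace Necklaces

open scoped TensorProduct

noncomputable section

/-! ### Finite linear combinations of evaluations -/

section EvalSpan

variable {A α β : Type*} [CommRing A]

/-- The functional `f ↦ Φ f` is a finite linear combination of evaluations at points. -/
def IsEvalComb (Φ : (α → A) → A) : Prop :=
  Φ ∈ Submodule.span A (Set.range (fun (x : α) (f : α → A) => f x))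

namespace IsEvalComb

theorem eval (x : α) : IsEvalComb (fun f : α → A => f x) := Submodule.subset_span ⟨x, rfl⟩

theorem zero : IsEvalComb (fun _ : α → A => 0) := Submodule.zero_mem _

theorem add {Φ Ψ : (α → A) → A} (h : IsEvalComb Φ) (h' : IsEvalComb Ψ) :
    IsEvalComb (fun f => Φ f + Ψ f) := Submodule.add_mem _ h h'

theorem mul_left {Φ : (α → A) → A} (c : A) (h : IsEvalComb Φ) :
    IsEvalComb (fun f => c * Φ f) := Submodule.smul_mem _ c h

theorem sum {ι : Type*} {s : Finset ι} {Φ : ι → (α → A) → A} (h : ∀ i ∈ s, IsEvalComb (Φ i)) :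
    IsEvalComb (fun f => ∑ i ∈ s, Φ i f) := by
  have : (fun f => ∑ i ∈ s, Φ i f) = ∑ i ∈ s, Φ i := by ext f; simp
  rw [IsEvalComb, this]
  exact Submodule.sum_mem _ h

theorem map_add {Φ : (α → A) → A} (h : IsEvalComb Φ) (f g : α → A) :
    Φ (fun x => f x + g x) = Φ f + Φ g := by
  induction h using Submodule.span_induction with
  | mem Φ h => obtain ⟨x, rfl⟩ := h; rfl
  | zero => simp
  | add Φ Ψ _ _ h h' => simp only [Pi.add_apply, h, h']; ring
  | smul c Φ _ h => simp only [Pi.smul_apply, h, smul_eq_mul]; ring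

theorem map_mul_left {Φ : (α → A) → A} (h : IsEvalComb Φ) (c : A) (f : α → A) :
    Φ (fun x => c * f x) = c * Φ f := by
  induction h using Submodule.span_induction with
  | mem Φ h => obtain ⟨x, rfl⟩ := h; rfl
  | zero => simp
  | add Φ Ψ _ _ h h' => simp only [Pi.add_apply, h, h']; ring
  | smul c Φ _ h => simp only [Pi.smul_apply, h, smul_eq_mul]; ring

theorem map_zero {Φ : (α → A) → A} (h : IsEvalComb Φ) : Φ (fun _ => 0) = 0 := by
  simpa using h.map_mul_left 0 (fun _ => 0)

theorem map_mul_right {Φ : (α → A) → A} (h : IsEvalComb Φ) (c : A) (f : α → A) :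
    Φ (fun x => f x * c) = Φ f * c := by
  simp_rw [mul_comm _ c]
  exact h.map_mul_left c f

/-- Iterated sums, in which the inner range depends on the outer variable, stay in the class; this
is the shape of all the recursions below. -/
theorem bind {Φ : (α → A) → A} (h : IsEvalComb Φ) {Ψ : α → (β → A) → A}
    (h' : ∀ x, IsEvalComb (Ψ x)) : IsEvalComb (fun f => Φ (fun x => Ψ x f)) := by
  induction h using Submodule.span_induction with
  | mem Φ h => obtain ⟨x, rfl⟩ := h; exact h' x
  | zero => exact zero
  | add Φ Ψ _ _ h h' => exact h.add h'
  | smul c Φ _ h => exact h.mul_left c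

theorem comap {Φ : (α → A) → A} (h : IsEvalComb Φ) (r : α → β) :
    IsEvalComb (fun f => Φ (fun x => f (r x))) := h.bind fun x => eval (r x)

/-- Fubini for finite sums: by linearity of `Ψ` it suffices to take an evaluation for `Φ`, where
both sides coincide. Only this form of interchange is used for sums over cuts, so the cuts
themselves need not be indexed. -/
theorem comm {Φ : (α → A) → A} (h : IsEvalComb Φ) {Ψ : (β → A) → A} (h' : IsEvalComb Ψ)
    (F : α → β → A) : Φ (fun x => Ψ (fun y => F x y)) = Ψ (fun y => Φ (fun x => F x y)) := by
  induction h using Submodule.span_induction with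
  | mem Φ h => obtain ⟨x, rfl⟩ := h; rfl
  | zero => exact h'.map_zero.symm
  | add Φ Φ' _ _ h1 h2 =>
    simp only [Pi.add_apply, h1, h2]
    exact (h'.map_add (fun y => Φ fun x => F x y) (fun y => Φ' fun x => F x y)).symm
  | smul c Φ _ h1 =>
    simp only [Pi.smul_apply, h1, smul_eq_mul]
    exact (h'.map_mul_left _ _).symm

end IsEvalComb

end EvalSpan

/-! ### Planar rooted trees -/

/-- Planar rooted trees with vertices labelled by `L`, built by grafting: `graft o s t` is
obtained from `t` by adding an edge from its root to the root of `s`, which becomes the first edge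
at the root of `t`. The edge points away from the root if `o` holds. -/
inductive PlanarTree (L : Type*)
  | leaf (l : L) : PlanarTree L
  | graft (o : Prop) (s t : PlanarTree L) : PlanarTree L

namespace PlanarTree

variable {L A : Type*} [CommRing A]

/-- The sum over all simple cuts of `χ(cut off branches) * f(trunk)`. -/
def cutSum (χ : PlanarTree L → A) : PlanarTree L → (PlanarTree L → A) → A
  | leaf l, f => f (leaf l)
  | graft o s t, f =>
    χ s * cutSum χ t f + cutSum χ s (fun x => cutSum χ t (fun y => f (graft o x y)))

theorem isEvalComb_cutSum (χ : PlanarTree L → A) (t : PlanarTree L) : IsEvalComb (cutSum χ t) := by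
  induction t with
  | leaf l => exact .eval _
  | graft o s t ihs iht => exact (iht.mul_left _).add (ihs.bind fun x => iht.comap _)

/-- The Connes-Kreimer convolution of two characters, given by their values on trees. -/
def conv (χ ψ : PlanarTree L → A) (t : PlanarTree L) : A := χ t + cutSum χ t ψ

/-- Coassociativity in functional form. Both sides run over pairs of successive simple cuts: a
branch cut off on the left side either goes to `χ` as a whole, or its own branches go to `χ` and its
trunk to `ψ`; on the right side the trunk of the first cut is cut again. -/
theorem cutSum_conv (χ ψ : PlanarTree L → A) (t : PlanarTree L) (f : PlanarTree L → A) :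
    cutSum (conv χ ψ) t f = cutSum χ t (fun x => cutSum ψ x f) := by
  induction t generalizing f with
  | leaf l => rfl
  | graft o s t ihs iht =>
    have hs := isEvalComb_cutSum χ s
    have ht := isEvalComb_cutSum χ t
    simp only [cutSum, ihs, iht, conv]
    -- The three resulting terms: the first edge belongs to the `χ`-cut, to the `ψ`-cut, or to
    -- neither of them.
    rw [add_mul, add_assoc]
    congr 1
    simp_rw [ht.map_add, hs.map_add]
    congr 1
    · simp_rw [ht.map_mul_left]
      exact (hs.map_mul_right _ _).symm
    · congr 1
      ext x
      -- The `ψ`-cuts of `x` and the `χ`-cuts of `t` concern different branches and can be summed in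
      -- either order.
      exact (isEvalComb_cutSum ψ x).comm ht _

end PlanarTree

/-! ### Recursive sums over the cuts of a word -/

section Words

variable {I A : Type*} [Quiver I] [CommRing A]

open Classical in
/-- The sum over all decompositions `l = u a* v`. -/
def splitSum (a : Arrow I) (l : List (Arrow I)) (F : List (Arrow I) → List (Arrow I) → A) : A :=
  ∑ j ∈ Finset.range l.length,
    if l[j]? = some (Arrow.star a) then F (l.take j) (l.drop (j + 1)) else 0

theorem splitSum_nil (a : Arrow I) (F : List (Arrow I) → List (Arrow I) → A) :
    splitSum a [] F = 0 := rfl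

open Classical in
theorem splitSum_cons (a b : Arrow I) (l : List (Arrow I))
    (F : List (Arrow I) → List (Arrow I) → A) :
    splitSum a (b :: l) F =
      splitSum a l (fun u v => F (b :: u) v) + (if b = Arrow.star a then F [] l else 0) := by
  simp [splitSum, Finset.sum_range_succ']

theorem splitSum_congr (a : Arrow I) (l : List (Arrow I))
    {F G : List (Arrow I) → List (Arrow I) → A}
    (h : ∀ u v, u.length < l.length → v.length < l.length → F u v = G u v) :
    splitSum a l F = splitSum a l G := by
  refine Finset.sum_congr rfl fun j hj => ?_
  rw [Finset.mem_range] at hj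
  rw [h _ _ (by simp; omega) (by simp; omega)]

theorem splitSum_add (a : Arrow I) (l : List (Arrow I))
    (F G : List (Arrow I) → List (Arrow I) → A) :
    splitSum a l (fun u v => F u v + G u v) = splitSum a l F + splitSum a l G := by
  simp only [splitSum, ← Finset.sum_add_distrib]
  exact Finset.sum_congr rfl fun j _ => by split <;> simp

theorem splitSum_mul_left (a : Arrow I) (l : List (Arrow I)) (c : A)
    (F : List (Arrow I) → List (Arrow I) → A) :
    splitSum a l (fun u v => c * F u v) = c * splitSum a l F := by
  simp only [splitSum, Finset.mul_sum]
  exact Finset.sum_congr rfl fun j _ => by split <;> simp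

theorem IsEvalComb.splitSum {α : Type*} (a : Arrow I) (l : List (Arrow I))
    {Φ : List (Arrow I) → List (Arrow I) → (α → A) → A}
    (h : ∀ u v, u.length < l.length → v.length < l.length → IsEvalComb (Φ u v)) :
    IsEvalComb (fun f => splitSum a l (fun u v => Φ u v f)) := by
  refine IsEvalComb.sum fun j hj => ?_
  rw [Finset.mem_range] at hj
  by_cases hc : l[j]? = some (Arrow.star a)
  · simp only [hc, if_true]
    exact h _ _ (by simp; omega) (by simp; omega)
  · simp only [hc, if_false]
    exact .zero

/-- Cutting a word at `b*` and then its left part at `a*` is the same as cutting it at `a*` and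
then its right part at `b*`. -/
theorem splitSum_splitSum (a b : Arrow I) (l : List (Arrow I))
    (F : List (Arrow I) → List (Arrow I) → List (Arrow I) → A) :
    splitSum a l (fun u v => splitSum b v (fun x y => F u x y)) =
      splitSum b l (fun u v => splitSum a u (fun x y => F x y v)) := by
  induction l generalizing F with
  | nil => rfl
  | cons c l ih =>
    classical
    simp only [splitSum_cons, splitSum_add, splitSum_nil]
    rw [ih (fun u x y => F (c :: u) x y)]
    have : splitSum b l (fun u v => if c = Arrow.star a then F [] u v else 0) =
        if c = Arrow.star a then splitSum b l (fun u v => F [] u v) else 0 := by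
      split
      · rfl
      · simp [splitSum]
    rw [this]
    simp

/-- The sign `-ω(a, a*)`. -/
def chordSign (a : Arrow I) : ℤ := -omega a (Arrow.star a)

/-- Add an arrow at the beginning of the label of the root. -/
def prependRoot (a : Arrow I) :
    PlanarTree (I × List (Arrow I)) → PlanarTree (I × List (Arrow I))
  | .leaf l => .leaf (l.1, a :: l.2)
  | .graft o s t => .graft o s (prependRoot a t)

/-- The root always belongs to the trunk, so the additional letter is invisible to the branches. -/
theorem cutSum_prependRoot (a : Arrow I) (χ f : PlanarTree (I × List (Arrow I)) → A)
    (t : PlanarTree (I × List (Arrow I))) :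
    PlanarTree.cutSum χ (prependRoot a t) f =
      PlanarTree.cutSum χ t (fun x => f (prependRoot a x)) := by
  induction t generalizing f with
  | leaf l => rfl
  | graft o s t _ iht => simp only [prependRoot, PlanarTree.cutSum, iht]

open Classical in
/-- The sum over all cuts of the word `l`, begun at `i`, of the signed values of `f` at the dual
trees, organized by the partner of the first letter. -/
def wordSum (i : I) : List (Arrow I) → (PlanarTree (I × List (Arrow I)) → A) → A
  | [], f => f (.leaf (i, []))
  | a :: l, f => wordSum i l (fun t => f (prependRoot a t)) +
      ∑ j ∈ Finset.range l.length, if l[j]? = some (Arrow.star a) then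
        (chordSign a : A) * wordSum (Arrow.tgt a) (l.take j) (fun s =>
          wordSum i (l.drop (j + 1)) (fun t => f (.graft (a.isLeft = true) s t))) else 0
  termination_by l => l.length
  decreasing_by all_goals (simp; try omega)

theorem wordSum_nil (i : I) (f : PlanarTree (I × List (Arrow I)) → A) :
    wordSum i [] f = f (.leaf (i, [])) := by rw [wordSum]

theorem wordSum_cons (i : I) (a : Arrow I) (l : List (Arrow I))
    (f : PlanarTree (I × List (Arrow I)) → A) :
    wordSum i (a :: l) f = wordSum i l (fun t => f (prependRoot a t)) +
      splitSum a l (fun u v => (chordSign a : A) * wordSum (Arrow.tgt a) u (fun s =>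
        wordSum i v (fun t => f (.graft (a.isLeft = true) s t)))) := by
  rw [wordSum, splitSum]

open Classical in
/-- The sum over all simple cuts of the word `l` of the signed products of the values of `χ` at the
words cut off and `f` at the remaining word, organized by the partner of the first letter. -/
def simpleSum (χ : I × List (Arrow I) → A) : List (Arrow I) → (List (Arrow I) → A) → A
  | [], f => f []
  | a :: l, f => simpleSum χ l (fun w => f (a :: w)) +
      ∑ j ∈ Finset.range l.length, if l[j]? = some (Arrow.star a) then
        (chordSign a : A) * χ (Arrow.tgt a, l.take j) * simpleSum χ (l.drop (j + 1)) f else 0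
  termination_by l => l.length
  decreasing_by all_goals (simp; try omega)

theorem simpleSum_nil (χ : I × List (Arrow I) → A) (f : List (Arrow I) → A) :
    simpleSum χ [] f = f [] := by rw [simpleSum]

theorem simpleSum_cons (χ : I × List (Arrow I) → A) (a : Arrow I) (l : List (Arrow I))
    (f : List (Arrow I) → A) :
    simpleSum χ (a :: l) f = simpleSum χ l (fun w => f (a :: w)) +
      splitSum a l (fun u v => (chordSign a : A) * χ (Arrow.tgt a, u) * simpleSum χ v f) := by
  rw [simpleSum, splitSum]

theorem isEvalComb_wordSum (i : I) (l : List (Arrow I)) :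
    IsEvalComb (wordSum (A := A) i l) := by
  induction hn : l.length using Nat.strong_induction_on generalizing i l with
  | _ n ih =>
  subst hn
  cases l with
  | nil =>
    have : wordSum (A := A) i [] = fun f => f (.leaf (i, [])) := funext fun f => wordSum_nil i f
    rw [this]
    exact .eval _
  | cons a l =>
    have : wordSum (A := A) i (a :: l) = _ := funext fun f => wordSum_cons i a l f
    rw [this]
    refine .add ((ih _ (by simp) i l rfl).comap _) (.splitSum a l fun u v hu hv => ?_)
    refine .mul_left _ (.bind (ih _ (by simp; omega) _ u rfl) fun s => ?_)
    exact (ih _ (by simp; omega) i v rfl).comap _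

theorem isEvalComb_simpleSum (χ : I × List (Arrow I) → A) (l : List (Arrow I)) :
    IsEvalComb (simpleSum χ l) := by
  induction hn : l.length using Nat.strong_induction_on generalizing l with
  | _ n ih =>
  subst hn
  cases l with
  | nil =>
    have : simpleSum χ [] = fun f => f [] := funext fun f => simpleSum_nil χ f
    rw [this]
    exact .eval _
  | cons a l =>
    have : simpleSum χ (a :: l) = _ := funext fun f => simpleSum_cons χ a l f
    rw [this]
    refine .add ((ih _ (by simp) l rfl).comap _) (.splitSum a l fun u v hu hv => ?_)
    exact (ih _ (by simp; omega) v rfl).mul_left _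

/-- Splitting the word that remains after a simple cut is the same as splitting the word first and
then cutting both parts. -/
theorem simpleSum_splitSum (χ : I × List (Arrow I) → A) (a : Arrow I) (l : List (Arrow I))
    (F : List (Arrow I) → List (Arrow I) → A) :
    simpleSum χ l (fun w => splitSum a w F) =
      splitSum a l (fun u v => simpleSum χ u (fun x => simpleSum χ v (fun y => F x y))) := by
  classical
  induction hn : l.length using Nat.strong_induction_on generalizing l F with
  | _ n ih =>
  subst hn
  cases l with
  | nil => simp only [simpleSum_nil, splitSum_nil]
  | cons b l =>
    simp only [simpleSum_cons, splitSum_cons, simpleSum_nil]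
    rw [(isEvalComb_simpleSum χ l).map_add, ih _ (by simp) l _ rfl, splitSum_add, add_assoc,
      add_assoc, add_comm (splitSum a l _) (ite _ _ _)]
    congr 2
    · split
      · rfl
      · exact (isEvalComb_simpleSum χ l).map_zero
    -- The remaining case: `b` is matched. Its chord ends to the left of the splitting point, and
    -- the two positions can be chosen in either order. The renaming puts the inner summand in the
    -- form that `splitSum_splitSum` expects.
    · have h1 : ∀ u v, splitSum b u (fun x y => (chordSign b : A) * χ (Arrow.tgt b, x) *
            simpleSum χ y (fun x' => simpleSum χ v (fun y' => F x' y'))) =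
          splitSum b u (fun x y => (fun x y z => (chordSign b : A) * χ (Arrow.tgt b, x) *
            simpleSum χ y (fun x' => simpleSum χ z (fun y' => F x' y'))) x y v) := fun _ _ => rfl
      simp_rw [h1]
      rw [← splitSum_splitSum]
      refine splitSum_congr b l fun u v hu hv => ?_
      rw [ih _ (by simp; omega) v _ rfl, ← splitSum_mul_left]

/-- Summing over all cuts of a word and the simple cuts of the dual trees is the same as summing
over the simple cuts of the word and all cuts of the words they produce. -/
theorem wordSum_cutSum (χ f : PlanarTree (I × List (Arrow I)) → A) (i : I) (l : List (Arrow I)) :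
    wordSum i l (fun t => PlanarTree.cutSum χ t f) =
      simpleSum (fun w => wordSum w.1 w.2 χ) l (fun w => wordSum i w f) := by
  induction hn : l.length using Nat.strong_induction_on generalizing i l f with
  | _ n ih =>
  subst hn
  cases l with
  | nil => simp only [simpleSum_nil, wordSum_nil, PlanarTree.cutSum]
  | cons a l =>
    simp only [simpleSum_cons, wordSum_cons, cutSum_prependRoot]
    -- A letter `a` that is left unmatched by the simple cut may still be matched by a cut of the
    -- remaining word. `simpleSum_splitSum` chooses its partner first.
    rw [(isEvalComb_simpleSum _ l).map_add, ← ih _ (by simp) _ i l rfl, simpleSum_splitSum,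
      add_assoc, ← splitSum_add]
    congr 1
    refine splitSum_congr a l fun u v hu hv => ?_
    have hu' : u.length < (a :: l).length := by simp; omega
    have hv' : v.length < (a :: l).length := by simp; omega
    have Eu := isEvalComb_wordSum (A := A) (Arrow.tgt a) u
    have Ev := isEvalComb_wordSum (A := A) i v
    have Cu := isEvalComb_simpleSum (fun w => wordSum (A := A) w.1 w.2 χ) u
    have Cv := isEvalComb_simpleSum (fun w => wordSum (A := A) w.1 w.2 χ) v
    simp only [PlanarTree.cutSum]
    simp_rw [Ev.map_add, Eu.map_add, Ev.map_mul_left, Eu.map_mul_right, Cv.map_mul_left,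
      Cu.map_mul_left]
    -- The two terms: the edge across the chord of `a` is kept, or it is cut, and then `u` is one of
    -- the words cut off.
    rw [mul_add, add_comm]
    congr 1
    · congr 1
      -- Moving the cuts of `v` inside those of the tree of `u` lets the induction hypothesis apply
      -- to `u`; after a second interchange it applies to `v`.
      simp_rw [Ev.comm (PlanarTree.isEvalComb_cutSum χ _)]
      rw [ih _ hu' _ _ u rfl]
      congr 1
      ext x
      rw [Cv.comm (isEvalComb_wordSum (A := A) (Arrow.tgt a) x)]
      congr 1
      ext s
      exact ih _ hv' _ _ v rfl
    · rw [ih _ hv' _ _ v rfl, mul_assoc]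

end Words

/-! ### The parent relation of a rooted tree -/

namespace RootedTree

variable (T : RootedTree)

/-- `u` is the parent of `v`. -/
def Child (u v : T.V) : Prop := ∃ h : v ≠ T.root, (T.parent v h).1 = u

/-- The length of the path from `v` to the root. -/
def depth (v : T.V) : ℕ := (T.isTree.existsUnique_path v T.root).choose.length

variable {T}

theorem depth_eq {v : T.V} (q : T.graph.Walk v T.root) (hq : q.IsPath) : T.depth v = q.length := by
  have h := (T.isTree.existsUnique_path v T.root).choose_spec
  rw [depth, h.2 q hq]

theorem Child.adj {u v : T.V} (h : T.Child u v) : T.graph.Adj u v := by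
  obtain ⟨h, rfl⟩ := h
  exact (T.parent v h).2.symm

theorem Child.depth_eq {u v : T.V} (h : T.Child u v) : T.depth v = T.depth u + 1 := by
  obtain ⟨h, rfl⟩ := h
  obtain ⟨q, hq⟩ := (T.exists_parent v h).choose_spec
  exact (RootedTree.depth_eq _ hq).trans
    (congrArg (· + 1) (RootedTree.depth_eq q (SimpleGraph.Walk.cons_isPath_iff _ _ |>.1 hq).1).symm)

theorem not_child_root (u : T.V) : ¬ T.Child u T.root := fun ⟨h, _⟩ => h rfl

theorem Child.ne_root {u v : T.V} (h : T.Child u v) : v ≠ T.root := h.1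

theorem Child.unique {u u' v : T.V} (h : T.Child u v) (h' : T.Child u' v) : u = u' :=
  h.2.symm.trans h'.2

theorem exists_child {v : T.V} (h : v ≠ T.root) : ∃ u, T.Child u v := ⟨_, h, rfl⟩

theorem Child.asymm {u v : T.V} (h : T.Child u v) : ¬ T.Child v u := fun h' => by
  have := h.depth_eq
  have := h'.depth_eq
  omega

theorem child_of_isPath {u v : T.V} (h : T.graph.Adj v u) (q : T.graph.Walk u T.root)
    (hq : (q.cons h).IsPath) : T.Child u v := by
  have hv : v ≠ T.root := by
    rintro rfl
    have := SimpleGraph.Walk.isPath_iff_nil.1 hq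
    cases this
  refine ⟨hv, ?_⟩
  obtain ⟨q', hq'⟩ := (T.exists_parent v hv).choose_spec
  have := (T.isTree.existsUnique_path v T.root).unique hq hq'
  have h1 := congrArg (fun p => p.getVert 1) this
  exact q'.getVert_zero.symm.trans (h1.symm.trans q.getVert_zero)

/-- If the path from `u` to the root meets `v`, uniqueness of paths makes `v` its second vertex,
hence the parent of `u`. Otherwise the path can be prolonged by `v`, and `u` is the parent of `v`.
-/
theorem child_or_child {u v : T.V} (h : T.graph.Adj u v) : T.Child u v ∨ T.Child v u := by
  classical
  obtain ⟨q, hq, -⟩ := T.isTree.existsUnique_path u T.root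
  by_cases hv : v ∈ q.support
  · right
    have h1 : (q.takeUntil v hv).IsPath := hq.takeUntil hv
    have h2 : (SimpleGraph.Walk.cons h .nil).IsPath := by
      simp [SimpleGraph.Walk.cons_isPath_iff, h.ne]
    have h3 := (T.isTree.existsUnique_path u v).unique h1 h2
    have h4 := q.take_spec hv
    rw [h3, SimpleGraph.Walk.cons_append, SimpleGraph.Walk.nil_append] at h4
    exact child_of_isPath h _ (h4 ▸ hq)
  · left
    exact child_of_isPath h.symm q ((SimpleGraph.Walk.cons_isPath_iff _ _).2 ⟨hq, hv⟩)

theorem adj_iff {u v : T.V} : T.graph.Adj u v ↔ T.Child u v ∨ T.Child v u :=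
  ⟨child_or_child, fun h => h.elim Child.adj fun h => h.adj.symm⟩

/-- `v` is equal to `u` or a descendant of it. -/
def Desc (T : RootedTree) : T.V → T.V → Prop := Relation.ReflTransGen T.Child

theorem root_desc (v : T.V) : T.Desc T.root v := by
  induction hn : T.depth v using Nat.strong_induction_on generalizing v with
  | _ n ih =>
  by_cases h : v = T.root
  · rw [h]; exact .refl
  · obtain ⟨u, hu⟩ := exists_child h
    have := hu.depth_eq
    exact (ih (T.depth u) (by omega) u rfl).tail hu

theorem Desc.depth_le {u v : T.V} (h : T.Desc u v) : T.depth u ≤ T.depth v := by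
  induction h with
  | refl => rfl
  | tail _ h ih => have := h.depth_eq; omega

theorem Desc.antisymm {u v : T.V} (h : T.Desc u v) (h' : T.Desc v u) : u = v := by
  rcases Relation.ReflTransGen.cases_tail h with h1 | ⟨w, h1, h2⟩
  · exact h1.symm
  · have h3 := Desc.depth_le h1
    have h4 := h2.depth_eq
    have h5 := Desc.depth_le h'
    omega

theorem Desc.total {u v w : T.V} (h : T.Desc u w) (h' : T.Desc v w) :
    T.Desc u v ∨ T.Desc v u := by
  induction h with
  | refl => exact Or.inr h'
  | tail h1 h2 ih =>
    rcases Relation.ReflTransGen.cases_tail h' with h3 | ⟨y, h3, h4⟩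
    · subst h3
      exact Or.inl (.tail h1 h2)
    · rw [← h2.unique h4] at h3
      exact ih h3

/-- Induction on the depth: if `c` pointed the wrong way along an edge from `u` down to `v`, then
`v` and the true parent of `u` would be two `c`-parents of `u`. This identifies parents in
components, under isomorphisms and in dual trees without any walks. -/
theorem child_eq_of {c : T.V → T.V → Prop} (h1 : ∀ u, ¬ c u T.root)
    (h2 : ∀ u u' v, c u v → c u' v → u = u') (h3 : ∀ u v, T.graph.Adj u v ↔ c u v ∨ c v u)
    (u v : T.V) : T.Child u v ↔ c u v := by
  have key : ∀ n, ∀ u v, T.depth u = n → T.Child u v → c u v := by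
    intro n
    induction n using Nat.strong_induction_on with
    | _ n ih =>
    intro u v hn h
    rcases (h3 u v).1 h.adj with h4 | h4
    · exact h4
    · have hu : u ≠ T.root := by rintro rfl; exact (h1 _ h4).elim
      obtain ⟨w, hw⟩ := exists_child hu
      have := ih (T.depth w) (by have := hw.depth_eq; omega) w u rfl hw
      obtain rfl := h2 _ _ _ this h4
      exact (h.asymm hw).elim
  refine ⟨key _ u v rfl, fun h => ?_⟩
  have hv : v ≠ T.root := by rintro rfl; exact h1 _ h
  obtain ⟨w, hw⟩ := exists_child hv
  rwa [h2 _ _ _ h (key _ w v rfl hw)]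

/-- `w` is the vertex of its component of `T ∖ H` closest to the root. -/
def IsTop (T : RootedTree) (H : Set (Sym2 T.V)) (w : T.V) : Prop :=
  ∀ u, T.Child u w → s(u, w) ∈ H

theorem isTop_root (H : Set (Sym2 T.V)) : T.IsTop H T.root :=
  fun u hu => (not_child_root u hu).elim

/-- The edge above `w`, if there is one, is deleted, so a walk from `w` can never rise above `w`; a
step upwards only undoes the last step of a descending chain. -/
theorem reachable_iff {H : Set (Sym2 T.V)} {w : T.V} (hw : T.IsTop H w) (v : T.V) :
    (T.graph.deleteEdges H).Reachable w v ↔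
      Relation.ReflTransGen (fun a b => T.Child a b ∧ s(a, b) ∉ H) w v := by
  constructor
  · rintro ⟨p⟩
    induction p using SimpleGraph.Walk.concatRec with
    | Hnil => exact .refl
    | @Hconcat w b c p h ih =>
      have ih := ih hw
      rw [SimpleGraph.deleteEdges_adj] at h
      rcases child_or_child h.1 with h1 | h1
      · exact ih.tail ⟨h1, h.2⟩
      · rcases Relation.ReflTransGen.cases_tail ih with h2 | ⟨y, h2, h3⟩
        · subst h2
          exact (h.2 (by rw [Sym2.eq_swap]; exact hw _ h1)).elim
        · rwa [h1.unique h3.1]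
  · intro h
    induction h with
    | refl => exact .refl _
    | tail _ h ih =>
      refine ih.trans (SimpleGraph.Adj.reachable ?_)
      rw [SimpleGraph.deleteEdges_adj]
      exact ⟨h.1.adj, h.2⟩

theorem desc_of_reachable {H : Set (Sym2 T.V)} {w : T.V} (hw : T.IsTop H w) {v : T.V}
    (h : (T.graph.deleteEdges H).Reachable w v) : T.Desc w v :=
  Relation.ReflTransGen.mono (fun _ _ h => h.1) _ _ ((reachable_iff hw v).1 h)

theorem not_mem_of_child {H : Set (Sym2 T.V)} {w : T.V} (hw : T.IsTop H w) {u v : T.V}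
    (hu : (T.graph.deleteEdges H).Reachable w u) (hv : (T.graph.deleteEdges H).Reachable w v)
    (h : T.Child u v) : s(u, v) ∉ H := by
  rcases Relation.ReflTransGen.cases_tail ((reachable_iff hw v).1 hv) with h1 | ⟨y, h1, h2⟩
  · subst h1
    have := h.depth_eq
    have := (desc_of_reachable hw hu).depth_le
    omega
  · rw [h.unique h2.1]
    exact h2.2

theorem child_comp {H : Set (Sym2 T.V)} {w : T.V} (hw : T.IsTop H w) (u v : (T.comp H w).V) :
    (T.comp H w).Child u v ↔ T.Child u.1 v.1 := by
  apply child_eq_of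
  · intro u h
    have h1 : T.Child u.1 w := h
    have := h1.depth_eq
    have := (desc_of_reachable hw u.2).depth_le
    omega
  · intro u u' v h h'
    exact Subtype.ext (h.unique h')
  · intro u v
    change (T.graph.deleteEdges H).Adj u.1 v.1 ↔ _
    rw [SimpleGraph.deleteEdges_adj, adj_iff, and_iff_left_iff_imp]
    rintro (h | h)
    · exact not_mem_of_child hw u.2 v.2 h
    · rw [Sym2.eq_swap]
      exact not_mem_of_child hw v.2 u.2 h

theorem child_iso {T T' : RootedTree} (f : T.graph ≃g T'.graph) (hf : f T.root = T'.root)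
    (u v : T.V) : T.Child u v ↔ T'.Child (f u) (f v) := by
  refine child_eq_of (c := fun u v => T'.Child (f u) (f v)) ?_ ?_ ?_ u v
  · intro u
    rw [hf]
    exact not_child_root _
  · intro u u' v h h'
    exact f.injective (h.unique h')
  · intro u v
    rw [← f.map_adj_iff, adj_iff]

end RootedTree

/-! ### Planar data -/

/-- The data which determine a planar rooted tree with vertex set `V`: the parent relation, the
order of the children of each vertex, the vertices whose edge towards the root points away from the
root, and the labels. -/
structure PlanarData (L : Type*) (V : Type*) where
  ch : V → V → Prop
  le : V → V → Prop
  dn : V → Prop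
  lab : V → L

namespace PlanarData

variable {L : Type*} {V W Z : Type*}

/-- `f` is an embedding of planar trees. -/
structure IsEmb (P : PlanarData L V) (Q : PlanarData L W) (f : V → W) : Prop where
  inj : Function.Injective f
  ch : ∀ x y, P.ch x y ↔ Q.ch (f x) (f y)
  -- The order is compared among siblings only, and `dn` only at vertices which have a parent;
  -- elsewhere the values carry no information.
  le : ∀ z x y, P.ch z x → P.ch z y → (P.le x y ↔ Q.le (f x) (f y))
  dn : ∀ z x, P.ch z x → (P.dn x ↔ Q.dn (f x))
  lab : ∀ x, P.lab x = Q.lab (f x)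

theorem IsEmb.id (P : PlanarData L V) : P.IsEmb P id :=
  ⟨Function.injective_id, fun _ _ => Iff.rfl, fun _ _ _ _ _ => Iff.rfl, fun _ _ _ => Iff.rfl,
    fun _ => rfl⟩

theorem IsEmb.comp {P : PlanarData L V} {Q : PlanarData L W} {R : PlanarData L Z} {f : V → W}
    {g : W → Z} (hg : Q.IsEmb R g) (hf : P.IsEmb Q f) : P.IsEmb R (g ∘ f) where
  inj := hg.inj.comp hf.inj
  ch x y := (hf.ch x y).trans (hg.ch _ _)
  le z x y hx hy := (hf.le z x y hx hy).trans (hg.le (f z) _ _ ((hf.ch _ _).1 hx) ((hf.ch _ _).1 hy))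
  dn z x hx := (hf.dn z x hx).trans (hg.dn (f z) _ ((hf.ch _ _).1 hx))
  lab x := (hf.lab x).trans (hg.lab _)

/-- An embedding into `R` whose image lies in that of the embedding `g` factors through `g`. -/
theorem IsEmb.of_comp {P : PlanarData L V} {Q : PlanarData L W} {R : PlanarData L Z} {f : V → W}
    {g : W → Z} (hg : Q.IsEmb R g) (hf : P.IsEmb R (g ∘ f)) : P.IsEmb Q f where
  inj := hf.inj.of_comp
  ch x y := (hf.ch x y).trans (hg.ch _ _).symm
  le z x y hx hy := (hf.le z x y hx hy).trans
    (hg.le (f z) _ _ ((hg.ch _ _).2 ((hf.ch _ _).1 hx)) ((hg.ch _ _).2 ((hf.ch _ _).1 hy))).symm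
  dn z x hx := (hf.dn z x hx).trans (hg.dn (f z) _ ((hg.ch _ _).2 ((hf.ch _ _).1 hx))).symm
  lab x := (hf.lab x).trans (hg.lab _).symm

theorem IsEmb.symm {P : PlanarData L V} {Q : PlanarData L W} (e : V ≃ W) (h : P.IsEmb Q e) :
    Q.IsEmb P e.symm := by
  refine h.of_comp ?_
  rw [Equiv.self_comp_symm]
  exact .id _

/-- `R` is obtained from `Q` by adding an edge from `q` to the root `p` of `P`, as the first edge
at `q`. -/
structure IsGraft (o : Prop) (P : PlanarData L V) (p : V) (Q : PlanarData L W) (q : W)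
    (R : PlanarData L Z) (α : V → Z) (β : W → Z) : Prop where
  inj : Function.Injective (Sum.elim α β)
  ch_left : ∀ x y, R.ch (α x) (α y) ↔ P.ch x y
  ch_right : ∀ x y, R.ch (β x) (β y) ↔ Q.ch x y
  not_ch : ∀ x y, ¬ R.ch (α x) (β y)
  ch_right_left : ∀ x y, R.ch (β x) (α y) ↔ x = q ∧ y = p
  le_left : ∀ z x y, P.ch z x → P.ch z y → (P.le x y ↔ R.le (α x) (α y))
  le_right : ∀ z x y, Q.ch z x → Q.ch z y → (Q.le x y ↔ R.le (β x) (β y))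
  le_self : R.le (α p) (α p)
  le_first : ∀ y, Q.ch q y → R.le (α p) (β y) ∧ ¬ R.le (β y) (α p)
  dn_left : ∀ z x, P.ch z x → (P.dn x ↔ R.dn (α x))
  dn_right : ∀ z x, Q.ch z x → (Q.dn x ↔ R.dn (β x))
  dn_first : o ↔ R.dn (α p)
  lab_left : ∀ x, P.lab x = R.lab (α x)
  lab_right : ∀ x, Q.lab x = R.lab (β x)

end PlanarData

namespace PlanarTree

variable {L : Type*} {Z : Type*}

/-- The vertices of a planar tree. -/
def V : PlanarTree L → Type
  | leaf _ => Unit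
  | graft _ s t => s.V ⊕ t.V

/-- The root. -/
def root : (t : PlanarTree L) → t.V
  | leaf _ => ()
  | graft _ _ t => Sum.inr t.root

instance instFintypeV : (t : PlanarTree L) → Fintype t.V
  | leaf _ => inferInstanceAs (Fintype Unit)
  | graft _ s t => @instFintypeSum _ _ (instFintypeV s) (instFintypeV t)

/-- The parent relation. -/
def ch : (t : PlanarTree L) → t.V → t.V → Prop
  | leaf _ => fun _ _ => False
  | graft _ s t => Sum.elim (fun x => Sum.elim (fun y => s.ch x y) (fun _ => False))
      (fun x => Sum.elim (fun y => x = t.root ∧ y = s.root) (fun y => t.ch x y))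

/-- The order on siblings. -/
def le : (t : PlanarTree L) → t.V → t.V → Prop
  | leaf _ => fun _ _ => True
  -- The only siblings in different parts are the root of `s` and the children of the root of `t`,
  -- and the root of `s` comes first.
  | graft _ s t => Sum.elim (fun x => Sum.elim (fun y => s.le x y) (fun _ => True))
      (fun x => Sum.elim (fun _ => False) (fun y => t.le x y))

/-- The edge of the vertex towards the root points away from the root. -/
def dn : (t : PlanarTree L) → t.V → Prop
  | leaf _ => fun _ => False
  | graft o s t => Sum.elim (fun x => (x = s.root ∧ o) ∨ (x ≠ s.root ∧ s.dn x)) (fun x => t.dn x)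

/-- The labels. -/
def lab : (t : PlanarTree L) → t.V → L
  | leaf l => fun _ => l
  | graft _ s t => Sum.elim s.lab t.lab

/-- The planar data of a planar tree. -/
def data (t : PlanarTree L) : PlanarData L t.V := ⟨t.ch, t.le, t.dn, t.lab⟩

theorem not_ch_root (t : PlanarTree L) (x : t.V) : ¬ t.ch x t.root := by
  induction t with
  | leaf l => exact id
  | graft o s t _ ih =>
    rcases x with x | x
    · exact id
    · exact ih x

theorem le_root (t : PlanarTree L) : t.le t.root t.root := by
  induction t with
  | leaf l => trivial
  | graft o s t _ ih => exact ih

theorem exists_ch (t : PlanarTree L) {x : t.V} (hx : x ≠ t.root) : ∃ y, t.ch y x := by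
  induction t with
  | leaf l => exact (hx rfl).elim
  | graft o s t ihs iht =>
    rcases x with x | x
    · by_cases h : x = s.root
      · exact ⟨Sum.inr t.root, rfl, h⟩
      · obtain ⟨y, hy⟩ := ihs h
        exact ⟨Sum.inl y, hy⟩
    · obtain ⟨y, hy⟩ := iht (fun h => hx (congrArg Sum.inr h))
      exact ⟨Sum.inr y, hy⟩

/-- The root goes to the root under an embedding onto a tree with root `r`. -/
theorem map_root (t : PlanarTree L) {P : PlanarData L Z} {f : t.V → Z} (h : t.data.IsEmb P f)
    (hf : Function.Surjective f) {r : Z} (hr : ∀ x, ¬ P.ch x r) : f t.root = r := by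
  obtain ⟨x, rfl⟩ := hf r
  by_cases hx : x = t.root
  · rw [hx]
  · obtain ⟨y, hy⟩ := t.exists_ch hx
    exact (hr _ ((h.ch y x).1 hy)).elim

/-- The inductive step for recognizing a planar tree: used for codes of rooted trees, for the trunks
of cuts and for dual trees. -/
theorem isEmb_graft {o : Prop} {s t : PlanarTree L} {V W : Type*} {P : PlanarData L V} {p : V}
    {Q : PlanarData L W} {q : W} {R : PlanarData L Z} {α : V → Z} {β : W → Z}
    (hR : PlanarData.IsGraft o P p Q q R α β) {f : s.V → V} {g : t.V → W} (hf : s.data.IsEmb P f)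
    (hg : t.data.IsEmb Q g) (hp : f s.root = p) (hq : g t.root = q) :
    (graft o s t).data.IsEmb R (Sum.elim (α ∘ f) (β ∘ g)) where
  inj := by
    have : Sum.elim (α ∘ f) (β ∘ g) = Sum.elim α β ∘ Sum.map f g := by
      ext x
      rcases x with x | x <;> rfl
    rw [this]
    exact hR.inj.comp (Sum.map_injective.2 ⟨hf.inj, hg.inj⟩)
  ch x y := by
    rcases x with x | x <;> rcases y with y | y
    · exact (hf.ch x y).trans (hR.ch_left _ _).symm
    · exact ⟨False.elim, hR.not_ch _ _⟩
    · refine Iff.trans ?_ (hR.ch_right_left _ _).symm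
      rw [← hp, ← hq, hf.inj.eq_iff, hg.inj.eq_iff]
      rfl
    · exact (hg.ch x y).trans (hR.ch_right _ _).symm
  le z x y hx hy := by
    rcases x with x | x <;> rcases y with y | y
    · rcases z with z | z
      · exact (hf.le z x y hx hy).trans (hR.le_left _ _ _ ((hf.ch _ _).1 hx) ((hf.ch _ _).1 hy))
      · obtain rfl : x = s.root := hx.2
        obtain rfl : y = s.root := hy.2
        refine ⟨fun _ => ?_, fun _ => s.le_root⟩
        change R.le (α (f s.root)) (α (f s.root))
        rw [hp]
        exact hR.le_self
    · rcases z with z | z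
      · exact hy.elim
      · obtain rfl : x = s.root := hx.2
        obtain rfl : z = t.root := hx.1
        refine ⟨fun _ => ?_, fun _ => trivial⟩
        change R.le (α (f s.root)) (β (g y))
        rw [hp]
        exact (hR.le_first _ (hq ▸ (hg.ch _ _).1 hy)).1
    · rcases z with z | z
      · exact hx.elim
      · obtain rfl : y = s.root := hy.2
        obtain rfl : z = t.root := hy.1
        refine ⟨False.elim, fun h => ?_⟩
        change R.le (β (g x)) (α (f s.root)) at h
        rw [hp] at h
        exact ((hR.le_first _ (hq ▸ (hg.ch _ _).1 hx)).2 h).elim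
    · rcases z with z | z
      · exact hx.elim
      · exact (hg.le z x y hx hy).trans (hR.le_right _ _ _ ((hg.ch _ _).1 hx) ((hg.ch _ _).1 hy))
  dn z x hx := by
    rcases x with x | x
    · rcases z with z | z
      · have hne : x ≠ s.root := by rintro rfl; exact s.not_ch_root z hx
        refine Iff.trans ?_ ((hf.dn z x hx).trans (hR.dn_left _ _ ((hf.ch _ _).1 hx)))
        exact ⟨fun h => h.elim (fun h => (hne h.1).elim) And.right, fun h => Or.inr ⟨hne, h⟩⟩
      · obtain rfl : x = s.root := hx.2
        have h2 := hR.dn_first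
        rw [← hp] at h2
        refine Iff.trans ?_ h2
        exact ⟨fun h => h.elim And.right (fun h => (h.1 rfl).elim), fun h => Or.inl ⟨rfl, h⟩⟩
    · rcases z with z | z
      · exact hx.elim
      · exact (hg.dn z x hx).trans (hR.dn_right _ _ ((hg.ch _ _).1 hx))
  lab x := by
    rcases x with x | x
    · exact (hf.lab x).trans (hR.lab_left _)
    · exact (hg.lab x).trans (hR.lab_right _)

theorem isGraft_graft (o : Prop) (s t : PlanarTree L) :
    PlanarData.IsGraft o s.data s.root t.data t.root (graft o s t).data Sum.inl Sum.inr where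
  inj x y h := by rcases x with x | x <;> rcases y with y | y <;> exact h
  ch_left _ _ := Iff.rfl
  ch_right _ _ := Iff.rfl
  not_ch _ _ := id
  ch_right_left _ _ := Iff.rfl
  le_left _ _ _ _ _ := Iff.rfl
  le_right _ _ _ _ _ := Iff.rfl
  le_self := s.le_root
  le_first _ _ := ⟨trivial, id⟩
  dn_left z x hx := by
    have hne : x ≠ s.root := by rintro rfl; exact s.not_ch_root z hx
    exact ⟨fun h => Or.inr ⟨hne, h⟩, fun h => h.elim (fun h => (hne h.1).elim) And.right⟩
  dn_right _ _ _ := Iff.rfl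
  dn_first := ⟨fun h => Or.inl ⟨rfl, h⟩, fun h => h.elim And.right (fun h => (h.1 rfl).elim)⟩
  lab_left _ := rfl
  lab_right _ := rfl

theorem isEmb_inl (o : Prop) (s t : PlanarTree L) :
    s.data.IsEmb (graft o s t).data Sum.inl :=
  have h := isGraft_graft o s t
  ⟨Sum.inl_injective, fun x y => (h.ch_left x y).symm, h.le_left, h.dn_left, h.lab_left⟩

theorem isEmb_inr (o : Prop) (s t : PlanarTree L) :
    t.data.IsEmb (graft o s t).data Sum.inr :=
  have h := isGraft_graft o s t
  ⟨Sum.inr_injective, fun x y => (h.ch_right x y).symm, h.le_right, h.dn_right, h.lab_right⟩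

/-- `y` is equal to `x` or a descendant of it. -/
def desc (t : PlanarTree L) : t.V → t.V → Prop := Relation.ReflTransGen t.ch

theorem root_desc (t : PlanarTree L) (x : t.V) : t.desc t.root x := by
  induction t with
  | leaf l => exact .refl
  | graft o s t ihs iht =>
    rcases x with x | x
    · have h1 : (graft o s t).ch (Sum.inr t.root) (Sum.inl s.root) := ⟨rfl, rfl⟩
      exact (Relation.ReflTransGen.single h1).trans
        (Relation.ReflTransGen.lift (Sum.inl : s.V → (graft o s t).V) (fun _ _ h => h) _ _ (ihs x))
    · exact Relation.ReflTransGen.lift (Sum.inr : t.V → (graft o s t).V) (fun _ _ h => h) _ _ (iht x)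

theorem not_desc_root (t : PlanarTree L) {x : t.V} (hx : x ≠ t.root) : ¬ t.desc x t.root := by
  intro h
  rcases Relation.ReflTransGen.cases_tail h with h | ⟨y, -, h⟩
  · exact hx h.symm
  · exact t.not_ch_root y h

theorem desc_inl_iff {o : Prop} {s t : PlanarTree L} (x : s.V) (y : (graft o s t).V) :
    (graft o s t).desc (Sum.inl x) y ↔ ∃ y', y = Sum.inl y' ∧ s.desc x y' := by
  constructor
  · intro h
    induction h with
    | refl => exact ⟨x, rfl, .refl⟩
    | @tail y z _ h ih =>
      obtain ⟨y', rfl, ih⟩ := ih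
      rcases z with z | z
      · exact ⟨z, rfl, ih.tail h⟩
      · exact h.elim
  · rintro ⟨y', rfl, h⟩
    exact Relation.ReflTransGen.lift (Sum.inl : s.V → (graft o s t).V) (fun _ _ h => h) _ _ h

/-- The root of `t` must be excluded, as it acquires the vertices of `s` as descendants. -/
theorem desc_inr_iff {o : Prop} {s t : PlanarTree L} {x : t.V} (hx : x ≠ t.root)
    (y : (graft o s t).V) :
    (graft o s t).desc (Sum.inr x) y ↔ ∃ y', y = Sum.inr y' ∧ t.desc x y' := by
  constructor
  · intro h
    induction h with
    | refl => exact ⟨x, rfl, .refl⟩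
    | @tail y z _ h ih =>
      obtain ⟨y', rfl, ih⟩ := ih
      rcases z with z | z
      · obtain rfl : y' = t.root := h.1
        exact (t.not_desc_root hx ih).elim
      · exact ⟨z, rfl, ih.tail h⟩
  · rintro ⟨y', rfl, h⟩
    exact Relation.ReflTransGen.lift (Sum.inr : t.V → (graft o s t).V) (fun _ _ h => h) _ _ h

end PlanarTree

/-! ### The planar data of a rooted tree with structure -/

section Data

variable {I : Type*} [Quiver I]

/-- The label of a path. -/
def QPath.word (X : QPath I) : I × List (Arrow I) := (X.start, X.arrows)

theorem QPath.word_injective : Function.Injective (QPath.word (I := I)) := fun _ _ h =>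
  QPath.ext (congrArg Prod.fst h) (congrArg Prod.snd h)

theorem PhiRt.linOrd_root {T : RootedTree} (s : PhiRt I T) (a b : T.graph.neighborSet T.root) :
    (s.linOrd T.root).le a b ↔ s.corner.le a b := by
  unfold linOrd
  rw [dif_pos rfl]

theorem PhiRt.linOrd_of_ne {T : RootedTree} (s : PhiRt I T) {v : T.V} (hv : v ≠ T.root)
    (a b : T.graph.neighborSet v) :
    (s.linOrd v).le a b ↔
      a = T.parent v hv ∨ (b ≠ T.parent v hv ∧ (s.ribbon v).btw (T.parent v hv) a b) := by
  unfold linOrd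
  rw [dif_neg hv]
  rfl

namespace RTree

/-- The planar data of a rooted tree with structure. -/
def data (X : RTree I) : PlanarData (I × List (Arrow I)) X.1.V where
  ch := X.1.Child
  le a b := ∃ (p : X.1.V) (ha : X.1.graph.Adj p a) (hb : X.1.graph.Adj p b),
    X.1.Child p a ∧ X.1.Child p b ∧ (X.2.linOrd p).le ⟨a, ha⟩ ⟨b, hb⟩
  dn v := ∃ u, X.1.Child u v ∧ X.2.orient.arr u v
  lab v := (X.2.label v).word

theorem data_le_iff (X : RTree I) {p a b : X.1.V} (ha : X.1.Child p a) (hb : X.1.Child p b) :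
    X.data.le a b ↔ (X.2.linOrd p).le ⟨a, ha.adj⟩ ⟨b, hb.adj⟩ := by
  constructor
  · rintro ⟨q, h1, h2, h3, h4, h5⟩
    obtain rfl := ha.unique h3
    exact h5
  · exact fun h => ⟨p, _, _, ha, hb, h⟩

theorem data_dn_iff (X : RTree I) {u v : X.1.V} (h : X.1.Child u v) :
    X.data.dn v ↔ X.2.orient.arr u v := by
  constructor
  · rintro ⟨q, h1, h2⟩
    rwa [h.unique h1]
  · exact fun h' => ⟨u, h, h'⟩

theorem orient_iff (X : RTree I) (u v : X.1.V) : X.2.orient.arr u v ↔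
    (X.1.Child u v ∧ X.data.dn v) ∨ (X.1.Child v u ∧ ¬ X.data.dn u) := by
  constructor
  · intro h
    rcases RootedTree.child_or_child (X.2.orient.adj_of_arr h) with h1 | h1
    · exact Or.inl ⟨h1, (X.data_dn_iff h1).2 h⟩
    · exact Or.inr ⟨h1, fun h2 => X.2.orient.asymm h ((X.data_dn_iff h1).1 h2)⟩
  · rintro (⟨h1, h2⟩ | ⟨h1, h2⟩)
    · exact (X.data_dn_iff h1).1 h2
    · exact (X.2.orient.arr_or_arr h1.adj.symm).resolve_right fun h3 => h2 ((X.data_dn_iff h1).2 h3)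

/-- The parent comes first and the children follow in their order. Hence the planar data determine
the corner and all linear orders, and with them the ribbon structure. -/
theorem linOrd_iff (X : RTree I) (p : X.1.V) (a b : X.1.graph.neighborSet p) :
    (X.2.linOrd p).le a b ↔ X.1.Child a p ∨ (X.1.Child p a ∧ X.1.Child p b ∧ X.data.le a b) := by
  have hbot : ∀ a : X.1.graph.neighborSet p, X.1.Child a p → ∀ b, (X.2.linOrd p).le a b := by
    intro a ha b
    have hp := ha.ne_root
    rw [PhiRt.linOrd_of_ne _ hp]
    exact Or.inl (Subtype.ext (ha.unique ⟨hp, rfl⟩))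
  by_cases ha : X.1.Child a p
  · exact ⟨fun _ => Or.inl ha, fun _ => hbot a ha b⟩
  · have ha' := (RootedTree.child_or_child a.2).resolve_right ha
    by_cases hb : X.1.Child b p
    · refine ⟨fun h => ?_, ?_⟩
      · have := (X.2.linOrd p).le_antisymm _ _ h (hbot b hb a)
        rw [this] at ha
        exact (ha hb).elim
      · rintro (h | ⟨-, h, -⟩)
        · exact (ha h).elim
        · exact (h.asymm hb).elim
    · have hb' := (RootedTree.child_or_child b.2).resolve_right hb
      rw [X.data_le_iff ha' hb']
      exact ⟨fun h => Or.inr ⟨ha', hb', h⟩, fun h => (h.resolve_left ha).2.2⟩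

/-- A bijection which preserves the planar data is an isomorphism. -/
theorem equiv_of_isEmb {X Y : RTree I} (e : X.1.V ≃ Y.1.V) (h : X.data.IsEmb Y.data e) :
    X ≈ Y := by
  have hadj : ∀ {u v}, Y.1.graph.Adj (e u) (e v) ↔ X.1.graph.Adj u v := fun {u v} => by
    rw [RootedTree.adj_iff, RootedTree.adj_iff]
    exact (or_congr (h.ch u v) (h.ch v u)).symm
  have hroot : e X.1.root = Y.1.root := by
    by_contra hne
    obtain ⟨u, hu⟩ := RootedTree.exists_child hne
    obtain ⟨u, rfl⟩ := e.surjective u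
    exact RootedTree.not_child_root u ((h.ch _ _).2 hu)
  have hlin : ∀ (p p' : _) (a b : X.1.graph.neighborSet p) (a' b' : Y.1.graph.neighborSet p'),
      e p = p' → e a = a' → e b = b' →
      ((X.2.linOrd p).le a b ↔ (Y.2.linOrd p').le a' b') := by
    rintro p _ a b a' b' rfl ha hb
    rw [linOrd_iff, linOrd_iff, ← ha, ← hb]
    have h1 : X.1.Child a p ↔ Y.1.Child (e a) (e p) := h.ch _ _
    have h2 : X.1.Child p a ↔ Y.1.Child (e p) (e a) := h.ch _ _
    have h3 : X.1.Child p b ↔ Y.1.Child (e p) (e b) := h.ch _ _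
    rw [← h1, ← h2, ← h3]
    refine or_congr Iff.rfl (and_congr_right fun h4 => and_congr_right fun h5 => ?_)
    exact h.le p a b h4 h5
  refine ⟨⟨e, hadj⟩, hroot, ?_, ?_, ?_, ?_⟩
  · intro v a b c
    -- A cyclic order is determined by any of its corners, so it suffices to compare the linear
    -- orders at `v` and `e v`.
    rw [X.2.isCorner_linOrd v, Y.2.isCorner_linOrd (e v)]
    have key : ∀ a b : X.1.graph.neighborSet v, (X.2.linOrd v).le a b ↔
        (Y.2.linOrd (e v)).le (SimpleGraph.Iso.mapNeighborSet ⟨e, hadj⟩ v a)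
          (SimpleGraph.Iso.mapNeighborSet ⟨e, hadj⟩ v b) :=
      fun a b => hlin v _ a b _ _ rfl rfl rfl
    rw [key, key, key]
  · intro a b a' b' ha hb
    rw [← PhiRt.linOrd_root, ← PhiRt.linOrd_root]
    exact hlin _ _ a b a' b' hroot ha hb
  · intro v w
    rw [orient_iff, orient_iff]
    have h1 : X.1.Child v w ↔ Y.1.Child (e v) (e w) := h.ch _ _
    have h2 : X.1.Child w v ↔ Y.1.Child (e w) (e v) := h.ch _ _
    change _ ↔ (Y.1.Child (e v) (e w) ∧ Y.data.dn (e w)) ∨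
      (Y.1.Child (e w) (e v) ∧ ¬ Y.data.dn (e v))
    rw [← h1, ← h2]
    refine or_congr (and_congr_right fun h3 => h.dn _ _ h3)
      (and_congr_right fun h3 => not_congr (h.dn _ _ h3))
  · exact fun v => QPath.word_injective (h.lab v)

/-- An isomorphism preserves the planar data. -/
theorem isEmb_of_isIso {X Y : RTree I} {f : X.1.graph ≃g Y.1.graph} (h : RTree.IsIso X Y f) :
    X.data.IsEmb Y.data f where
  inj := f.injective
  ch := RootedTree.child_iso f h.root
  le z x y hx hy := by
    have hx' := (RootedTree.child_iso f h.root _ _).1 hx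
    have hy' := (RootedTree.child_iso f h.root _ _).1 hy
    rw [X.data_le_iff hx hy, Y.data_le_iff hx' hy']
    by_cases hz : z = X.1.root
    · subst hz
      rw [PhiRt.linOrd_root]
      have key : ∀ (r : Y.1.V) (hr : r = Y.1.root) (ha : Y.1.graph.Adj r (f x))
          (hb : Y.1.graph.Adj r (f y)),
          (Y.2.linOrd r).le ⟨f x, ha⟩ ⟨f y, hb⟩ ↔
            Y.2.corner.le ⟨f x, hr ▸ ha⟩ ⟨f y, hr ▸ hb⟩ := by
        rintro r rfl ha hb
        exact PhiRt.linOrd_root _ _ _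
      rw [key _ h.root]
      exact h.corner _ _ _ _ rfl rfl
    · have hz' : f z ≠ Y.1.root := fun h' => hz (f.injective (h'.trans h.root.symm))
      rw [PhiRt.linOrd_of_ne _ hz, PhiRt.linOrd_of_ne _ hz']
      have hp : f.mapNeighborSet z (X.1.parent z hz) = Y.1.parent (f z) hz' := by
        refine Subtype.ext ?_
        have : Y.1.Child (f (X.1.parent z hz)) (f z) :=
          (RootedTree.child_iso f h.root _ _).1 ⟨hz, rfl⟩
        exact this.unique ⟨hz', rfl⟩
      rw [h.ribbon z, ← hp]
      exact or_congr (f.mapNeighborSet z).injective.eq_iff.symm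
        (and_congr (not_congr (f.mapNeighborSet z).injective.eq_iff.symm) Iff.rfl)
  dn z x hx := by
    rw [X.data_dn_iff hx, Y.data_dn_iff ((RootedTree.child_iso f h.root _ _).1 hx)]
    exact h.orient _ _
  lab x := congrArg QPath.word (h.label x)

/-- At the top `w` the corner of the component is the restricted linear order by definition. At any
other vertex the parent lies in the component, so the cyclic order is opened at the same edge as
before. -/
theorem isEmb_comp (X : RTree I) {H : Set (Sym2 X.1.V)} {w : X.1.V} (hw : X.1.IsTop H w) :
    (X.comp H w).data.IsEmb X.data Subtype.val where
  inj := Subtype.val_injective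
  ch := RootedTree.child_comp hw
  le z x y hx hy := by
    have hx' : X.1.Child z.1 x.1 := (RootedTree.child_comp hw _ _).1 hx
    have hy' : X.1.Child z.1 y.1 := (RootedTree.child_comp hw _ _).1 hy
    rw [(X.comp H w).data_le_iff hx hy, X.data_le_iff hx' hy']
    by_cases hz : z = (X.comp H w).1.root
    · subst hz
      rw [PhiRt.linOrd_root]
      rfl
    · have hz' : z.1 ≠ X.1.root := by
        obtain ⟨u, hu⟩ := RootedTree.exists_child hz
        exact ((RootedTree.child_comp hw _ _).1 hu).ne_root
      rw [PhiRt.linOrd_of_ne _ hz, PhiRt.linOrd_of_ne _ hz']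
      have hp : compNbr X.1.graph H w z ((X.comp H w).1.parent z hz) = X.1.parent z.1 hz' := by
        refine Subtype.ext ?_
        have : X.1.Child ((X.comp H w).1.parent z hz).1.1 z.1 :=
          (RootedTree.child_comp hw _ _).1 ⟨hz, rfl⟩
        exact this.unique ⟨hz', rfl⟩
      rw [← hp]
      exact or_congr (compNbr_injective X.1.graph H w z).eq_iff.symm
        (and_congr (not_congr (compNbr_injective X.1.graph H w z).eq_iff.symm) Iff.rfl)
  dn z x hx := by
    rw [(X.comp H w).data_dn_iff hx, X.data_dn_iff ((RootedTree.child_comp hw _ _).1 hx)]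
    exact ⟨fun h => h.1, fun h => ⟨h, hx.adj⟩⟩
  lab x := rfl

/-! ### Codes -/

/-- `t` is a planar tree isomorphic to `X`. -/
def HasCode (X : RTree I) (t : PlanarTree (I × List (Arrow I))) : Prop :=
  ∃ f : t.V → X.1.V, t.data.IsEmb X.data f ∧ Function.Bijective f

/-- This makes `codeVal` meaningful: functions of isomorphism classes can be evaluated at planar
trees. -/
theorem HasCode.equiv {X Y : RTree I} {t : PlanarTree (I × List (Arrow I))} (hX : X.HasCode t)
    (hY : Y.HasCode t) : X ≈ Y := by
  obtain ⟨f, hf, hf'⟩ := hX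
  obtain ⟨g, hg, hg'⟩ := hY
  have hf2 := PlanarData.IsEmb.symm (Equiv.ofBijective f hf') hf
  have h : X.data.IsEmb Y.data (g ∘ (Equiv.ofBijective f hf').symm) := hg.comp hf2
  exact equiv_of_isEmb ((Equiv.ofBijective f hf').symm.trans (Equiv.ofBijective g hg')) h

theorem HasCode.of_equiv {X Y : RTree I} {t : PlanarTree (I × List (Arrow I))} (hX : X.HasCode t)
    (h : X ≈ Y) : Y.HasCode t := by
  obtain ⟨f, hf, hf'⟩ := hX
  obtain ⟨g, hg⟩ := h
  exact ⟨g ∘ f, (isEmb_of_isIso hg).comp hf, g.bijective.comp hf'⟩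

/-- The codes of a component depend only on its set of vertices inside `X`. Components for different
sets of deleted edges can thus be compared. -/
theorem hasCode_comp_iff (X : RTree I) {H : Set (Sym2 X.1.V)} {w : X.1.V} (hw : X.1.IsTop H w)
    (t : PlanarTree (I × List (Arrow I))) : (X.comp H w).HasCode t ↔ ∃ f : t.V → X.1.V,
      t.data.IsEmb X.data f ∧ ∀ v, v ∈ Set.range f ↔ (X.1.graph.deleteEdges H).Reachable w v := by
  constructor
  · rintro ⟨f, hf, hf'⟩
    refine ⟨Subtype.val ∘ f, (X.isEmb_comp hw).comp hf, fun v => ⟨?_, fun hv => ?_⟩⟩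
    · rintro ⟨x, rfl⟩
      exact (f x).2
    · obtain ⟨x, hx⟩ := hf'.2 ⟨v, hv⟩
      exact ⟨x, congrArg Subtype.val hx⟩
  · rintro ⟨f, hf, hf'⟩
    let g : t.V → (X.comp H w).1.V := fun x => ⟨f x, (hf' _).1 ⟨x, rfl⟩⟩
    have hg : t.data.IsEmb (X.comp H w).data g := (X.isEmb_comp hw).of_comp hf
    refine ⟨g, hg, hg.inj, fun v => ?_⟩
    obtain ⟨x, hx⟩ := (hf' v.1).2 v.2
    exact ⟨x, Subtype.ext hx⟩

end RTree

end Data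

/-! ### Components of a rooted tree -/

namespace RootedTree

variable {T : RootedTree}

theorem reachable_iff_desc {H : Set (Sym2 T.V)} {w : T.V} (hw : T.IsTop H w) (v : T.V) :
    (T.graph.deleteEdges H).Reachable w v ↔
      T.Desc w v ∧ ∀ a b, T.Child a b → s(a, b) ∈ H → T.Desc w a → ¬ T.Desc b v := by
  rw [reachable_iff hw]
  constructor
  · intro h
    refine ⟨Relation.ReflTransGen.mono (fun _ _ h => h.1) _ _ h, fun a b hab hH hwa => ?_⟩
    induction h with
    | refl =>
      intro hb
      have := hab.depth_eq
      have := hwa.depth_le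
      have := hb.depth_le
      omega
    | tail _ h ih =>
      intro hb
      rcases Relation.ReflTransGen.cases_tail hb with h1 | ⟨y, h1, h2⟩
      · subst h1
        rw [hab.unique h.1] at hH
        exact h.2 hH
      · rw [h2.unique h.1] at h1
        exact ih h1
  · rintro ⟨h, h'⟩
    induction h with
    | refl => exact .refl
    | tail h1 h2 ih =>
      exact (ih fun a b hab hH hwa hb => h' a b hab hH hwa (hb.tail h2)).tail
        ⟨h2, fun hH => h' _ _ h2 hH h1 .refl⟩

theorem mem_pair {u v a b : T.V} (h : T.Child u v) (h' : T.Child a b) (he : s(a, b) = s(u, v)) :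
    a = u ∧ b = v := by
  rcases Sym2.eq_iff.1 he with h1 | ⟨rfl, rfl⟩
  · exact h1
  · exact (h.asymm h').elim

theorem isTop_of_child {u v : T.V} {H : Set (Sym2 T.V)} (h : T.Child u v) (hH : s(u, v) ∈ H) :
    T.IsTop H v := fun w hw => by rwa [hw.unique h]

theorem reachable_above {u v : T.V} (h : T.Child u v) (w : T.V) :
    (T.graph.deleteEdges {s(u, v)}).Reachable T.root w ↔ ¬ T.Desc v w := by
  rw [reachable_iff_desc (isTop_root _)]
  constructor
  · exact fun h' => h'.2 u v h rfl (root_desc u)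
  · refine fun h' => ⟨root_desc w, fun a b hab he _ hb => h' ?_⟩
    rwa [← (mem_pair h hab he).2]

theorem reachable_below {u v : T.V} (h : T.Child u v) (w : T.V) :
    (T.graph.deleteEdges {s(u, v)}).Reachable v w ↔ T.Desc v w := by
  rw [reachable_iff_desc (isTop_of_child h (Set.mem_singleton _)), and_iff_left_iff_imp]
  intro _ a b hab he ha
  obtain ⟨rfl, rfl⟩ := mem_pair h hab he
  exact absurd (ha.depth_le) (by have := h.depth_eq; omega)

theorem far_spec (e : T.graph.edgeSet) : ∃ u, T.Child u (T.far e) ∧ e.1 = s(u, T.far e) := by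
  obtain ⟨h1, h2⟩ := (T.exists_far e).choose_spec
  change T.far e ∈ e.1 at h1
  change T.Sep e (T.far e) at h2
  obtain ⟨e, he⟩ := e
  induction e using Sym2.ind with
  | _ x y =>
  change T.graph.Adj x y at he
  have key : ∀ x y (he : T.graph.Adj x y), T.Child x y → T.far ⟨s(x, y), he⟩ ∈ s(x, y) →
      T.Sep ⟨s(x, y), he⟩ (T.far ⟨s(x, y), he⟩) → T.far ⟨s(x, y), he⟩ = y := by
    intro x y he h h1 h2
    rcases Sym2.mem_iff.1 h1 with h3 | h3
    · unfold Sep at h2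
      rw [h3, reachable_above h, not_not] at h2
      exact absurd h2.depth_le (by have := h.depth_eq; omega)
    · exact h3
  rcases child_or_child he with h | h
  · have := key x y he h h1 h2
    exact ⟨x, by rw [this]; exact ⟨h, rfl⟩⟩
  · have e1 : (⟨s(x, y), he⟩ : T.graph.edgeSet) = ⟨s(y, x), he.symm⟩ :=
      Subtype.ext Sym2.eq_swap
    rw [e1] at h1 h2 ⊢
    have := key y x he.symm h h1 h2
    exact ⟨y, by rw [this]; exact ⟨h, rfl⟩⟩

theorem far_eq {u v : T.V} (h : T.Child u v) : T.far ⟨s(u, v), h.adj⟩ = v := by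
  obtain ⟨w, h1, h2⟩ := far_spec (T := T) ⟨s(u, v), h.adj⟩
  exact (mem_pair h h1 h2.symm).2

theorem far_injective : Function.Injective T.far := by
  intro e e' h
  obtain ⟨u, h1, h2⟩ := far_spec e
  obtain ⟨u', h1', h2'⟩ := far_spec e'
  rw [← h] at h1' h2'
  exact Subtype.ext (by rw [h2, h2', h1.unique h1'])

theorem exists_far_eq {v : T.V} (hv : v ≠ T.root) : ∃ e, T.far e = v := by
  obtain ⟨u, hu⟩ := exists_child hv
  exact ⟨_, far_eq hu⟩

theorem far_ne_root (e : T.graph.edgeSet) : T.far e ≠ T.root := (far_spec e).choose_spec.1.ne_root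

theorem sep_iff (e : T.graph.edgeSet) (v : T.V) : T.Sep e v ↔ T.Desc (T.far e) v := by
  obtain ⟨u, h1, h2⟩ := far_spec e
  unfold Sep
  rw [h2, reachable_above h1, not_not]

/-- Edges on the path from the root to one vertex have far ends that are comparable for `Desc`, by
`Desc.total`. -/
theorem isSimpleCut_iff (H : Finset T.graph.edgeSet) :
    T.IsSimpleCut H ↔ ∀ e ∈ H, ∀ e' ∈ H, T.Desc (T.far e) (T.far e') → e = e' := by
  constructor
  · intro h e he e' he' hd
    exact h (T.far e') e he e' he' ((sep_iff _ _).2 hd) ((sep_iff _ _).2 .refl)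
  · intro h v e he e' he' h1 h2
    rw [sep_iff] at h1 h2
    rcases h1.total h2 with h3 | h3
    · exact h e he e' he' h3
    · exact (h e' he' e he h3).symm

theorem child_mem_edges {H : Finset T.graph.edgeSet} {a b : T.V} (h : T.Child a b) :
    s(a, b) ∈ T.edges H ↔ ∃ e ∈ H, T.far e = b := by
  constructor
  · rintro ⟨e, he, h1⟩
    obtain ⟨u, h2, h3⟩ := far_spec e
    exact ⟨e, he, (mem_pair h h2 (h3.symm.trans h1)).2⟩
  · rintro ⟨e, he, rfl⟩
    obtain ⟨u, h2, h3⟩ := far_spec e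
    exact ⟨e, he, by rw [h3, h2.unique h]⟩

theorem isTop_far {H : Finset T.graph.edgeSet} {e : T.graph.edgeSet} (he : e ∈ H) :
    T.IsTop (T.edges H) (T.far e) := fun _ hu => (child_mem_edges hu).2 ⟨e, he, rfl⟩

theorem reachable_root_iff (H : Finset T.graph.edgeSet) (v : T.V) :
    (T.graph.deleteEdges (T.edges H)).Reachable T.root v ↔ ∀ e ∈ H, ¬ T.Desc (T.far e) v := by
  rw [reachable_iff_desc (isTop_root _)]
  constructor
  · rintro ⟨-, h⟩ e he
    obtain ⟨u, h1, -⟩ := far_spec e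
    exact h u _ h1 ((child_mem_edges h1).2 ⟨e, he, rfl⟩) (root_desc u)
  · refine fun h => ⟨root_desc v, fun a b hab hH _ hb => ?_⟩
    obtain ⟨e, he, rfl⟩ := (child_mem_edges hab).1 hH
    exact h e he hb

theorem reachable_far_iff {H : Finset T.graph.edgeSet} (hH : T.IsSimpleCut H) {e : T.graph.edgeSet}
    (he : e ∈ H) (v : T.V) :
    (T.graph.deleteEdges (T.edges H)).Reachable (T.far e) v ↔ T.Desc (T.far e) v := by
  rw [reachable_iff_desc (isTop_far he), and_iff_left_iff_imp]
  intro _ a b hab h1 h2 _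
  obtain ⟨e', he', rfl⟩ := (child_mem_edges hab).1 h1
  have h3 := (isSimpleCut_iff H).1 hH e he e' he' (h2.tail hab)
  subst h3
  exact absurd h2.depth_le (by have := hab.depth_eq; omega)

end RootedTree

/-! ### Every tree has a code -/

section Codes

variable {I : Type*} [Quiver I]

-- Induction on the number of vertices: the branch at the first child of the root is detached, both
-- pieces have codes, and the tree is the graft of one onto the other.
open Necklaces.RootedTree in
theorem RTree.exists_hasCode (X : RTree I) : ∃ t, X.HasCode t := by
  induction hn : Nat.card X.1.V using Nat.strong_induction_on generalizing X with
  | _ n ih =>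
  subst hn
  by_cases hc : ∃ c, X.1.Child X.1.root c
  · obtain ⟨c₀, hc₀⟩ := hc
    -- At the root all neighbours are children, and the least one for the corner is taken.
    obtain ⟨c, hc, hmin⟩ : ∃ c, X.1.Child X.1.root c ∧
        ∀ b, X.1.Child X.1.root b → X.data.le c b ∧ (X.data.le b c → b = c) := by
      let := X.2.corner
      have : Nonempty (X.1.graph.neighborSet X.1.root) := ⟨⟨c₀, hc₀.adj⟩⟩
      obtain ⟨c, hc⟩ := Finite.exists_min (fun x : X.1.graph.neighborSet X.1.root => x)
      have hcc : X.1.Child X.1.root c :=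
        (child_or_child c.2).resolve_right (not_child_root _)
      refine ⟨c, hcc, fun b hb => ?_⟩
      rw [X.data_le_iff hcc hb, X.data_le_iff hb hcc, PhiRt.linOrd_root, PhiRt.linOrd_root]
      refine ⟨hc ⟨b, hb.adj⟩, fun h => ?_⟩
      exact congrArg Subtype.val (le_antisymm h (hc ⟨b, hb.adj⟩))
    let H : Set (Sym2 X.1.V) := {s(X.1.root, c)}
    have htop : X.1.IsTop H c := isTop_of_child hc (Set.mem_singleton _)
    have hr : ¬ X.1.Desc c X.1.root := fun h =>
      absurd h.depth_le (by have := hc.depth_eq; omega)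
    have hS : Nat.card (X.comp H c).1.V < Nat.card X.1.V :=
      Finite.card_subtype_lt (x := X.1.root) (fun h => hr ((reachable_below hc _).1 h))
    have hT : Nat.card (X.comp H X.1.root).1.V < Nat.card X.1.V :=
      Finite.card_subtype_lt (x := c) (fun h => (reachable_above hc _).1 h .refl)
    obtain ⟨s, f, hf, hf'⟩ := ih _ hS _ rfl
    obtain ⟨t, g, hg, hg'⟩ := ih _ hT _ rfl
    have eS := X.isEmb_comp htop
    have eT := X.isEmb_comp (isTop_root H)
    have hdS : ∀ x : (X.comp H c).1.V, X.1.Desc c x.1 := fun x => (reachable_below hc _).1 x.2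
    have hdT : ∀ x : (X.comp H X.1.root).1.V, ¬ X.1.Desc c x.1 :=
      fun x => (reachable_above hc _).1 x.2
    have hG : PlanarData.IsGraft (X.data.dn c) (X.comp H c).data (X.comp H c).1.root
        (X.comp H X.1.root).data (X.comp H X.1.root).1.root X.data Subtype.val Subtype.val :=
      { inj := by
          rintro (x | x) (y | y) h
          · exact congrArg Sum.inl (Subtype.ext h)
          · exact (hdT y (by have := hdS x; rwa [show x.1 = y.1 from h] at this)).elim
          · exact (hdT x (by have := hdS y; rwa [← show x.1 = y.1 from h] at this)).elim
          · exact congrArg Sum.inr (Subtype.ext h)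
        ch_left := fun x y => (eS.ch x y).symm
        ch_right := fun x y => (eT.ch x y).symm
        not_ch := fun x y h => hdT y ((hdS x).tail h)
        ch_right_left := fun x y => by
          constructor
          · intro h
            rcases Relation.ReflTransGen.cases_tail (hdS y) with h1 | ⟨z, h1, h2⟩
            · refine ⟨Subtype.ext ?_, Subtype.ext h1⟩
              change X.1.Child x.1 y.1 at h
              rw [h1] at h
              exact h.unique hc
            · change X.1.Child x.1 y.1 at h
              rw [h2.unique h] at h1
              exact (hdT x h1).elim
          · rintro ⟨rfl, rfl⟩
            exact hc
        le_left := eS.le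
        le_right := eT.le
        le_self := (X.data_le_iff hc hc).2 ((X.2.linOrd _).le_refl _)
        le_first := fun y hy => by
          have h1 : X.1.Child X.1.root y.1 := (eT.ch _ _).1 hy
          refine ⟨(hmin _ h1).1, fun h => ?_⟩
          have h2 : y.1 = c := (hmin _ h1).2 h
          exact hdT y (h2 ▸ .refl)
        dn_left := eS.dn
        dn_right := eT.dn
        dn_first := Iff.rfl
        lab_left := fun _ => rfl
        lab_right := fun _ => rfl }
    refine ⟨.graft (X.data.dn c) s t, _, PlanarTree.isEmb_graft hG hf hg
      (s.map_root hf hf'.2 fun x => not_child_root x)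
      (t.map_root hg hg'.2 fun x => not_child_root x), ?_, fun v => ?_⟩
    · exact (PlanarTree.isEmb_graft hG hf hg
        (s.map_root hf hf'.2 fun x => not_child_root x)
        (t.map_root hg hg'.2 fun x => not_child_root x)).inj
    · by_cases hv : X.1.Desc c v
      · obtain ⟨x, hx⟩ := hf'.2 ⟨v, (reachable_below hc _).2 hv⟩
        exact ⟨Sum.inl x, congrArg Subtype.val hx⟩
      · obtain ⟨x, hx⟩ := hg'.2 ⟨v, (reachable_above hc _).2 hv⟩
        exact ⟨Sum.inr x, congrArg Subtype.val hx⟩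
  · have hall : ∀ v, v = X.1.root := by
      intro v
      rcases Relation.ReflTransGen.cases_head (root_desc v) with h | ⟨c, h, -⟩
      · exact h.symm
      · exact (hc ⟨c, h⟩).elim
    refine ⟨.leaf (X.2.label X.1.root).word, fun _ => X.1.root,
      ⟨fun _ _ _ => rfl, fun _ _ => ⟨False.elim, not_child_root _⟩, fun _ _ _ h => h.elim,
        fun _ _ h => h.elim, fun _ => rfl⟩, fun _ _ _ => rfl, fun v => ⟨(), (hall v).symm⟩⟩

end Codes

/-! ### Sums over simple cuts -/

namespace PlanarTree

variable {L A : Type*} [CommRing A]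

/-- A simple cut, given by the far ends of its edges. -/
def IsSimple (t : PlanarTree L) (K : Finset t.V) : Prop :=
  t.root ∉ K ∧ ∀ x ∈ K, ∀ y ∈ K, t.desc x y → x = y

/-- If the new edge, represented by the root of `s`, is cut, then nothing below it may be cut. -/
theorem isSimple_graft_iff {o : Prop} {s t : PlanarTree L} (K : Finset s.V) (K' : Finset t.V) :
    (graft o s t).IsSimple (K.disjSum K') ↔ t.IsSimple K' ∧ (K = {s.root} ∨ s.IsSimple K) := by
  constructor
  · rintro ⟨h1, h2⟩
    refine ⟨⟨fun h => h1 (Finset.inr_mem_disjSum.2 h), fun x hx y hy h => ?_⟩, ?_⟩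
    · have hx' : x ≠ t.root := by rintro rfl; exact h1 (Finset.inr_mem_disjSum.2 hx)
      exact Sum.inr_injective (h2 _ (Finset.inr_mem_disjSum.2 hx) _ (Finset.inr_mem_disjSum.2 hy)
        ((desc_inr_iff hx' _).2 ⟨y, rfl, h⟩))
    · have h3 : ∀ x ∈ K, ∀ y ∈ K, s.desc x y → x = y := fun x hx y hy h =>
        Sum.inl_injective (h2 _ (Finset.inl_mem_disjSum.2 hx) _ (Finset.inl_mem_disjSum.2 hy)
          ((desc_inl_iff x _).2 ⟨y, rfl, h⟩))
      by_cases hr : s.root ∈ K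
      · exact Or.inl (Finset.eq_singleton_iff_unique_mem.2
          ⟨hr, fun x hx => (h3 _ hr x hx (s.root_desc x)).symm⟩)
      · exact Or.inr ⟨hr, h3⟩
  · rintro ⟨h1, h2⟩
    refine ⟨fun h => h1.1 (Finset.inr_mem_disjSum.1 h), ?_⟩
    rintro (x | x) hx y hy h
    · obtain ⟨y, rfl, h'⟩ := (desc_inl_iff x _).1 h
      replace hx := Finset.inl_mem_disjSum.1 hx
      replace hy := Finset.inl_mem_disjSum.1 hy
      rcases h2 with rfl | h2
      · rw [Finset.mem_singleton] at hx hy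
        rw [hx, hy]
      · rw [h2.2 x hx y hy h']
    · replace hx := Finset.inr_mem_disjSum.1 hx
      have hx' : x ≠ t.root := by rintro rfl; exact h1.1 hx
      obtain ⟨y, rfl, h'⟩ := (desc_inr_iff hx' _).1 h
      replace hy := Finset.inr_mem_disjSum.1 hy
      rw [h1.2 x hx y hy h']

theorem map_root_of_mem {t t' : PlanarTree L} {g : t'.V → t.V} (hg : t'.data.IsEmb t.data g)
    (h : t.root ∈ Set.range g) : g t'.root = t.root := by
  obtain ⟨x, hx⟩ := h
  by_cases hx' : x = t'.root
  · rw [← hx', hx]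
  · obtain ⟨y, hy⟩ := t'.exists_ch hx'
    have := (hg.ch _ _).1 hy
    rw [hx] at this
    exact (t.not_ch_root _ this).elim

-- The recursion `cutSum` is a sum over simple cuts. The values `φ` and `ψ` are prescribed through
-- arbitrary planar trees embedded onto a branch or a trunk; in this form the hypotheses pass from a
-- graft to its two parts, and the induction closes.
open Classical in
theorem sum_isSimple (χ : PlanarTree L → A) (t : PlanarTree L) (f : PlanarTree L → A)
    (φ : t.V → A) (ψ : Finset t.V → A)
    (hφ : ∀ v, v ≠ t.root → ∀ (t' : PlanarTree L) (g : t'.V → t.V), t'.data.IsEmb t.data g →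
      Set.range g = {u | t.desc v u} → φ v = χ t')
    (hψ : ∀ K, t.IsSimple K → ∀ (t' : PlanarTree L) (g : t'.V → t.V), t'.data.IsEmb t.data g →
      Set.range g = {u | ∀ v ∈ K, ¬ t.desc v u} → ψ K = f t') :
    ∑ K : Finset t.V, (if t.IsSimple K then (∏ v ∈ K, φ v) * ψ K else 0) = cutSum χ t f := by
  induction t generalizing f with
  | leaf l =>
    have h1 : ∀ K : Finset (leaf l).V, (leaf l).IsSimple K ↔ K = ∅ := by
      refine fun K => ⟨fun h => Finset.eq_empty_of_forall_notMem fun x hx => h.1 hx, ?_⟩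
      rintro rfl
      exact ⟨Finset.notMem_empty _, fun x hx => (Finset.notMem_empty _ hx).elim⟩
    simp_rw [h1]
    rw [Finset.sum_ite_eq' Finset.univ ∅]
    simp only [Finset.mem_univ, if_true, Finset.prod_empty, one_mul, cutSum]
    refine hψ ∅ ((h1 _).2 rfl) (leaf l) id (.id _) ?_
    ext u
    simp
  | graft o s t ihs iht =>
    have hroot : ∀ {s : PlanarTree L} {K : Finset s.V}, s.IsSimple K →
        s.root ∈ {u | ∀ v ∈ K, ¬ s.desc v u} := fun {s K} hK v hv =>
      s.not_desc_root (by rintro rfl; exact hK.1 hv)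
    have hinl : ∀ (t' : PlanarTree L) (g : t'.V → s.V), t'.data.IsEmb s.data g →
        ∀ v, Set.range g = {u | s.desc v u} → φ (Sum.inl v) = χ t' := by
      intro t' g hg v hv
      refine hφ (Sum.inl v) (fun h => by cases h) t' (Sum.inl ∘ g) ((isEmb_inl o s t).comp hg) ?_
      ext u
      rw [Set.mem_ofPred_eq, desc_inl_iff]
      constructor
      · rintro ⟨x, rfl⟩
        exact ⟨g x, rfl, hv.subset ⟨x, rfl⟩⟩
      · rintro ⟨y, rfl, h⟩
        obtain ⟨x, rfl⟩ := hv.symm.subset h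
        exact ⟨x, rfl⟩
    have hinr : ∀ v, v ≠ t.root → ∀ (t' : PlanarTree L) (g : t'.V → t.V), t'.data.IsEmb t.data g →
        Set.range g = {u | t.desc v u} → φ (Sum.inr v) = χ t' := by
      intro v hv t' g hg hvr
      refine hφ (Sum.inr v) (fun h => hv (Sum.inr_injective h)) t' (Sum.inr ∘ g)
        ((isEmb_inr o s t).comp hg) ?_
      ext u
      rw [Set.mem_ofPred_eq, desc_inr_iff hv]
      constructor
      · rintro ⟨x, rfl⟩
        exact ⟨g x, rfl, hvr.subset ⟨x, rfl⟩⟩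
      · rintro ⟨y, rfl, h⟩
        obtain ⟨x, rfl⟩ := hvr.symm.subset h
        exact ⟨x, rfl⟩
    have hfirst : φ (Sum.inl s.root) = χ s := by
      refine hinl s id (.id _) s.root ?_
      ext u
      simpa using s.root_desc u
    -- The cuts through the new edge: the trunk lies inside `t`.
    have e1 : ∑ K' : Finset t.V, (if t.IsSimple K' then (∏ v ∈ K', φ (Sum.inr v)) *
        ψ (({s.root} : Finset s.V).disjSum K') else 0) = cutSum χ t f := by
      refine iht f (fun v => φ (Sum.inr v)) (fun K' => ψ (({s.root} : Finset s.V).disjSum K')) hinr ?_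
      intro K' hK' t' g hg hr
      refine hψ _ ((isSimple_graft_iff _ _).2 ⟨hK', Or.inl rfl⟩) t' (Sum.inr ∘ g)
        ((isEmb_inr o s t).comp hg) ?_
      ext u
      constructor
      · rintro ⟨x, rfl⟩ (v | v) hv h
        · obtain ⟨y, hy, -⟩ := (desc_inl_iff _ _).1 h
          cases hy
        · replace hv := Finset.inr_mem_disjSum.1 hv
          obtain ⟨y, hy, h⟩ := (desc_inr_iff (by rintro rfl; exact hK'.1 hv) _).1 h
          obtain rfl : g x = y := Sum.inr_injective hy
          exact hr.subset ⟨x, rfl⟩ v hv h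
      · intro h
        rcases u with u | u
        · exact (h (Sum.inl s.root) (Finset.inl_mem_disjSum.2 (Finset.mem_singleton_self _))
            ((desc_inl_iff _ _).2 ⟨u, rfl, s.root_desc u⟩)).elim
        · obtain ⟨x, rfl⟩ := (Set.ext_iff.1 hr u).2 fun v hv hd =>
            h (Sum.inr v) (Finset.inr_mem_disjSum.2 hv)
              ((desc_inr_iff (by rintro rfl; exact hK'.1 hv) _).2 ⟨u, rfl, hd⟩)
          exact ⟨x, rfl⟩
    -- The cuts which keep the new edge: the trunk is a graft of the two trunks. The inner sum over
    -- cuts of `t` plays the role of `ψ` for `s`.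
    have e2 : ∑ K : Finset s.V, (if s.IsSimple K then (∏ v ∈ K, φ (Sum.inl v)) *
        (∑ K' : Finset t.V, if t.IsSimple K' then (∏ v ∈ K', φ (Sum.inr v)) *
          ψ (K.disjSum K') else 0) else 0) =
        cutSum χ s (fun x => cutSum χ t (fun y => f (graft o x y))) := by
      refine ihs _ (fun v => φ (Sum.inl v)) (fun K => ∑ K' : Finset t.V, if t.IsSimple K' then
        (∏ v ∈ K', φ (Sum.inr v)) * ψ (K.disjSum K') else 0)
        (fun v _ t' g hg hv => hinl t' g hg v hv) ?_
      intro K hK s' g hg hr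
      refine iht _ (fun v => φ (Sum.inr v)) (fun K' => ψ (K.disjSum K')) hinr ?_
      intro K' hK' t' g' hg' hr'
      have hp := map_root_of_mem hg (hr.symm.subset (hroot hK))
      have hq := map_root_of_mem hg' (hr'.symm.subset (hroot hK'))
      refine hψ _ ((isSimple_graft_iff _ _).2 ⟨hK', Or.inr hK⟩) (graft o s' t') _
        (isEmb_graft (isGraft_graft o s t) hg hg' hp hq) ?_
      ext u
      constructor
      · rintro ⟨x | x, rfl⟩ (v | v) hv h
        · obtain ⟨y, hy, h⟩ := (desc_inl_iff _ _).1 h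
          obtain rfl : g x = y := Sum.inl_injective hy
          exact hr.subset ⟨x, rfl⟩ v (Finset.inl_mem_disjSum.1 hv) h
        · replace hv := Finset.inr_mem_disjSum.1 hv
          obtain ⟨y, hy, h⟩ := (desc_inr_iff (by rintro rfl; exact hK'.1 hv) _).1 h
          cases hy
        · obtain ⟨y, hy, -⟩ := (desc_inl_iff _ _).1 h
          cases hy
        · replace hv := Finset.inr_mem_disjSum.1 hv
          obtain ⟨y, hy, h⟩ := (desc_inr_iff (by rintro rfl; exact hK'.1 hv) _).1 h
          obtain rfl : g' x = y := Sum.inr_injective hy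
          exact hr'.subset ⟨x, rfl⟩ v hv h
      · intro h
        rcases u with u | u
        · obtain ⟨x, rfl⟩ := (Set.ext_iff.1 hr u).2 fun v hv hd =>
            h (Sum.inl v) (Finset.inl_mem_disjSum.2 hv) ((desc_inl_iff _ _).2 ⟨u, rfl, hd⟩)
          exact ⟨Sum.inl x, rfl⟩
        · obtain ⟨x, rfl⟩ := (Set.ext_iff.1 hr' u).2 fun v hv hd =>
            h (Sum.inr v) (Finset.inr_mem_disjSum.2 hv)
              ((desc_inr_iff (by rintro rfl; exact hK'.1 hv) _).2 ⟨u, rfl, hd⟩)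
          exact ⟨Sum.inr x, rfl⟩
    rw [cutSum, ← e1, ← e2, ← hfirst]
    -- The two summands never occur together, because a simple cut of `s` does not contain the root
    -- of `s`.
    have hsplit : ∀ (K : Finset s.V) (K' : Finset t.V),
        (if (graft o s t).IsSimple (K.disjSum K') then
          (∏ v ∈ K.disjSum K', φ v) * ψ (K.disjSum K') else 0) =
        (if K = {s.root} then φ (Sum.inl s.root) * (if t.IsSimple K' then
          (∏ v ∈ K', φ (Sum.inr v)) * ψ (({s.root} : Finset s.V).disjSum K') else 0) else 0) +
        (if s.IsSimple K then (∏ v ∈ K, φ (Sum.inl v)) * (if t.IsSimple K' then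
          (∏ v ∈ K', φ (Sum.inr v)) * ψ (K.disjSum K') else 0) else 0) := by
      intro K K'
      rw [isSimple_graft_iff]
      have hprod : ∏ v ∈ K.disjSum K', φ v =
          (∏ v ∈ K, φ (Sum.inl v)) * ∏ v ∈ K', φ (Sum.inr v) := Finset.prod_disjSum _ _ _
      rw [hprod]
      by_cases h1 : t.IsSimple K'
      · by_cases h2 : K = {s.root}
        · have h3 : ¬ s.IsSimple K := fun h => h.1 (h2 ▸ Finset.mem_singleton_self _)
          subst h2
          simp [h1, h3, mul_assoc]
        · by_cases h3 : s.IsSimple K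
          · simp [h1, h2, h3, mul_assoc]
          · simp [h2, h3]
      · simp [h1]
    have hsum : ∑ K : Finset (graft o s t).V, (if (graft o s t).IsSimple K then
          (∏ v ∈ K, φ v) * ψ K else 0) =
        ∑ p : Finset s.V × Finset t.V, (if (graft o s t).IsSimple (p.1.disjSum p.2) then
          (∏ v ∈ p.1.disjSum p.2, φ v) * ψ (p.1.disjSum p.2) else 0) :=
      (Fintype.sum_equiv (Finset.sumEquiv (α := s.V) (β := t.V)).toEquiv.symm _ _
        fun p => rfl).symm
    rw [hsum, Fintype.sum_prod_type]
    simp_rw [hsplit, Finset.sum_add_distrib]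
    congr 1
    · have : ∀ (x : Finset s.V), ∑ y : Finset t.V, (if x = {s.root} then φ (Sum.inl s.root) *
          (if t.IsSimple y then (∏ v ∈ y, φ (Sum.inr v)) *
            ψ (({s.root} : Finset s.V).disjSum y) else 0) else 0) =
          if x = {s.root} then φ (Sum.inl s.root) * ∑ y : Finset t.V, (if t.IsSimple y then
            (∏ v ∈ y, φ (Sum.inr v)) * ψ (({s.root} : Finset s.V).disjSum y) else 0) else 0 := by
        intro x
        split
        · rw [Finset.mul_sum]
        · simp
      simp_rw [this]
      rw [Finset.sum_ite_eq' Finset.univ]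
      simp
    · refine Finset.sum_congr rfl fun K _ => ?_
      split
      · rw [Finset.mul_sum]
      · simp

end PlanarTree

/-! ### Simple cuts of rooted trees through codes -/

section

variable {I A : Type*} [Quiver I] [CommRing A]

theorem RTree.HasCode.desc_iff {X : RTree I} {t : PlanarTree (I × List (Arrow I))} {f : t.V → X.1.V}
    (hf : t.data.IsEmb X.data f) (hf' : Function.Bijective f) (x y : t.V) :
    t.desc x y ↔ X.1.Desc (f x) (f y) := by
  constructor
  · exact fun h => Relation.ReflTransGen.lift f (fun a b h => (hf.ch a b).1 h) _ _ h
  · intro h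
    have h' := Relation.ReflTransGen.lift (p := t.ch) (Equiv.ofBijective f hf').symm (fun a b h => by
      refine (hf.ch _ _).2 ?_
      have e := Equiv.ofBijective_apply_symm_apply f hf'
      change X.1.Child (f _) (f _)
      rwa [e a, e b]) _ _ h
    simp only [Function.onFun] at h'
    rwa [Equiv.ofBijective_symm_apply_apply, Equiv.ofBijective_symm_apply_apply] at h'

-- Along a code, an edge corresponds to its far end, and simple cuts of `X` to simple sets of
-- vertices of `t`, so that `PlanarTree.sum_isSimple` applies.
open Classical in
open Necklaces.RootedTree in
theorem RTree.sum_isSimpleCut (X : RTree I) (t : PlanarTree (I × List (Arrow I)))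
    (ht : X.HasCode t) (χ f : PlanarTree (I × List (Arrow I)) → A) (φ ψ : RTree I → A)
    (hφ : ∀ Y s, Y.HasCode s → φ Y = χ s) (hψ : ∀ Y s, Y.HasCode s → ψ Y = f s) :
    ∑ H : {H : Finset X.1.graph.edgeSet // X.1.IsSimpleCut H},
      (∏ e ∈ H.1, φ (X.comp (X.1.edges H.1) (X.1.far e))) *
        ψ (X.comp (X.1.edges H.1) X.1.root) = PlanarTree.cutSum χ t f := by
  obtain ⟨c, hc, hc'⟩ := ht
  have hroot : c t.root = X.1.root := t.map_root hc hc'.2 not_child_root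
  let κ : X.1.graph.edgeSet → t.V := fun e => (Equiv.ofBijective c hc').symm (X.1.far e)
  have hκ : ∀ e, c (κ e) = X.1.far e := fun e => Equiv.ofBijective_apply_symm_apply c hc' _
  have hκi : Function.Injective κ := (Equiv.injective _).comp far_injective
  have hκr : ∀ e, κ e ≠ t.root := fun e h => far_ne_root e (by rw [← hκ, h, hroot])
  have hκs : ∀ v, v ≠ t.root → ∃ e, κ e = v := by
    intro v hv
    obtain ⟨e, he⟩ := exists_far_eq (T := X.1) (v := c v) (fun h => hv (hc'.1 (h.trans hroot.symm)))
    exact ⟨e, hc'.1 ((hκ e).trans he)⟩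
  let cut : Finset t.V → Finset X.1.graph.edgeSet := fun K => Finset.univ.filter (fun e => κ e ∈ K)
  -- The edge above `c v`, as a set; at the root it is empty, so that it is defined for every
  -- vertex.
  let E : t.V → Set (Sym2 X.1.V) := fun v => {z | ∃ u, X.1.Child u (c v) ∧ z = s(u, c v)}
  have hE : ∀ v, X.1.IsTop (E v) (c v) := fun v u hu => ⟨u, hu, rfl⟩
  have hEe : ∀ e, E (κ e) = {e.1} := by
    intro e
    obtain ⟨u, h1, h2⟩ := far_spec e
    ext z
    simp only [E, Set.mem_ofPred_eq, Set.mem_singleton_iff, hκ]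
    constructor
    · rintro ⟨u', h3, rfl⟩
      rw [h2, h1.unique h3]
    · rintro rfl
      exact ⟨u, h1, h2⟩
  have hEreach : ∀ v, v ≠ t.root → ∀ w,
      (X.1.graph.deleteEdges (E v)).Reachable (c v) w ↔ X.1.Desc (c v) w := by
    intro v hv w
    obtain ⟨e, rfl⟩ := hκs v hv
    obtain ⟨u, h1, h2⟩ := far_spec e
    rw [hEe, hκ, h2]
    exact reachable_below h1 w
  have hsum := PlanarTree.sum_isSimple χ t f (fun v => φ (X.comp (E v) (c v)))
    (fun K => ψ (X.comp (X.1.edges (cut K)) X.1.root)) ?_ ?_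
  · rw [← hsum, ← Finset.sum_filter]
    refine Finset.sum_bij (fun H _ => H.1.image κ) ?_ ?_ ?_ ?_
    · rintro ⟨H, hH⟩ -
      rw [Finset.mem_filter]
      refine ⟨Finset.mem_univ _, fun h => ?_, fun x hx y hy hd => ?_⟩
      · obtain ⟨e, -, he⟩ := Finset.mem_image.1 h
        exact hκr e he
      · obtain ⟨e, he, rfl⟩ := Finset.mem_image.1 hx
        obtain ⟨e', he', rfl⟩ := Finset.mem_image.1 hy
        rw [RTree.HasCode.desc_iff hc hc', hκ, hκ] at hd
        rw [(isSimpleCut_iff H).1 hH e he e' he' hd]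
    · rintro ⟨H, hH⟩ - ⟨H', hH'⟩ - h
      exact Subtype.ext (Finset.image_injective hκi h)
    · intro K hK
      obtain ⟨-, hK⟩ := Finset.mem_filter.1 hK
      refine ⟨⟨cut K, (isSimpleCut_iff _).2 fun e he e' he' hd => ?_⟩, Finset.mem_univ _, ?_⟩
      · rw [← hκ, ← hκ, ← RTree.HasCode.desc_iff hc hc'] at hd
        exact hκi (hK.2 _ (Finset.mem_filter.1 he).2 _ (Finset.mem_filter.1 he').2 hd)
      · ext v
        rw [Finset.mem_image]
        constructor
        · rintro ⟨e, he, rfl⟩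
          exact (Finset.mem_filter.1 he).2
        · intro hv
          obtain ⟨e, rfl⟩ := hκs v (by rintro rfl; exact hK.1 hv)
          exact ⟨e, Finset.mem_filter.2 ⟨Finset.mem_univ _, hv⟩, rfl⟩
    · rintro ⟨H, hH⟩ -
      have h1 : cut (H.image κ) = H := by
        ext e
        rw [Finset.mem_filter, Finset.mem_image]
        exact ⟨fun ⟨_, e', he', h⟩ => hκi h ▸ he', fun h => ⟨Finset.mem_univ _, e, h, rfl⟩⟩
      rw [h1, Finset.prod_image hκi.injOn]
      congr 1
      refine Finset.prod_congr rfl fun e he => ?_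
      have htop : X.1.IsTop (E (κ e)) (X.1.far e) := by rw [← hκ]; exact hE _
      -- Since `H` is simple, deleting `e` alone or all of `H` leaves the same branch below `e`,
      -- namely all descendants of its far end. The two components therefore share a code.
      obtain ⟨s, hs⟩ := (X.comp (X.1.edges H) (X.1.far e)).exists_hasCode
      rw [hφ _ s hs]
      symm
      refine hφ _ s ?_
      rw [hκ]
      rw [RTree.hasCode_comp_iff _ (isTop_far he)] at hs
      rw [RTree.hasCode_comp_iff _ htop]
      obtain ⟨g, hg, hr⟩ := hs
      refine ⟨g, hg, fun v => (hr v).trans ?_⟩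
      rw [reachable_far_iff hH he, ← hκ, hEreach _ (hκr e)]
  · intro v hv t' g hg hr
    refine hφ _ _ ((RTree.hasCode_comp_iff _ (hE v) _).2 ⟨c ∘ g, hc.comp hg, fun w => ?_⟩)
    obtain ⟨w, rfl⟩ := hc'.2 w
    rw [hEreach v hv, ← RTree.HasCode.desc_iff hc hc', Set.range_comp, hc'.1.mem_set_image, hr]
    rfl
  · intro K hK t' g hg hr
    refine hψ _ _ ((RTree.hasCode_comp_iff _ (isTop_root _) _).2 ⟨c ∘ g, hc.comp hg, fun w => ?_⟩)
    obtain ⟨w, rfl⟩ := hc'.2 w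
    rw [reachable_root_iff, Set.range_comp, hc'.1.mem_set_image, hr]
    constructor
    · intro h e he
      rw [← hκ, ← RTree.HasCode.desc_iff hc hc']
      exact h _ (Finset.mem_filter.1 he).2
    · intro h v hv
      obtain ⟨e, rfl⟩ := hκs v (by rintro rfl; exact hK.1 hv)
      have := h e (Finset.mem_filter.2 ⟨Finset.mem_univ _, hv⟩)
      rwa [← hκ, ← RTree.HasCode.desc_iff hc hc'] at this

end

/-! ### Cuts of words by the partner of the first letter -/

section WordCuts

variable {I : Type*} [Quiver I]

/-- The chords of a word. -/
def WordChord (l : List (Arrow I)) (c : ℕ × ℕ) : Prop :=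
  c.1 < c.2 ∧ ∃ a, l[c.1]? = some a ∧ l[c.2]? = some (Arrow.star a)

/-- The cuts of a word. -/
structure WordCut (l : List (Arrow I)) (H : Finset (ℕ × ℕ)) : Prop where
  chord : ∀ c ∈ H, WordChord l c
  distinct : ∀ c ∈ H, ∀ d ∈ H, c ≠ d → c.1 ≠ d.1 ∧ c.1 ≠ d.2 ∧ c.2 ≠ d.2
  noncrossing : ∀ c ∈ H, ∀ d ∈ H, ¬ (c.1 < d.1 ∧ d.1 < c.2 ∧ c.2 < d.2)

theorem QPath.isCut_iff {X : QPath I} {H : Finset (ℕ × ℕ)} : X.IsCut H ↔ WordCut X.arrows H :=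
  ⟨fun h => ⟨h.1, h.2, h.3⟩, fun h => ⟨h.1, h.2, h.3⟩⟩

theorem WordChord.lt_length {l : List (Arrow I)} {c : ℕ × ℕ} (h : WordChord l c) :
    c.1 < c.2 ∧ c.2 < l.length := by
  obtain ⟨h, a, ha, hb⟩ := h
  exact ⟨h, (List.getElem?_eq_some_iff.1 hb).1⟩

open Classical in
/-- The finite set of all cuts of a word. -/
def wordCuts (l : List (Arrow I)) : Finset (Finset (ℕ × ℕ)) :=
  ((Finset.range l.length ×ˢ Finset.range l.length).powerset).filter (WordCut l)

theorem mem_wordCuts {l : List (Arrow I)} {H : Finset (ℕ × ℕ)} :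
    H ∈ wordCuts l ↔ WordCut l H := by
  classical
  rw [wordCuts, Finset.mem_filter, Finset.mem_powerset, and_iff_right_iff_imp]
  intro h c hc
  have := (h.chord c hc).lt_length
  rw [Finset.mem_product, Finset.mem_range, Finset.mem_range]
  omega

theorem QPath.cuts_eq (X : QPath I) : X.cuts = wordCuts X.arrows := by
  ext H
  rw [QPath.mem_cuts, mem_wordCuts, QPath.isCut_iff]

/-- Translation of chords. -/
def shift (n : ℕ) : ℕ × ℕ ↪ ℕ × ℕ :=
  ⟨fun c => (c.1 + n, c.2 + n), fun c d h => by
    have h1 := congrArg Prod.fst h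
    have h2 := congrArg Prod.snd h
    exact Prod.ext (by simpa using h1) (by simpa using h2)⟩

@[simp] theorem shift_fst (n : ℕ) (c : ℕ × ℕ) : (shift n c).1 = c.1 + n := rfl

@[simp] theorem shift_snd (n : ℕ) (c : ℕ × ℕ) : (shift n c).2 = c.2 + n := rfl

/-- The cut of a word `a u a* v`, where `u` has length `j`, which consists of the chord from `a` to
`a*`, a cut of `u` and a cut of `v`. -/
def joinCut (j : ℕ) (A B : Finset (ℕ × ℕ)) : Finset (ℕ × ℕ) :=
  insert (0, j + 1) (A.map (shift 1) ∪ B.map (shift (j + 2)))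

theorem mem_joinCut {j : ℕ} {A B : Finset (ℕ × ℕ)} {c : ℕ × ℕ} : c ∈ joinCut j A B ↔
    c = (0, j + 1) ∨ (∃ d ∈ A, shift 1 d = c) ∨ ∃ d ∈ B, shift (j + 2) d = c := by
  simp [joinCut]

theorem wordChord_cons_shift {a : Arrow I} {l : List (Arrow I)} {c : ℕ × ℕ} :
    WordChord (a :: l) (shift 1 c) ↔ WordChord l c := by
  simp [WordChord]

theorem wordChord_take {l : List (Arrow I)} {j : ℕ} {c : ℕ × ℕ} :
    WordChord (l.take j) c ↔ WordChord l c ∧ c.2 < j := by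
  constructor
  · rintro ⟨h, b, h1, h2⟩
    have h3 := (List.getElem?_eq_some_iff.1 h2).1
    rw [List.length_take, lt_min_iff] at h3
    rw [List.getElem?_take_of_lt (by omega)] at h1 h2
    exact ⟨⟨h, b, h1, h2⟩, h3.1⟩
  · rintro ⟨⟨h, b, h1, h2⟩, h3⟩
    refine ⟨h, b, ?_, ?_⟩ <;> rw [List.getElem?_take_of_lt (by omega)] <;> assumption

theorem wordChord_drop {l : List (Arrow I)} {j : ℕ} {c : ℕ × ℕ} :
    WordChord (l.drop j) c ↔ WordChord l (shift j c) := by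
  simp [WordChord, add_comm]

theorem wordCut_cons_shift {a : Arrow I} {l : List (Arrow I)} {H : Finset (ℕ × ℕ)} :
    WordCut (a :: l) (H.map (shift 1)) ↔ WordCut l H := by
  constructor
  · intro h
    refine ⟨fun c hc => wordChord_cons_shift.1 (h.chord _ (Finset.mem_map_of_mem _ hc)),
      fun c hc d hd hne => ?_, fun c hc d hd => ?_⟩
    · have := h.distinct _ (Finset.mem_map_of_mem _ hc) _ (Finset.mem_map_of_mem _ hd)
        ((shift 1).injective.ne hne)
      simp at this
      omega
    · have := h.noncrossing _ (Finset.mem_map_of_mem _ hc) _ (Finset.mem_map_of_mem _ hd)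
      simp at this
      omega
  · intro h
    refine ⟨fun c hc₀ => ?_, fun c hc₀ d hd₀ hne => ?_, fun c hc₀ d hd₀ => ?_⟩
    · obtain ⟨c, hc, rfl⟩ := Finset.mem_map.1 hc₀
      exact wordChord_cons_shift.2 (h.chord c hc)
    · obtain ⟨c, hc, rfl⟩ := Finset.mem_map.1 hc₀
      obtain ⟨d, hd, rfl⟩ := Finset.mem_map.1 hd₀
      have := h.distinct c hc d hd (fun h => hne (by rw [h]))
      simp
      omega
    · obtain ⟨c, hc, rfl⟩ := Finset.mem_map.1 hc₀
      obtain ⟨d, hd, rfl⟩ := Finset.mem_map.1 hd₀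
      have := h.noncrossing c hc d hd
      simp
      omega

theorem wordCut_joinCut {a : Arrow I} {l : List (Arrow I)} {j : ℕ}
    (hj : l[j]? = some (Arrow.star a)) {A B : Finset (ℕ × ℕ)} (hA : WordCut (l.take j) A)
    (hB : WordCut (l.drop (j + 1)) B) : WordCut (a :: l) (joinCut j A B) := by
  have hA' : ∀ c ∈ A, c.1 < c.2 ∧ c.2 < j := fun c hc =>
    ⟨(hA.chord c hc).1, (wordChord_take.1 (hA.chord c hc)).2⟩
  have hB' : ∀ c ∈ B, c.1 < c.2 := fun c hc => (hB.chord c hc).1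
  refine ⟨fun c hc₀ => ?_, fun c hc₀ d hd₀ hne => ?_, fun c hc₀ d hd₀ => ?_⟩
  · rcases mem_joinCut.1 hc₀ with rfl | ⟨c, hc, rfl⟩ | ⟨c, hc, rfl⟩
    · exact ⟨Nat.succ_pos _, a, rfl, hj⟩
    · exact wordChord_cons_shift.2 (wordChord_take.1 (hA.chord c hc)).1
    · exact wordChord_cons_shift.2 (wordChord_drop.1 (hB.chord c hc))
  · rcases mem_joinCut.1 hc₀ with rfl | ⟨c, hc, rfl⟩ | ⟨c, hc, rfl⟩ <;>
      rcases mem_joinCut.1 hd₀ with rfl | ⟨d, hd, rfl⟩ | ⟨d, hd, rfl⟩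
    · exact (hne rfl).elim
    · have := hA' d hd; simp; omega
    · have := hB' d hd; simp; omega
    · have := hA' c hc; simp; omega
    · have := hA.distinct c hc d hd (fun h => hne (by rw [h])); simp; omega
    · have := hA' c hc; have := hB' d hd; simp; omega
    · have := hB' c hc; simp; omega
    · have := hA' d hd; have := hB' c hc; simp; omega
    · have := hB.distinct c hc d hd (fun h => hne (by rw [h])); simp; omega
  · rcases mem_joinCut.1 hc₀ with rfl | ⟨c, hc, rfl⟩ | ⟨c, hc, rfl⟩ <;>
      rcases mem_joinCut.1 hd₀ with rfl | ⟨d, hd, rfl⟩ | ⟨d, hd, rfl⟩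
    · simp
    · have := hA' d hd; simp; omega
    · have := hB' d hd; simp; omega
    · have := hA' c hc; simp
    · have := hA.noncrossing c hc d hd; simp; omega
    · have := hA' c hc; have := hB' d hd; simp; omega
    · have := hB' c hc; simp
    · have := hA' d hd; have := hB' c hc; simp; omega
    · have := hB.noncrossing c hc d hd; simp; omega

theorem exists_shift_of_wordCut {a : Arrow I} {l : List (Arrow I)} {H : Finset (ℕ × ℕ)}
    (hH : WordCut (a :: l) H) (h0 : ∀ c ∈ H, c.1 ≠ 0) :
    ∃ H', WordCut l H' ∧ H'.map (shift 1) = H := by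
  have hmap : (H.image fun c => (c.1 - 1, c.2 - 1)).map (shift 1) = H := by
    ext c
    simp only [Finset.mem_map, Finset.mem_image]
    constructor
    · rintro ⟨_, ⟨d, hd, rfl⟩, rfl⟩
      have h1 := h0 d hd
      have h2 := (hH.chord d hd).1
      have : shift 1 (d.1 - 1, d.2 - 1) = d := Prod.ext (by simp; omega) (by simp; omega)
      rwa [this]
    · intro hc
      have h1 := h0 c hc
      have h2 := (hH.chord c hc).1
      exact ⟨_, ⟨c, hc, rfl⟩, Prod.ext (by simp; omega) (by simp; omega)⟩
  exact ⟨_, wordCut_cons_shift.1 (hmap.symm ▸ hH), hmap⟩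

/-- A chord disjoint from `(0, j + 1)` and not crossing it lies either entirely below it or entirely
to its right. -/
theorem exists_joinCut_of_wordCut {a : Arrow I} {l : List (Arrow I)} {H : Finset (ℕ × ℕ)}
    (hH : WordCut (a :: l) H) {j : ℕ} (h0 : (0, j + 1) ∈ H) :
    ∃ A B, WordCut (l.take j) A ∧ WordCut (l.drop (j + 1)) B ∧ joinCut j A B = H := by
  classical
  let A := (H.filter fun c => 0 < c.1 ∧ c.2 < j + 1).image fun c => (c.1 - 1, c.2 - 1)
  let B := (H.filter fun c => j + 1 < c.1).image fun c => (c.1 - (j + 2), c.2 - (j + 2))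
  have hA : ∀ c, c ∈ A ↔ shift 1 c ∈ H ∧ c.2 < j := by
    intro c
    simp only [A, Finset.mem_image, Finset.mem_filter]
    constructor
    · rintro ⟨d, ⟨hd, h1, h2⟩, rfl⟩
      have h3 := (hH.chord d hd).1
      have : shift 1 (d.1 - 1, d.2 - 1) = d := Prod.ext (by simp; omega) (by simp; omega)
      rw [this]
      exact ⟨hd, by simp only; omega⟩
    · rintro ⟨h1, h2⟩
      exact ⟨_, ⟨h1, by simp, by simp [h2]⟩, by simp⟩
  have hB : ∀ c, c ∈ B ↔ shift (j + 2) c ∈ H := by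
    intro c
    simp only [B, Finset.mem_image, Finset.mem_filter]
    constructor
    · rintro ⟨d, ⟨hd, h1⟩, rfl⟩
      have h3 := (hH.chord d hd).1
      have : shift (j + 2) (d.1 - (j + 2), d.2 - (j + 2)) = d :=
        Prod.ext (by simp; omega) (by simp; omega)
      rwa [this]
    · intro h1
      exact ⟨_, ⟨h1, by simp only [shift_fst]; omega⟩, by simp⟩
  refine ⟨A, B, ⟨fun c hc => ?_, fun c hc d hd hne => ?_, fun c hc d hd => ?_⟩,
    ⟨fun c hc => ?_, fun c hc d hd hne => ?_, fun c hc d hd => ?_⟩, ?_⟩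
  · rw [hA] at hc
    exact wordChord_take.2 ⟨wordChord_cons_shift.1 (hH.chord _ hc.1), hc.2⟩
  · rw [hA] at hc hd
    have := hH.distinct _ hc.1 _ hd.1 ((shift 1).injective.ne hne)
    simp at this
    omega
  · rw [hA] at hc hd
    have := hH.noncrossing _ hc.1 _ hd.1
    simp at this
    omega
  · rw [hB] at hc
    exact wordChord_drop.2 (wordChord_cons_shift.1 (hH.chord _ hc))
  · rw [hB] at hc hd
    have := hH.distinct _ hc _ hd ((shift _).injective.ne hne)
    simp at this
    omega
  · rw [hB] at hc hd
    have := hH.noncrossing _ hc _ hd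
    simp at this
    omega
  · ext c
    rw [mem_joinCut]
    constructor
    · rintro (rfl | ⟨d, hd, rfl⟩ | ⟨d, hd, rfl⟩)
      · exact h0
      · exact ((hA d).1 hd).1
      · exact (hB d).1 hd
    · intro hc
      by_cases hne : c = (0, j + 1)
      · exact Or.inl hne
      have h1 := (hH.chord c hc).1
      have h2 := hH.distinct c hc _ h0 hne
      have h3 := hH.noncrossing _ h0 c hc
      simp only at h2 h3
      by_cases h4 : c.2 < j + 1
      · refine Or.inr (Or.inl ⟨(c.1 - 1, c.2 - 1), (hA _).2 ⟨?_, by simp only; omega⟩, ?_⟩)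
        · rwa [show shift 1 (c.1 - 1, c.2 - 1) = c from
            Prod.ext (by simp; omega) (by simp; omega)]
        · exact Prod.ext (by simp; omega) (by simp; omega)
      · refine Or.inr (Or.inr ⟨(c.1 - (j + 2), c.2 - (j + 2)), (hB _).2 ?_, ?_⟩)
        · rwa [show shift (j + 2) (c.1 - (j + 2), c.2 - (j + 2)) = c from
            Prod.ext (by simp; omega) (by simp; omega)]
        · exact Prod.ext (by simp; omega) (by simp; omega)

theorem joinCut_injective {l : List (Arrow I)} {j j' : ℕ} {A B A' B' : Finset (ℕ × ℕ)}
    (hA : WordCut (l.take j) A) (hA' : WordCut (l.take j') A')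
    (h : joinCut j A B = joinCut j' A' B') : j = j' ∧ A = A' ∧ B = B' := by
  have hlt : ∀ {j} {A}, WordCut (l.take j) A → ∀ c ∈ A, c.2 < j := fun hA c hc =>
    (wordChord_take.1 (hA.chord c hc)).2
  have h1 : j = j' := by
    have : (0, j + 1) ∈ joinCut j' A' B' := h ▸ mem_joinCut.2 (Or.inl rfl)
    rcases mem_joinCut.1 this with h2 | ⟨d, -, h2⟩ | ⟨d, -, h2⟩
    · simpa using congrArg Prod.snd h2
    · simpa using congrArg Prod.fst h2
    · simpa using congrArg Prod.fst h2
  subst h1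
  have key : ∀ {A B A' B'}, WordCut (l.take j) A → WordCut (l.take j) A' →
      joinCut j A B = joinCut j A' B' → A ⊆ A' ∧ B ⊆ B' := by
    intro A B A' B' hA hA' h
    refine ⟨fun c hc => ?_, fun c hc => ?_⟩
    · have h1 : shift 1 c ∈ joinCut j A' B' := h ▸ mem_joinCut.2 (Or.inr (Or.inl ⟨c, hc, rfl⟩))
      have h3 := hlt hA c hc
      rcases mem_joinCut.1 h1 with h2 | ⟨d, hd, h2⟩ | ⟨d, hd, h2⟩
      · simpa using congrArg Prod.fst h2
      · rwa [← (shift 1).injective h2]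
      · have h4 := (hA.chord c hc).1
        have h2 := congrArg Prod.fst h2
        simp at h2
        omega
    · have h1 : shift (j + 2) c ∈ joinCut j A' B' :=
        h ▸ mem_joinCut.2 (Or.inr (Or.inr ⟨c, hc, rfl⟩))
      rcases mem_joinCut.1 h1 with h2 | ⟨d, hd, h2⟩ | ⟨d, hd, h2⟩
      · simpa using congrArg Prod.fst h2
      · have h3 := hlt hA' d hd
        have h2 := congrArg Prod.snd h2
        simp at h2
        omega
      · rwa [← (shift (j + 2)).injective h2]
  exact ⟨rfl, (key hA hA' h).1.antisymm (key hA' hA h.symm).1,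
    (key hA hA' h).2.antisymm (key hA' hA h.symm).2⟩

-- The first letter recursion for actual cuts, of the same shape as those defining `wordSum` and
-- `simpleSum`.
open Classical in
theorem sum_wordCuts_cons {M : Type*} [AddCommMonoid M] (a : Arrow I) (l : List (Arrow I))
    (F : Finset (ℕ × ℕ) → M) :
    ∑ H ∈ wordCuts (a :: l), F H = ∑ H ∈ wordCuts l, F (H.map (shift 1)) +
      ∑ j ∈ Finset.range l.length, if l[j]? = some (Arrow.star a) then
        ∑ A ∈ wordCuts (l.take j), ∑ B ∈ wordCuts (l.drop (j + 1)), F (joinCut j A B) else 0 := by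
  rw [← Finset.sum_filter_not_add_sum_filter (wordCuts (a :: l)) (fun H => ∃ c ∈ H, c.1 = 0)]
  congr 1
  · symm
    refine Finset.sum_bij (fun H _ => H.map (shift 1)) ?_ ?_ ?_ ?_
    · intro H hH
      rw [Finset.mem_filter, mem_wordCuts, wordCut_cons_shift]
      refine ⟨mem_wordCuts.1 hH, ?_⟩
      rintro ⟨c, hc, h⟩
      obtain ⟨d, -, rfl⟩ := Finset.mem_map.1 hc
      simp at h
    · exact fun H _ H' _ h => Finset.map_injective _ h
    · intro H hH
      rw [Finset.mem_filter, mem_wordCuts] at hH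
      obtain ⟨H', h1, h2⟩ := exists_shift_of_wordCut hH.1 (fun c hc h => hH.2 ⟨c, hc, h⟩)
      exact ⟨H', mem_wordCuts.2 h1, h2⟩
    · exact fun _ _ => rfl
  · symm
    rw [← Finset.sum_filter]
    simp_rw [← Finset.sum_product']
    rw [Finset.sum_sigma']
    refine Finset.sum_bij (fun x _ => joinCut x.1 x.2.1 x.2.2) ?_ ?_ ?_ ?_
    · rintro ⟨j, A, B⟩ h
      simp only [Finset.mem_sigma, Finset.mem_filter, Finset.mem_product, mem_wordCuts] at h
      rw [Finset.mem_filter, mem_wordCuts]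
      exact ⟨wordCut_joinCut h.1.2 h.2.1 h.2.2, _, mem_joinCut.2 (Or.inl rfl), rfl⟩
    · rintro ⟨j, A, B⟩ h ⟨j', A', B'⟩ h' he
      simp only [Finset.mem_sigma, Finset.mem_filter, Finset.mem_product, mem_wordCuts] at h h'
      obtain ⟨rfl, rfl, rfl⟩ := joinCut_injective h.2.1 h'.2.1 he
      rfl
    · intro H hH
      rw [Finset.mem_filter, mem_wordCuts] at hH
      obtain ⟨hH, ⟨c1, c2⟩, hc, rfl⟩ := hH
      have h1 := hH.chord _ hc
      obtain ⟨h2, b, h3, h4⟩ := h1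
      obtain ⟨j, rfl⟩ : ∃ j, c2 = j + 1 := ⟨c2 - 1, by simp at h2; omega⟩
      obtain ⟨A, B, hA, hB, h⟩ := exists_joinCut_of_wordCut hH hc
      obtain rfl : a = b := by simpa using h3
      have h5 : l[j]? = some (Arrow.star a) := by simpa using h4
      refine ⟨⟨j, A, B⟩, ?_, h⟩
      simp only [Finset.mem_sigma, Finset.mem_filter, Finset.mem_product, mem_wordCuts,
        Finset.mem_range]
      exact ⟨⟨(List.getElem?_eq_some_iff.1 h5).1, h5⟩, hA, hB⟩
    · exact fun _ _ => rfl

end WordCuts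

/-! ### Dual trees of words -/

section WordFace

variable {I : Type*} [Quiver I]

open Classical in
/-- The letters of `l` whose positions satisfy `p`. -/
def subword (p : ℕ → Prop) (l : List (Arrow I)) : List (Arrow I) :=
  (List.range l.length).filterMap (fun m => if p m then l[m]? else none)

theorem subword_nil (p : ℕ → Prop) : subword p ([] : List (Arrow I)) = [] := rfl

open Classical in
theorem subword_cons (p : ℕ → Prop) (a : Arrow I) (l : List (Arrow I)) :
    subword p (a :: l) =
      if p 0 then a :: subword (fun m => p (m + 1)) l else subword (fun m => p (m + 1)) l := by
  have h : (List.range l.length).filterMap ((fun m => if p m then (a :: l)[m]? else none) ∘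
      Nat.succ) = subword (fun m => p (m + 1)) l := rfl
  rw [subword, List.length_cons, List.range_succ_eq_map, List.filterMap_cons, List.filterMap_map, h]
  by_cases h0 : p 0 <;> simp [h0]

theorem subword_congr {p q : ℕ → Prop} {l : List (Arrow I)} (h : ∀ m < l.length, p m ↔ q m) :
    subword p l = subword q l := by
  classical
  refine List.filterMap_congr fun m hm => ?_
  rw [h m (List.mem_range.1 hm)]

theorem subword_append (p : ℕ → Prop) (l l' : List (Arrow I)) :
    subword p (l ++ l') = subword p l ++ subword (fun m => p (m + l.length)) l' := by
  classical
  induction l generalizing p with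
  | nil => rfl
  | cons a l ih =>
    rw [List.cons_append, subword_cons, subword_cons, ih]
    have : (fun m => p (m + l.length + 1)) = fun m => p (m + (a :: l).length) := by
      ext m; rw [List.length_cons, Nat.add_assoc]
    rw [this]
    split <;> rfl

theorem subword_eq_nil {p : ℕ → Prop} {l : List (Arrow I)} (h : ∀ m < l.length, ¬ p m) :
    subword p l = [] := by
  classical
  rw [subword, List.filterMap_eq_nil_iff]
  intro m hm
  rw [if_neg (h m (List.mem_range.1 hm))]

theorem subword_eq_self {p : ℕ → Prop} {l : List (Arrow I)} (h : ∀ m < l.length, p m) :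
    subword p l = l := by
  classical
  induction l generalizing p with
  | nil => rfl
  | cons a l ih =>
    rw [subword_cons, if_pos (h 0 (by simp)), ih fun m hm => h (m + 1) (by simpa using hm)]

theorem length_subword_lt {p : ℕ → Prop} {l : List (Arrow I)} {m : ℕ} (hm : m < l.length)
    (h : ¬ p m) : (subword p l).length < l.length := by
  classical
  have hle : ∀ (p : ℕ → Prop) (l : List (Arrow I)), (subword p l).length ≤ l.length := fun p l =>
    (List.length_filterMap_le _ _).trans (by simp)
  induction l generalizing p m with
  | nil => simp at hm
  | cons a l ih =>
    rw [subword_cons]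
    rcases m with _ | m
    · rw [if_neg h, List.length_cons]
      exact Nat.lt_succ_of_le (hle _ _)
    · have := ih (p := fun m => p (m + 1)) (m := m) (by simpa using hm) h
      split <;> simp <;> omega

open QPath

/-- The target of the letter in position `m` (or `i`, if there is none). -/
def letterTgt (i : I) (l : List (Arrow I)) (m : ℕ) : I := (l[m]?).elim i Arrow.tgt

/-- The left end of the chord of the face carries an arrow of the quiver itself. -/
def faceDn (l : List (Arrow I)) (H : Finset (ℕ × ℕ)) : Face H → Prop
  | none => False
  | some c => ∃ e, l[c.1.1]? = some (Sum.inl e)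

/-- The vertex at which the word of a face starts. -/
def faceBase (i : I) (l : List (Arrow I)) (H : Finset (ℕ × ℕ)) : Face H → I
  | none => i
  | some c => letterTgt i l c.1.1

/-- The planar data of the dual tree of a cut of a word. -/
def wordData (i : I) (l : List (Arrow I)) (H : Finset (ℕ × ℕ)) :
    PlanarData (I × List (Arrow I)) (Face H) where
  ch := Imm H
  le u v := pos H u ≤ pos H v
  dn := faceDn l H
  lab u := (faceBase i l H u, subword (InFace H u) l)

theorem not_imm_none {H : Finset (ℕ × ℕ)} (u : Face H) : ¬ Imm H u none := by
  rintro ⟨h, -⟩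
  rcases u with _ | u <;> exact h

/-! #### The first letter is not matched -/

/-- The faces of a translated cut. -/
def shiftFace (n : ℕ) (H : Finset (ℕ × ℕ)) : Face H → Face (H.map (shift n))
  | none => none
  | some c => some ⟨shift n c.1, Finset.mem_map_of_mem _ c.2⟩

theorem shiftFace_surjective (n : ℕ) (H : Finset (ℕ × ℕ)) :
    Function.Surjective (shiftFace n H) := by
  rintro (_ | ⟨c, hc⟩)
  · exact ⟨none, rfl⟩
  · obtain ⟨d, hd, rfl⟩ := Finset.mem_map.1 hc
    exact ⟨some ⟨d, hd⟩, rfl⟩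

theorem shiftFace_injective (n : ℕ) (H : Finset (ℕ × ℕ)) :
    Function.Injective (shiftFace n H) := by
  rintro (_ | ⟨c, hc⟩) (_ | ⟨d, hd⟩) h
  · rfl
  · cases h
  · cases h
  · have := (shift n).injective (congrArg Subtype.val (Option.some_injective _ h))
    simp only at this
    subst this
    rfl

theorem encl_shiftFace (n : ℕ) (H : Finset (ℕ × ℕ)) (u v : Face H) :
    Encl (H.map (shift n)) (shiftFace n H u) (shiftFace n H v) ↔ Encl H u v := by
  rcases u with _ | u <;> rcases v with _ | v <;> simp [Encl, shiftFace]

theorem imm_shiftFace (n : ℕ) (H : Finset (ℕ × ℕ)) (u v : Face H) :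
    Imm (H.map (shift n)) (shiftFace n H u) (shiftFace n H v) ↔ Imm H u v := by
  unfold Imm
  rw [encl_shiftFace, (shiftFace_surjective n H).forall]
  simp_rw [encl_shiftFace]

theorem inFace_shiftFace_add (n : ℕ) (H : Finset (ℕ × ℕ)) (u : Face H) (m : ℕ) :
    InFace (H.map (shift n)) (shiftFace n H u) (m + n) ↔ InFace H u m := by
  unfold InFace
  refine and_congr ?_ ⟨fun h d hd hm => ?_, fun h d hd hm => ?_⟩
  · rcases u with _ | u <;> simp [Below, shiftFace]
  · refine h ⟨shift n d.1, Finset.mem_map_of_mem _ d.2⟩ ((encl_shiftFace n H u (some d)).2 hd) ?_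
    simpa using hm
  · obtain ⟨d, hd'⟩ := d
    obtain ⟨d, hd₂, rfl⟩ := Finset.mem_map.1 hd'
    refine h ⟨d, hd₂⟩ ((encl_shiftFace n H u (some ⟨d, hd₂⟩)).1 hd) ?_
    simpa using hm

/-- Only the label of the root changes. The vertices of the two trees form different types, whence
the explicit bijection. -/
theorem exists_prependRoot (a : Arrow I) (t : PlanarTree (I × List (Arrow I))) :
    ∃ e : (prependRoot a t).V → t.V, Function.Bijective e ∧ e (prependRoot a t).root = t.root ∧
      (∀ x y, (prependRoot a t).ch x y ↔ t.ch (e x) (e y)) ∧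
      (∀ x y, (prependRoot a t).le x y ↔ t.le (e x) (e y)) ∧
      (∀ x, (prependRoot a t).dn x ↔ t.dn (e x)) ∧
      (∀ x, e x ≠ t.root → (prependRoot a t).lab x = t.lab (e x)) ∧
      (prependRoot a t).lab (prependRoot a t).root = ((t.lab t.root).1, a :: (t.lab t.root).2) := by
  induction t with
  | leaf l =>
    exact ⟨id, Function.bijective_id, rfl, fun _ _ => Iff.rfl, fun _ _ => Iff.rfl, fun _ => Iff.rfl,
      fun x hx => (hx rfl).elim, rfl⟩
  | graft o s t _ ih =>
    obtain ⟨e, h1, h2, h3, h4, h5, h6, h7⟩ := ih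
    refine ⟨Sum.map id e, ⟨Sum.map_injective.2 ⟨Function.injective_id, h1.1⟩,
      Sum.map_surjective.2 ⟨Function.surjective_id, h1.2⟩⟩, congrArg Sum.inr h2, ?_, ?_, ?_, ?_, h7⟩
    · rintro (x | x) (y | y)
      · exact Iff.rfl
      · exact Iff.rfl
      · refine and_congr ?_ Iff.rfl
        rw [← h1.1.eq_iff, h2]
      · exact h3 x y
    · rintro (x | x) (y | y)
      · exact Iff.rfl
      · exact Iff.rfl
      · exact Iff.rfl
      · exact h4 x y
    · rintro (x | x)
      · exact Iff.rfl
      · exact h5 x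
    · rintro (x | x) hx
      · rfl
      · exact h6 x (fun h => hx (congrArg Sum.inr h))

theorem isEmb_prependRoot {V Z : Type*} {a : Arrow I} {t : PlanarTree (I × List (Arrow I))}
    {P : PlanarData (I × List (Arrow I)) V} {Q : PlanarData (I × List (Arrow I)) Z} {f : t.V → V}
    (hf : t.data.IsEmb P f) {r : V} (hr : f t.root = r) {σ : V → Z} (hσ : Function.Injective σ)
    (hch : ∀ x y, P.ch x y ↔ Q.ch (σ x) (σ y))
    (hle : ∀ z x y, P.ch z x → P.ch z y → (P.le x y ↔ Q.le (σ x) (σ y)))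
    (hdn : ∀ z x, P.ch z x → (P.dn x ↔ Q.dn (σ x)))
    (hlab : ∀ x, x ≠ r → P.lab x = Q.lab (σ x))
    (hlabr : Q.lab (σ r) = ((P.lab r).1, a :: (P.lab r).2)) :
    ∃ e : (prependRoot a t).V → t.V, Function.Bijective e ∧
      (prependRoot a t).data.IsEmb Q (σ ∘ f ∘ e) := by
  obtain ⟨e, h1, h2, h3, h4, h5, h6, h7⟩ := exists_prependRoot a t
  refine ⟨e, h1, hσ.comp (hf.inj.comp h1.1), fun x y => ?_, fun z x y hx hy => ?_, fun z x hx => ?_,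
    fun x => ?_⟩
  · exact (h3 x y).trans ((hf.ch _ _).trans (hch _ _))
  · have hx' := (h3 z x).1 hx
    have hy' := (h3 z y).1 hy
    exact (h4 x y).trans ((hf.le _ _ _ hx' hy').trans (hle _ _ _ ((hf.ch _ _).1 hx')
      ((hf.ch _ _).1 hy')))
  · have hx' := (h3 z x).1 hx
    exact (h5 x).trans ((hf.dn _ _ hx').trans (hdn _ _ ((hf.ch _ _).1 hx')))
  · by_cases hx : x = (prependRoot a t).root
    · subst hx
      change (prependRoot a t).lab _ = Q.lab (σ (f (e _)))
      rw [h2, hr, hlabr, h7, ← hr, ← hf.lab]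
      rfl
    · have hx' : e x ≠ t.root := fun h => hx (h1.1 (h.trans h2.symm))
      refine (h6 x hx').trans ((hf.lab _).trans (hlab _ fun h => hx' (hf.inj (h.trans hr.symm))))

/-- `t` is a planar tree isomorphic to the dual tree of the cut `H`. -/
def WordCode (i : I) (l : List (Arrow I)) (H : Finset (ℕ × ℕ))
    (t : PlanarTree (I × List (Arrow I))) : Prop :=
  ∃ f : t.V → Face H, t.data.IsEmb (wordData i l H) f ∧ Function.Bijective f

/-- An unmatched first letter lies under no chord, so it belongs to the unbounded face, that is, to
the label of the root. -/
theorem WordCode.prependRoot {i : I} {l : List (Arrow I)} {H : Finset (ℕ × ℕ)}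
    {t : PlanarTree (I × List (Arrow I))} (ht : WordCode i l H t) (a : Arrow I) :
    WordCode i (a :: l) (H.map (shift 1)) (prependRoot a t) := by
  classical
  obtain ⟨f, hf, hf'⟩ := ht
  have hroot := t.map_root hf hf'.2 not_imm_none
  have hpos : ∀ x : Face H, ∀ y : Face H, pos H x ≤ pos H y ↔
      pos (H.map (shift 1)) (shiftFace 1 H x) ≤ pos (H.map (shift 1)) (shiftFace 1 H y) := by
    rintro (_ | x) (_ | y) <;> simp [pos, shiftFace]
  have hlab : ∀ x : Face H, (wordData i (a :: l) (H.map (shift 1))).lab (shiftFace 1 H x) =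
      (((wordData i l H).lab x).1, if InFace (H.map (shift 1)) (shiftFace 1 H x) 0 then
        a :: ((wordData i l H).lab x).2 else ((wordData i l H).lab x).2) := by
    intro x
    refine Prod.ext ?_ ?_
    · rcases x with _ | x <;> rfl
    · simp only [wordData, subword_cons]
      rw [subword_congr (q := InFace H x) fun m _ => inFace_shiftFace_add 1 H x m]
  have key : ∃ e : (Necklaces.prependRoot a t).V → t.V, Function.Bijective e ∧
      (Necklaces.prependRoot a t).data.IsEmb (wordData i (a :: l) (H.map (shift 1)))
        (shiftFace 1 H ∘ f ∘ e) := by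
    refine isEmb_prependRoot hf hroot (shiftFace_injective 1 H)
      (fun x y => (imm_shiftFace 1 H x y).symm) (fun z x y _ _ => hpos x y) (fun z x _ => ?_)
      (fun x hx => ?_) ?_
    · rcases x with _ | x <;> exact Iff.rfl
    · rw [hlab, if_neg]
      rintro ⟨h, -⟩
      rcases x with _ | x
      · exact hx rfl
      · simp [Below, shiftFace] at h
    · rw [hlab, if_pos]
      refine ⟨trivial, fun d _ hd => ?_⟩
      obtain ⟨c, -, hc⟩ := Finset.mem_map.1 d.2
      have := congrArg Prod.fst hc
      simp at this hd
      omega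
  obtain ⟨e, he, he'⟩ := key
  exact ⟨_, he', he'.inj, (shiftFace_surjective 1 H).comp (hf'.2.comp he.2)⟩

/-! #### The first letter is matched -/

/-- The faces to the left of the partner of the first letter. -/
def leftFace (j : ℕ) (A B : Finset (ℕ × ℕ)) : Face A → Face (joinCut j A B)
  -- The unbounded face of the left part becomes the face below the chord of the first letter.
  | none => some ⟨(0, j + 1), mem_joinCut.2 (Or.inl rfl)⟩
  | some c => some ⟨shift 1 c.1, mem_joinCut.2 (Or.inr (Or.inl ⟨c.1, c.2, rfl⟩))⟩

/-- The faces to the right of the partner of the first letter. -/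
def rightFace (j : ℕ) (A B : Finset (ℕ × ℕ)) : Face B → Face (joinCut j A B)
  | none => none
  -- The right part is preceded by `j + 2` letters: the first letter, the left part of length `j`,
  -- and the partner.
  | some c => some ⟨shift (j + 2) c.1, mem_joinCut.2 (Or.inr (Or.inr ⟨c.1, c.2, rfl⟩))⟩

section

variable {a : Arrow I} {l : List (Arrow I)} {j : ℕ} {A B : Finset (ℕ × ℕ)}

theorem WordCut.take_lt (hA : WordCut (l.take j) A) (c : {c // c ∈ A}) :
    c.1.1 < c.1.2 ∧ c.1.2 < j :=
  ⟨(hA.chord _ c.2).1, (wordChord_take.1 (hA.chord _ c.2)).2⟩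

theorem face_surjective (j : ℕ) (A B : Finset (ℕ × ℕ)) :
    Function.Surjective (Sum.elim (leftFace j A B) (rightFace j A B)) := by
  rintro (_ | ⟨c, hc⟩)
  · exact ⟨Sum.inr none, rfl⟩
  · rcases mem_joinCut.1 hc with rfl | ⟨d, hd, rfl⟩ | ⟨d, hd, rfl⟩
    · exact ⟨Sum.inl none, rfl⟩
    · exact ⟨Sum.inl (some ⟨d, hd⟩), rfl⟩
    · exact ⟨Sum.inr (some ⟨d, hd⟩), rfl⟩

theorem forall_face {j : ℕ} {A B : Finset (ℕ × ℕ)} {p : Face (joinCut j A B) → Prop} :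
    (∀ w, p w) ↔ (∀ x, p (leftFace j A B x)) ∧ ∀ x, p (rightFace j A B x) := by
  rw [(face_surjective j A B).forall, Sum.forall]
  rfl

theorem forall_mem_face {j : ℕ} {A B : Finset (ℕ × ℕ)}
    {p : {c // c ∈ joinCut j A B} → Prop} : (∀ w, p w) ↔
      p ⟨(0, j + 1), mem_joinCut.2 (Or.inl rfl)⟩ ∧
      (∀ c : {c // c ∈ A}, p ⟨shift 1 c.1, mem_joinCut.2 (Or.inr (Or.inl ⟨c.1, c.2, rfl⟩))⟩) ∧
      ∀ c : {c // c ∈ B}, p ⟨shift (j + 2) c.1, mem_joinCut.2 (Or.inr (Or.inr ⟨c.1, c.2, rfl⟩))⟩ := by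
  refine ⟨fun h => ⟨h _, fun _ => h _, fun _ => h _⟩, ?_⟩
  rintro ⟨h1, h2, h3⟩ ⟨c, hc⟩
  rcases mem_joinCut.1 hc with rfl | ⟨d, hd, rfl⟩ | ⟨d, hd, rfl⟩
  · exact h1
  · exact h2 ⟨d, hd⟩
  · exact h3 ⟨d, hd⟩

theorem encl_left (hA : WordCut (l.take j) A) (x y : Face A) :
    Encl (joinCut j A B) (leftFace j A B x) (leftFace j A B y) ↔ Encl A x y := by
  rcases x with _ | x <;> rcases y with _ | y <;> simp [Encl, leftFace]
  have := hA.take_lt y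
  omega

theorem encl_right (x y : Face B) :
    Encl (joinCut j A B) (rightFace j A B x) (rightFace j A B y) ↔ Encl B x y := by
  rcases x with _ | x <;> rcases y with _ | y <;> simp [Encl, rightFace]

theorem not_encl_left_right (hA : WordCut (l.take j) A) (hB : WordCut (l.drop (j + 1)) B)
    (x : Face A) (y : Face B) :
    ¬ Encl (joinCut j A B) (leftFace j A B x) (rightFace j A B y) := by
  rcases y with _ | y
  · rcases x with _ | x <;> exact id
  have hy := (hB.chord _ y.2).1
  rcases x with _ | x
  · simp [Encl, leftFace, rightFace]
    omega
  · have := hA.take_lt x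
    simp [Encl, leftFace, rightFace]
    omega

theorem encl_right_left (hA : WordCut (l.take j) A) (hB : WordCut (l.drop (j + 1)) B)
    (x : Face B) (y : Face A) :
    Encl (joinCut j A B) (rightFace j A B x) (leftFace j A B y) ↔ x = none := by
  rcases x with _ | x
  · rcases y with _ | y <;> simp [Encl, leftFace, rightFace]
  · have hx := (hB.chord _ x.2).1
    rcases y with _ | y
    · simp [Encl, leftFace, rightFace]
    · have := hA.take_lt y
      simp [Encl, leftFace, rightFace]
      omega

theorem imm_left (hA : WordCut (l.take j) A) (hB : WordCut (l.drop (j + 1)) B) (x y : Face A) :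
    Imm (joinCut j A B) (leftFace j A B x) (leftFace j A B y) ↔ Imm A x y := by
  unfold Imm
  rw [forall_face]
  simp only [encl_left hA, not_encl_left_right hA hB, false_and, not_false_eq_true, implies_true,
    and_true]

theorem imm_right (hA : WordCut (l.take j) A) (hB : WordCut (l.drop (j + 1)) B) (x y : Face B) :
    Imm (joinCut j A B) (rightFace j A B x) (rightFace j A B y) ↔ Imm B x y := by
  unfold Imm
  rw [forall_face]
  simp only [encl_right, not_encl_left_right hA hB, and_false, not_false_eq_true, implies_true,
    true_and]

/-- The two parts of the diagram are adjacent only across the chord of the first letter. -/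
theorem imm_right_left (hA : WordCut (l.take j) A) (hB : WordCut (l.drop (j + 1)) B)
    (x : Face B) (y : Face A) :
    Imm (joinCut j A B) (rightFace j A B x) (leftFace j A B y) ↔ x = none ∧ y = none := by
  unfold Imm
  rw [forall_face]
  simp only [encl_right, encl_left hA, encl_right_left hA hB]
  constructor
  · rintro ⟨rfl, h1, -⟩
    refine ⟨rfl, ?_⟩
    rcases y with _ | y
    · rfl
    · exact (h1 none ⟨rfl, trivial⟩).elim
  · rintro ⟨rfl, rfl⟩
    refine ⟨rfl, fun w h => ?_, fun w h => ?_⟩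
    · rcases w with _ | w <;> exact h.2
    · obtain ⟨h1, rfl⟩ := h
      exact h1

theorem inFace_left_succ (hA : WordCut (l.take j) A) (hB : WordCut (l.drop (j + 1)) B)
    (x : Face A) {m : ℕ} (hm : m < j) :
    InFace (joinCut j A B) (leftFace j A B x) (m + 1) ↔ InFace A x m := by
  unfold InFace
  rw [forall_mem_face]
  have h1 : ¬ Encl (joinCut j A B) (leftFace j A B x)
      (some ⟨(0, j + 1), mem_joinCut.2 (Or.inl rfl)⟩) := by
    rcases x with _ | x <;> simp [Encl, leftFace]
  refine and_congr ?_ ⟨fun h d hd hm => ?_, fun h => ⟨fun h' => (h1 h').elim, fun d hd hm => ?_,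
    fun d hd => (not_encl_left_right hA hB x (some d) hd).elim⟩⟩
  · rcases x with _ | x <;> simp [Below, leftFace, hm]
  · exact h.2.1 d ((encl_left hA x (some d)).2 hd) (by simpa using hm)
  · exact h d ((encl_left hA x (some d)).1 hd) (by simpa using hm)

theorem not_inFace_left (hA : WordCut (l.take j) A) (x : Face A) {m : ℕ}
    (hm : m = 0 ∨ j + 1 ≤ m) : ¬ InFace (joinCut j A B) (leftFace j A B x) m := by
  rintro ⟨h, -⟩
  rcases x with _ | x
  · simp [Below, leftFace] at h
    omega
  · have := hA.take_lt x
    simp [Below, leftFace] at h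
    omega

theorem inFace_right_add (hA : WordCut (l.take j) A) (x : Face B) (m : ℕ) : InFace (joinCut j A B) (rightFace j A B x) (m + (j + 2)) ↔ InFace B x m := by
  unfold InFace
  rw [forall_mem_face]
  refine and_congr ?_ ⟨fun h d hd hm => ?_, fun h => ⟨fun _ hm => ?_, fun d _ hm => ?_,
    fun d hd hm => ?_⟩⟩
  · rcases x with _ | x <;> simp [Below, rightFace]
  · exact h.2.2 d ((encl_right x (some d)).2 hd) (by simpa using hm)
  · have h2 : m + (j + 2) ≤ j + 1 := hm.2
    omega
  · have := hA.take_lt d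
    have h2 : m + (j + 2) ≤ d.1.2 + 1 := hm.2
    omega
  · exact h d ((encl_right x (some d)).1 hd) (by simpa using hm)

theorem not_inFace_right (x : Face B) {m : ℕ} (hm : m ≤ j + 1) :
    ¬ InFace (joinCut j A B) (rightFace j A B x) m := by
  rintro ⟨h, h'⟩
  rcases x with _ | x
  · exact h' ⟨(0, j + 1), mem_joinCut.2 (Or.inl rfl)⟩ trivial ⟨Nat.zero_le _, hm⟩
  · simp [Below, rightFace] at h
    omega

theorem eq_append_of_getElem? {b : Arrow I} (hj : l[j]? = some b) :
    l = l.take j ++ b :: l.drop (j + 1) := by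
  obtain ⟨h, rfl⟩ := List.getElem?_eq_some_iff.1 hj
  rw [← List.drop_eq_getElem_cons h, List.take_append_drop]

theorem subword_left {b : Arrow I} (hj : l[j]? = some b) (hA : WordCut (l.take j) A)
    (hB : WordCut (l.drop (j + 1)) B) (x : Face A) :
    subword (InFace (joinCut j A B) (leftFace j A B x)) (a :: l) =
      subword (InFace A x) (l.take j) := by
  classical
  have hlen := (List.getElem?_eq_some_iff.1 hj).1
  have hl : (l.take j).length = j := by simp; omega
  conv_lhs => rw [eq_append_of_getElem? hj]
  rw [subword_cons, if_neg (not_inFace_left hA x (Or.inl rfl)), subword_append,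
    subword_eq_nil (l := b :: _) fun m _ => not_inFace_left hA x (Or.inr (by omega)),
    List.append_nil]
  exact subword_congr fun m hm => inFace_left_succ hA hB x (by omega)

theorem subword_right {b : Arrow I} (hj : l[j]? = some b) (hA : WordCut (l.take j) A) (x : Face B) :
    subword (InFace (joinCut j A B) (rightFace j A B x)) (a :: l) =
      subword (InFace B x) (l.drop (j + 1)) := by
  classical
  have hlen := (List.getElem?_eq_some_iff.1 hj).1
  have hl : (l.take j).length = j := by simp; omega
  conv_lhs => rw [eq_append_of_getElem? hj]
  rw [subword_cons, if_neg (not_inFace_right x (by omega)), subword_append,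
    subword_eq_nil (l := l.take j) fun m hm => not_inFace_right x (by omega),
    List.nil_append, subword_cons, if_neg (not_inFace_right x (by omega))]
  refine subword_congr fun m _ => ?_
  rw [show m + 1 + (l.take j).length + 1 = m + (j + 2) by omega]
  exact inFace_right_add hA x m

/-- The dual tree of `a u a* v` is a graft. The new face is the first child of the unbounded one
because its chord begins at position `0`, and its label starts at the target of `a`, where `u`
starts. -/
theorem isGraft_wordData (hj : l[j]? = some (Arrow.star a)) (hA : WordCut (l.take j) A)
    (hB : WordCut (l.drop (j + 1)) B) (i : I) :
    PlanarData.IsGraft (a.isLeft = true) (wordData (Arrow.tgt a) (l.take j) A) none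
      (wordData i (l.drop (j + 1)) B) none (wordData i (a :: l) (joinCut j A B))
      (leftFace j A B) (rightFace j A B) where
  inj := by
    have h0 : ∀ c d : ℕ × ℕ, ∀ hc hd, (some ⟨c, hc⟩ : Face (joinCut j A B)) = some ⟨d, hd⟩ →
        c.1 = d.1 ∧ c.2 = d.2 := fun c d _ _ h => by
      have := congrArg Subtype.val (Option.some_injective _ h)
      exact ⟨congrArg Prod.fst this, congrArg Prod.snd this⟩
    have hsub : ∀ {C : Finset (ℕ × ℕ)} (c d : {c // c ∈ C}), c.1.1 = d.1.1 → c.1.2 = d.1.2 →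
        (some c : Face C) = some d := fun c d h h' => congrArg some (Subtype.ext (Prod.ext h h'))
    rintro (x | x) (y | y) h <;> rcases x with _ | x <;> rcases y with _ | y
    · rfl
    · have := (h0 _ _ _ _ h).1; simp at this
    · have := (h0 _ _ _ _ h).1; simp at this
    · have := h0 _ _ _ _ h
      simp at this
      exact congrArg Sum.inl (hsub x y this.1 this.2)
    · cases h
    · have := (h0 _ _ _ _ h).1; simp at this
    · cases h
    · have := (h0 _ _ _ _ h).1
      have := hA.take_lt x
      simp at *
      omega
    · cases h
    · cases h
    · have := (h0 _ _ _ _ h).1; simp at this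
    · have := (h0 _ _ _ _ h).1
      have := hA.take_lt y
      simp at *
      omega
    · rfl
    · cases h
    · cases h
    · have := h0 _ _ _ _ h
      simp at this
      exact congrArg Sum.inr (hsub x y this.1 this.2)
  ch_left := imm_left hA hB
  ch_right := imm_right hA hB
  not_ch x y h := not_encl_left_right hA hB x y h.1
  ch_right_left := imm_right_left hA hB
  le_left _ x y _ _ := by
    rcases x with _ | x <;> rcases y with _ | y <;> simp [wordData, leftFace, pos]
  le_right _ x y _ _ := by
    rcases x with _ | x <;> rcases y with _ | y <;> simp [wordData, rightFace, pos]
  le_self := le_refl _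
  le_first y hy := by
    rcases y with _ | y
    · exact (not_imm_none _ hy).elim
    · simp [wordData, leftFace, rightFace, pos]
  dn_left z x hx := by
    rcases x with _ | x
    · exact (not_imm_none _ hx).elim
    · have := hA.take_lt x
      change (∃ e, (l.take j)[x.1.1]? = _) ↔ ∃ e, (a :: l)[x.1.1 + 1]? = _
      rw [List.getElem?_cons_succ, List.getElem?_take_of_lt (this.1.trans this.2)]
  dn_right z x hx := by
    rcases x with _ | x
    · exact (not_imm_none _ hx).elim
    · change (∃ e, (l.drop (j + 1))[x.1.1]? = _) ↔ ∃ e, (a :: l)[x.1.1 + (j + 1) + 1]? = _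
      rw [List.getElem?_cons_succ, List.getElem?_drop, add_comm (j + 1)]
  dn_first := by
    change (a.isLeft = true) ↔ ∃ e, (a :: l)[0]? = some (Sum.inl e)
    rcases a with a | a <;> simp
  lab_left x := by
    refine Prod.ext ?_ (subword_left hj hA hB x).symm
    rcases x with _ | x
    · rfl
    · have := hA.take_lt x
      have hx : x.1.1 < l.length := by
        have := (List.getElem?_eq_some_iff.1 hj).1
        omega
      change ((l.take j)[x.1.1]?).elim a.tgt Arrow.tgt = ((a :: l)[x.1.1 + 1]?).elim i Arrow.tgt
      rw [List.getElem?_cons_succ, List.getElem?_take_of_lt (this.1.trans this.2),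
        List.getElem?_eq_getElem hx]
      rfl
  lab_right x := by
    refine Prod.ext ?_ (subword_right hj hA x).symm
    rcases x with _ | x
    · rfl
    · change ((l.drop (j + 1))[x.1.1]?).elim i Arrow.tgt =
        ((a :: l)[x.1.1 + (j + 1) + 1]?).elim i Arrow.tgt
      rw [List.getElem?_cons_succ, List.getElem?_drop, add_comm (j + 1)]

theorem WordCode.graft (hj : l[j]? = some (Arrow.star a)) (hA : WordCut (l.take j) A)
    (hB : WordCut (l.drop (j + 1)) B) {i : I} {s t : PlanarTree (I × List (Arrow I))}
    (hs : WordCode (Arrow.tgt a) (l.take j) A s) (ht : WordCode i (l.drop (j + 1)) B t) :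
    WordCode i (a :: l) (joinCut j A B) (.graft (a.isLeft = true) s t) := by
  obtain ⟨f, hf, hf'⟩ := hs
  obtain ⟨g, hg, hg'⟩ := ht
  have h := PlanarTree.isEmb_graft (isGraft_wordData hj hA hB i) hf hg
    (s.map_root hf hf'.2 not_imm_none) (t.map_root hg hg'.2 not_imm_none)
  refine ⟨_, h, h.inj, ?_⟩
  have : Sum.elim (leftFace j A B ∘ f) (rightFace j A B ∘ g) =
      Sum.elim (leftFace j A B) (rightFace j A B) ∘ Sum.map f g := by
    ext x
    rcases x with x | x <;> rfl
  rw [this]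
  exact (face_surjective j A B).comp (Sum.map_surjective.2 ⟨hf'.2, hg'.2⟩)

end

end WordFace

/-! ### Signs of cuts, and sums over cuts as recursive sums -/

section WordSign

variable {I : Type*} [Quiver I]

open QPath

/-- The sign of a cut of a word. -/
def wordSign (l : List (Arrow I)) (H : Finset (ℕ × ℕ)) : ℤ :=
  -- The left letter `a` of a chord determines the sign, the right one being `a*`. The default value
  -- is not used for chords of `l`.
  ∏ c ∈ H, (l[c.1]?).elim 0 chordSign

theorem prod_joinCut {M : Type*} [CommMonoid M] {l : List (Arrow I)} {j : ℕ}
    {A : Finset (ℕ × ℕ)} (hA : WordCut (l.take j) A) (B : Finset (ℕ × ℕ)) (F : ℕ × ℕ → M) :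
    ∏ c ∈ joinCut j A B, F c =
      F (0, j + 1) * (∏ c ∈ A, F (shift 1 c)) * ∏ c ∈ B, F (shift (j + 2) c) := by
  rw [joinCut, Finset.prod_insert, Finset.prod_union, Finset.prod_map, Finset.prod_map, mul_assoc]
  · refine Finset.disjoint_left.2 fun c hc hc' => ?_
    obtain ⟨d, hd, rfl⟩ := Finset.mem_map.1 hc
    obtain ⟨e, he, h⟩ := Finset.mem_map.1 hc'
    have h1 := congrArg Prod.fst h
    have h2 := hA.take_lt ⟨d, hd⟩
    simp at h1 h2
    omega
  · rw [Finset.mem_union, Finset.mem_map, Finset.mem_map]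
    rintro (⟨d, -, h⟩ | ⟨d, -, h⟩)
    · have := congrArg Prod.fst h
      simp at this
    · have := congrArg Prod.fst h
      simp at this

theorem wordSign_map_shift (a : Arrow I) (l : List (Arrow I)) (H : Finset (ℕ × ℕ)) :
    wordSign (a :: l) (H.map (shift 1)) = wordSign l H := by
  rw [wordSign, Finset.prod_map]
  rfl

theorem wordSign_joinCut (a : Arrow I) {l : List (Arrow I)} {j : ℕ} {A : Finset (ℕ × ℕ)}
    (hA : WordCut (l.take j) A) (B : Finset (ℕ × ℕ)) : wordSign (a :: l) (joinCut j A B) =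
      chordSign a * wordSign (l.take j) A * wordSign (l.drop (j + 1)) B := by
  rw [wordSign, prod_joinCut hA]
  congr 1
  · congr 1
    refine Finset.prod_congr rfl fun c hc => ?_
    have := hA.take_lt ⟨c, hc⟩
    rw [List.getElem?_take_of_lt (this.1.trans this.2)]
    rfl
  · refine Finset.prod_congr rfl fun c hc => ?_
    rw [List.getElem?_drop, add_comm (j + 1)]
    rfl

theorem wordCode_nil (i : I) : WordCode i ([] : List (Arrow I)) ∅ (.leaf (i, [])) := by
  refine ⟨fun _ => none, ⟨fun _ _ _ => rfl, fun _ _ => ⟨fun h => h.elim, fun h => h.1.elim⟩,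
    fun _ _ _ h => h.elim, fun _ _ h => h.elim, fun _ => rfl⟩, fun _ _ _ => rfl, ?_⟩
  rintro (_ | ⟨c, hc⟩)
  · exact ⟨(), rfl⟩
  · simp at hc

variable {A : Type*} [CommRing A]

/-- Compares the recursion of `sum_wordCuts_cons` with that of `wordSum`. Requiring agreement of `φ`
and `f` only along codes of dual trees makes the hypothesis stable under `WordCode.prependRoot` and
`WordCode.graft`. -/
theorem sum_wordSign_mul (i : I) (l : List (Arrow I)) (φ : Finset (ℕ × ℕ) → A)
    (f : PlanarTree (I × List (Arrow I)) → A)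
    (h : ∀ H, WordCut l H → ∀ t, WordCode i l H t → φ H = f t) :
    ∑ H ∈ wordCuts l, (wordSign l H : A) * φ H = wordSum i l f := by
  induction hn : l.length using Nat.strong_induction_on generalizing i l φ f with
  | _ n ih =>
  subst hn
  rcases l with _ | ⟨a, l⟩
  · have h0 : wordCuts ([] : List (Arrow I)) = {∅} := by
      ext H
      rw [mem_wordCuts, Finset.mem_singleton]
      constructor
      · intro hH
        refine Finset.eq_empty_of_forall_notMem fun c hc => ?_
        have := (hH.chord c hc).lt_length
        simp at this
      · rintro rfl
        exact ⟨by simp, by simp, by simp⟩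
    have h1 : WordCut ([] : List (Arrow I)) ∅ := ⟨by simp, by simp, by simp⟩
    rw [h0, Finset.sum_singleton, wordSum_nil, h ∅ h1 _ (wordCode_nil i)]
    simp [wordSign]
  · rw [sum_wordCuts_cons, wordSum]
    congr 1
    · simp_rw [wordSign_map_shift]
      refine ih l.length (by simp) i l _ _ (fun H hH t ht => ?_) rfl
      exact h _ (wordCut_cons_shift.2 hH) _ (ht.prependRoot a)
    · refine Finset.sum_congr rfl fun j hj => ?_
      rw [Finset.mem_range] at hj
      split
      case isFalse => rfl
      case isTrue hja =>
        -- For a fixed cut of the left part, the sum over the cuts of the right part serves as the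
        -- function `φ`; the induction hypothesis is used for both parts.
        rw [← ih _ _ _ (l.take j) (fun A' => ∑ B ∈ wordCuts (l.drop (j + 1)),
          (wordSign (l.drop (j + 1)) B : A) * φ (joinCut j A' B)) _ (fun A' hA s hs => ?_) rfl,
          Finset.mul_sum]
        · refine Finset.sum_congr rfl fun A' hA => ?_
          rw [Finset.mul_sum, Finset.mul_sum]
          refine Finset.sum_congr rfl fun B hB => ?_
          rw [wordSign_joinCut a (mem_wordCuts.1 hA)]
          push_cast
          ring
        · simp
        · refine ih _ ?_ _ (l.drop (j + 1)) _ _ (fun B hB t ht => ?_) rfl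
          · simp
          · exact h _ (wordCut_joinCut hja hA hB) _ (WordCode.graft hja hA hB hs ht)

theorem subword_Ico (lo hi : ℕ) (l : List (Arrow I)) :
    subword (fun m => lo ≤ m ∧ m < hi) l = (l.take hi).drop lo := by
  induction l generalizing lo hi with
  | nil => simp [subword_nil]
  | cons a l ih =>
    rw [subword_cons]
    rcases hi with _ | hi
    · simp [subword_eq_nil]
    · rcases lo with _ | lo
      · have := ih 0 hi
        simp at this
        simp [this]
      · have := ih lo hi
        simp [this]

/-- No chord lies below `c`, so all letters strictly between its ends are on the boundary of its
face. -/
theorem subword_some_of_isSimple {H : Finset (ℕ × ℕ)} (hH : IsSimple H) {l : List (Arrow I)}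
    (c : {c // c ∈ H}) :
    subword (InFace H (some c)) l = (l.take c.1.2).drop (c.1.1 + 1) := by
  rw [← subword_Ico]
  refine subword_congr fun m _ => ⟨fun h => h.1, fun h => ⟨h, fun d hd => ?_⟩⟩
  exact (hH _ c.2 _ d.2 hd).elim

theorem isSimple_map_shift {n : ℕ} {H : Finset (ℕ × ℕ)} :
    IsSimple (H.map (shift n)) ↔ IsSimple H := by
  constructor
  · intro h c hc d hd
    simpa using h _ (Finset.mem_map_of_mem _ hc) _ (Finset.mem_map_of_mem _ hd)
  · intro h c₀ hc₀ d₀ hd₀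
    obtain ⟨c, hc, rfl⟩ := Finset.mem_map.1 hc₀
    obtain ⟨d, hd, rfl⟩ := Finset.mem_map.1 hd₀
    simpa using h c hc d hd

theorem isSimple_joinCut {l : List (Arrow I)} {j : ℕ} {A B : Finset (ℕ × ℕ)}
    (hA : WordCut (l.take j) A) (hB : WordCut (l.drop (j + 1)) B) :
    IsSimple (joinCut j A B) ↔ A = ∅ ∧ IsSimple B := by
  constructor
  · intro h
    refine ⟨Finset.eq_empty_of_forall_notMem fun c hc => ?_, fun c hc d hd => ?_⟩
    · have := hA.take_lt ⟨c, hc⟩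
      refine h _ (mem_joinCut.2 (Or.inl rfl)) _ (mem_joinCut.2 (Or.inr (Or.inl ⟨c, hc, rfl⟩))) ?_
      simp at *
      omega
    · have := h _ (mem_joinCut.2 (Or.inr (Or.inr ⟨c, hc, rfl⟩))) _
        (mem_joinCut.2 (Or.inr (Or.inr ⟨d, hd, rfl⟩)))
      simpa using this
  · rintro ⟨rfl, h⟩ c hc d hd
    rcases mem_joinCut.1 hc with rfl | ⟨c', hc', rfl⟩ | ⟨c', hc', rfl⟩ <;>
      rcases mem_joinCut.1 hd with rfl | ⟨d', hd', rfl⟩ | ⟨d', hd', rfl⟩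
    · simp
    · simp at hd'
    · have := (hB.chord _ hd').1
      simp
      omega
    · simp at hc'
    · simp at hc'
    · simp at hc'
    · simp
    · simp at hd'
    · have := h _ hc' _ hd'
      simpa using this

theorem subword_shiftFace_none (a : Arrow I) (l : List (Arrow I)) (H : Finset (ℕ × ℕ)) :
    subword (InFace (H.map (shift 1)) none) (a :: l) = a :: subword (InFace H none) l := by
  classical
  rw [subword_cons, if_pos]
  · exact congrArg (a :: ·) (subword_congr fun m _ => inFace_shiftFace_add 1 H none m)
  · refine ⟨trivial, fun d _ hd => ?_⟩
    obtain ⟨c, -, hc⟩ := Finset.mem_map.1 d.2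
    have := congrArg Prod.fst hc
    simp at this hd
    omega

-- The counterpart of `sum_wordSign_mul` for simple cuts; the faces below the chords are plain
-- intervals, so words suffice in place of trees.
open Classical in
theorem sum_isSimple_wordSign (i : I) (l : List (Arrow I)) (χ : I × List (Arrow I) → A)
    (f : List (Arrow I) → A) :
    ∑ H ∈ (wordCuts l).filter (fun H => IsSimple H), (wordSign l H : A) *
      ((∏ c ∈ H, χ (letterTgt i l c.1, (l.take c.2).drop (c.1 + 1))) *
        f (subword (InFace H none) l)) = simpleSum χ l f := by
  induction hn : l.length using Nat.strong_induction_on generalizing l f with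
  | _ n ih =>
  subst hn
  have h1 : ∀ l : List (Arrow I), WordCut l ∅ := fun l => ⟨by simp, by simp, by simp⟩
  rcases l with _ | ⟨a, l⟩
  · have h0 : (wordCuts ([] : List (Arrow I))).filter (fun H => IsSimple H) = {∅} := by
      ext H
      rw [Finset.mem_filter, mem_wordCuts, Finset.mem_singleton]
      constructor
      · rintro ⟨hH, -⟩
        refine Finset.eq_empty_of_forall_notMem fun c hc => ?_
        have := (hH.chord c hc).lt_length
        simp at this
      · rintro rfl
        exact ⟨h1 _, by simp [IsSimple]⟩
    rw [h0, Finset.sum_singleton, simpleSum_nil]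
    simp [wordSign, subword_nil]
  · rw [Finset.sum_filter, sum_wordCuts_cons, simpleSum]
    congr 1
    · rw [← ih l.length (by simp) l _ rfl, Finset.sum_filter]
      refine Finset.sum_congr rfl fun H _ => ?_
      rw [isSimple_map_shift, wordSign_map_shift, Finset.prod_map, subword_shiftFace_none]
      rfl
    · refine Finset.sum_congr rfl fun j hj => ?_
      rw [Finset.mem_range] at hj
      split
      case isFalse => rfl
      case isTrue hja =>
        -- Any chord in the left part would be nested in that of the first letter, so only the empty
        -- cut of the left part contributes.
        rw [← ih _ _ (l.drop (j + 1)) _ rfl, Finset.sum_filter, Finset.sum_eq_single ∅,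
          Finset.mul_sum]
        · refine Finset.sum_congr rfl fun B hB => ?_
          rw [isSimple_joinCut (h1 _) (mem_wordCuts.1 hB)]
          by_cases hs : IsSimple B
          · rw [if_pos ⟨rfl, hs⟩, if_pos hs, wordSign_joinCut a (h1 _), prod_joinCut (h1 (l.take j))]
            have h2 := subword_right (a := a) (B := B) hja (h1 _) none
            have h3 : ∀ c ∈ B, χ (letterTgt i (a :: l) (shift (j + 2) c).1,
                ((a :: l).take (shift (j + 2) c).2).drop ((shift (j + 2) c).1 + 1)) =
                χ (letterTgt i (l.drop (j + 1)) c.1,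
                  ((l.drop (j + 1)).take c.2).drop (c.1 + 1)) := by
              intro c _
              congr 2
              · change ((a :: l)[c.1 + (j + 1) + 1]?).elim i Arrow.tgt =
                  ((l.drop (j + 1))[c.1]?).elim i Arrow.tgt
                rw [List.getElem?_cons_succ, List.getElem?_drop, add_comm (j + 1)]
              · change ((a :: l).take (c.2 + (j + 1) + 1)).drop (c.1 + (j + 1) + 1 + 1) = _
                rw [List.take_succ_cons, List.drop_succ_cons, List.take_drop, List.drop_drop]
                rw [show c.1 + (j + 1) + 1 = j + 1 + (c.1 + 1) by omega, add_comm c.2]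
            change subword (InFace (joinCut j ∅ B) none) (a :: l) = _ at h2
            rw [h2, Finset.prod_congr rfl h3]
            have h4 : letterTgt i (a :: l) 0 = Arrow.tgt a := rfl
            simp [wordSign, h4]
            ring
          · rw [if_neg (fun h => hs h.2), if_neg hs, mul_zero]
        · intro A' hA hne
          refine Finset.sum_eq_zero fun B hB => if_neg fun h => hne ?_
          exact ((isSimple_joinCut (mem_wordCuts.1 hA) (mem_wordCuts.1 hB)).1 h).1
        · intro h
          exact (h (mem_wordCuts.2 (h1 _))).elim
        · simp

end WordSign

/-! ### The planar data of dual trees -/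

section DualData

variable {I : Type*} [Quiver I]

open QPath

theorem QPath.child_dualRooted (X : QPath I) {H : Finset (ℕ × ℕ)} (hH : X.IsCut H)
    (u v : Face H) : (X.dualRooted H hH).Child u v ↔ Imm H u v :=
  RootedTree.child_eq_of (T := X.dualRooted H hH) (c := Imm H) not_imm_none
    (fun _ _ _ => imm_unique hH) (fun _ _ => Iff.rfl) u v

/-- The position of the parent is smaller than those of all children, so opening the cyclic order at
the parent yields the order by positions. -/
theorem QPath.linOrd_dualR (X : QPath I) {H : Finset (ℕ × ℕ)} (hH : X.IsCut H) {z x y : Face H}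
    (hx : Imm H z x) (hy : Imm H z y) (hx' : (dualGraph H).Adj z x) (hy' : (dualGraph H).Adj z y) :
    ((X.dualR H hH).2.linOrd z).le ⟨x, hx'⟩ ⟨y, hy'⟩ ↔ pos H x ≤ pos H y := by
  rcases z with _ | z
  · exact PhiRt.linOrd_root (X.dualR H hH).2 _ _
  · have hz : (some z : Face H) ≠ (X.dualRooted H hH).root := Option.some_ne_none z
    have hp : Imm H ((X.dualRooted H hH).parent (some z) hz).1 (some z) :=
      (X.child_dualRooted hH _ _).1 ⟨hz, rfl⟩
    have h1 := hp.1.pos_lt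
    have h2 := hx.1.pos_lt
    have h3 := hy.1.pos_lt
    have hne : ∀ (w : Face H) (hw : (dualGraph H).Adj (some z) w), Imm H (some z) w →
        (⟨w, hw⟩ : (dualGraph H).neighborSet (some z)) ≠
          (X.dualRooted H hH).parent (some z) hz := by
      intro w hw hzw h
      have h4 := hzw.1.pos_lt
      have h5 := congrArg (fun q : (dualGraph H).neighborSet (some z) => pos H q.1) h
      simp only at h5
      exact absurd h5 (h1.trans h4).ne'
    refine (PhiRt.linOrd_of_ne (X.dualR H hH).2 hz _ _).trans ?_
    refine (or_iff_right (hne x hx' hx)).trans ((and_iff_right (hne y hy' hy)).trans ?_)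
    set q := pos H ((X.dualRooted H hH).parent (some z) hz).1
    change (q ≤ pos H x ∧ pos H x ≤ pos H y) ∨ (pos H x ≤ pos H y ∧ pos H y ≤ q) ∨
      (pos H y ≤ q ∧ q ≤ pos H x) ↔ _
    omega

theorem QPath.word_facePath (X : QPath I) {H : Finset (ℕ × ℕ)} (hH : X.IsCut H) (u : Face H) :
    (X.facePath H hH u).word = (wordData X.start X.arrows H).lab u := by
  refine Prod.ext ?_ rfl
  rcases u with _ | c
  · rfl
  · obtain ⟨-, a, ha, -⟩ := hH.chord c.1 c.2
    change X.vert (c.1.1 + 1) = (X.arrows[c.1.1]?).elim X.start Arrow.tgt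
    rw [ha]
    exact (X.src_tgt ha).2

/-- Passes from words, where the recursion takes place, to the dual tree with its actual structure.
-/
theorem QPath.isEmb_dualR (X : QPath I) {H : Finset (ℕ × ℕ)} (hH : X.IsCut H) :
    (wordData X.start X.arrows H).IsEmb (X.dualR H hH).data id where
  inj := Function.injective_id
  ch x y := (X.child_dualRooted hH x y).symm
  le z x y hx hy := ((RTree.data_le_iff (X.dualR H hH) ((X.child_dualRooted hH z x).2 hx)
    ((X.child_dualRooted hH z y).2 hy)).trans (X.linOrd_dualR hH hx hy _ _)).symm
  dn z x hx := by
    have hd : faceDn X.arrows H x ↔ X.LeftInQ H x := by rcases x with _ | x <;> exact Iff.rfl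
    refine hd.trans ((RTree.data_dn_iff (X.dualR H hH) ((X.child_dualRooted hH z x).2 hx)).trans
      ?_).symm
    change (Imm H z x ∧ X.LeftInQ H x) ∨ (Imm H x z ∧ ¬ X.LeftInQ H z) ↔ _
    constructor
    · rintro (h | h)
      · exact h.2
      · exact (lt_asymm hx.1.pos_lt h.1.1.pos_lt).elim
    · exact fun h => Or.inl ⟨hx, h⟩
  lab x := (X.word_facePath hH x).symm

theorem WordCode.hasCode {X : QPath I} {H : Finset (ℕ × ℕ)} (hH : X.IsCut H)
    {t : PlanarTree (I × List (Arrow I))} (h : WordCode X.start X.arrows H t) :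
    (X.dualR H hH).HasCode t := by
  obtain ⟨f, hf, hf'⟩ := h
  exact ⟨f, (X.isEmb_dualR hH).comp hf, hf'⟩

theorem QPath.eps_eq (X : QPath I) {H : Finset (ℕ × ℕ)} (hH : X.IsCut H) :
    X.eps H = wordSign X.arrows H := by
  refine Finset.prod_congr rfl fun c hc => ?_
  have h1 : c.1 < X.arrows.length ∧ c.2 < X.arrows.length := (hH.chord c hc).lt_length
  obtain ⟨-, a, ha, hb⟩ := hH.chord c hc
  rw [ha, QPath.om, dif_pos h1]
  rw [List.getElem?_eq_getElem h1.1] at ha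
  rw [List.getElem?_eq_getElem h1.2] at hb
  rw [Option.some_injective _ ha, Option.some_injective _ hb]
  rfl

/-- The value at a planar tree of a function on isomorphism classes. -/
def codeVal {A : Type*} [Zero A] (g : RTreeClass I → A) (t : PlanarTree (I × List (Arrow I))) : A :=
  open Classical in if h : ∃ X : RTree I, X.HasCode t then g (Quotient.mk _ h.choose) else 0

theorem RTree.HasCode.codeVal_eq {A : Type*} [Zero A] (g : RTreeClass I → A) {X : RTree I}
    {t : PlanarTree (I × List (Arrow I))} (h : X.HasCode t) :
    codeVal g t = g (Quotient.mk _ X) := by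
  have h' : ∃ X : RTree I, X.HasCode t := ⟨X, h⟩
  rw [codeVal, dif_pos h']
  exact congrArg g (Quotient.sound (h'.choose_spec.equiv h))

end DualData

/-! ### Values of homomorphisms on the comultiplications and on η_rt -/

section Formulas

open SymmetricAlgebra QPath

variable {k : Type*} [CommRing k] {I : Type*} [Quiver I] {A : Type*} [CommRing A] [Algebra k A]

theorem map_intCast_smul {R M : Type*} [Ring R] [Algebra k R] [AddCommGroup M] [Module k M]
    (F : M →ₗ[k] R) (n : ℤ) (x : M) : F ((n : k) • x) = (n : R) * F x := by
  rw [map_smul, Algebra.smul_def, map_intCast]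

/-- An algebra homomorphism on the tensor square sees a comultiplication only through its values on
the generators of the two factors. Together with `map_comulPFun` and `map_etaRtFun` this turns
identities in tensor products into identities between `conv`, `simpleSum` and `wordSum` with values
in a commutative ring. -/
theorem map_comulRtFun (F : SymmetricAlgebra k (TRt k I) ⊗[k] SymmetricAlgebra k (TRt k I) →ₐ[k] A)
    {χ f : PlanarTree (I × List (Arrow I)) → A}
    (hχ : ∀ (Y : RTree I) s, Y.HasCode s → F (ι k _ (Y.el k) ⊗ₜ 1) = χ s)
    (hf : ∀ (Y : RTree I) s, Y.HasCode s → F (1 ⊗ₜ ι k _ (Y.el k)) = f s)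
    {X : RTree I} {t : PlanarTree (I × List (Arrow I))} (ht : X.HasCode t) :
    F (comulRtFun k X) = PlanarTree.conv χ f t := by
  classical
  rw [comulRtFun, map_add, map_sum, hχ X t ht, PlanarTree.conv,
    ← RTree.sum_isSimpleCut X t ht χ f (fun Y => F (ι k _ (Y.el k) ⊗ₜ 1))
      (fun Y => F (1 ⊗ₜ ι k _ (Y.el k))) hχ hf]
  congr 1
  refine Finset.sum_congr rfl fun H _ => ?_
  rw [← map_prod F, ← map_mul F]
  congr 1
  have : ∀ s : Finset X.1.graph.edgeSet, ∀ g : X.1.graph.edgeSet → SymmetricAlgebra k (TRt k I),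
      ∏ e ∈ s, (g e ⊗ₜ[k] (1 : SymmetricAlgebra k (TRt k I))) = (∏ e ∈ s, g e) ⊗ₜ 1 := fun s g =>
    (map_prod (Algebra.TensorProduct.includeLeft :
      SymmetricAlgebra k (TRt k I) →ₐ[k] _ ⊗[k] SymmetricAlgebra k (TRt k I)) g s).symm
  rw [this, Algebra.TensorProduct.tmul_mul_tmul, one_mul, mul_one]

theorem sum_subtype_eq {α M : Type*} [AddCommMonoid M] {s t : Finset α} (h : s = t)
    {F : {x // x ∈ s} → M} {G : α → M} (hFG : ∀ x, F x = G x) : ∑ x, F x = ∑ x ∈ t, G x := by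
  subst h
  rw [← Finset.sum_coe_sort s G]
  exact Finset.sum_congr rfl fun x _ => hFG x

theorem map_comulPFun
    (F : SymmetricAlgebra k (PathModule k I) ⊗[k] SymmetricAlgebra k (PathModule k I) →ₐ[k] A)
    {χ f : I × List (Arrow I) → A}
    (hχ : ∀ Y : QPath I, F (ι k _ (Y.el k) ⊗ₜ 1) = χ Y.word)
    (hf : ∀ Y : QPath I, F (1 ⊗ₜ ι k _ (Y.el k)) = f Y.word) (X : QPath I) :
    F (comulPFun k X) = χ X.word + simpleSum χ X.arrows (fun w => f (X.start, w)) := by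
  classical
  rw [comulPFun, map_add, map_sum, hχ X, ← sum_isSimple_wordSign X.start]
  refine congrArg _ (sum_subtype_eq (by rw [QPath.cuts_eq]) fun H => ?_)
  have hs := (Finset.mem_filter.1 H.2).2
  have hH := QPath.mem_cuts.1 (Finset.mem_filter.1 H.2).1
  have : ∀ g : {c // c ∈ H.1} → SymmetricAlgebra k (PathModule k I),
      (∏ e, g e) ⊗ₜ[k] (1 : SymmetricAlgebra k (PathModule k I)) = ∏ e, g e ⊗ₜ 1 := fun g =>
    map_prod (Algebra.TensorProduct.includeLeft :
      SymmetricAlgebra k (PathModule k I) →ₐ[k] _ ⊗[k] SymmetricAlgebra k (PathModule k I)) g _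
  refine (map_intCast_smul F.toLinearMap (X.eps H.1) _).trans ?_
  rw [X.eps_eq hH, AlgHom.toLinearMap_apply]
  congr 1
  rw [← mul_one (∏ c, _), ← one_mul (ι k _ ((X.facePath H.1 _ none).el k)),
    ← Algebra.TensorProduct.tmul_mul_tmul, map_mul, this, map_prod, hf, ← Finset.prod_coe_sort H.1]
  refine congrArg₂ (· * ·) (Finset.prod_congr rfl fun c _ => ?_) (congrArg f ?_)
  · rw [hχ, X.word_facePath hH]
    refine congrArg χ (Prod.ext rfl ?_)
    exact subword_some_of_isSimple hs c
  · exact X.word_facePath hH none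

theorem map_etaRtFun (F : TRt k I →ₗ[k] A)
    {f : PlanarTree (I × List (Arrow I)) → A}
    (hf : ∀ (Y : RTree I) s, Y.HasCode s → F (Y.el k) = f s) (X : QPath I) :
    F (etaRtFun k X) = wordSum X.start X.arrows f := by
  classical
  rw [etaRtFun, map_sum, ← sum_wordSign_mul X.start X.arrows
    (fun H => if hH : X.IsCut H then F ((X.dualR H hH).el k) else 0) f, ← QPath.cuts_eq,
    ← Finset.sum_coe_sort X.cuts]
  · refine Finset.sum_congr rfl fun H _ => ?_
    have hH := QPath.mem_cuts.1 H.2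
    rw [dif_pos hH, map_intCast_smul, X.eps_eq hH]
  · intro H hH t ht
    have hH' := QPath.isCut_iff.2 hH
    rw [dif_pos hH']
    exact hf _ _ (ht.hasCode hH')

end Formulas

/-! ### Coassociativity on trees, and compatibility of η_rt with comultiplications -/

section HopfFormulas

open SymmetricAlgebra QPath

variable {k : Type*} [CommRing k] {I : Type*} [Quiver I] {A : Type*} [CommRing A] [Algebra k A]

/-- The value at a planar tree of a linear map on trees. -/
def treeVal (F : TRt k I →ₗ[k] A) : PlanarTree (I × List (Arrow I)) → A :=
  codeVal (fun c => F (Finsupp.single c 1))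

theorem RTree.HasCode.treeVal_eq (F : TRt k I →ₗ[k] A) {X : RTree I}
    {t : PlanarTree (I × List (Arrow I))} (h : X.HasCode t) : F (X.el k) = treeVal F t :=
  (h.codeVal_eq (fun c => F (Finsupp.single c 1))).symm

variable (k)

/-- Isomorphic trees have a common code, and by `map_comulRtFun` for the identity map the value is a
function of the code. -/
theorem comulRtFun_congr {X Y : RTree I} (h : X ≈ Y) : comulRtFun k X = comulRtFun k Y := by
  obtain ⟨t, ht⟩ := X.exists_hasCode
  let a := (Algebra.TensorProduct.includeLeft (R := k) (S := k)
    (A := SymmetricAlgebra k (TRt k I)) (B := SymmetricAlgebra k (TRt k I))).toLinearMap ∘ₗ ι k _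
  let b := (Algebra.TensorProduct.includeRight (R := k)
    (A := SymmetricAlgebra k (TRt k I)) (B := SymmetricAlgebra k (TRt k I))).toLinearMap ∘ₗ ι k _
  have h1 := fun {Z : RTree I} (hZ : Z.HasCode t) => map_comulRtFun (k := k) (AlgHom.id k _)
    (fun Y s hs => hs.treeVal_eq a) (fun Y s hs => hs.treeVal_eq b) hZ
  exact (h1 ht).trans (h1 (ht.of_equiv h)).symm

theorem comulRt_ι (X : RTree I) : comulRt k I (ι k _ (X.el k)) = comulRtFun k X := by
  rw [comulRt, lift_ι_apply]
  refine (Finsupp.linearCombination_single k 1 _).trans ((one_smul k _).trans ?_)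
  exact comulRtFun_congr k (Quotient.mk_out X)

theorem comulP_ι (X : QPath I) : comulP k I (ι k _ (X.el k)) = comulPFun k X := by
  rw [comulP, lift_ι_apply, QPath.el, Finsupp.linearCombination_single, one_smul]

theorem etaRt_el (X : QPath I) : etaRt k I (X.el k) = etaRtFun k X := by
  rw [etaRt, QPath.el, Finsupp.linearCombination_single, one_smul]

theorem symEtaRt_ι (X : QPath I) : symEtaRt k I (ι k _ (X.el k)) = ι k _ (etaRtFun k X) := by
  rw [symEtaRt, lift_ι_apply, LinearMap.comp_apply, etaRt_el]

variable {k}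

theorem algHom_ext_rt {F G : SymmetricAlgebra k (TRt k I) →ₐ[k] A}
    (h : ∀ X : RTree I, F (ι k _ (X.el k)) = G (ι k _ (X.el k))) : F = G := by
  refine algHom_ext (Finsupp.lhom_ext' fun c => LinearMap.ext_ring ?_)
  induction c using Quotient.ind with
  | _ X => exact h X

theorem algHom_ext_path {F G : SymmetricAlgebra k (PathModule k I) →ₐ[k] A}
    (h : ∀ X : QPath I, F (ι k _ (X.el k)) = G (ι k _ (X.el k))) : F = G :=
  algHom_ext (Finsupp.lhom_ext' fun X => LinearMap.ext_ring (h X))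

theorem PlanarTree.conv_assoc {L : Type*} (χ φ ψ : PlanarTree L → A) :
    PlanarTree.conv (PlanarTree.conv χ φ) ψ = PlanarTree.conv χ (PlanarTree.conv φ ψ) := by
  ext t
  rw [PlanarTree.conv, PlanarTree.cutSum_conv]
  refine (add_assoc _ _ _).trans (congrArg _ ?_)
  exact ((PlanarTree.isEvalComb_cutSum χ t).map_add φ (fun x => PlanarTree.cutSum φ x ψ)).symm

/-- Coassociativity with the threefold tensor product replaced by a ring `A`. The maps `a`, `b`, `c`
stand for the inclusions of the generators into the three factors; both composites are their
threefold convolution, bracketed in the two ways. -/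
theorem map_comulRtFun_coassoc {a b c : TRt k I →ₗ[k] A}
    {F₁ F₂ G₁ G₂ : SymmetricAlgebra k (TRt k I) ⊗[k] SymmetricAlgebra k (TRt k I) →ₐ[k] A}
    (hF₁ : ∀ Y : RTree I, F₁ (ι k _ (Y.el k) ⊗ₜ 1) = G₁ (comulRtFun k Y))
    (hF₁' : ∀ Y : RTree I, F₁ (1 ⊗ₜ ι k _ (Y.el k)) = c (Y.el k))
    (hG₁ : ∀ Y : RTree I, G₁ (ι k _ (Y.el k) ⊗ₜ 1) = a (Y.el k))
    (hG₁' : ∀ Y : RTree I, G₁ (1 ⊗ₜ ι k _ (Y.el k)) = b (Y.el k))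
    (hF₂ : ∀ Y : RTree I, F₂ (ι k _ (Y.el k) ⊗ₜ 1) = a (Y.el k))
    (hF₂' : ∀ Y : RTree I, F₂ (1 ⊗ₜ ι k _ (Y.el k)) = G₂ (comulRtFun k Y))
    (hG₂ : ∀ Y : RTree I, G₂ (ι k _ (Y.el k) ⊗ₜ 1) = b (Y.el k))
    (hG₂' : ∀ Y : RTree I, G₂ (1 ⊗ₜ ι k _ (Y.el k)) = c (Y.el k)) (X : RTree I) :
    F₁ (comulRtFun k X) = F₂ (comulRtFun k X) := by
  obtain ⟨t, ht⟩ := X.exists_hasCode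
  have h1 : F₁ (comulRtFun k X) =
      PlanarTree.conv (PlanarTree.conv (treeVal a) (treeVal b)) (treeVal c) t :=
    map_comulRtFun F₁ (fun Y s hs => (hF₁ Y).trans (map_comulRtFun G₁
      (fun Y s hs => (hG₁ Y).trans (hs.treeVal_eq a))
      (fun Y s hs => (hG₁' Y).trans (hs.treeVal_eq b)) hs))
      (fun Y s hs => (hF₁' Y).trans (hs.treeVal_eq c)) ht
  have h2 : F₂ (comulRtFun k X) =
      PlanarTree.conv (treeVal a) (PlanarTree.conv (treeVal b) (treeVal c)) t :=
    map_comulRtFun F₂ (fun Y s hs => (hF₂ Y).trans (hs.treeVal_eq a))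
      (fun Y s hs => (hF₂' Y).trans (map_comulRtFun G₂
        (fun Y s hs => (hG₂ Y).trans (hs.treeVal_eq b))
        (fun Y s hs => (hG₂' Y).trans (hs.treeVal_eq c)) hs)) ht
  rw [h1, h2, PlanarTree.conv_assoc]

variable (k I)

/-- The comultiplication on polynomials in trees is coassociative. -/
theorem comulRt_coassoc :
    (Algebra.TensorProduct.assoc k k k (SymmetricAlgebra k (TRt k I))
      (SymmetricAlgebra k (TRt k I)) (SymmetricAlgebra k (TRt k I))).toAlgHom.comp
      ((Algebra.TensorProduct.map (comulRt k I) (.id k (SymmetricAlgebra k (TRt k I)))).comp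
        (comulRt k I)) =
      (Algebra.TensorProduct.map (.id k (SymmetricAlgebra k (TRt k I))) (comulRt k I)).comp
        (comulRt k I) := by
  let R := SymmetricAlgebra k (TRt k I)
  let j := ι k (TRt k I)
  let a : TRt k I →ₗ[k] R ⊗[k] (R ⊗[k] R) :=
    (Algebra.TensorProduct.includeLeft (R := k) (S := k)).toLinearMap ∘ₗ j
  let b : TRt k I →ₗ[k] R ⊗[k] (R ⊗[k] R) := (Algebra.TensorProduct.includeRight (R := k)).toLinearMap
    ∘ₗ (Algebra.TensorProduct.includeLeft (R := k) (S := k)).toLinearMap ∘ₗ j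
  let c : TRt k I →ₗ[k] R ⊗[k] (R ⊗[k] R) := (Algebra.TensorProduct.includeRight (R := k)).toLinearMap
    ∘ₗ (Algebra.TensorProduct.includeRight (R := k)).toLinearMap ∘ₗ j
  let asc := (Algebra.TensorProduct.assoc k k k R R R).toAlgHom
  let G₁ : R ⊗[k] R →ₐ[k] R ⊗[k] (R ⊗[k] R) :=
    asc.comp (Algebra.TensorProduct.includeLeft (R := k) (S := k))
  let G₂ : R ⊗[k] R →ₐ[k] R ⊗[k] (R ⊗[k] R) := Algebra.TensorProduct.includeRight (R := k)
  refine algHom_ext_rt (k := k) (A := R ⊗[k] (R ⊗[k] R)) fun X => ?_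
  let F₁ : R ⊗[k] R →ₐ[k] R ⊗[k] (R ⊗[k] R) :=
    asc.comp (Algebra.TensorProduct.map (comulRt k I) (.id k R))
  let F₂ : R ⊗[k] R →ₐ[k] R ⊗[k] (R ⊗[k] R) :=
    Algebra.TensorProduct.map (.id k R) (comulRt k I)
  change F₁ (comulRt k I (ι k _ (X.el k))) = F₂ (comulRt k I (ι k _ (X.el k)))
  rw [comulRt_ι]
  apply map_comulRtFun_coassoc (k := k) (I := I) (A := R ⊗[k] (R ⊗[k] R)) (a := a) (b := b)
    (c := c) (G₁ := G₁) (G₂ := G₂)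
  · intro Y
    rw [AlgHom.comp_apply, Algebra.TensorProduct.map_tmul, comulRt_ι]
    rfl
  · intro Y
    rw [AlgHom.comp_apply, Algebra.TensorProduct.map_tmul, map_one]
    rfl
  · exact fun Y => rfl
  · exact fun Y => rfl
  · intro Y
    rw [Algebra.TensorProduct.map_tmul, map_one]
    rfl
  · intro Y
    rw [Algebra.TensorProduct.map_tmul, comulRt_ι, map_one]
    rfl
  · exact fun Y => rfl
  · exact fun Y => rfl

/-- The multiplicative extension of `η_rt` is compatible with the comultiplications. -/
theorem symEtaRt_comul :
    (Algebra.TensorProduct.map (symEtaRt k I) (symEtaRt k I)).comp (comulP k I) =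
      (comulRt k I).comp (symEtaRt k I) := by
  let R := SymmetricAlgebra k (TRt k I)
  let a : TRt k I →ₗ[k] R ⊗[k] R :=
    (Algebra.TensorProduct.includeLeft (R := k) (S := k)).toLinearMap ∘ₗ ι k (TRt k I)
  let b : TRt k I →ₗ[k] R ⊗[k] R :=
    (Algebra.TensorProduct.includeRight (R := k)).toLinearMap ∘ₗ ι k (TRt k I)
  refine algHom_ext_path fun X => ?_
  have h1 : (Algebra.TensorProduct.map (symEtaRt k I) (symEtaRt k I)) (comulPFun k X) =
      wordSum X.start X.arrows (treeVal a) + simpleSum (fun w => wordSum w.1 w.2 (treeVal a))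
        X.arrows (fun w => wordSum X.start w (treeVal b)) := by
    refine map_comulPFun (χ := fun w => wordSum w.1 w.2 (treeVal a))
      (f := fun w => wordSum w.1 w.2 (treeVal b)) _ (fun Y => ?_) (fun Y => ?_) X
    · rw [Algebra.TensorProduct.map_tmul, symEtaRt_ι, map_one]
      exact map_etaRtFun a (fun Y s hs => hs.treeVal_eq a) Y
    · rw [Algebra.TensorProduct.map_tmul, symEtaRt_ι, map_one]
      exact map_etaRtFun b (fun Y s hs => hs.treeVal_eq b) Y
  have h2 : (comulRt k I) (ι k _ (etaRtFun k X)) =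
      wordSum X.start X.arrows (PlanarTree.conv (treeVal a) (treeVal b)) := by
    refine map_etaRtFun ((comulRt k I).toLinearMap ∘ₗ ι k _) (fun Y s hs => ?_) X
    rw [LinearMap.comp_apply, AlgHom.toLinearMap_apply, comulRt_ι]
    exact map_comulRtFun (AlgHom.id k _) (fun Y s hs => hs.treeVal_eq a)
      (fun Y s hs => hs.treeVal_eq b) hs
  -- The terms other than `X ⊗ 1` are matched by `wordSum_cutSum`.
  rw [AlgHom.comp_apply, AlgHom.comp_apply, comulP_ι, symEtaRt_ι, h1, h2, ← wordSum_cutSum]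
  exact ((isEvalComb_wordSum X.start X.arrows).map_add _ _).symm

end HopfFormulas

/-! ### Convolution of algebra homomorphisms and antipodes -/

section Convolution

open Algebra.TensorProduct

variable {k : Type*} [CommRing k] {R R' A : Type*} [CommRing R] [Algebra k R] [CommRing R']
  [Algebra k R'] [CommRing A] [Algebra k A]

/-- The convolution product of algebra homomorphisms. -/
def convHom (Δ : R →ₐ[k] R ⊗[k] R) (f g : R →ₐ[k] A) : R →ₐ[k] A := (productMap f g).comp Δ

theorem convHom_assoc {Δ : R →ₐ[k] R ⊗[k] R}
    (hΔ : (Algebra.TensorProduct.assoc k k k R R R).toAlgHom.comp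
      ((Algebra.TensorProduct.map Δ (.id k R)).comp Δ)
      = (Algebra.TensorProduct.map (.id k R) Δ).comp Δ) (f g h : R →ₐ[k] A) :
    convHom Δ (convHom Δ f g) h = convHom Δ f (convHom Δ g h) := by
  have h1 : productMap (convHom Δ f g) h = ((productMap f (productMap g h)).comp
      (Algebra.TensorProduct.assoc k k k R R R).toAlgHom).comp
        (Algebra.TensorProduct.map Δ (.id k R)) := by
    have h3 : (productMap f (productMap g h)).comp (Algebra.TensorProduct.assoc k k k R R R).toAlgHom
        = productMap (productMap f g) h := by
      ext <;> simp [Algebra.TensorProduct.one_def]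
    rw [h3]
    ext <;> simp [convHom]
  have h2 : productMap f (convHom Δ g h) = (productMap f (productMap g h)).comp
      (Algebra.TensorProduct.map (.id k R) Δ) := by
    ext <;> simp [convHom]
  rw [convHom, h1, AlgHom.comp_assoc, AlgHom.comp_assoc, hΔ, ← AlgHom.comp_assoc, ← h2]
  rfl

theorem convHom_counit_left {Δ : R →ₐ[k] R ⊗[k] R} {ε : R →ₐ[k] k}
    (h : (Algebra.TensorProduct.map ε (.id k R)).comp Δ = (Algebra.TensorProduct.lid k R).symm)
    (f : R →ₐ[k] A) : convHom Δ ((Algebra.ofId k A).comp ε) f = f := by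
  have h1 : productMap ((Algebra.ofId k A).comp ε) f =
      (productMap (Algebra.ofId k A) f).comp (Algebra.TensorProduct.map ε (.id k R)) := by
    ext <;> simp
  rw [convHom, h1, AlgHom.comp_assoc, h]
  ext x
  simp

theorem convHom_counit_right {Δ : R →ₐ[k] R ⊗[k] R} {ε : R →ₐ[k] k}
    (h : (Algebra.TensorProduct.map (.id k R) ε).comp Δ = (Algebra.TensorProduct.rid k k R).symm)
    (f : R →ₐ[k] A) : convHom Δ f ((Algebra.ofId k A).comp ε) = f := by
  have h1 : productMap f ((Algebra.ofId k A).comp ε) =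
      (productMap f (Algebra.ofId k A)).comp (Algebra.TensorProduct.map (.id k R) ε) := by
    ext <;> simp
  rw [convHom, h1, AlgHom.comp_assoc, h]
  ext x
  simp

theorem comp_convHom (Δ : R →ₐ[k] R ⊗[k] R) (f g : R →ₐ[k] R') (h : R' →ₐ[k] A) :
    h.comp (convHom Δ f g) = convHom Δ (h.comp f) (h.comp g) := by
  have h1 : h.comp (productMap f g) = productMap (h.comp f) (h.comp g) := by ext <;> simp
  rw [convHom, convHom, ← AlgHom.comp_assoc, h1]

theorem convHom_comp {Δ : R →ₐ[k] R ⊗[k] R} {Δ' : R' →ₐ[k] R' ⊗[k] R'} {h : R →ₐ[k] R'}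
    (hh : (Algebra.TensorProduct.map h h).comp Δ = Δ'.comp h) (f g : R' →ₐ[k] A) :
    (convHom Δ' f g).comp h = convHom Δ (f.comp h) (g.comp h) := by
  have h1 : productMap (f.comp h) (g.comp h) =
      (productMap f g).comp (Algebra.TensorProduct.map h h) := by ext <;> simp
  rw [convHom, convHom, h1, AlgHom.comp_assoc, AlgHom.comp_assoc, hh]

/-- Left and right inverses for the convolution product agree. -/
theorem convHom_inv_unique {Δ : R →ₐ[k] R ⊗[k] R} {ε : R →ₐ[k] k}
    (hΔ : (Algebra.TensorProduct.assoc k k k R R R).toAlgHom.comp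
      ((Algebra.TensorProduct.map Δ (.id k R)).comp Δ)
      = (Algebra.TensorProduct.map (.id k R) Δ).comp Δ)
    (hl : (Algebra.TensorProduct.map ε (.id k R)).comp Δ = (Algebra.TensorProduct.lid k R).symm)
    (hr : (Algebra.TensorProduct.map (.id k R) ε).comp Δ = (Algebra.TensorProduct.rid k k R).symm)
    {f g h : R →ₐ[k] A} (hf : convHom Δ f g = (Algebra.ofId k A).comp ε)
    (hh : convHom Δ g h = (Algebra.ofId k A).comp ε) : f = h := by
  rw [← convHom_counit_right hr f, ← hh, ← convHom_assoc hΔ, hf, convHom_counit_left hl]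

theorem isHopfAlgebra_of_convHom {Δ : R →ₐ[k] R ⊗[k] R} {ε : R →ₐ[k] k}
    (hΔ : (Algebra.TensorProduct.assoc k k k R R R).toAlgHom.comp
      ((Algebra.TensorProduct.map Δ (.id k R)).comp Δ)
      = (Algebra.TensorProduct.map (.id k R) Δ).comp Δ)
    (hl : (Algebra.TensorProduct.map ε (.id k R)).comp Δ = (Algebra.TensorProduct.lid k R).symm)
    (hr : (Algebra.TensorProduct.map (.id k R) ε).comp Δ = (Algebra.TensorProduct.rid k k R).symm)
    {S : R →ₐ[k] R} (hS : convHom Δ S (.id k R) = (Algebra.ofId k R).comp ε)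
    (hS' : convHom Δ (.id k R) S = (Algebra.ofId k R).comp ε) :
    IsHopfAlgebra Δ ε S.toLinearMap where
  coassoc := hΔ
  counit_left := hl
  counit_right := hr
  antipode_left := by
    have h1 : LinearMap.mul' k R ∘ₗ S.toLinearMap.rTensor R =
        (productMap S (.id k R)).toLinearMap := by
      ext x y
      simp
    rw [← LinearMap.comp_assoc, h1]
    ext x
    exact DFunLike.congr_fun hS x
  antipode_right := by
    have h1 : LinearMap.mul' k R ∘ₗ S.toLinearMap.lTensor R =
        (productMap (.id k R) S).toLinearMap := by
      ext x y
      simp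
    rw [← LinearMap.comp_assoc, h1]
    ext x
    exact DFunLike.congr_fun hS' x

/-- For the convolution product, `f.comp S` is a left inverse of `f` and `S'.comp f` a right
inverse, so they coincide. -/
theorem antipode_compat {Δ : R →ₐ[k] R ⊗[k] R} {ε : R →ₐ[k] k} {Δ' : R' →ₐ[k] R' ⊗[k] R'}
    {ε' : R' →ₐ[k] k}
    (hΔ : (Algebra.TensorProduct.assoc k k k R R R).toAlgHom.comp
      ((Algebra.TensorProduct.map Δ (.id k R)).comp Δ)
      = (Algebra.TensorProduct.map (.id k R) Δ).comp Δ)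
    (hl : (Algebra.TensorProduct.map ε (.id k R)).comp Δ = (Algebra.TensorProduct.lid k R).symm)
    (hr : (Algebra.TensorProduct.map (.id k R) ε).comp Δ = (Algebra.TensorProduct.rid k k R).symm)
    {S : R →ₐ[k] R} (hS : convHom Δ S (.id k R) = (Algebra.ofId k R).comp ε)
    {S' : R' →ₐ[k] R'} (hS' : convHom Δ' (.id k R') S' = (Algebra.ofId k R').comp ε')
    {f : R →ₐ[k] R'} (hf : (Algebra.TensorProduct.map f f).comp Δ = Δ'.comp f)
    (hε : ε'.comp f = ε) : f.comp S = S'.comp f := by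
  refine convHom_inv_unique hΔ hl hr (g := f) ?_ ?_
  · have := comp_convHom Δ S (.id k R) f
    rw [hS] at this
    rw [← AlgHom.comp_id f, AlgHom.comp_assoc, AlgHom.id_comp, ← this, ← AlgHom.comp_assoc]
    congr 1
    exact Subsingleton.elim _ _
  · have := convHom_comp hf (.id k R') S'
    rw [hS', AlgHom.comp_assoc, hε, AlgHom.id_comp] at this
    exact this.symm

end Convolution

/-! ### Construction of antipodes by recursion on size -/

section Antipode

open Algebra.TensorProduct SymmetricAlgebra

variable {k : Type*} [CommRing k] {B : Type*} (sz : B → ℕ)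

/-- The subalgebra generated by the elements `b ⊗ 1`, where `b` is a basis element of size less
than `n`, and the elements `1 ⊗ x`. -/
def leftSmaller (k : Type*) [CommRing k] {B : Type*} (sz : B → ℕ) (n : ℕ) :
    Subalgebra k (SymmetricAlgebra k (B →₀ k) ⊗[k] SymmetricAlgebra k (B →₀ k)) :=
  Algebra.adjoin k
    ({z | ∃ b, sz b < n ∧ z = ι k (B →₀ k) (Finsupp.single b 1) ⊗ₜ 1} ∪ {z | ∃ x, z = 1 ⊗ₜ x})

theorem productMap_eq_of_mem_leftSmaller {n : ℕ}
    {f g h : SymmetricAlgebra k (B →₀ k) →ₐ[k] SymmetricAlgebra k (B →₀ k)}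
    (hfg : ∀ b, sz b < n → f (ι k _ (Finsupp.single b 1)) = g (ι k _ (Finsupp.single b 1)))
    {z : SymmetricAlgebra k (B →₀ k) ⊗[k] SymmetricAlgebra k (B →₀ k)}
    (hz : z ∈ leftSmaller k sz n) : productMap f h z = productMap g h z := by
  refine AlgHom.eqOn_adjoin_iff.2 ?_ hz
  rintro z (⟨b, hb, rfl⟩ | ⟨x, rfl⟩)
  · simp [hfg b hb]
  · simp

/-- The equation for `S` at a generator `b` reads `S b = -(S * id)(Δ b - b ⊗ 1)`, where by
hypothesis the right side involves `S` only at generators smaller than `b`. Being an algebra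
homomorphism, `S` need only satisfy it at generators. -/
theorem exists_left_antipode
    {Δ : SymmetricAlgebra k (B →₀ k) →ₐ[k] SymmetricAlgebra k (B →₀ k) ⊗[k]
      SymmetricAlgebra k (B →₀ k)}
    (hΔ : ∀ b, Δ (ι k _ (Finsupp.single b 1)) - ι k _ (Finsupp.single b 1) ⊗ₜ 1 ∈
      leftSmaller k sz (sz b)) :
    ∃ S : SymmetricAlgebra k (B →₀ k) →ₐ[k] SymmetricAlgebra k (B →₀ k),
      convHom Δ S (.id k _) = (Algebra.ofId k _).comp (symCounit k (B →₀ k)) := by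
  let R := SymmetricAlgebra k (B →₀ k)
  let x : B → R := fun b => ι k _ (Finsupp.single b 1)
  let F : (B → R) → (R →ₐ[k] R) := fun v => lift (Finsupp.linearCombination k v)
  have hF : ∀ v b, F v (x b) = v b := fun v b => by
    simp only [F, x]
    rw [lift_ι_apply, Finsupp.linearCombination_single, one_smul]
  -- One step of the recursion: iterated from any start, it settles the value at `b` after `sz b +
  -- 1` steps, as `hstab` shows.
  let next : (R →ₐ[k] R) → (R →ₐ[k] R) := fun S =>
    F (fun b => -productMap S (.id k R) (Δ (x b) - x b ⊗ₜ 1))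
  let Sn : ℕ → (R →ₐ[k] R) := fun n => Nat.rec (F 0) (fun _ S => next S) n
  have hSn : ∀ n b, Sn (n + 1) (x b) = -productMap (Sn n) (.id k R) (Δ (x b) - x b ⊗ₜ 1) :=
    fun n b => hF _ b
  have hstab : ∀ n m b, sz b < n → n ≤ m → Sn m (x b) = Sn n (x b) := by
    intro n
    induction n with
    | zero => intro m b h; omega
    | succ n ih =>
      intro m b hb hm
      obtain ⟨m, rfl⟩ : ∃ m', m = m' + 1 := ⟨m - 1, by omega⟩
      rw [hSn, hSn, productMap_eq_of_mem_leftSmaller sz (fun b' hb' => ?_) (hΔ b)]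
      exact ih m b' (by omega) (by omega)
  let S : R →ₐ[k] R := F (fun b => Sn (sz b + 1) (x b))
  have hS : ∀ b, S (x b) = -productMap S (.id k R) (Δ (x b) - x b ⊗ₜ 1) := by
    intro b
    have h1 : S (x b) = Sn (sz b + 1) (x b) := hF _ b
    rw [h1, hSn]
    refine congrArg _ (productMap_eq_of_mem_leftSmaller sz (fun b' hb' => ?_) (hΔ b))
    have h2 : S (x b') = Sn (sz b' + 1) (x b') := hF _ b'
    exact (hstab _ _ b' (Nat.lt_succ_self _) hb').trans h2.symm
  refine ⟨S, algHom_ext (Finsupp.lhom_ext' fun b => LinearMap.ext_ring ?_)⟩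
  change productMap S (.id k R) (Δ (x b)) = Algebra.ofId k R (symCounit k (B →₀ k) (x b))
  have h0 : symCounit k (B →₀ k) (x b) = 0 := by
    rw [symCounit, lift_ι_apply, LinearMap.zero_apply]
  rw [h0, map_zero]
  have h1 := hS b
  rw [map_sub, productMap_apply_tmul, map_one, mul_one] at h1
  linear_combination h1

/-- A graded-connected comultiplication on a symmetric algebra has an antipode. -/
theorem exists_antipode
    {Δ : SymmetricAlgebra k (B →₀ k) →ₐ[k] SymmetricAlgebra k (B →₀ k) ⊗[k]
      SymmetricAlgebra k (B →₀ k)}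
    (hΔ : (Algebra.TensorProduct.assoc k k k _ _ _).toAlgHom.comp
      ((Algebra.TensorProduct.map Δ (.id k _)).comp Δ)
      = (Algebra.TensorProduct.map (.id k _) Δ).comp Δ)
    (hl : (Algebra.TensorProduct.map (symCounit k (B →₀ k)) (.id k _)).comp Δ =
      (Algebra.TensorProduct.lid k (SymmetricAlgebra k (B →₀ k))).symm)
    (hr : (Algebra.TensorProduct.map (.id k (SymmetricAlgebra k (B →₀ k))) (symCounit k (B →₀ k))).comp Δ =
      (Algebra.TensorProduct.rid k k (SymmetricAlgebra k (B →₀ k))).symm)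
    (h₁ : ∀ b, Δ (ι k _ (Finsupp.single b 1)) - ι k _ (Finsupp.single b 1) ⊗ₜ 1 ∈
      leftSmaller k sz (sz b))
    (h₂ : ∀ b, Algebra.TensorProduct.comm k _ _ (Δ (ι k _ (Finsupp.single b 1))) -
      ι k _ (Finsupp.single b 1) ⊗ₜ 1 ∈ leftSmaller k sz (sz b)) :
    ∃ S : SymmetricAlgebra k (B →₀ k) →ₐ[k] SymmetricAlgebra k (B →₀ k),
      convHom Δ S (.id k _) = (Algebra.ofId k _).comp (symCounit k (B →₀ k)) ∧
      convHom Δ (.id k _) S = (Algebra.ofId k _).comp (symCounit k (B →₀ k)) := by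
  obtain ⟨S, hS⟩ := exists_left_antipode sz h₁
  -- A left antipode for the opposite comultiplication is a right one for `Δ`, since the target is
  -- commutative; the two inverses of the identity then agree.
  obtain ⟨S', hS'⟩ := exists_left_antipode sz
    (Δ := (Algebra.TensorProduct.comm k _ _).toAlgHom.comp Δ) h₂
  have hS'' : convHom Δ (.id k _) S' = (Algebra.ofId k _).comp (symCounit k (B →₀ k)) := by
    rw [← hS', convHom, convHom, ← AlgHom.comp_assoc]
    congr 1
    ext <;> simp
  refine ⟨S, hS, ?_⟩
  rwa [convHom_inv_unique hΔ hl hr hS hS'']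

end Antipode

/-! ### The Hopf algebras of trees and of paths -/

section Transfer

variable {k : Type*} [CommRing k] {R R' : Type*} [CommRing R] [Algebra k R] [CommRing R']
  [Algebra k R']

/-- The left inverse keeps `f ⊗ f ⊗ f` injective over every base ring, so the identity can be
checked after applying it. Nothing is asked of `g` with regard to the comultiplications. -/
theorem coassoc_of_leftInverse {Δ : R →ₐ[k] R ⊗[k] R} {Δ' : R' →ₐ[k] R' ⊗[k] R'} {f : R →ₐ[k] R'}
    {g : R' →ₐ[k] R} (hgf : g.comp f = .id k R)
    (hf : (Algebra.TensorProduct.map f f).comp Δ = Δ'.comp f)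
    (h : (Algebra.TensorProduct.assoc k k k R' R' R').toAlgHom.comp
      ((Algebra.TensorProduct.map Δ' (.id k R')).comp Δ')
      = (Algebra.TensorProduct.map (.id k R') Δ').comp Δ') :
    (Algebra.TensorProduct.assoc k k k R R R).toAlgHom.comp
      ((Algebra.TensorProduct.map Δ (.id k R)).comp Δ)
      = (Algebra.TensorProduct.map (.id k R) Δ).comp Δ := by
  have hinj : Function.Injective (Algebra.TensorProduct.map f (Algebra.TensorProduct.map f f)) := by
    refine Function.LeftInverse.injective
      (g := Algebra.TensorProduct.map g (Algebra.TensorProduct.map g g)) fun z => ?_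
    rw [← AlgHom.comp_apply, ← Algebra.TensorProduct.map_comp, ← Algebra.TensorProduct.map_comp,
      hgf, Algebra.TensorProduct.map_id, Algebra.TensorProduct.map_id]
    rfl
  have h1 : (Algebra.TensorProduct.map f (Algebra.TensorProduct.map f f)).comp
      ((Algebra.TensorProduct.assoc k k k R R R).toAlgHom.comp
        (Algebra.TensorProduct.map Δ (.id k R))) =
      ((Algebra.TensorProduct.assoc k k k R' R' R').toAlgHom.comp
        (Algebra.TensorProduct.map Δ' (.id k R'))).comp (Algebra.TensorProduct.map f f) := by
    have h3 : (Algebra.TensorProduct.map f (Algebra.TensorProduct.map f f)).comp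
        (Algebra.TensorProduct.assoc k k k R R R).toAlgHom =
        (Algebra.TensorProduct.assoc k k k R' R' R').toAlgHom.comp
          (Algebra.TensorProduct.map (Algebra.TensorProduct.map f f) f) := by
      ext <;> simp [Algebra.TensorProduct.one_def]
    rw [← AlgHom.comp_assoc, h3, AlgHom.comp_assoc, AlgHom.comp_assoc,
      ← Algebra.TensorProduct.map_comp, ← Algebra.TensorProduct.map_comp, hf, AlgHom.id_comp,
      AlgHom.comp_id]
  have h2 : (Algebra.TensorProduct.map f (Algebra.TensorProduct.map f f)).comp
      (Algebra.TensorProduct.map (.id k R) Δ) =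
      (Algebra.TensorProduct.map (.id k R') Δ').comp (Algebra.TensorProduct.map f f) := by
    rw [← Algebra.TensorProduct.map_comp, ← Algebra.TensorProduct.map_comp, hf, AlgHom.id_comp,
      AlgHom.comp_id]
  refine AlgHom.ext fun x => hinj ?_
  have h3 := DFunLike.congr_fun h1 (Δ x)
  have h4 := DFunLike.congr_fun h2 (Δ x)
  have h5 := DFunLike.congr_fun hf x
  have h6 := DFunLike.congr_fun h (f x)
  simp only [AlgHom.comp_apply] at h3 h4 h5 h6 ⊢
  rw [h3, h4, h5, h6]

end Transfer

/-! ### Sizes of the pieces of a cut -/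

section SimpleCuts

variable {I : Type*} [Quiver I]

theorem card_eq_of_equiv {X Y : RTree I} (h : X ≈ Y) : Nat.card X.1.V = Nat.card Y.1.V := by
  obtain ⟨f, -⟩ := h
  exact Nat.card_congr f.toEquiv

/-- The number of vertices of a tree. -/
def treeSize (c : RTreeClass I) : ℕ :=
  Quotient.lift (fun X : RTree I => Nat.card X.1.V) (fun _ _ h => card_eq_of_equiv h) c

theorem RTree.comp_edges_empty (X : RTree I) : X.comp (X.1.edges ∅) X.1.root ≈ X := by
  have h := X.isEmb_comp (RootedTree.isTop_root (T := X.1) (X.1.edges ∅))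
  refine RTree.equiv_of_isEmb (Equiv.ofBijective _ ⟨h.inj, fun v => ?_⟩) h
  exact ⟨⟨v, (RootedTree.reachable_root_iff ∅ v).2 (by simp)⟩, rfl⟩

theorem RTree.card_comp_far_lt (X : RTree I) {H : Finset X.1.graph.edgeSet} {e : X.1.graph.edgeSet}
    (he : e ∈ H) : Nat.card (X.comp (X.1.edges H) (X.1.far e)).1.V < Nat.card X.1.V := by
  refine Finite.card_subtype_lt (x := X.1.root) fun h => RootedTree.far_ne_root e ?_
  exact (RootedTree.desc_of_reachable (RootedTree.isTop_far he) h).antisymm (RootedTree.root_desc _)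

theorem RTree.card_comp_root_lt (X : RTree I) {H : Finset X.1.graph.edgeSet} (hH : H.Nonempty) :
    Nat.card (X.comp (X.1.edges H) X.1.root).1.V < Nat.card X.1.V := by
  obtain ⟨e, he⟩ := hH
  refine Finite.card_subtype_lt (x := X.1.far e) fun h => ?_
  exact (RootedTree.reachable_root_iff H _).1 h e he .refl

open QPath

theorem QPath.length_facePath_lt (X : QPath I) {H : Finset (ℕ × ℕ)} (hH : X.IsCut H)
    {u : Face H} {m : ℕ} (hm : m < X.length) (h : ¬ InFace H u m) :
    (X.facePath H hH u).length < X.length :=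
  length_subword_lt hm h

theorem QPath.length_facePath_some_lt (X : QPath I) {H : Finset (ℕ × ℕ)} (hH : X.IsCut H)
    (c : {c // c ∈ H}) : (X.facePath H hH (some c)).length < X.length :=
  X.length_facePath_lt hH (hH.chord _ c.2).lt_length.1 fun h => lt_irrefl _ h.1.1

theorem QPath.length_facePath_none_lt (X : QPath I) {H : Finset (ℕ × ℕ)} (hH : X.IsCut H)
    (hne : H.Nonempty) : (X.facePath H hH none).length < X.length := by
  obtain ⟨c, hc⟩ := hne
  refine X.length_facePath_lt hH (hH.chord _ hc).lt_length.1 fun h => ?_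
  exact h.2 ⟨c, hc⟩ trivial ⟨le_rfl, (hH.chord _ hc).1.le⟩

theorem QPath.isCut_empty (X : QPath I) : X.IsCut ∅ := ⟨by simp, by simp, by simp⟩

theorem QPath.facePath_empty (X : QPath I) : X.facePath ∅ X.isCut_empty none = X := by
  refine QPath.ext rfl (subword_eq_self fun m _ => ⟨trivial, fun d => ?_⟩)
  exact absurd d.2 (Finset.notMem_empty _)

end SimpleCuts

/-! ### Counits, antipodes and injectivity for paths and rooted trees -/

section Hopf

open SymmetricAlgebra QPath

variable (k : Type*) [CommRing k] (I : Type*) [Quiver I]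

theorem symCounit_ι {M : Type*} [AddCommGroup M] [Module k M] (x : M) :
    symCounit k M (ι k M x) = 0 := by
  rw [symCounit, lift_ι_apply, LinearMap.zero_apply]

/-- Only the empty cut has no branches and survives; this is the left counit axiom. -/
theorem PlanarTree.cutSum_zero {A : Type*} [CommRing A] {L : Type*} (t : PlanarTree L)
    (f : PlanarTree L → A) : PlanarTree.cutSum (fun _ => 0) t f = f t := by
  induction t generalizing f with
  | leaf l => rfl
  | graft o s t hs ht => rw [cutSum, zero_mul, zero_add, hs, ht]

theorem simpleSum_zero {A : Type*} [CommRing A] {I : Type*} [Quiver I] (l : List (Arrow I))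
    (f : List (Arrow I) → A) : simpleSum (fun _ => 0) l f = f l := by
  induction l generalizing f with
  | nil => exact simpleSum_nil _ _
  | cons a l ih =>
    rw [simpleSum, ih, add_eq_left]
    exact Finset.sum_eq_zero fun j _ => by split <;> simp

theorem comulRt_counit_left :
    (Algebra.TensorProduct.map (symCounit k (TRt k I)) (.id k (SymmetricAlgebra k (TRt k I)))).comp (comulRt k I) =
      (Algebra.TensorProduct.lid k (SymmetricAlgebra k (TRt k I))).symm.toAlgHom := by
  let b : TRt k I →ₗ[k] k ⊗[k] SymmetricAlgebra k (TRt k I) :=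
    (Algebra.TensorProduct.includeRight (R := k)).toLinearMap ∘ₗ ι k (TRt k I)
  refine algHom_ext_rt fun X => ?_
  obtain ⟨t, ht⟩ := X.exists_hasCode
  rw [AlgHom.comp_apply, comulRt_ι, map_comulRtFun (k := k) (χ := fun _ => 0) (f := treeVal b) _
    (fun Y s hs => ?_) (fun Y s hs => ?_) ht, PlanarTree.conv, zero_add, PlanarTree.cutSum_zero,
    ← ht.treeVal_eq b]
  · rfl
  · rw [Algebra.TensorProduct.map_tmul, symCounit_ι, TensorProduct.zero_tmul]
  · rw [Algebra.TensorProduct.map_tmul, map_one, ← hs.treeVal_eq b]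
    rfl

theorem comulRt_counit_right :
    (Algebra.TensorProduct.map (.id k (SymmetricAlgebra k (TRt k I))) (symCounit k (TRt k I))).comp (comulRt k I) =
      (Algebra.TensorProduct.rid k k (SymmetricAlgebra k (TRt k I))).symm.toAlgHom := by
  let a : TRt k I →ₗ[k] SymmetricAlgebra k (TRt k I) ⊗[k] k :=
    (Algebra.TensorProduct.includeLeft (R := k) (S := k)).toLinearMap ∘ₗ ι k (TRt k I)
  refine algHom_ext_rt fun X => ?_
  obtain ⟨t, ht⟩ := X.exists_hasCode
  rw [AlgHom.comp_apply, comulRt_ι, map_comulRtFun (k := k) (χ := treeVal a) (f := fun _ => 0) _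
    (fun Y s hs => ?_) (fun Y s hs => ?_) ht, PlanarTree.conv,
    (PlanarTree.isEvalComb_cutSum _ t).map_zero, add_zero, ← ht.treeVal_eq a]
  · rfl
  · rw [Algebra.TensorProduct.map_tmul, map_one, ← hs.treeVal_eq a]
    rfl
  · rw [Algebra.TensorProduct.map_tmul, symCounit_ι, TensorProduct.tmul_zero]

variable {k I} in
/-- The value at a word of a linear map on paths. -/
def wordVal {A : Type*} [AddCommGroup A] [Module k A] (F : PathModule k I →ₗ[k] A)
    (w : I × List (Arrow I)) : A :=
  open Classical in if h : IsPath w.1 w.2 then F ((⟨w.1, w.2, h⟩ : QPath I).el k) else 0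

variable {k I} in
theorem wordVal_word {A : Type*} [AddCommGroup A] [Module k A] (F : PathModule k I →ₗ[k] A)
    (X : QPath I) : wordVal F X.word = F (X.el k) := dif_pos X.isPath

theorem comulP_counit_left :
    (Algebra.TensorProduct.map (symCounit k (PathModule k I)) (.id k (SymmetricAlgebra k (PathModule k I)))).comp (comulP k I) =
      (Algebra.TensorProduct.lid k (SymmetricAlgebra k (PathModule k I))).symm.toAlgHom := by
  let b : PathModule k I →ₗ[k] k ⊗[k] SymmetricAlgebra k (PathModule k I) :=
    (Algebra.TensorProduct.includeRight (R := k)).toLinearMap ∘ₗ ι k (PathModule k I)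
  refine algHom_ext_path fun X => ?_
  rw [AlgHom.comp_apply, comulP_ι, map_comulPFun (k := k) (χ := fun _ => 0) (f := wordVal b) _
    (fun Y => ?_) (fun Y => ?_) X, zero_add, simpleSum_zero]
  · exact wordVal_word b X
  · rw [Algebra.TensorProduct.map_tmul, symCounit_ι, TensorProduct.zero_tmul]
  · rw [Algebra.TensorProduct.map_tmul, map_one, wordVal_word]
    rfl

theorem comulP_counit_right :
    (Algebra.TensorProduct.map (.id k (SymmetricAlgebra k (PathModule k I))) (symCounit k (PathModule k I))).comp (comulP k I) =
      (Algebra.TensorProduct.rid k k (SymmetricAlgebra k (PathModule k I))).symm.toAlgHom := by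
  let a : PathModule k I →ₗ[k] SymmetricAlgebra k (PathModule k I) ⊗[k] k :=
    (Algebra.TensorProduct.includeLeft (R := k) (S := k)).toLinearMap ∘ₗ ι k (PathModule k I)
  refine algHom_ext_path fun X => ?_
  rw [AlgHom.comp_apply, comulP_ι, map_comulPFun (k := k) (χ := wordVal a) (f := fun _ => 0) _
    (fun Y => ?_) (fun Y => ?_) X, (isEvalComb_simpleSum _ X.arrows).map_zero, add_zero]
  · exact wordVal_word a X
  · rw [Algebra.TensorProduct.map_tmul, map_one, wordVal_word]
    rfl
  · rw [Algebra.TensorProduct.map_tmul, symCounit_ι, TensorProduct.tmul_zero]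

theorem prod_tmul_mem_leftSmaller {B J : Type*} {sz : B → ℕ} {n : ℕ} {s : Finset J} {g : J → B}
    (hg : ∀ j ∈ s, sz (g j) < n) (y : SymmetricAlgebra k (B →₀ k)) :
    (∏ j ∈ s, ι k (B →₀ k) (Finsupp.single (g j) 1)) ⊗ₜ y ∈ leftSmaller k sz n := by
  have h : (∏ j ∈ s, ι k (B →₀ k) (Finsupp.single (g j) 1)) ⊗ₜ[k] y =
      (∏ j ∈ s, ι k (B →₀ k) (Finsupp.single (g j) 1) ⊗ₜ 1) * (1 ⊗ₜ y) := by
    have : (∏ j ∈ s, ι k (B →₀ k) (Finsupp.single (g j) 1)) ⊗ₜ[k]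
        (1 : SymmetricAlgebra k (B →₀ k)) = ∏ j ∈ s, ι k (B →₀ k) (Finsupp.single (g j) 1) ⊗ₜ 1 :=
      map_prod (Algebra.TensorProduct.includeLeft : SymmetricAlgebra k (B →₀ k) →ₐ[k]
        _ ⊗[k] SymmetricAlgebra k (B →₀ k)) (fun j => ι k (B →₀ k) (Finsupp.single (g j) 1)) s
    rw [← this, Algebra.TensorProduct.tmul_mul_tmul, one_mul, mul_one]
  rw [h]
  refine mul_mem (prod_mem fun j hj => ?_) (Algebra.subset_adjoin (Or.inr ⟨y, rfl⟩))
  exact Algebra.subset_adjoin (Or.inl ⟨g j, hg j hj, rfl⟩)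

theorem comulRt_sub_mem (c : RTreeClass I) :
    comulRt k I (ι k _ (Finsupp.single c 1)) - ι k _ (Finsupp.single c 1) ⊗ₜ 1 ∈
      leftSmaller k treeSize (treeSize c) := by
  classical
  induction c using Quotient.ind with
  | _ X =>
  have h := comulRt_ι k X
  rw [RTree.el] at h
  rw [h, comulRtFun, RTree.el, add_sub_cancel_left]
  refine sum_mem fun H _ => ?_
  exact prod_tmul_mem_leftSmaller k (g := fun e => Quotient.mk _ (X.comp (X.1.edges H.1) (X.1.far e)))
    (fun e he => X.card_comp_far_lt he) _

/-- With the factors exchanged, the leading term is the one of the empty cut. For any other cut the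
trunk lacks the far end of an edge and is smaller than the tree. -/
theorem comm_comulRt_sub_mem (c : RTreeClass I) :
    Algebra.TensorProduct.comm k _ _ (comulRt k I (ι k _ (Finsupp.single c 1))) -
      ι k _ (Finsupp.single c 1) ⊗ₜ 1 ∈ leftSmaller k treeSize (treeSize c) := by
  classical
  induction c using Quotient.ind with
  | _ X =>
  have h := comulRt_ι k X
  rw [RTree.el] at h
  rw [h, comulRtFun, RTree.el, map_add, map_sum, add_sub_assoc]
  simp only [Algebra.TensorProduct.comm_tmul]
  have h0 : X.1.IsSimpleCut ∅ := by simp [RootedTree.IsSimpleCut]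
  refine add_mem (Algebra.subset_adjoin (Or.inr ⟨_, rfl⟩)) ?_
  have h1 : (ι k (TRt k I) (Finsupp.single (Quotient.mk _ X) 1) ⊗ₜ[k] 1 :
      SymmetricAlgebra k (TRt k I) ⊗[k] SymmetricAlgebra k (TRt k I)) =
      ι k (TRt k I) ((X.comp (X.1.edges ∅) X.1.root).el k) ⊗ₜ[k]
        ∏ e ∈ (∅ : Finset X.1.graph.edgeSet),
          ι k (TRt k I) ((X.comp (X.1.edges ∅) (X.1.far e)).el k) := by
    rw [Finset.prod_empty, RTree.el, Quotient.sound X.comp_edges_empty]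
  rw [h1, ← Finset.sum_erase_eq_sub (a := (⟨∅, h0⟩ : {H // X.1.IsSimpleCut H}))
    (f := fun H => ι k (TRt k I) ((X.comp (X.1.edges H.1) X.1.root).el k) ⊗ₜ[k]
        ∏ e ∈ H.1, ι k (TRt k I) ((X.comp (X.1.edges H.1) (X.1.far e)).el k)) (Finset.mem_univ _)]
  refine sum_mem fun H hH => ?_
  have hne : H.1.Nonempty := by
    rw [Finset.nonempty_iff_ne_empty]
    exact fun h => (Finset.mem_erase.1 hH).1 (Subtype.ext h)
  have := prod_tmul_mem_leftSmaller k (s := {()}) (sz := treeSize (I := I))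
    (n := treeSize (Quotient.mk _ X))
    (g := fun _ => Quotient.mk _ (X.comp (X.1.edges H.1) X.1.root))
    (fun _ _ => X.card_comp_root_lt hne)
    (∏ e ∈ H.1, ι k (TRt k I) ((X.comp (X.1.edges H.1) (X.1.far e)).el k))
  rwa [Finset.prod_singleton] at this

theorem comulP_sub_mem (X : QPath I) :
    comulP k I (ι k _ (Finsupp.single X 1)) - ι k _ (Finsupp.single X 1) ⊗ₜ 1 ∈
      leftSmaller k QPath.length X.length := by
  classical
  have h := comulP_ι k X
  rw [QPath.el] at h
  rw [h, comulPFun, QPath.el, add_sub_cancel_left]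
  refine sum_mem fun H _ => Subalgebra.smul_mem _ ?_ _
  exact prod_tmul_mem_leftSmaller k (s := Finset.univ) (g := fun c : {c // c ∈ H.1} =>
    X.facePath H.1 (QPath.mem_cuts.1 (Finset.mem_filter.1 H.2).1) (some c))
    (fun c _ => X.length_facePath_some_lt _ c) _

theorem comm_comulP_sub_mem (X : QPath I) :
    Algebra.TensorProduct.comm k _ _ (comulP k I (ι k _ (Finsupp.single X 1))) -
      ι k _ (Finsupp.single X 1) ⊗ₜ 1 ∈ leftSmaller k QPath.length X.length := by
  classical
  have h := comulP_ι k X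
  rw [QPath.el] at h
  rw [h, comulPFun, QPath.el, map_add, map_sum, add_sub_assoc]
  simp only [map_smul, Algebra.TensorProduct.comm_tmul]
  have h0 : (∅ : Finset (ℕ × ℕ)) ∈ X.cuts.filter (fun H => QPath.IsSimple H) :=
    Finset.mem_filter.2 ⟨QPath.mem_cuts.2 X.isCut_empty, by simp [QPath.IsSimple]⟩
  refine add_mem (Algebra.subset_adjoin (Or.inr ⟨_, rfl⟩)) ?_
  let G : {H // H ∈ X.cuts.filter (fun H => QPath.IsSimple H)} →
      SymmetricAlgebra k (PathModule k I) ⊗[k] SymmetricAlgebra k (PathModule k I) := fun H =>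
    ((X.eps H.1 : ℤ) : k) • (ι k (PathModule k I)
      ((X.facePath H.1 (QPath.mem_cuts.1 (Finset.mem_filter.1 H.2).1) none).el k) ⊗ₜ[k]
      ∏ c : {c // c ∈ H.1}, ι k (PathModule k I)
        ((X.facePath H.1 (QPath.mem_cuts.1 (Finset.mem_filter.1 H.2).1) (some c)).el k))
  have h1 : (ι k (PathModule k I) (Finsupp.single X 1) ⊗ₜ[k] 1 :
      SymmetricAlgebra k (PathModule k I) ⊗[k] SymmetricAlgebra k (PathModule k I)) =
      G ⟨∅, h0⟩ := by
    have h2 : X.eps ∅ = 1 := Finset.prod_empty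
    simp only [G]
    rw [Finset.univ_eq_empty, Finset.prod_empty, X.facePath_empty, h2, Int.cast_one, one_smul,
      QPath.el]
  rw [h1]
  refine (Finset.sum_erase_eq_sub (f := G) (Finset.mem_univ _)).symm ▸ sum_mem fun H hH => ?_
  have hne : H.1.Nonempty := by
    rw [Finset.nonempty_iff_ne_empty]
    exact fun h => (Finset.mem_erase.1 hH).1 (Subtype.ext h)
  refine Subalgebra.smul_mem _ ?_ _
  have := prod_tmul_mem_leftSmaller k (s := {()}) (sz := QPath.length (I := I)) (n := X.length)
    (g := fun _ => X.facePath H.1 (QPath.mem_cuts.1 (Finset.mem_filter.1 H.2).1) none)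
    (fun _ _ => X.length_facePath_none_lt _ hne)
    (∏ c : {c // c ∈ H.1}, ι k (PathModule k I)
        ((X.facePath H.1 (QPath.mem_cuts.1 (Finset.mem_filter.1 H.2).1) (some c)).el k))
  rwa [Finset.prod_singleton] at this

/-! #### A left inverse of `η_rt` -/

/-- The label of the root of a tree with one vertex; zero for other trees. -/
def trunk : TRt k I →ₗ[k] PathModule k I :=
  Finsupp.linearCombination k (Quotient.lift (fun X : RTree I =>
    if Nat.card X.1.V = 1 then (X.2.label X.1.root).el k else 0) (fun X Y h => by
      rw [card_eq_of_equiv h]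
      obtain ⟨f, hf⟩ := h
      rw [hf.label, hf.root]))

theorem trunk_el (X : RTree I) :
    trunk k I (X.el k) = if Nat.card X.1.V = 1 then (X.2.label X.1.root).el k else 0 :=
  (Finsupp.linearCombination_single k 1 _).trans (one_smul k _)

/-- `T_H` has one vertex more than `H` has chords, so only the empty cut contributes, with sign `1`
and label `X`. -/
theorem trunk_etaRt (X : PathModule k I) : trunk k I (etaRt k I X) = X := by
  have h : trunk k I ∘ₗ etaRt k I = LinearMap.id := by
    refine Finsupp.lhom_ext' fun X => LinearMap.ext_ring ?_
    change trunk k I (etaRt k I (X.el k)) = X.el k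
    rw [etaRt_el, etaRtFun, map_sum, Finset.sum_eq_single ⟨∅, QPath.mem_cuts.2 X.isCut_empty⟩]
    · have h2 : X.eps ∅ = 1 := Finset.prod_empty
      rw [map_smul, h2, Int.cast_one, one_smul, trunk_el]
      refine (if_pos ?_).trans (congrArg (QPath.el k) X.facePath_empty)
      change Nat.card (Face ∅) = 1
      simp
    · intro H _ hne
      rw [map_smul, trunk_el, if_neg, smul_zero]
      intro hc
      change Nat.card (Face H.1) = 1 at hc
      rw [Finite.card_option] at hc
      refine hne (Subtype.ext (Finset.eq_empty_of_forall_notMem fun c hc' => ?_))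
      have : Nonempty {c // c ∈ H.1} := ⟨⟨c, hc'⟩⟩
      have := Nat.card_pos (α := {c // c ∈ H.1})
      omega
    · intro h
      exact (h (Finset.mem_univ _)).elim
  exact DFunLike.congr_fun h X

theorem etaRt_injective : Function.Injective (etaRt k I) :=
  Function.LeftInverse.injective (trunk_etaRt k I)

/-- The left inverse of the multiplicative extension of `η_rt`. -/
def symTrunk : SymmetricAlgebra k (TRt k I) →ₐ[k] SymmetricAlgebra k (PathModule k I) :=
  lift (ι k _ ∘ₗ trunk k I)

theorem symTrunk_comp_symEtaRt : (symTrunk k I).comp (symEtaRt k I) = .id k _ := by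
  refine algHom_ext (LinearMap.ext fun x => ?_)
  change symTrunk k I (symEtaRt k I (ι k _ x)) = ι k _ x
  rw [symEtaRt, lift_ι_apply, LinearMap.comp_apply, symTrunk, lift_ι_apply, LinearMap.comp_apply,
    trunk_etaRt]

theorem symEtaRt_injective : Function.Injective (symEtaRt k I) :=
  Function.LeftInverse.injective (DFunLike.congr_fun (symTrunk_comp_symEtaRt k I))

/-- The comultiplication on polynomials in paths is coassociative. -/
theorem comulP_coassoc :
    (Algebra.TensorProduct.assoc k k k (SymmetricAlgebra k (PathModule k I))
      (SymmetricAlgebra k (PathModule k I)) (SymmetricAlgebra k (PathModule k I))).toAlgHom.comp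
      ((Algebra.TensorProduct.map (comulP k I) (.id k (SymmetricAlgebra k (PathModule k I)))).comp
        (comulP k I)) =
      (Algebra.TensorProduct.map (.id k (SymmetricAlgebra k (PathModule k I))) (comulP k I)).comp
        (comulP k I) := by
  -- No combinatorics of paths is needed here: `Sym P` embeds into polynomials in trees, compatibly
  -- with the comultiplications.
  exact coassoc_of_leftInverse (symTrunk_comp_symEtaRt k I) (symEtaRt_comul k I)
    (comulRt_coassoc k I)

theorem symEtaRt_counit :
    (symCounit k (TRt k I)).comp (symEtaRt k I) = symCounit k (PathModule k I) := by
  refine algHom_ext_path fun X => ?_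
  rw [AlgHom.comp_apply, symEtaRt_ι, symCounit_ι, symCounit_ι]

/-- The Hopf algebra structures, and the homomorphism between them. -/
theorem hopf_main :
    ∃ (S : SymmetricAlgebra k (PathModule k I) →ₗ[k] SymmetricAlgebra k (PathModule k I))
        (S' : SymmetricAlgebra k (TRt k I) →ₗ[k] SymmetricAlgebra k (TRt k I)),
      IsHopfAlgebra (comulP k I) (symCounit k (PathModule k I)) S ∧
      IsHopfAlgebra (comulRt k I) (symCounit k (TRt k I)) S' ∧
      IsHopfHom (comulP k I) (symCounit k (PathModule k I)) S
        (comulRt k I) (symCounit k (TRt k I)) S' (symEtaRt k I) ∧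
      Function.Injective (symEtaRt k I) := by
  obtain ⟨S, hS, hS'⟩ := exists_antipode QPath.length (comulP_coassoc k I)
    (comulP_counit_left k I) (comulP_counit_right k I) (comulP_sub_mem k I)
    (comm_comulP_sub_mem k I)
  obtain ⟨S', hT, hT'⟩ := exists_antipode treeSize (comulRt_coassoc k I)
    (comulRt_counit_left k I) (comulRt_counit_right k I) (comulRt_sub_mem k I)
    (comm_comulRt_sub_mem k I)
  refine ⟨S.toLinearMap, S'.toLinearMap,
    isHopfAlgebra_of_convHom (comulP_coassoc k I) (comulP_counit_left k I)
      (comulP_counit_right k I) hS hS',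
    isHopfAlgebra_of_convHom (comulRt_coassoc k I) (comulRt_counit_left k I)
      (comulRt_counit_right k I) hT hT',
    ⟨symEtaRt_comul k I, symEtaRt_counit k I, ?_⟩, symEtaRt_injective k I⟩
  exact congrArg AlgHom.toLinearMap (antipode_compat (comulP_coassoc k I)
    (comulP_counit_left k I) (comulP_counit_right k I) hS hT' (symEtaRt_comul k I)
    (symEtaRt_counit k I))

end Hopf

/-! ### Linear parts of comultiplications -/

/-- `Λ` is the linear part of polynomials in the elements of the image of `j`. -/
structure IsLinPart {k R M : Type*} [CommRing k] [CommRing R] [Algebra k R] [AddCommGroup M]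
    [Module k M] (ε : R →ₐ[k] k) (j : M →ₗ[k] R) (Λ : R →ₗ[k] M) : Prop where
  gen : ∀ x, Λ (j x) = x
  counit : ∀ x, ε (j x) = 0
  mul : ∀ x y, Λ (x * y) = ε x • Λ y + ε y • Λ x
  adjoin : Algebra.adjoin k (Set.range j) = ⊤

section LinComul

variable {k R M : Type*} [CommRing k] [CommRing R] [Algebra k R] [AddCommGroup M] [Module k M]

/-- The linear part of a comultiplication. -/
def linComul (j : M →ₗ[k] R) (Λ : R →ₗ[k] M) (Δ : R →ₐ[k] R ⊗[k] R) : M →ₗ[k] M ⊗[k] M :=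
  TensorProduct.map Λ Λ ∘ₗ Δ.toLinearMap ∘ₗ j

theorem linComul_apply (j : M →ₗ[k] R) (Λ : R →ₗ[k] M) (Δ : R →ₐ[k] R ⊗[k] R) (x : M) :
    linComul j Λ Δ x = TensorProduct.map Λ Λ (Δ (j x)) := rfl

variable {ε : R →ₐ[k] k} {j : M →ₗ[k] R} {Λ : R →ₗ[k] M} {Δ : R →ₐ[k] R ⊗[k] R}

theorem lid_map_counit {N : Type*} [AddCommGroup N] [Module k N] (f : R →ₗ[k] N)
    (hl : (Algebra.TensorProduct.map ε (.id k R)).comp Δ =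
      (Algebra.TensorProduct.lid k R).symm.toAlgHom) (s : R) :
    TensorProduct.lid k N (TensorProduct.map ε.toLinearMap f (Δ s)) = f s := by
  have h := DFunLike.congr_fun hl s
  have h1 : ∀ z : R ⊗[k] R, TensorProduct.lid k N (TensorProduct.map ε.toLinearMap f z) =
      f (Algebra.TensorProduct.lid k R (Algebra.TensorProduct.map ε (.id k R) z)) := by
    intro z
    induction z with
    | zero => simp
    | add z z' hz hz' => simp only [map_add, hz, hz']
    | tmul x y => simp
  rw [h1]
  rw [AlgHom.comp_apply] at h
  rw [h]
  simp

theorem rid_map_counit {N : Type*} [AddCommGroup N] [Module k N] (f : R →ₗ[k] N)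
    (hr : (Algebra.TensorProduct.map (.id k R) ε).comp Δ =
      (Algebra.TensorProduct.rid k k R).symm.toAlgHom) (s : R) :
    TensorProduct.rid k N (TensorProduct.map f ε.toLinearMap (Δ s)) = f s := by
  have h := DFunLike.congr_fun hr s
  have h1 : ∀ z : R ⊗[k] R, TensorProduct.rid k N (TensorProduct.map f ε.toLinearMap z) =
      f (Algebra.TensorProduct.rid k k R (Algebra.TensorProduct.map (.id k R) ε z)) := by
    intro z
    induction z with
    | zero => simp
    | add z z' hz hz' => simp only [map_add, hz, hz']
    | tmul x y => simp
  rw [h1]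
  rw [AlgHom.comp_apply] at h
  rw [h]
  simp

namespace IsLinPart

theorem one (h : IsLinPart ε j Λ) : Λ 1 = 0 := by
  have := h.mul 1 1
  rw [mul_one, map_one ε, one_smul] at this
  exact left_eq_add.1 this

theorem algebraMap (h : IsLinPart ε j Λ) (c : k) : Λ (algebraMap k R c) = 0 := by
  rw [Algebra.algebraMap_eq_smul_one, map_smul, h.one, smul_zero]

theorem prod (h : IsLinPart ε j Λ) {J : Type*} {s : Finset J} (g : J → M) (hs : s.card ≠ 1) :
    Λ (∏ i ∈ s, j (g i)) = 0 := by
  classical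
  rcases s.eq_empty_or_nonempty with rfl | ⟨i, hi⟩
  · rw [Finset.prod_empty, h.one]
  · have hc := Finset.card_erase_add_one hi
    obtain ⟨i', hi'⟩ : (s.erase i).Nonempty := by
      rw [← Finset.card_pos]
      omega
    rw [← Finset.mul_prod_erase s _ hi, h.mul, h.counit, zero_smul, zero_add, map_prod,
      Finset.prod_eq_zero hi' (h.counit _), zero_smul]

/-- `Λ` is a derivation over `ε`, so `Λ ⊗ Λ` of a product has four terms. For `z = Δ s` and `w = Δ
t` the counit axioms turn the last two into `Λ s ⊗ Λ t` and `Λ t ⊗ Λ s`. -/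
theorem map_mul (h : IsLinPart ε j Λ) (z w : R ⊗[k] R) :
    TensorProduct.map Λ Λ (z * w) =
      TensorProduct.lid k k (TensorProduct.map ε.toLinearMap ε.toLinearMap w) •
        TensorProduct.map Λ Λ z +
      TensorProduct.lid k k (TensorProduct.map ε.toLinearMap ε.toLinearMap z) •
        TensorProduct.map Λ Λ w +
      (TensorProduct.rid k M (TensorProduct.map Λ ε.toLinearMap z) ⊗ₜ
        TensorProduct.lid k M (TensorProduct.map ε.toLinearMap Λ w) +
      TensorProduct.rid k M (TensorProduct.map Λ ε.toLinearMap w) ⊗ₜ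
        TensorProduct.lid k M (TensorProduct.map ε.toLinearMap Λ z)) := by
  induction z with
  | zero => simp
  | add z z' hz hz' =>
    rw [add_mul, map_add, hz, hz']
    simp only [map_add, TensorProduct.add_tmul, TensorProduct.tmul_add, add_smul, smul_add]
    abel
  | tmul x y =>
    induction w with
    | zero => simp
    | add w w' hw hw' =>
      rw [mul_add, map_add, hw, hw']
      simp only [map_add, TensorProduct.add_tmul, TensorProduct.tmul_add, add_smul, smul_add]
      abel
    | tmul x' y' =>
      simp only [Algebra.TensorProduct.tmul_mul_tmul, TensorProduct.map_tmul, h.mul,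
        TensorProduct.lid_tmul, TensorProduct.rid_tmul, AlgHom.toLinearMap_apply,
        TensorProduct.add_tmul, TensorProduct.tmul_add, TensorProduct.smul_tmul_smul, smul_eq_mul]
      module

/-- The source of the pre-Lie identity. On generators the two maps agree; on a product `s t` they
differ, up to multiples of the differences for `s` and `t`, by `Λ s ⊗ Λ t + Λ t ⊗ Λ s`, which is
symmetric. -/
theorem comm_sub_linComul (h : IsLinPart ε j Λ)
    (hl : (Algebra.TensorProduct.map ε (.id k R)).comp Δ =
      (Algebra.TensorProduct.lid k R).symm.toAlgHom)
    (hr : (Algebra.TensorProduct.map (.id k R) ε).comp Δ =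
      (Algebra.TensorProduct.rid k k R).symm.toAlgHom) (s : R) :
    TensorProduct.comm k M M (linComul j Λ Δ (Λ s) - TensorProduct.map Λ Λ (Δ s)) =
      linComul j Λ Δ (Λ s) - TensorProduct.map Λ Λ (Δ s) := by
  have hs : s ∈ Algebra.adjoin k (Set.range j) := by rw [h.adjoin]; trivial
  induction hs using Algebra.adjoin_induction with
  | algebraMap c =>
    rw [h.algebraMap, AlgHom.commutes, Algebra.TensorProduct.algebraMap_apply,
      TensorProduct.map_tmul, h.one]
    simp
  | mem x hx =>
    obtain ⟨x, rfl⟩ := hx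
    rw [h.gen, linComul_apply, sub_self, map_zero]
  | add s t _ _ hs ht =>
    rw [map_add, map_add, map_add, map_add, add_sub_add_comm, map_add, hs, ht]
  | mul s t _ _ hs ht =>
    have h1 : linComul j Λ Δ (Λ (s * t)) - TensorProduct.map Λ Λ (Δ (s * t)) =
        ε t • (linComul j Λ Δ (Λ s) - TensorProduct.map Λ Λ (Δ s)) +
        ε s • (linComul j Λ Δ (Λ t) - TensorProduct.map Λ Λ (Δ t)) -
        (Λ s ⊗ₜ Λ t + Λ t ⊗ₜ Λ s) := by
      rw [_root_.map_mul Δ, h.map_mul, lid_map_counit Λ hl, lid_map_counit Λ hl,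
        rid_map_counit Λ hr, rid_map_counit Λ hr]
      have h2 := lid_map_counit ε.toLinearMap hl
      rw [h2, h2, h.mul, map_add, map_smul, map_smul, smul_sub, smul_sub]
      simp only [AlgHom.toLinearMap_apply]
      abel
    rw [h1, map_sub, map_add, map_smul, map_smul, hs, ht, map_add, TensorProduct.comm_tmul,
      TensorProduct.comm_tmul, add_comm (Λ t ⊗ₜ[k] _)]

theorem map_assoc (z : R ⊗[k] R) (y : R) :
    TensorProduct.map Λ (TensorProduct.map Λ Λ) (TensorProduct.assoc k R R R (z ⊗ₜ y)) =
      TensorProduct.assoc k M M M (TensorProduct.map Λ Λ z ⊗ₜ Λ y) := by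
  induction z with
  | zero => simp
  | add z z' hz hz' => simp only [map_add, TensorProduct.add_tmul, hz, hz']
  | tmul x y => simp

/-- The linear part of a coassociative comultiplication which is linear in its right hand factor
is a pre-Lie comultiplication. -/
theorem isPreLieCoalgebra (h : IsLinPart ε j Λ)
    (hΔ : (Algebra.TensorProduct.assoc k k k R R R).toAlgHom.comp
      ((Algebra.TensorProduct.map Δ (.id k R)).comp Δ)
      = (Algebra.TensorProduct.map (.id k R) Δ).comp Δ)
    (hl : (Algebra.TensorProduct.map ε (.id k R)).comp Δ =
      (Algebra.TensorProduct.lid k R).symm.toAlgHom)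
    (hr : (Algebra.TensorProduct.map (.id k R) ε).comp Δ =
      (Algebra.TensorProduct.rid k k R).symm.toAlgHom)
    {G : Set M} (hG : Submodule.span k G = ⊤)
    (hD : ∀ x ∈ G, ∃ D : R ⊗[k] M, Δ (j x) = j x ⊗ₜ 1 + j.lTensor R D) :
    IsPreLieCoalgebra (linComul j Λ Δ) := by
  refine LinearMap.ext_on hG fun x hx => ?_
  obtain ⟨D, hD⟩ := hD x hx
  have hδ : linComul j Λ Δ x = Λ.rTensor M D := by
    rw [linComul_apply, hD, map_add, TensorProduct.map_tmul, h.one, TensorProduct.tmul_zero,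
      zero_add]
    clear hD
    induction D with
    | zero => simp
    | add z z' hz hz' => simp only [map_add, hz, hz']
    | tmul x y => simp [h.gen]
  -- The right hand factor of `D` consists of generators, so here the second comultiplication may be
  -- replaced by its linear part.
  have hright : TensorProduct.map Λ (TensorProduct.map Λ Λ)
      (Algebra.TensorProduct.map (.id k R) Δ (Δ (j x))) =
        (linComul j Λ Δ).lTensor M (Λ.rTensor M D) := by
    rw [hD, map_add, map_add, Algebra.TensorProduct.map_tmul, map_one, TensorProduct.map_tmul,
      Algebra.TensorProduct.one_def, TensorProduct.map_tmul, h.one, TensorProduct.tmul_zero,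
      TensorProduct.tmul_zero, zero_add]
    clear hD hδ
    induction D with
    | zero => simp
    | add z z' hz hz' => simp only [map_add, hz, hz']
    | tmul x y => simp [linComul_apply]
  -- The left hand factor of `D` is a polynomial, and applying `Δ` before taking linear parts is not
  -- the same as applying `linComul` to its linear part.
  have hleft : TensorProduct.map Λ (TensorProduct.map Λ Λ)
      (TensorProduct.assoc k R R R (Algebra.TensorProduct.map Δ (.id k R) (Δ (j x)))) =
      TensorProduct.assoc k M M M ((TensorProduct.map Λ Λ ∘ₗ Δ.toLinearMap).rTensor M D) := by
    rw [hD, map_add, map_add, map_add, Algebra.TensorProduct.map_tmul, map_one, map_assoc, h.one,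
      TensorProduct.tmul_zero, map_zero, zero_add]
    clear hD hδ hright
    induction D with
    | zero => simp
    | add z z' hz hz' => simp only [map_add, hz, hz']
    | tmul x y =>
      rw [LinearMap.lTensor_tmul, Algebra.TensorProduct.map_tmul, map_assoc,
        LinearMap.rTensor_tmul, AlgHom.id_apply, h.gen]
      rfl
  have hco : TensorProduct.assoc k M M M
      ((TensorProduct.map Λ Λ ∘ₗ Δ.toLinearMap).rTensor M D) =
      (linComul j Λ Δ).lTensor M (Λ.rTensor M D) := by
    rw [← hleft, ← hright]
    exact congrArg _ (DFunLike.congr_fun hΔ (j x))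
  -- By coassociativity the associator is precisely the defect studied in `comm_sub_linComul`,
  -- applied to the left hand factor of `D`; its values are symmetric in the first two places.
  have hdiff : (iterLeft (linComul j Λ Δ) - iterRight (linComul j Λ Δ)) x =
      TensorProduct.assoc k M M M
        ((linComul j Λ Δ ∘ₗ Λ - TensorProduct.map Λ Λ ∘ₗ Δ.toLinearMap).rTensor M D) := by
    have h1 : iterLeft (linComul j Λ Δ) x = TensorProduct.assoc k M M M
        ((linComul j Λ Δ).rTensor M (linComul j Λ Δ x)) := rfl
    have h2 : iterRight (linComul j Λ Δ) x = (linComul j Λ Δ).lTensor M (linComul j Λ Δ x) := rfl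
    rw [LinearMap.sub_apply, h1, h2, hδ, ← hco, LinearMap.rTensor_sub, LinearMap.sub_apply, map_sub,
      LinearMap.rTensor_comp M (linComul j Λ Δ) Λ]
    rfl
  rw [LinearMap.comp_apply, hdiff, LinearMap.sub_apply, LinearMap.id_apply, LinearMap.zero_apply,
    sub_eq_zero]
  clear hdiff hco hleft hright hδ hD
  induction D with
  | zero => simp
  | add z z' hz hz' =>
    simp only [map_add]
    rw [← hz, ← hz']
  | tmul s m =>
    have h1 : ∀ z : M ⊗[k] M, (TensorProduct.leftComm k M M M).toLinearMap
        (TensorProduct.assoc k M M M (z ⊗ₜ m)) =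
        TensorProduct.assoc k M M M (TensorProduct.comm k M M z ⊗ₜ m) := by
      intro z
      induction z with
      | zero => simp
      | add z z' hz hz' => simp only [map_add, TensorProduct.add_tmul, hz, hz']
      | tmul x y => simp
    rw [LinearMap.rTensor_tmul, h1]
    exact congrArg (fun z => TensorProduct.assoc k M M M (z ⊗ₜ m))
      (h.comm_sub_linComul hl hr s).symm

end IsLinPart

/-- Linear parts of homomorphisms. -/
theorem isCoalgHom_linComul {R' M' : Type*} [CommRing R'] [Algebra k R'] [AddCommGroup M']
    [Module k M'] {j' : M' →ₗ[k] R'} {Λ' : R' →ₗ[k] M'} {Δ' : R' →ₐ[k] R' ⊗[k] R'}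
    {f : R →ₐ[k] R'} {g : M →ₗ[k] M'} (hf : ∀ x, f (j x) = j' (g x))
    (hΛ : ∀ s, Λ' (f s) = g (Λ s)) (h : (Algebra.TensorProduct.map f f).comp Δ = Δ'.comp f) :
    IsCoalgHom (linComul j Λ Δ) (linComul j' Λ' Δ') g := by
  refine LinearMap.ext fun x => ?_
  have h1 := DFunLike.congr_fun h (j x)
  rw [AlgHom.comp_apply, AlgHom.comp_apply, hf] at h1
  rw [LinearMap.comp_apply, LinearMap.comp_apply, linComul_apply, linComul_apply, ← h1]
  induction Δ (j x) with
  | zero => simp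
  | add z z' hz hz' => simp only [map_add, hz, hz']
  | tmul x y => simp [hΛ]

end LinComul

/-! ### The part of degree one in a symmetric algebra -/

section SymmetricAlgebra

open SymmetricAlgebra

variable (k : Type*) [CommRing k] (B : Type*)

/-- The algebra homomorphism to the square zero extension which describes the part of degree at
most one. -/
def jet : SymmetricAlgebra k (B →₀ k) →ₐ[k] TrivSqZeroExt k (B →₀ k) :=
  lift (TrivSqZeroExt.inrHom k (B →₀ k))

/-- The part of degree one. -/
def linPart : SymmetricAlgebra k (B →₀ k) →ₗ[k] (B →₀ k) :=
  TrivSqZeroExt.sndHom k (B →₀ k) ∘ₗ (jet k B).toLinearMap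

theorem jet_fst (x : SymmetricAlgebra k (B →₀ k)) :
    (jet k B x).fst = symCounit k (B →₀ k) x := by
  have h : (TrivSqZeroExt.fstHom k k (B →₀ k)).comp (jet k B) = symCounit k (B →₀ k) := by
    refine algHom_ext (LinearMap.ext fun x => ?_)
    simp [jet, symCounit]
  exact DFunLike.congr_fun h x

/-- The multiplication of the square zero extension is exactly the derivation rule over the counit.
-/
theorem isLinPart_linPart :
    IsLinPart (symCounit k (B →₀ k)) (ι k (B →₀ k)) (linPart k B) where
  gen x := by simp [linPart, jet]
  counit := symCounit_ι k
  mul x y := by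
    change (jet k B (x * y)).snd = _
    rw [map_mul, TrivSqZeroExt.snd_mul, jet_fst, jet_fst, op_smul_eq_smul]
    rfl
  adjoin := by
    refine Algebra.eq_top_iff.2 fun x => ?_
    induction x using SymmetricAlgebra.induction with
    | algebraMap c => exact Subalgebra.algebraMap_mem _ c
    | ι x => exact Algebra.subset_adjoin ⟨x, rfl⟩
    | mul x y hx hy => exact mul_mem hx hy
    | add x y hx hy => exact add_mem hx hy

end SymmetricAlgebra

/-! ### The pre-Lie coalgebras as linear parts of the Hopf algebras -/

section PreLie

theorem subword_compl_Icc (lo hi : ℕ) (h : lo ≤ hi) {I : Type*} [Quiver I] (l : List (Arrow I)) :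
    subword (fun m => ¬ (lo ≤ m ∧ m ≤ hi)) l = l.take lo ++ l.drop (hi + 1) := by
  induction l generalizing lo hi with
  | nil => simp [subword_nil]
  | cons a l ih =>
    rw [subword_cons]
    rcases lo with _ | lo
    · rcases hi with _ | hi
      · rw [if_neg (by simp), subword_eq_self (fun m _ => by omega)]
        rfl
      · rw [if_neg (by simp)]
        have := ih 0 hi (Nat.zero_le _)
        simpa using this
    · rcases hi with _ | hi
      · omega
      · have := ih lo hi (by omega)
        simpa using this

namespace QPath

variable {I : Type*} [Quiver I] {X : QPath I} {c : ℕ × ℕ}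

theorem isCut_singleton (hc : X.IsChord c) : X.IsCut {c} where
  chord d hd := by rwa [Finset.mem_singleton.1 hd]
  distinct d hd e he h := by
    rw [Finset.mem_singleton.1 hd, Finset.mem_singleton.1 he] at h
    exact (h rfl).elim
  noncrossing d hd e he h := by
    rw [Finset.mem_singleton.1 hd, Finset.mem_singleton.1 he] at h
    exact lt_irrefl _ h.1

theorem isSimple_singleton (c : ℕ × ℕ) : IsSimple {c} := by
  intro d hd e he h
  rw [Finset.mem_singleton.1 hd, Finset.mem_singleton.1 he] at h
  exact lt_irrefl _ h.1

theorem facePath_singleton_some (hc : X.IsChord c) :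
    X.facePath {c} (isCut_singleton hc) (some ⟨c, Finset.mem_singleton_self c⟩) = X.inner c :=
  QPath.ext rfl (subword_some_of_isSimple (isSimple_singleton c) ⟨c, Finset.mem_singleton_self c⟩)

theorem facePath_singleton_none (hc : X.IsChord c) :
    X.facePath {c} (isCut_singleton hc) none = X.outer c hc := by
  refine QPath.ext rfl ((subword_congr fun m _ => ?_).trans
    (subword_compl_Icc c.1 c.2 hc.1.le X.arrows))
  constructor
  · exact fun h => h.2 ⟨c, Finset.mem_singleton_self c⟩ trivial
  · refine fun h => ⟨trivial, fun d _ => ?_⟩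
    rwa [Finset.mem_singleton.1 d.2]

end QPath

theorem RootedTree.isSimpleCut_singleton (T : RootedTree) (e : T.graph.edgeSet) :
    T.IsSimpleCut {e} := by
  intro v d hd e he _ _
  rw [Finset.mem_singleton.1 hd, Finset.mem_singleton.1 he]

theorem RootedTree.edges_singleton (T : RootedTree) (e : T.graph.edgeSet) :
    T.edges {e} = {e.1} := by
  rw [RootedTree.edges, Finset.coe_singleton, Set.image_singleton]

/-- Reduces a sum over simple cuts to the cuts with a single element, once all other terms vanish.
-/
theorem sum_eq_sum_singleton {α J M : Type*} [AddCommMonoid M] [Fintype J] {P : Finset α → Prop}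
    [Fintype {H // P H}] {e : J → α} (he : Function.Injective e) (hP : ∀ i, P {e i})
    (hP' : ∀ a, P {a} → ∃ i, e i = a) {g : {H // P H} → M} (hg : ∀ H, H.1.card ≠ 1 → g H = 0) :
    ∑ H, g H = ∑ i, g ⟨{e i}, hP i⟩ := by
  symm
  refine Finset.sum_of_injOn (fun i => ⟨{e i}, hP i⟩) ?_ (fun i _ => Finset.mem_univ _) ?_
    (fun i _ => rfl)
  · intro i _ i' _ h
    exact he (Finset.singleton_injective (congrArg Subtype.val h))
  · intro H _ hH
    refine hg H fun h1 => ?_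
    obtain ⟨a, ha⟩ := Finset.card_eq_one.1 h1
    obtain ⟨i, hi⟩ := hP' a (ha ▸ H.2)
    exact hH ⟨i, Finset.mem_coe.2 (Finset.mem_univ _), Subtype.ext (by simp [hi, ha])⟩

open SymmetricAlgebra

variable (k : Type*) [CommRing k] {I : Type*} [Quiver I]

/-- `linPart` kills `1` and every product of two or more generators. This removes the term `(T, s) ⊗
1`, the empty cut and all cuts with several edges. -/
theorem rhoRtFun_eq (X : RTree I) : rhoRtFun k X =
    TensorProduct.map (linPart k (RTreeClass I)) (linPart k (RTreeClass I)) (comulRtFun k X) := by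
  classical
  have h := isLinPart_linPart k (RTreeClass I)
  rw [comulRtFun, map_add, TensorProduct.map_tmul, h.one, TensorProduct.tmul_zero, zero_add,
    map_sum]
  rw [sum_eq_sum_singleton (e := fun e : X.1.graph.edgeSet => e) Function.injective_id
    X.1.isSimpleCut_singleton (fun a _ => ⟨a, rfl⟩)]
  · refine Finset.sum_congr rfl fun e _ => ?_
    rw [TensorProduct.map_tmul, Finset.prod_singleton, h.gen, h.gen, RootedTree.edges_singleton]
  · intro H hH
    rw [TensorProduct.map_tmul]
    exact (congrArg (· ⊗ₜ[k] _) (h.prod _ hH)).trans (TensorProduct.zero_tmul _ _)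

theorem deltaRtFun_eq (X : QPath I) : deltaRtFun k X =
    TensorProduct.map (linPart k (QPath I)) (linPart k (QPath I)) (comulPFun k X) := by
  classical
  have h := isLinPart_linPart k (QPath I)
  rw [comulPFun, map_add, TensorProduct.map_tmul, h.one, TensorProduct.tmul_zero, zero_add,
    map_sum]
  rw [sum_eq_sum_singleton (e := fun c : {c // c ∈ X.chords} => c.1) Subtype.val_injective
    (fun c => Finset.mem_filter.2 ⟨QPath.mem_cuts.2 (QPath.isCut_singleton
      (QPath.mem_chords.1 c.2)), QPath.isSimple_singleton c.1⟩)
    (fun a ha => ⟨⟨a, QPath.mem_chords.2 ((QPath.mem_cuts.1 (Finset.mem_filter.1 ha).1).chord a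
      (Finset.mem_singleton_self a))⟩, rfl⟩)]
  · refine Finset.sum_congr rfl fun c _ => ?_
    have hc := QPath.mem_chords.1 c.2
    rw [map_smul, TensorProduct.map_tmul, Fintype.prod_unique, h.gen, h.gen]
    refine congrArg₂ (· • ·) ?_ (congrArg₂ (· ⊗ₜ[k] ·) (congrArg (QPath.el k) ?_)
      (congrArg (QPath.el k) (QPath.facePath_singleton_none hc).symm))
    · rw [QPath.eps, Finset.prod_singleton]
    · exact (QPath.facePath_singleton_some hc).symm
  · intro H hH
    rw [map_smul, TensorProduct.map_tmul]
    refine (congrArg (fun z => _ • (z ⊗ₜ[k] _)) (h.prod _ ?_)).trans ?_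
    · rwa [Finset.card_univ, Fintype.card_coe]
    · rw [TensorProduct.zero_tmul, smul_zero]

theorem rhoRt_el (X : RTree I) : rhoRt k I (X.el k) = rhoRtFun k X := by
  rw [rhoRt]
  refine (Finsupp.linearCombination_single k 1 _).trans ((one_smul k _).trans ?_)
  rw [rhoRtFun_eq, rhoRtFun_eq, comulRtFun_congr k (Quotient.mk_out X)]

theorem deltaRt_el (X : QPath I) : deltaRt k I (X.el k) = deltaRtFun k X := by
  rw [deltaRt, QPath.el, Finsupp.linearCombination_single, one_smul]

variable (I)

theorem rhoRt_eq : rhoRt k I =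
    linComul (ι k (TRt k I)) (linPart k (RTreeClass I)) (comulRt k I) := by
  refine Finsupp.lhom_ext' fun c => LinearMap.ext_ring ?_
  induction c using Quotient.ind with
  | _ X => exact (rhoRt_el k X).trans ((rhoRtFun_eq k X).trans
      (congrArg _ (comulRt_ι k X).symm))

theorem deltaRt_eq : deltaRt k I =
    linComul (ι k (PathModule k I)) (linPart k (QPath I)) (comulP k I) := by
  refine Finsupp.lhom_ext' fun X => LinearMap.ext_ring ?_
  exact (deltaRt_el k X).trans ((deltaRtFun_eq k X).trans (congrArg _ (comulP_ι k X).symm))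

theorem span_basis (B : Type*) :
    Submodule.span k (Set.range fun b : B => (Finsupp.single b 1 : B →₀ k)) = ⊤ := by
  have := (Finsupp.basisSingleOne (R := k) (ι := B)).span_eq
  rwa [Finsupp.coe_basisSingleOne] at this

theorem isPreLieCoalgebra_rhoRt : IsPreLieCoalgebra (rhoRt k I) := by
  classical
  rw [rhoRt_eq]
  refine (isLinPart_linPart k (RTreeClass I)).isPreLieCoalgebra (comulRt_coassoc k I)
    (comulRt_counit_left k I) (comulRt_counit_right k I) (span_basis k _) ?_
  rintro _ ⟨c, rfl⟩
  induction c using Quotient.ind with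
  | _ X =>
    refine ⟨∑ H : {H : Finset X.1.graph.edgeSet // X.1.IsSimpleCut H},
      (∏ e ∈ H.1, ι k _ ((X.comp (X.1.edges H.1) (X.1.far e)).el k)) ⊗ₜ[k]
        ((X.comp (X.1.edges H.1) X.1.root).el k), (comulRt_ι k X).trans ?_⟩
    rw [comulRtFun, map_sum]
    rfl

theorem isPreLieCoalgebra_deltaRt : IsPreLieCoalgebra (deltaRt k I) := by
  rw [deltaRt_eq]
  refine (isLinPart_linPart k (QPath I)).isPreLieCoalgebra (comulP_coassoc k I)
    (comulP_counit_left k I) (comulP_counit_right k I) (span_basis k _) ?_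
  rintro _ ⟨X, rfl⟩
  classical
  refine ⟨∑ H : {H // H ∈ X.cuts.filter (fun H => QPath.IsSimple H)}, ((X.eps H.1 : ℤ) : k) •
      ((∏ c : {c // c ∈ H.1}, ι k _ ((X.facePath H.1
          (QPath.mem_cuts.1 (Finset.mem_filter.1 H.2).1) (some c)).el k)) ⊗ₜ[k]
        ((X.facePath H.1
          (QPath.mem_cuts.1 (Finset.mem_filter.1 H.2).1) none).el k)), (comulP_ι k X).trans ?_⟩
  rw [comulPFun, map_sum]
  refine congrArg _ (Finset.sum_congr rfl fun H _ => ?_)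
  rw [map_smul, LinearMap.lTensor_tmul]

/-- Generators go to linear combinations of generators, so the multiplicative extension respects the
part of degree one. -/
theorem linPart_symEtaRt (s : SymmetricAlgebra k (PathModule k I)) :
    linPart k (RTreeClass I) (symEtaRt k I s) = etaRt k I (linPart k (QPath I) s) := by
  have h := isLinPart_linPart k (RTreeClass I)
  have h' := isLinPart_linPart k (QPath I)
  have hc := DFunLike.congr_fun (symEtaRt_counit k I)
  induction s using SymmetricAlgebra.induction with
  | algebraMap c => rw [AlgHom.commutes, h.algebraMap, h'.algebraMap, map_zero]
  | ι x => rw [symEtaRt, lift_ι_apply, LinearMap.comp_apply, h.gen, h'.gen]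
  | mul x y hx hy =>
    rw [map_mul, h.mul, h'.mul, map_add, map_smul, map_smul, hx, hy]
    have h1 := hc x
    have h2 := hc y
    rw [AlgHom.comp_apply] at h1 h2
    rw [h1, h2]
  | add x y hx hy => rw [map_add, map_add, hx, hy, map_add, map_add]

theorem isCoalgHom_etaRt : IsCoalgHom (deltaRt k I) (rhoRt k I) (etaRt k I) := by
  rw [deltaRt_eq, rhoRt_eq]
  refine isCoalgHom_linComul (f := symEtaRt k I) (fun x => ?_) (linPart_symEtaRt k I)
    (symEtaRt_comul k I)
  rw [symEtaRt, lift_ι_apply, LinearMap.comp_apply]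

end PreLie

/-! ### Antisymmetrization of pre-Lie coalgebras -/

section Antisymmetrization

variable {k M N : Type*} [CommRing k] [AddCommGroup M] [Module k M] [AddCommGroup N] [Module k N]

/-- The antisymmetrization `x ⊗ y ↦ x ⊗ y - y ⊗ x`. -/
def antisymm (k M : Type*) [CommRing k] [AddCommGroup M] [Module k M] :
    M ⊗[k] M →ₗ[k] M ⊗[k] M :=
  LinearMap.id - (TensorProduct.comm k M M).toLinearMap

theorem antisymm_tmul (x y : M) : antisymm k M (x ⊗ₜ y) = x ⊗ₜ y - y ⊗ₜ x := rfl

theorem neg_smul_antisymm (n : ℤ) (x y : M) :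
    ((-n : ℤ) : k) • antisymm k M (x ⊗ₜ y) = (n : k) • (y ⊗ₜ x - x ⊗ₜ y) := by
  rw [antisymm_tmul, Int.cast_neg, neg_smul, ← smul_neg, neg_sub]

theorem neg_one_smul_antisymm (x y : M) :
    (((-1 : ℤ) : k)) • antisymm k M (x ⊗ₜ y) = y ⊗ₜ x - x ⊗ₜ y := by
  rw [antisymm_tmul, Int.cast_neg, Int.cast_one, neg_smul, one_smul, neg_sub]

theorem one_smul_antisymm (x y : M) :
    (((1 : ℤ) : k)) • antisymm k M (x ⊗ₜ y) = x ⊗ₜ y - y ⊗ₜ x := by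
  rw [antisymm_tmul, Int.cast_one, one_smul]

theorem map_antisymm (f : M →ₗ[k] N) (z : M ⊗[k] M) :
    TensorProduct.map f f (antisymm k M z) = antisymm k N (TensorProduct.map f f z) := by
  induction z with
  | zero => simp
  | add z z' hz hz' => simp only [map_add, hz, hz']
  | tmul x y => simp [antisymm_tmul]

/-- For a term `x ⊗ y` of `δ`, the summand `- y ⊗ x` of its antisymmetrization contributes `δ y ⊗
x`, which is the rotation of `x ⊗ δ y`; this is where `iterRight` enters. -/
theorem iterLeft_antisymm (δ : M →ₗ[k] M ⊗[k] M) (x : M) :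
    iterLeft (antisymm k M ∘ₗ δ) x =
      (iterLeft δ x - cyc k M (iterRight δ x)) -
        TensorProduct.leftComm k M M M (iterLeft δ x - cyc k M (iterRight δ x)) := by
  have h1 : ∀ (w : M ⊗[k] M) (y : M), TensorProduct.assoc k M M M (antisymm k M w ⊗ₜ y) =
      TensorProduct.assoc k M M M (w ⊗ₜ y) -
        TensorProduct.leftComm k M M M (TensorProduct.assoc k M M M (w ⊗ₜ y)) := by
    intro w y
    induction w with
    | zero => simp
    | add z z' hz hz' =>
      simp only [map_add, TensorProduct.add_tmul, hz, hz']
      abel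
    | tmul x y => simp [antisymm_tmul, TensorProduct.sub_tmul]
  have h2 : ∀ z : M ⊗[k] M, TensorProduct.assoc k M M M
      ((antisymm k M ∘ₗ δ).rTensor M (antisymm k M z)) =
      (TensorProduct.assoc k M M M (δ.rTensor M z) - cyc k M (δ.lTensor M z)) -
        TensorProduct.leftComm k M M M
          (TensorProduct.assoc k M M M (δ.rTensor M z) - cyc k M (δ.lTensor M z)) := by
    intro z
    induction z with
    | zero => simp
    | add z z' hz hz' =>
      simp only [map_add, hz, hz', map_sub]
      abel
    | tmul x y =>
      have h3 : cyc k M (x ⊗ₜ δ y) = TensorProduct.assoc k M M M (δ y ⊗ₜ x) := rfl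
      rw [antisymm_tmul, map_sub, map_sub, LinearMap.rTensor_tmul, LinearMap.rTensor_tmul,
        LinearMap.rTensor_tmul, LinearMap.lTensor_tmul, LinearMap.comp_apply, LinearMap.comp_apply,
        h1, h1, h3, map_sub]
      abel
  exact h2 (δ x)

/-- The antisymmetrization of a pre-Lie comultiplication satisfies the co-Jacobi identity. -/
theorem IsPreLieCoalgebra.coJacobi {δ : M →ₗ[k] M ⊗[k] M} (h : IsPreLieCoalgebra δ) :
    (LinearMap.id + cyc k M + cyc k M ∘ₗ cyc k M) ∘ₗ iterLeft (antisymm k M ∘ₗ δ) = 0 := by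
  refine LinearMap.ext fun x => ?_
  have h0 : TensorProduct.leftComm k M M M (iterLeft δ x - iterRight δ x) =
      iterLeft δ x - iterRight δ x := by
    have := DFunLike.congr_fun h x
    exact (sub_eq_zero.1 this).symm
  have h1 : ∀ w, cyc k M (cyc k M (cyc k M w)) = w := by
    intro w
    have : cyc k M ∘ₗ cyc k M ∘ₗ cyc k M = LinearMap.id :=
      TensorProduct.ext_threefold' fun x y z => rfl
    exact DFunLike.congr_fun this w
  -- The relation `τ c = c² τ` of the symmetric group on three letters.
  have h2 : ∀ w, TensorProduct.leftComm k M M M (cyc k M w) =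
      cyc k M (cyc k M (TensorProduct.leftComm k M M M w)) := by
    intro w
    have : (TensorProduct.leftComm k M M M).toLinearMap ∘ₗ cyc k M =
        cyc k M ∘ₗ cyc k M ∘ₗ (TensorProduct.leftComm k M M M).toLinearMap :=
      TensorProduct.ext_threefold' fun x y z => rfl
    exact DFunLike.congr_fun this w
  have h3 := congrArg (cyc k M) h0
  have h4 := congrArg (cyc k M) h3
  rw [LinearMap.comp_apply, iterLeft_antisymm]
  simp only [LinearMap.add_apply, LinearMap.comp_apply, LinearMap.id_apply, LinearMap.zero_apply,
    map_sub, h1, h2] at h0 h3 h4 ⊢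
  -- The co-Jacobi sum is the sum of the three rotations of the pre-Lie identity.
  refine Eq.trans ?_ (congrArg₂ (· + ·) (congrArg₂ (· + ·) (sub_eq_zero.2 h0.symm)
    (sub_eq_zero.2 h3.symm)) (sub_eq_zero.2 h4.symm) |>.trans (by simp))
  abel

/-- Carries the co-Jacobi identity from rooted trees to oriented trees, and from paths to necklaces.
-/
theorem coJacobi_of_surjective {δ : M →ₗ[k] M ⊗[k] M} {δ' : N →ₗ[k] N ⊗[k] N} {p : M →ₗ[k] N}
    (hp : Function.Surjective p) (h : IsCoalgHom δ δ' p)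
    (hδ : (LinearMap.id + cyc k M + cyc k M ∘ₗ cyc k M) ∘ₗ iterLeft δ = 0) :
    (LinearMap.id + cyc k N + cyc k N ∘ₗ cyc k N) ∘ₗ iterLeft δ' = 0 := by
  have h1 : ∀ w, cyc k N (TensorProduct.map p (TensorProduct.map p p) w) =
      TensorProduct.map p (TensorProduct.map p p) (cyc k M w) := by
    intro w
    have : cyc k N ∘ₗ TensorProduct.map p (TensorProduct.map p p) =
        TensorProduct.map p (TensorProduct.map p p) ∘ₗ cyc k M :=
      TensorProduct.ext_threefold' fun x y z => rfl
    exact DFunLike.congr_fun this w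
  have h2 : ∀ x, δ' (p x) = TensorProduct.map p p (δ x) := fun x => (DFunLike.congr_fun h x).symm
  have h3 : ∀ x, iterLeft δ' (p x) =
      TensorProduct.map p (TensorProduct.map p p) (iterLeft δ x) := by
    intro x
    have h4 : ∀ z : M ⊗[k] M, TensorProduct.assoc k N N N
        (δ'.rTensor N (TensorProduct.map p p z)) =
        TensorProduct.map p (TensorProduct.map p p)
          (TensorProduct.assoc k M M M (δ.rTensor M z)) := by
      intro z
      induction z with
      | zero => simp
      | add z z' hz hz' => simp only [map_add, hz, hz']
      | tmul x y =>
        rw [TensorProduct.map_tmul, LinearMap.rTensor_tmul, LinearMap.rTensor_tmul, h2]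
        induction δ x with
        | zero => simp
        | add z z' hz hz' => simp only [map_add, TensorProduct.add_tmul, hz, hz']
        | tmul x y => rfl
    change TensorProduct.assoc k N N N (δ'.rTensor N (δ' (p x))) = _
    rw [h2, h4]
    rfl
  refine LinearMap.ext fun y => ?_
  obtain ⟨x, rfl⟩ := hp y
  have h5 := congrArg (TensorProduct.map p (TensorProduct.map p p)) (DFunLike.congr_fun hδ x)
  rw [LinearMap.zero_apply, map_zero] at h5
  rw [LinearMap.zero_apply, ← h5, LinearMap.comp_apply, LinearMap.comp_apply, h3]
  simp only [LinearMap.add_apply, LinearMap.comp_apply, LinearMap.id_apply, map_add, h1]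

theorem IsCoalgHom.antisymm {δ : M →ₗ[k] M ⊗[k] M} {δ' : N →ₗ[k] N ⊗[k] N} {f : M →ₗ[k] N}
    (h : IsCoalgHom δ δ' f) :
    IsCoalgHom (Necklaces.antisymm k M ∘ₗ δ) (Necklaces.antisymm k N ∘ₗ δ') f := by
  refine LinearMap.ext fun x => ?_
  have := DFunLike.congr_fun h x
  simp only [LinearMap.comp_apply] at this ⊢
  rw [map_antisymm, this]

/-- A homomorphism descends along a surjective homomorphism. -/
theorem IsCoalgHom.of_surjective {M' N' : Type*} [AddCommGroup M'] [Module k M'] [AddCommGroup N']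
    [Module k N'] {δ : M →ₗ[k] M ⊗[k] M} {δ' : N →ₗ[k] N ⊗[k] N} {γ : M' →ₗ[k] M' ⊗[k] M'}
    {γ' : N' →ₗ[k] N' ⊗[k] N'} {f : M →ₗ[k] N} {g : M' →ₗ[k] N'} {p : M →ₗ[k] M'}
    {q : N →ₗ[k] N'} (hp : Function.Surjective p) (hf : IsCoalgHom δ δ' f) (hδ : IsCoalgHom δ γ p)
    (hδ' : IsCoalgHom δ' γ' q) (h : ∀ x, g (p x) = q (f x)) : IsCoalgHom γ γ' g := by
  refine LinearMap.ext fun y => ?_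
  obtain ⟨x, rfl⟩ := hp y
  have h1 : γ (p x) = _ := (DFunLike.congr_fun hδ x).symm
  have h2 : γ' (q (f x)) = _ := (DFunLike.congr_fun hδ' (f x)).symm
  have h3 : δ' (f x) = _ := (DFunLike.congr_fun hf x).symm
  rw [LinearMap.comp_apply, LinearMap.comp_apply, h, h1, h2]
  simp only [LinearMap.comp_apply]
  rw [h3, LinearMap.comp_apply]
  induction δ x with
  | zero => simp
  | add z z' hz hz' => simp only [map_add, hz, hz']
  | tmul x y => simp [h]

end Antisymmetrization

/-! ### From rooted to oriented trees -/

section Components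

variable {I : Type*} [Quiver I]

theorem OTree.comp_equiv {X Y : OTree I} {f : X.1.graph ≃g Y.1.graph} (h : OTree.IsIso X Y f)
    {H : Set (Sym2 X.1.V)} {H' : Set (Sym2 Y.1.V)} {w : X.1.V} {w' : Y.1.V}
    (hH : ∀ a b, s(a, b) ∈ H ↔ s(f a, f b) ∈ H')
    (hw : (Y.1.graph.deleteEdges H').Reachable w' (f w)) : X.comp H w ≈ Y.comp H' w' := by
  let F : X.1.graph.deleteEdges H ≃g Y.1.graph.deleteEdges H' :=
    { toEquiv := f.toEquiv
      map_rel_iff' := by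
        intro a b
        rw [SimpleGraph.deleteEdges_adj, SimpleGraph.deleteEdges_adj, hH]
        exact and_congr_left fun _ => f.map_adj_iff }
  have hR : ∀ v, (X.1.graph.deleteEdges H).Reachable w v ↔
      (Y.1.graph.deleteEdges H').Reachable w' (f v) := fun v =>
    (F.reachable_iff (u := w) (v := v)).symm.trans ⟨hw.trans, hw.symm.trans⟩
  let E : (X.comp H w).1.V ≃ (Y.comp H' w').1.V := f.toEquiv.subtypeEquiv hR
  refine ⟨⟨E, fun {a b} => F.map_adj_iff (v := a.1) (w := b.1)⟩, fun v v' => ?_,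
    fun v a b c => h.ribbon v.1 _ _ _, fun v => h.label v.1⟩
  exact and_congr (h.orient _ _) (F.map_adj_iff (v := v.1) (w := v'.1)).symm

theorem OTree.comp_equiv_of_reachable (X : OTree I) {H : Set (Sym2 X.1.V)} {w w' : X.1.V}
    (h : (X.1.graph.deleteEdges H).Reachable w' w) : X.comp H w ≈ X.comp H w' :=
  OTree.comp_equiv (f := .refl) ⟨fun _ _ => Iff.rfl, fun _ _ _ _ => Iff.rfl, fun _ => rfl⟩
    (fun _ _ => Iff.rfl) h

variable (k : Type*) [CommRing k]

theorem OTree.el_eq_of_equiv {X Y : OTree I} (h : X ≈ Y) : X.el k = Y.el k :=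
  congrArg (fun c => Finsupp.single c 1) (Quotient.sound h)

theorem rhoOrFun_congr {X Y : OTree I} (h : X ≈ Y) : rhoOrFun k X = rhoOrFun k Y := by
  obtain ⟨f, hf⟩ := h
  refine Fintype.sum_equiv ((f.toEquiv.prodCongr f.toEquiv).subtypeEquiv fun p => hf.orient _ _)
    _ _ fun p => ?_
  have hH : ∀ a b, s(a, b) ∈ ({s(p.1.1, p.1.2)} : Set (Sym2 X.1.V)) ↔
      s(f a, f b) ∈ ({s(f p.1.1, f p.1.2)} : Set (Sym2 Y.1.V)) := by
    intro a b
    rw [Set.mem_singleton_iff, Set.mem_singleton_iff]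
    exact (Sym2.map.injective f.injective).eq_iff.symm
  rw [OTree.el_eq_of_equiv k (OTree.comp_equiv hf hH (w := p.1.1) (.refl _)),
    OTree.el_eq_of_equiv k (OTree.comp_equiv hf hH (w := p.1.2) (.refl _))]
  rfl

theorem rhoOr_el (X : OTree I) : rhoOr k I (X.el k) = rhoOrFun k X := by
  rw [rhoOr]
  refine (Finsupp.linearCombination_single k 1 _).trans ((one_smul k _).trans ?_)
  exact rhoOrFun_congr k (Quotient.mk_out X)

end Components

/-! ### Signs of rooted trees and their underlying oriented trees -/

namespace RTree

variable {I : Type*} [Quiver I]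

open Classical in
/-- The sign `(-1)^m`, where `m` is the number of edges which point away from the root. -/
def sgn (X : RTree I) : ℤ :=
  have := Fintype.ofFinite X.1.V
  ∏ v : X.1.V, if X.data.dn v then -1 else 1

open Classical in
theorem sgn_eq (X : RTree I) [Fintype X.1.V] :
    X.sgn = ∏ v : X.1.V, if X.data.dn v then -1 else 1 := by
  rw [sgn]
  congr!

theorem sgn_mul_self (X : RTree I) : X.sgn * X.sgn = 1 := by
  classical
  rw [sgn, ← Finset.prod_mul_distrib]
  exact Finset.prod_eq_one fun v _ => by split <;> rfl

theorem not_dn_root (X : RTree I) : ¬ X.data.dn X.1.root := fun ⟨_, h, _⟩ =>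
  RootedTree.not_child_root _ h

theorem sgn_congr {X Y : RTree I} (h : X ≈ Y) : X.sgn = Y.sgn := by
  classical
  have := Fintype.ofFinite X.1.V
  have := Fintype.ofFinite Y.1.V
  obtain ⟨f, hf⟩ := h
  rw [sgn_eq, sgn_eq]
  refine Fintype.prod_equiv f.toEquiv _ _ fun v => ?_
  by_cases hv : v = X.1.root
  · subst hv
    have h1 : ¬ Y.data.dn (f.toEquiv X.1.root) := by
      change ¬ Y.data.dn (f X.1.root)
      rw [hf.root]
      exact Y.not_dn_root
    rw [if_neg X.not_dn_root, if_neg h1]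
  · obtain ⟨u, hu⟩ := RootedTree.exists_child hv
    exact if_congr ((isEmb_of_isIso hf).dn u v hu) rfl rfl

-- The sign is a product over edges; cutting `e` distributes the other edges over the two components
-- and leaves the factor of `e` itself.
open Classical in
open Necklaces.RootedTree in
theorem sgn_eq_mul (X : RTree I) (e : X.1.graph.edgeSet) :
    X.sgn = (if X.data.dn (X.1.far e) then -1 else 1) *
      (X.comp {e.1} (X.1.far e)).sgn * (X.comp {e.1} X.1.root).sgn := by
  have := Fintype.ofFinite X.1.V
  obtain ⟨u, h1, h2⟩ := far_spec e
  have htop : X.1.IsTop {e.1} (X.1.far e) := isTop_of_child h1 h2.symm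
  have h3 : ∀ v, ¬ (X.1.graph.deleteEdges {e.1}).Reachable (X.1.far e) v ↔
      (X.1.graph.deleteEdges {e.1}).Reachable X.1.root v := by
    intro v
    rw [h2, reachable_below h1, reachable_above h1]
  let : Fintype (X.comp {e.1} (X.1.far e)).1.V := Subtype.fintype _
  let : Fintype (X.comp {e.1} X.1.root).1.V := Subtype.fintype _
  rw [sgn_eq, sgn_eq, sgn_eq, ← Fintype.prod_subtype_mul_prod_subtype
    (fun v => (X.1.graph.deleteEdges {e.1}).Reachable (X.1.far e) v)]
  refine congrArg₂ (· * ·) ?_ ?_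
  -- The factor of `e` is spread as a product concentrated at the root of the branch: in `X` this
  -- vertex carries the sign of `e`, in the branch it has no parent and carries `1`.
  · rw [← Fintype.prod_ite_eq (X.comp {e.1} (X.1.far e)).1.root
      (fun _ => if X.data.dn (X.1.far e) then (-1 : ℤ) else 1), ← Finset.prod_mul_distrib]
    refine Finset.prod_congr rfl fun (v : (X.comp {e.1} (X.1.far e)).1.V) _ => ?_
    by_cases hv : (X.comp {e.1} (X.1.far e)).1.root = v
    · subst hv
      rw [if_pos rfl, if_neg (not_dn_root _), mul_one]
      rfl
    · obtain ⟨y, hy⟩ := exists_child (Ne.symm hv)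
      rw [if_neg hv, one_mul]
      exact if_congr ((X.isEmb_comp htop).dn _ _ hy).symm rfl rfl
  · refine Fintype.prod_equiv (Equiv.subtypeEquivRight h3) _ _ fun v => ?_
    by_cases hv : Equiv.subtypeEquivRight h3 v = (X.comp {e.1} X.1.root).1.root
    · have hv' : v.1 = X.1.root := congrArg Subtype.val hv
      rw [hv, hv', if_neg (not_dn_root _), if_neg (not_dn_root _)]
    · obtain ⟨y, hy⟩ := exists_child (T := (X.comp {e.1} X.1.root).1) hv
      exact if_congr ((X.isEmb_comp (isTop_root _)).dn _ _ hy).symm rfl rfl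

/-- All vertices are labelled by closed paths. -/
def IsClosed (X : RTree I) : Prop := ∀ v, (X.2.label v).IsClosed

/-- The oriented tree with structure which underlies a rooted tree labelled by closed paths. -/
def forget (X : RTree I) (h : X.IsClosed) : OTree I :=
  ⟨{ V := X.1.V
     graph := X.1.graph
     isTree := X.1.isTree
     orient := X.2.orient },
    { ribbon := X.2.ribbon
      label := fun v => Necklace.of (X.2.label v) (h v) }⟩

theorem IsClosed.comp {X : RTree I} (h : X.IsClosed) (H : Set (Sym2 X.1.V)) (w : X.1.V) :
    (X.comp H w).IsClosed := fun v => h v.1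

theorem IsClosed.of_equiv {X Y : RTree I} (h : X.IsClosed) (hXY : X ≈ Y) : Y.IsClosed := by
  obtain ⟨f, hf⟩ := hXY
  intro v
  obtain ⟨v, rfl⟩ := f.surjective v
  rw [← hf.label]
  exact h v

theorem forget_congr {X Y : RTree I} (h : X.IsClosed) (h' : Y.IsClosed) (hXY : X ≈ Y) :
    X.forget h ≈ Y.forget h' := by
  obtain ⟨f, hf⟩ := hXY
  refine ⟨f, hf.orient, hf.ribbon, fun v => ?_⟩
  change Necklace.of (X.2.label v) (h v) = Necklace.of (Y.2.label (f v)) (h' (f v))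
  congr 1
  exact hf.label v

/-- Any vertex may serve as root, any edge at it as initial edge, and any representatives as labels.
-/
theorem exists_forget (Y : OTree I) : ∃ (X : RTree I) (h : X.IsClosed), X.forget h ≈ Y := by
  obtain ⟨r⟩ := Y.1.isTree.1.nonempty
  have hL : ∃ L, IsCorner (Y.2.ribbon r) L := by
    rcases isEmpty_or_nonempty (Y.1.graph.neighborSet r) with hE | ⟨⟨p⟩⟩
    · exact ⟨linComap (fun x => (hE.false x).elim) (fun x => (hE.false x).elim)
        (inferInstance : LinearOrder ℕ), fun x => (hE.false x).elim⟩
    · exact ⟨_, isCorner_cutAt _ p⟩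
  obtain ⟨L, hL⟩ := hL
  refine ⟨⟨⟨Y.1.V, Y.1.graph, Y.1.isTree, r⟩,
    ⟨Y.2.ribbon, L, hL, Y.1.orient, fun v => (Quotient.out (Y.2.label v)).1⟩⟩,
    fun v => (Quotient.out (Y.2.label v)).2, .refl, fun _ _ => Iff.rfl, fun _ _ _ _ => Iff.rfl,
    fun v => Quotient.out_eq _⟩

end RTree

/-! ### From rooted to oriented trees, and the Lie coalgebra of oriented trees -/

section ToOriented

variable (k : Type*) [CommRing k] (I : Type*) [Quiver I]

open Classical in
/-- The signed sum of the oriented trees which underlie rooted trees; trees with labels which are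
not closed are mapped to zero. -/
def toOr : TRt k I →ₗ[k] TOr k I :=
  Finsupp.linearCombination k (Quotient.lift (fun X : RTree I =>
    if h : X.IsClosed then ((X.sgn : ℤ) : k) • (X.forget h).el k else 0) (fun X Y hXY => by
      by_cases h : X.IsClosed
      · have h' := h.of_equiv hXY
        rw [dif_pos h, dif_pos h', RTree.sgn_congr hXY,
          OTree.el_eq_of_equiv k (RTree.forget_congr h h' hXY)]
      · rw [dif_neg h, dif_neg fun h' => h (RTree.IsClosed.of_equiv h' (Setoid.symm hXY))]))

variable {I}

theorem toOr_el {X : RTree I} (h : X.IsClosed) :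
    toOr k I (X.el k) = ((X.sgn : ℤ) : k) • (X.forget h).el k :=
  (Finsupp.linearCombination_single k 1 _).trans ((one_smul k _).trans (dif_pos h))

theorem toOr_el_of_not {X : RTree I} (h : ¬ X.IsClosed) : toOr k I (X.el k) = 0 :=
  (Finsupp.linearCombination_single k 1 _).trans ((one_smul k _).trans (dif_neg h))

variable (I)

theorem toOr_surjective : Function.Surjective (toOr k I) := by
  rw [← LinearMap.range_eq_top, ← top_le_iff, ← span_basis, Submodule.span_le]
  rintro _ ⟨c, rfl⟩
  induction c using Quotient.ind with
  | _ Y =>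
    obtain ⟨X, h, hX⟩ := RTree.exists_forget Y
    refine ⟨((X.sgn : ℤ) : k) • X.el k, ?_⟩
    rw [map_smul, toOr_el k h, smul_smul, ← Int.cast_mul, X.sgn_mul_self, Int.cast_one, one_smul]
    exact OTree.el_eq_of_equiv k hX

variable {I}

-- In the rooted convention the far component comes first; in the oriented one the component from
-- which the edge points comes first. They disagree exactly for edges pointing away from the root,
-- and each such edge contributes `-1` to `sgn`.
open Necklaces.RootedTree in
theorem toOr_comp (X : RTree I) :
    TensorProduct.map (toOr k I) (toOr k I) (antisymm k _ (rhoRtFun k X)) =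
      rhoOr k I (toOr k I (X.el k)) := by
  classical
  rw [map_antisymm, rhoRtFun, map_sum, map_sum]
  by_cases h : X.IsClosed
  · rw [toOr_el k h, map_smul, rhoOr_el, rhoOrFun, Finset.smul_sum]
    symm
    refine Fintype.sum_bijective (fun p => ⟨s(p.1.1, p.1.2), X.2.orient.adj_of_arr p.2⟩)
      ⟨?_, ?_⟩ _ _ fun p => ?_
    · rintro ⟨⟨a, b⟩, hp⟩ ⟨⟨a', b'⟩, hp'⟩ hpp
      rcases Sym2.eq_iff.1 (congrArg Subtype.val hpp) with ⟨h1, h2⟩ | ⟨h1, h2⟩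
      · exact Subtype.ext (Prod.ext h1 h2)
      · change a = b' at h1
        change b = a' at h2
        subst h1 h2
        exact (X.2.orient.asymm hp hp').elim
    · rintro ⟨e, he⟩
      induction e using Sym2.ind with
      | _ x y =>
      rcases X.2.orient.arr_or_arr he with h1 | h1
      · exact ⟨⟨(x, y), h1⟩, rfl⟩
      · exact ⟨⟨(y, x), h1⟩, Subtype.ext Sym2.eq_swap⟩
    · obtain ⟨⟨a, b⟩, hp⟩ := p
      have hadj : X.1.graph.Adj a b := X.2.orient.adj_of_arr hp
      change X.2.orient.arr a b at hp
      -- Here `s` is the sign of `e`. As `X.sgn` is `s` times the signs of the two components,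
      -- multiplying it by `s` once more leaves their product.
      have key : ∀ (e : X.1.graph.edgeSet) (s : ℤ) (u : X.1.V),
          (if X.data.dn (X.1.far e) then (-1 : ℤ) else 1) = s → X.1.Child u (X.1.far e) →
          e.1 = s(u, X.1.far e) →
          antisymm k _ (TensorProduct.map (toOr k I) (toOr k I)
            ((X.comp {e.1} (X.1.far e)).el k ⊗ₜ (X.comp {e.1} X.1.root).el k)) =
          ((X.sgn : ℤ) : k) • ((s : ℤ) : k) • antisymm k _
            (((X.forget h).comp {e.1} (X.1.far e)).el k ⊗ₜ ((X.forget h).comp {e.1} u).el k) := by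
        intro e s u hs hu he
        have h1 : (X.forget h).comp {e.1} X.1.root ≈ (X.forget h).comp {e.1} u := by
          refine OTree.comp_equiv_of_reachable _ (SimpleGraph.Reachable.symm ?_)
          change (X.1.graph.deleteEdges {e.1}).Reachable X.1.root u
          rw [he, reachable_above hu]
          exact fun h1 => absurd h1.depth_le (by have := hu.depth_eq; omega)
        have hss : s * s = 1 := by rw [← hs]; split <;> rfl
        rw [TensorProduct.map_tmul, toOr_el k (h.comp _ _), toOr_el k (h.comp _ _),
          ← OTree.el_eq_of_equiv k h1, TensorProduct.smul_tmul_smul, map_smul, smul_smul,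
          X.sgn_eq_mul e, hs, ← Int.cast_mul, ← Int.cast_mul]
        refine congrArg₂ (fun (c : ℤ) z => (c : k) • antisymm k _ z) ?_ rfl
        linear_combination (-(X.comp {e.1} (X.1.far e)).sgn * (X.comp {e.1} X.1.root).sgn) * hss
      rcases child_or_child hadj with hc | hc
      · have hf := far_eq hc
        have h1 := key ⟨s(a, b), hadj⟩ (-1) a
          (by rw [hf]; exact if_pos ((X.data_dn_iff hc).2 hp)) (by rwa [hf]) (by rw [hf])
        refine Eq.trans ?_ h1.symm
        rw [hf]
        exact congrArg (_ • ·) (neg_one_smul_antisymm _ _).symm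
      · have he : (⟨s(a, b), hadj⟩ : X.1.graph.edgeSet) = ⟨s(b, a), hc.adj⟩ :=
          Subtype.ext Sym2.eq_swap
        have hf : X.1.far ⟨s(a, b), hadj⟩ = a := by rw [he]; exact far_eq hc
        have h1 := key ⟨s(a, b), hadj⟩ 1 b
          (by
            rw [hf]
            exact if_neg fun h2 => X.2.orient.asymm hp ((X.data_dn_iff hc).1 h2))
          (by rwa [hf]) (by rw [hf]; exact Sym2.eq_swap)
        refine Eq.trans ?_ h1.symm
        rw [hf]
        exact congrArg (_ • ·) (one_smul_antisymm _ _).symm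
  · rw [toOr_el_of_not k h, map_zero]
    refine Finset.sum_eq_zero fun e _ => ?_
    rw [TensorProduct.map_tmul]
    -- A label which is not closed survives in one of the two components, and that factor is mapped
    -- to zero.
    obtain ⟨v, hv⟩ := not_forall.1 h
    obtain ⟨u, h1, h2⟩ := far_spec e
    by_cases hd : X.1.Desc (X.1.far e) v
    · have hr : (X.1.graph.deleteEdges {e.1}).Reachable (X.1.far e) v := by
        rw [h2]
        exact (reachable_below h1 v).2 hd
      rw [toOr_el_of_not k (X := X.comp {e.1} (X.1.far e)) fun hc => hv (hc ⟨v, hr⟩),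
        TensorProduct.zero_tmul, map_zero]
    · have hr : (X.1.graph.deleteEdges {e.1}).Reachable X.1.root v := by
        rw [h2]
        exact (reachable_above h1 v).2 hd
      rw [toOr_el_of_not k (X := X.comp {e.1} X.1.root) fun hc => hv (hc ⟨v, hr⟩),
        TensorProduct.tmul_zero, map_zero]

variable (I)

theorem isCoalgHom_toOr : IsCoalgHom (antisymm k _ ∘ₗ rhoRt k I) (rhoOr k I) (toOr k I) := by
  refine Finsupp.lhom_ext' fun c => LinearMap.ext_ring ?_
  induction c using Quotient.ind with
  | _ X =>
    refine Eq.trans ?_ (toOr_comp k X)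
    rw [← rhoRt_el]
    rfl

theorem mem_span_wedge {M : Type*} [AddCommGroup M] [Module k M] (x y : M) :
    x ⊗ₜ[k] y - y ⊗ₜ x ∈
      Submodule.span k (Set.range (fun p : M × M => p.1 ⊗ₜ[k] p.2 - p.2 ⊗ₜ[k] p.1)) :=
  Submodule.subset_span ⟨(x, y), rfl⟩

/-- Oriented trees form a Lie coalgebra. -/
theorem isLieCoalgebra_rhoOr : IsLieCoalgebra (rhoOr k I) where
  skew x := by
    rw [rhoOr, Finsupp.linearCombination_apply]
    exact Submodule.sum_mem _ fun c _ => Submodule.smul_mem _ _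
      (Submodule.sum_mem _ fun p _ => mem_span_wedge k _ _)
  coJacobi := coJacobi_of_surjective (toOr_surjective k I) (isCoalgHom_toOr k I)
    (isPreLieCoalgebra_rhoRt k I).coJacobi

/-- The label of an oriented tree with one vertex; zero for other trees. -/
def trunkOr : TOr k I →ₗ[k] NecklaceModule k I :=
  Finsupp.linearCombination k (Quotient.lift (fun X : OTree I =>
    -- An oriented tree has no distinguished vertex; the sum over its only vertex avoids choosing
    -- one.
    if Nat.card X.1.V = 1 then ∑ᶠ v, (X.2.label v).el k else 0) (fun X Y h => by
      obtain ⟨f, hf⟩ := h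
      rw [Nat.card_congr f.toEquiv]
      refine if_congr Iff.rfl ?_ rfl
      refine finsum_eq_of_bijective f f.bijective fun v => ?_
      rw [hf.label]))

variable {I}

theorem trunkOr_el (X : OTree I) :
    trunkOr k I (X.el k) = if Nat.card X.1.V = 1 then ∑ᶠ v, (X.2.label v).el k else 0 :=
  (Finsupp.linearCombination_single k 1 _).trans (one_smul k _)

end ToOriented

/-! ### Nested families of intervals and their rotations -/

section Nests

variable {V : Type*}

/-- The interval of `v` lies inside the interval of `u`. -/
def Inside (lo hi : V → ℕ) (u v : V) : Prop := lo u < lo v ∧ hi v < hi u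

/-- The interval of `v` lies immediately inside the interval of `u`. -/
def ImmInside (lo hi : V → ℕ) (u v : V) : Prop :=
  Inside lo hi u v ∧ ∀ w, ¬ (Inside lo hi u w ∧ Inside lo hi w v)

/-- The position `m` is in the interval of `u`, but not in an interval inside it. -/
def InGap (lo hi : V → ℕ) (u : V) (m : ℕ) : Prop :=
  -- Ends of intervals are counted from `1`, letters from `0`, so the letter `m` sits at `m + 1`.
  -- This leaves `0` and `n + 2` for the ends of the outermost interval.
  (lo u ≤ m ∧ m + 1 < hi u) ∧ ∀ w, Inside lo hi u w → ¬ (lo w ≤ m + 1 ∧ m + 1 ≤ hi w)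

/-- A non-crossing family of intervals with disjoint ends, with outermost interval `[0, n + 2]`. -/
structure IsNest (n : ℕ) (lo hi : V → ℕ) (r : V) : Prop where
  lo_root : lo r = 0
  hi_root : hi r = n + 2
  lt : ∀ v, lo v < hi v
  le : ∀ v, v ≠ r → 1 ≤ lo v ∧ hi v ≤ n + 1
  disj : ∀ u v, u ≠ v → lo u ≠ lo v ∧ hi u ≠ hi v ∧ lo u ≠ hi v ∧
    ¬ (lo u < lo v ∧ lo v < hi u ∧ hi u < hi v)

/-- The rotation of a nested family in which no interval begins with the first position. -/
structure IsShiftedNest (n : ℕ) (lo hi lo' hi' : V → ℕ) (r : V) : Prop where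
  ne_one : ∀ v, lo v ≠ 1
  lo_root : lo' r = 0
  hi_root : hi' r = n + 2
  of_ne : ∀ v, v ≠ r → lo' v = lo v - 1 ∧ hi' v = hi v - 1

/-- The rotation of a nested family in which the interval of `z` begins with the first position. -/
structure IsRotatedNest (n : ℕ) (lo hi lo' hi' : V → ℕ) (r z : V) : Prop where
  ne : z ≠ r
  lo_eq : lo z = 1
  lo_root : lo' r = hi z - 1
  hi_root : hi' r = n + 1
  lo_first : lo' z = 0
  hi_first : hi' z = n + 2
  of_ne : ∀ v, v ≠ r → v ≠ z → lo' v = lo v - 1 ∧ hi' v = hi v - 1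

variable {n : ℕ} {lo hi lo' hi' : V → ℕ} {r z : V}

theorem ImmInside.eq (h : IsNest n lo hi r) {u u' v : V} (hu : ImmInside lo hi u v)
    (hu' : ImmInside lo hi u' v) : u = u' := by
  by_contra hne
  have h1 := h.disj u u' hne
  have h2 := h.disj u' u (Ne.symm hne)
  have h3 := hu.2 u'
  have h4 := hu'.2 u
  have h5 := h.lt v
  obtain ⟨h6, h7⟩ := hu.1
  obtain ⟨h8, h9⟩ := hu'.1
  unfold Inside at h3 h4
  omega

namespace IsShiftedNest

theorem lo_lt_iff (hn : IsNest n lo hi r) (h : IsShiftedNest n lo hi lo' hi' r) (u v : V) :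
    lo' u < lo' v ↔ lo u < lo v := by
  by_cases hu : u = r <;> by_cases hv : v = r <;> subst_vars
  · simp
  · have := h.of_ne v hv; have := hn.le v hv; have := h.ne_one v
    rw [h.lo_root, hn.lo_root]; omega
  · rw [h.lo_root, hn.lo_root]; omega
  · have := h.of_ne v hv; have := hn.le v hv; have := h.ne_one v
    have := h.of_ne u hu; have := hn.le u hu; have := h.ne_one u
    omega

theorem inside_iff (hn : IsNest n lo hi r) (h : IsShiftedNest n lo hi lo' hi' r) (u v : V) :
    Inside lo' hi' u v ↔ Inside lo hi u v := by
  unfold Inside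
  rw [h.lo_lt_iff hn]
  refine and_congr_right fun h1 => ?_
  by_cases hv : v = r
  · subst hv
    rw [hn.lo_root] at h1
    omega
  · have := h.of_ne v hv; have := hn.le v hv; have := hn.lt v
    by_cases hu : u = r
    · subst hu
      rw [h.hi_root, hn.hi_root]
      omega
    · have := h.of_ne u hu; have := hn.le u hu; have := hn.lt u
      omega

theorem immInside_iff (hn : IsNest n lo hi r) (h : IsShiftedNest n lo hi lo' hi' r) (u v : V) :
    ImmInside lo' hi' u v ↔ ImmInside lo hi u v := by
  unfold ImmInside
  simp only [h.inside_iff hn]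

theorem inGap_iff (hn : IsNest n lo hi r) (h : IsShiftedNest n lo hi lo' hi' r) (u : V) {m : ℕ}
    (hm : m < n) : InGap lo' hi' u m ↔ InGap lo hi u (m + 1) := by
  unfold InGap
  simp only [h.inside_iff hn]
  refine and_congr ?_ (forall_congr' fun w => imp_congr_right fun hw => not_congr ?_)
  · by_cases hu : u = r
    · subst hu
      rw [h.lo_root, h.hi_root, hn.lo_root, hn.hi_root]
      omega
    · have := h.of_ne u hu; have := hn.le u hu; have := hn.lt u
      omega
  · have hw' : w ≠ r := by
      rintro rfl
      have := hw.1
      rw [hn.lo_root] at this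
      omega
    have := h.of_ne w hw'; have := hn.le w hw'; have := hn.lt w
    omega

theorem inGap_zero (hn : IsNest n lo hi r) (h : IsShiftedNest n lo hi lo' hi' r) (u : V) :
    InGap lo hi u 0 ↔ u = r := by
  constructor
  · intro h1
    by_contra hu
    have := hn.le u hu
    have := h1.1.1
    omega
  · rintro rfl
    refine ⟨⟨hn.lo_root.le, by rw [hn.hi_root]; omega⟩, fun w hw => ?_⟩
    have := hw.1
    have := h.ne_one w
    rw [hn.lo_root] at *
    omega

theorem inGap_last (hn : IsNest n lo hi r) (h : IsShiftedNest n lo hi lo' hi' r) (u : V) :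
    InGap lo' hi' u n ↔ u = r := by
  constructor
  · intro h1
    by_contra hu
    have := hn.le u hu
    have := h.of_ne u hu
    have := h1.1.2
    omega
  · rintro rfl
    refine ⟨⟨by rw [h.lo_root]; omega, by rw [h.hi_root]; omega⟩, fun w hw => ?_⟩
    have hw' : w ≠ u := by
      rintro rfl
      exact lt_irrefl _ hw.1
    have := hn.le w hw'
    have := h.of_ne w hw'
    have := hn.lt w
    omega

end IsShiftedNest

namespace IsRotatedNest

theorem immInside_root (hn : IsNest n lo hi r) (h : IsRotatedNest n lo hi lo' hi' r z) :
    ImmInside lo hi r z := by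
  have h1 := hn.lo_root
  have h2 := hn.hi_root
  have h3 := hn.le z h.ne
  have h4 := h.lo_eq
  refine ⟨⟨by omega, by omega⟩, fun w hw => ?_⟩
  have h5 := hw.1.1
  have h6 := hw.2.1
  omega

/-- The rotation interchanges `r` and `z`: the complement of the interval of `z` becomes an
interval, that of the old outermost member, and `z` becomes the outermost one. -/
theorem immInside_first (hn : IsNest n lo hi r) (h : IsRotatedNest n lo hi lo' hi' r z) :
    ImmInside lo' hi' z r := by
  have h1 := h.lo_first
  have h2 := h.hi_first
  have h3 := h.lo_root
  have h4 := h.hi_root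
  have h5 := hn.lt z
  have h6 := h.lo_eq
  refine ⟨⟨by omega, by omega⟩, fun w hw => ?_⟩
  have h7 := hw.1.2
  have h8 := hw.2.2
  omega

/-- All other members keep their parent, even if it is `r` or `z`, whose own intervals change. -/
theorem immInside_of (hn : IsNest n lo hi r) (h : IsRotatedNest n lo hi lo' hi' r z) {u v : V}
    (hr : v ≠ r) (hz : v ≠ z) (huv : ImmInside lo hi u v) : ImmInside lo' hi' u v := by
  have a1 := hn.lo_root
  have a2 := hn.hi_root
  have a3 := h.lo_eq
  have a4 := h.lo_root
  have a5 := h.hi_root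
  have a6 := h.lo_first
  have a7 := h.hi_first
  have a8 := hn.le z h.ne
  have a9 := hn.lt z
  have v1 := h.of_ne v hr hz
  have v2 := hn.le v hr
  have v3 := hn.lt v
  have v4 := hn.disj v z hz
  have v5 := hn.disj z v (Ne.symm hz)
  obtain ⟨⟨e1, e2⟩, e3⟩ := huv
  have e4 := e3 z
  unfold Inside at e4
  have hin : Inside lo' hi' u v := by
    unfold Inside
    by_cases hu : u = r
    · subst hu
      omega
    · by_cases hu' : u = z
      · subst hu'
        omega
      · have := h.of_ne u hu hu'
        have := hn.le u hu
        omega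
  refine ⟨hin, fun w hw => e3 w ?_⟩
  unfold Inside at hw hin ⊢
  by_cases hwr : w = r
  · subst hwr
    by_cases hu' : u = z
    · subst hu'
      omega
    · have := h.of_ne u (by rintro rfl; omega) hu'
      have := hn.le u (by rintro rfl; omega)
      omega
  · by_cases hwz : w = z
    · subst hwz
      omega
    · have w1 := h.of_ne w hwr hwz
      have w2 := hn.le w hwr
      have w3 := hn.lt w
      have w4 := hn.disj w z hwz
      have w5 := hn.disj z w (Ne.symm hwz)
      by_cases hu : u = r
      · subst hu
        omega
      · by_cases hu' : u = z
        · subst hu'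
          omega
        · have := h.of_ne u hu hu'
          have := hn.le u hu
          omega

theorem inGap_iff (hn : IsNest n lo hi r) (h : IsRotatedNest n lo hi lo' hi' r z) (u : V) {m : ℕ}
    (hm : m < n) : InGap lo' hi' u m ↔ InGap lo hi u (m + 1) := by
  have a1 := hn.lo_root
  have a2 := hn.hi_root
  have a3 := h.lo_eq
  have a4 := h.lo_root
  have a5 := h.hi_root
  have a6 := h.lo_first
  have a7 := h.hi_first
  have a8 := hn.le z h.ne
  have a9 := hn.lt z
  have hcase : u = r ∨ u = z ∨ (u ≠ r ∧ u ≠ z ∧ (lo' u = lo u - 1 ∧ hi' u = hi u - 1) ∧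
      (1 ≤ lo u ∧ hi u ≤ n + 1) ∧ lo u < hi u) := by
    by_cases hu : u = r
    · exact Or.inl hu
    · by_cases hu' : u = z
      · exact Or.inr (Or.inl hu')
      · exact Or.inr (Or.inr ⟨hu, hu', h.of_ne u hu hu', hn.le u hu, hn.lt u⟩)
  unfold InGap Inside
  constructor
  · rintro ⟨h1, h2⟩
    have h3 := h2 r
    refine ⟨?_, fun w hw hc => ?_⟩
    · rcases hcase with rfl | rfl | hu <;> omega
    · have h4 := h2 w
      have hwr : w ≠ r := by
        rintro rfl
        omega
      by_cases hwz : w = z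
      · subst hwz
        rcases hcase with rfl | rfl | hu <;> omega
      · have w1 := h.of_ne w hwr hwz
        have w2 := hn.le w hwr
        have w3 := hn.lt w
        have w4 := hn.disj w z hwz
        have w5 := hn.disj z w (Ne.symm hwz)
        rcases hcase with rfl | rfl | hu <;> omega
  · rintro ⟨h1, h2⟩
    have h3 := h2 z
    refine ⟨?_, fun w hw hc => ?_⟩
    · rcases hcase with rfl | rfl | hu <;> omega
    · have h4 := h2 w
      have hwz : w ≠ z := by
        rintro rfl
        omega
      by_cases hwr : w = r
      · subst hwr
        rcases hcase with rfl | rfl | hu <;> omega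
      · have w1 := h.of_ne w hwr hwz
        have w2 := hn.le w hwr
        have w3 := hn.lt w
        have w4 := hn.disj w z hwz
        have w5 := hn.disj z w (Ne.symm hwz)
        rcases hcase with rfl | rfl | hu <;> omega

theorem not_inGap_zero (hn : IsNest n lo hi r) (h : IsRotatedNest n lo hi lo' hi' r z) (u : V) :
    ¬ InGap lo hi u 0 := by
  rintro ⟨h1, h2⟩
  have hu : u = r := by
    by_contra hu
    have := hn.le u hu
    omega
  subst hu
  have h3 := (h.immInside_root hn).1
  have h4 := h.lo_eq
  have h5 := hn.lt z
  exact h2 z h3 ⟨by omega, by omega⟩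

theorem not_inGap_last (hn : IsNest n lo hi r) (h : IsRotatedNest n lo hi lo' hi' r z) (u : V) :
    ¬ InGap lo' hi' u n := by
  rintro ⟨h1, h2⟩
  have hu : u = z := by
    by_contra hu
    by_cases hr : u = r
    · subst hr
      have := h.hi_root
      omega
    · have := hn.le u hr
      have := h.of_ne u hr hu
      omega
  subst hu
  have h3 := (h.immInside_first hn).1
  have h4 := h.hi_root
  have h5 := h.lo_root
  have h6 := hn.le u h.ne
  exact h2 r h3 ⟨by omega, by omega⟩

/-- At all vertices but one the order of the neighbours is preserved. -/
theorem lo_lt_iff (hn : IsNest n lo hi r) (h : IsRotatedNest n lo hi lo' hi' r z) {v x y : V}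
    (hv : v ≠ z) (hx : ImmInside lo hi v x ∨ ImmInside lo hi x v)
    (hy : ImmInside lo hi v y ∨ ImmInside lo hi y v) : lo' x < lo' y ↔ lo x < lo y := by
  have a1 := hn.lo_root
  have a2 := hn.hi_root
  have a3 := h.lo_eq
  have a4 := h.lo_root
  have a6 := h.lo_first
  have a8 := hn.le z h.ne
  have a9 := hn.lt z
  have key : ∀ y, (ImmInside lo hi v y ∨ ImmInside lo hi y v) →
      (ImmInside lo hi v r ∨ ImmInside lo hi r v) → y ≠ r → hi z < lo y ∧ y ≠ z := by
    intro y hy hr hyr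
    have b1 : ImmInside lo hi r v := by
      refine hr.resolve_left fun hr => ?_
      have := hr.1.1
      omega
    have b2 : ImmInside lo hi v y := by
      refine hy.resolve_right fun hy => hyr (hy.eq hn b1)
    have b3 := b1.2 z
    have b4 := hn.disj v z hv
    have b5 := hn.disj z v (Ne.symm hv)
    have b6 := (h.immInside_root hn).1
    obtain ⟨b7, b8⟩ := b1.1
    obtain ⟨b9, b10⟩ := b2.1
    have b11 := hn.lt y
    unfold Inside at b3 b6
    have : hi z < lo y := by omega
    refine ⟨this, ?_⟩
    rintro rfl
    omega
  by_cases hxr : x = r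
  · subst hxr
    by_cases hyr : y = x
    · subst hyr
      simp
    · have c1 := key y hy hx hyr
      have c2 := h.of_ne y hyr c1.2
      omega
  · by_cases hyr : y = r
    · subst hyr
      have c1 := key x hx hy hxr
      have c2 := h.of_ne x hxr c1.2
      omega
    · by_cases hxz : x = z <;> by_cases hyz : y = z
      · subst hxz hyz
        simp
      · subst hxz
        have c1 := h.of_ne y hyr hyz
        have c2 := hn.disj x y (Ne.symm hyz)
        have c3 := hn.le y hyr
        omega
      · subst hyz
        have c1 := h.of_ne x hxr hxz
        have c2 := hn.le x hxr
        omega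
      · have c1 := h.of_ne y hyr hyz
        have c2 := h.of_ne x hxr hxz
        have c3 := hn.le y hyr
        have c4 := hn.le x hxr
        omega

/-- At the vertex `z`, the root is moved from the first to the last place. -/
theorem lo_lt_iff_first (hn : IsNest n lo hi r) (h : IsRotatedNest n lo hi lo' hi' r z) {x y : V}
    (hx : ImmInside lo hi z x ∨ ImmInside lo hi x z)
    (hy : ImmInside lo hi z y ∨ ImmInside lo hi y z) :
    lo' x < lo' y ↔ (x ≠ r ∧ (y = r ∨ lo x < lo y)) := by
  have a1 := hn.lo_root
  have a3 := h.lo_eq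
  have a4 := h.lo_root
  have key : ∀ y, (ImmInside lo hi z y ∨ ImmInside lo hi y z) → y ≠ r →
      lo' y = lo y - 1 ∧ hi y < hi z ∧ 1 < lo y := by
    intro y hy hyr
    have b1 : ImmInside lo hi z y := hy.resolve_right fun hy => hyr (hy.eq hn (h.immInside_root hn))
    have b2 : y ≠ z := by
      rintro rfl
      exact lt_irrefl _ b1.1.1
    have := b1.1.1
    exact ⟨(h.of_ne y hyr b2).1, b1.1.2, by omega⟩
  by_cases hxr : x = r <;> by_cases hyr : y = r
  · subst hxr hyr
    simp
  · subst hxr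
    have := key y hy hyr
    have := hn.lt y
    simp only [ne_eq, not_true_eq_false, false_and, iff_false]
    omega
  · subst hyr
    have := key x hx hxr
    have := hn.lt x
    simp only [ne_eq, hxr, not_false_eq_true, true_or, and_self, iff_true]
    omega
  · have := key x hx hxr
    have := key y hy hyr
    rw [and_iff_right hxr, or_iff_right hyr]
    omega

end IsRotatedNest

end Nests

/-! ### Rotation of chord diagrams -/

section Rotation

/-- The effect on chords of moving the first letter of a word of length `n + 1` to its end. -/
def rotChord (n : ℕ) (c : ℕ × ℕ) : ℕ × ℕ :=
  -- The moved letter ends up in position `n`, so it turns from the left end of its chord into the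
  -- right end.
  if c.1 = 0 then (c.2 - 1, n) else (c.1 - 1, c.2 - 1)

theorem rotChord_of_eq {n : ℕ} {c : ℕ × ℕ} (h : c.1 = 0) : rotChord n c = (c.2 - 1, n) := if_pos h

theorem rotChord_of_ne {n : ℕ} {c : ℕ × ℕ} (h : c.1 ≠ 0) :
    rotChord n c = (c.1 - 1, c.2 - 1) := if_neg h

/-- The inverse of `rotChord`. -/
def unrotChord (n : ℕ) (c : ℕ × ℕ) : ℕ × ℕ := if c.2 = n then (0, c.1 + 1) else (c.1 + 1, c.2 + 1)

theorem rotChord_unrotChord {n : ℕ} {c : ℕ × ℕ} : rotChord n (unrotChord n c) = c := by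
  rcases c with ⟨i, j⟩
  by_cases h : j = n
  · subst h
    simp [rotChord, unrotChord]
  · simp [rotChord, unrotChord, h]

/-- The chords are disjoint and do not cross. -/
def Disjt (c d : ℕ × ℕ) : Prop :=
  (c.1 ≠ d.1 ∧ c.1 ≠ d.2 ∧ c.2 ≠ d.1 ∧ c.2 ≠ d.2) ∧ ¬ (c.1 < d.1 ∧ d.1 < c.2 ∧ c.2 < d.2) ∧
    ¬ (d.1 < c.1 ∧ c.1 < d.2 ∧ d.2 < c.2)

/-- Crossing is a property of chords of a circle, hence invariant under rotation. `Disjt` is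
symmetric in its arguments so that this can be stated for a pair in any order. -/
theorem disjt_rotChord {n : ℕ} {c d : ℕ × ℕ} (hc : c.1 < c.2 ∧ c.2 ≤ n) (hd : d.1 < d.2 ∧ d.2 ≤ n) :
    Disjt (rotChord n c) (rotChord n d) ↔ Disjt c d := by
  unfold Disjt
  by_cases h : c.1 = 0 <;> by_cases h' : d.1 = 0
  · rw [rotChord_of_eq h, rotChord_of_eq h']
    dsimp only
    omega
  · rw [rotChord_of_eq h, rotChord_of_ne h']
    dsimp only
    omega
  · rw [rotChord_of_ne h, rotChord_of_eq h']
    dsimp only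
    omega
  · rw [rotChord_of_ne h, rotChord_of_ne h']
    dsimp only
    omega

theorem rotChord_inj {n : ℕ} {c d : ℕ × ℕ} (hc : c.1 < c.2 ∧ c.2 ≤ n) (hd : d.1 < d.2 ∧ d.2 ≤ n)
    (h : rotChord n c = rotChord n d) : c = d := by
  have h1 := congrArg Prod.fst h
  have h2 := congrArg Prod.snd h
  refine Prod.ext ?_ ?_ <;> by_cases h3 : c.1 = 0 <;> by_cases h4 : d.1 = 0 <;>
    simp only [rotChord_of_eq, rotChord_of_ne, h3, h4, ne_eq, not_false_eq_true] at h1 h2 <;> omega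

variable {I : Type*} [Quiver I] {a : Arrow I} {l : List (Arrow I)} {H : Finset (ℕ × ℕ)}

theorem wordCut_iff : WordCut l H ↔
    (∀ c ∈ H, WordChord l c) ∧ ∀ c ∈ H, ∀ d ∈ H, c ≠ d → Disjt c d := by
  constructor
  · refine fun h => ⟨h.chord, fun c hc d hd hcd => ?_⟩
    have h1 := h.distinct c hc d hd hcd
    have h2 := h.distinct d hd c hc hcd.symm
    exact ⟨⟨h1.1, h1.2.1, h2.2.1.symm, h1.2.2⟩, h.noncrossing c hc d hd, h.noncrossing d hd c hc⟩
  · refine fun h => ⟨h.1, fun c hc d hd hcd => ?_, fun c hc d hd => ?_⟩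
    · have h1 := (h.2 c hc d hd hcd).1
      exact ⟨h1.1, h1.2.1, h1.2.2.2⟩
    · by_cases hcd : c = d
      · subst hcd
        exact fun h1 => lt_irrefl _ h1.1
      · exact (h.2 c hc d hd hcd).2.1

theorem star_star (a : Arrow I) : Arrow.star (Arrow.star a) = a := Sum.swap_swap a

theorem wordChord_rotChord {c : ℕ × ℕ} (hc : c.1 < c.2 ∧ c.2 ≤ l.length) :
    WordChord (l ++ [a]) (rotChord l.length c) ↔ WordChord (a :: l) c := by
  obtain ⟨i, j⟩ := c
  obtain ⟨j, rfl⟩ : ∃ j', j = j' + 1 := ⟨j - 1, by change i < j ∧ _ at hc; omega⟩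
  change i < j + 1 ∧ j + 1 ≤ l.length at hc
  unfold WordChord
  rcases i with _ | i
  · rw [rotChord_of_eq rfl]
    simp only [Nat.add_sub_cancel, List.getElem?_cons_zero, List.getElem?_cons_succ]
    rw [List.getElem?_append_left (by omega), List.getElem?_append_right le_rfl]
    simp only [Nat.sub_self, List.getElem?_cons_zero]
    constructor
    · rintro ⟨-, b, h1, h2⟩
      refine ⟨by omega, _, rfl, ?_⟩
      rw [Option.some_injective _ h2, star_star]
      exact h1
    · rintro ⟨-, b, h1, h2⟩
      refine ⟨by omega, _, h2, ?_⟩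
      rw [h1, star_star]
  · rw [rotChord_of_ne (Nat.succ_ne_zero i)]
    simp only [Nat.add_sub_cancel, List.getElem?_cons_succ]
    rw [List.getElem?_append_left (by omega), List.getElem?_append_left (by omega)]
    refine and_congr ⟨fun h => by omega, fun h => by omega⟩ Iff.rfl

theorem wordCut_image_rotChord (hH : ∀ c ∈ H, c.1 < c.2 ∧ c.2 ≤ l.length) :
    WordCut (l ++ [a]) (H.image (rotChord l.length)) ↔ WordCut (a :: l) H := by
  rw [wordCut_iff, wordCut_iff]
  simp only [Finset.forall_mem_image]
  refine and_congr (forall₂_congr fun c hc => wordChord_rotChord (hH c hc))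
    (forall₂_congr fun c hc => forall₂_congr fun d hd => ?_)
  refine imp_congr (not_congr ⟨rotChord_inj (hH c hc) (hH d hd), fun h => by rw [h]⟩)
    (disjt_rotChord (hH c hc) (hH d hd))

theorem WordCut.lt_le (h : WordCut (a :: l) H) : ∀ c ∈ H, c.1 < c.2 ∧ c.2 ≤ l.length := by
  intro c hc
  have := (h.chord c hc).lt_length
  rw [List.length_cons] at this
  omega

theorem exists_image_rotChord {H' : Finset (ℕ × ℕ)} (h : WordCut (l ++ [a]) H') :
    ∃ H, WordCut (a :: l) H ∧ H.image (rotChord l.length) = H' := by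
  have h1 : (H'.image (unrotChord l.length)).image (rotChord l.length) = H' := by
    rw [Finset.image_image]
    have : rotChord l.length ∘ unrotChord l.length = id := funext fun c => rotChord_unrotChord
    rw [this, Finset.image_id]
  refine ⟨H'.image (unrotChord l.length), (wordCut_image_rotChord ?_).1 (h1.symm ▸ h), h1⟩
  rw [Finset.forall_mem_image]
  intro c hc
  have := (h.chord c hc).lt_length
  rw [List.length_append, List.length_singleton] at this
  unfold unrotChord
  split_ifs
  · exact ⟨Nat.succ_pos _, by change c.1 + 1 ≤ _; omega⟩
  · exact ⟨by change c.1 + 1 < c.2 + 1; omega, by change c.2 + 1 ≤ _; omega⟩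

theorem image_rotChord_injective {H' : Finset (ℕ × ℕ)} (h : WordCut (a :: l) H)
    (h' : WordCut (a :: l) H')
    (he : H.image (rotChord l.length) = H'.image (rotChord l.length)) : H = H' := by
  have key : ∀ H H' : Finset (ℕ × ℕ), WordCut (a :: l) H → WordCut (a :: l) H' →
      H.image (rotChord l.length) = H'.image (rotChord l.length) → H ⊆ H' := by
    intro H H' h h' he c hc
    have h1 : rotChord l.length c ∈ H'.image (rotChord l.length) :=
      he ▸ Finset.mem_image_of_mem _ hc
    obtain ⟨d, hd, hdc⟩ := Finset.mem_image.1 h1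
    rwa [← rotChord_inj (h'.lt_le d hd) (h.lt_le c hc) hdc]
  exact (key _ _ h h' he).antisymm (key _ _ h' h he.symm)

end Rotation

/-! ### Faces -/

section Faces

open QPath

variable {I : Type*} [Quiver I] {a : Arrow I} {l : List (Arrow I)} {H : Finset (ℕ × ℕ)} {n : ℕ}

/-- The right end of the chord of a face (shifted by one; `n + 2` for the unbounded face). -/
def rightEnd (n : ℕ) (H : Finset (ℕ × ℕ)) : Face H → ℕ
  | none => n + 2
  | some c => c.1.2 + 1

theorem encl_iff_inside (hH : ∀ c ∈ H, c.1 < c.2 ∧ c.2 ≤ n) (u v : Face H) :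
    Encl H u v ↔ Inside (pos H) (rightEnd n H) u v := by
  rcases u with _ | u <;> rcases v with _ | v
  · exact ⟨False.elim, fun h => lt_irrefl _ h.1⟩
  · have := hH v.1 v.2
    exact ⟨fun _ => ⟨Nat.succ_pos _, by change v.1.2 + 1 < n + 2; omega⟩, fun _ => trivial⟩
  · exact ⟨False.elim, fun h => absurd h.1 (Nat.not_lt_zero _)⟩
  · exact and_congr Nat.succ_lt_succ_iff.symm Nat.succ_lt_succ_iff.symm

theorem imm_iff_immInside (hH : ∀ c ∈ H, c.1 < c.2 ∧ c.2 ≤ n) (u v : Face H) :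
    Imm H u v ↔ ImmInside (pos H) (rightEnd n H) u v := by
  unfold Imm ImmInside
  simp only [encl_iff_inside hH]

theorem inFace_iff_inGap (hH : ∀ c ∈ H, c.1 < c.2 ∧ c.2 ≤ n) (u : Face H) {m : ℕ} (hm : m ≤ n) :
    InFace H u m ↔ InGap (pos H) (rightEnd n H) u m := by
  unfold InFace InGap
  refine and_congr ?_ ?_
  · rcases u with _ | u
    · exact ⟨fun _ => ⟨Nat.zero_le _, by change m + 1 < n + 2; omega⟩, fun _ => trivial⟩
    · change u.1.1 < m ∧ m < u.1.2 ↔ u.1.1 + 1 ≤ m ∧ m + 1 < u.1.2 + 1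
      omega
  · constructor
    · rintro h (_ | d) hd
      · exact absurd hd.1 (Nat.not_lt_zero _)
      · have := h d ((encl_iff_inside hH _ _).2 hd)
        change ¬ (d.1.1 + 1 ≤ m + 1 ∧ m + 1 ≤ d.1.2 + 1)
        omega
    · intro h d hd
      have : ¬ (d.1.1 + 1 ≤ m + 1 ∧ m + 1 ≤ d.1.2 + 1) := h _ ((encl_iff_inside hH _ _).1 hd)
      omega

theorem WordCut.isNest (hcut : WordCut l H) (hH : ∀ c ∈ H, c.1 < c.2 ∧ c.2 ≤ n) :
    IsNest n (pos H) (rightEnd n H) none where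
  lo_root := rfl
  hi_root := rfl
  lt v := by
    rcases v with _ | v
    · exact Nat.succ_pos _
    · exact Nat.succ_lt_succ (hH v.1 v.2).1
  le v hv := by
    rcases v with _ | v
    · exact (hv rfl).elim
    · exact ⟨Nat.succ_pos _, Nat.succ_le_succ (hH v.1 v.2).2⟩
  disj u v huv := by
    rcases u with _ | u <;> rcases v with _ | v
    · exact (huv rfl).elim
    · have := hH v.1 v.2
      change 0 ≠ v.1.1 + 1 ∧ n + 2 ≠ v.1.2 + 1 ∧ 0 ≠ v.1.2 + 1 ∧
        ¬ (0 < v.1.1 + 1 ∧ v.1.1 + 1 < n + 2 ∧ n + 2 < v.1.2 + 1)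
      omega
    · have := hH u.1 u.2
      change u.1.1 + 1 ≠ 0 ∧ u.1.2 + 1 ≠ n + 2 ∧ u.1.1 + 1 ≠ n + 2 ∧
        ¬ (u.1.1 + 1 < 0 ∧ 0 < u.1.2 + 1 ∧ u.1.2 + 1 < n + 2)
      omega
    · have h1 := (wordCut_iff.1 hcut).2 u.1 u.2 v.1 v.2
        (fun h => huv (congrArg some (Subtype.ext h)))
      unfold Disjt at h1
      change u.1.1 + 1 ≠ v.1.1 + 1 ∧ u.1.2 + 1 ≠ v.1.2 + 1 ∧ u.1.1 + 1 ≠ v.1.2 + 1 ∧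
        ¬ (u.1.1 + 1 < v.1.1 + 1 ∧ v.1.1 + 1 < u.1.2 + 1 ∧ u.1.2 + 1 < v.1.2 + 1)
      omega

open Classical in
/-- The face which corresponds to a given one after rotation. -/
def rotFace (n : ℕ) (H : Finset (ℕ × ℕ)) : Face H → Face (H.image (rotChord n))
  -- If the first letter is matched, the face below its chord becomes the unbounded one, and the
  -- unbounded face comes to lie below the rotated chord.
  | none => if h : ∃ c ∈ H, c.1 = 0 then
      some ⟨rotChord n h.choose, Finset.mem_image_of_mem _ h.choose_spec.1⟩ else none
  | some c => if c.1.1 = 0 then none else some ⟨rotChord n c.1, Finset.mem_image_of_mem _ c.2⟩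

theorem rotFace_some_of_ne {c : {c // c ∈ H}} (hc : c.1.1 ≠ 0) :
    rotFace n H (some c) = some ⟨rotChord n c.1, Finset.mem_image_of_mem _ c.2⟩ := if_neg hc

theorem rotFace_some_of_eq {c : {c // c ∈ H}} (hc : c.1.1 = 0) : rotFace n H (some c) = none :=
  if_pos hc

theorem rotFace_none_of_ne (h : ∀ c ∈ H, c.1 ≠ 0) : rotFace n H none = none :=
  dif_neg fun ⟨c, hc, hc'⟩ => h c hc hc'

theorem WordCut.rotFace_none_of_eq (hcut : WordCut l H) {c : {c // c ∈ H}} (hc : c.1.1 = 0) :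
    rotFace n H none = some ⟨rotChord n c.1, Finset.mem_image_of_mem _ c.2⟩ := by
  have h : ∃ c ∈ H, c.1 = 0 := ⟨c.1, c.2, hc⟩
  have h1 : h.choose = c.1 := by
    by_contra hne
    exact (hcut.distinct _ h.choose_spec.1 _ c.2 hne).1 (h.choose_spec.2.trans hc.symm)
  exact (dif_pos h).trans (congrArg some (Subtype.ext (congrArg (rotChord n) h1)))

theorem WordCut.rotFace_injective (hcut : WordCut l H) (hH : ∀ c ∈ H, c.1 < c.2 ∧ c.2 ≤ n) :
    Function.Injective (rotFace n H) := by
  have key : ∀ c : {c // c ∈ H}, rotFace n H none ≠ rotFace n H (some c) := by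
    intro c h
    by_cases hc : c.1.1 = 0
    · rw [hcut.rotFace_none_of_eq hc, rotFace_some_of_eq hc] at h
      exact Option.some_ne_none _ h
    · rw [rotFace_some_of_ne hc] at h
      by_cases hz : ∃ c ∈ H, c.1 = 0
      · obtain ⟨z, hz, hz'⟩ := hz
        rw [hcut.rotFace_none_of_eq (c := ⟨z, hz⟩) hz'] at h
        have h1 := rotChord_inj (hH z hz) (hH c.1 c.2)
          (congrArg Subtype.val (Option.some_injective _ h))
        rw [← h1] at hc
        exact hc hz'
      · rw [rotFace_none_of_ne fun c hc hc' => hz ⟨c, hc, hc'⟩] at h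
        exact Option.some_ne_none _ h.symm
  rintro (_ | c) (_ | d) h
  · rfl
  · exact (key d h).elim
  · exact (key c h.symm).elim
  · by_cases hc : c.1.1 = 0 <;> by_cases hd : d.1.1 = 0
    · refine congrArg some (Subtype.ext ?_)
      by_contra hne
      exact (hcut.distinct _ c.2 _ d.2 hne).1 (hc.trans hd.symm)
    · rw [rotFace_some_of_eq hc, rotFace_some_of_ne hd] at h
      exact (Option.some_ne_none _ h.symm).elim
    · rw [rotFace_some_of_ne hc, rotFace_some_of_eq hd] at h
      exact (Option.some_ne_none _ h).elim
    · rw [rotFace_some_of_ne hc, rotFace_some_of_ne hd] at h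
      exact congrArg some (Subtype.ext (rotChord_inj (hH c.1 c.2) (hH d.1 d.2)
        (congrArg Subtype.val (Option.some_injective _ h))))

theorem WordCut.rotFace_bijective (hcut : WordCut l H) (hH : ∀ c ∈ H, c.1 < c.2 ∧ c.2 ≤ n) :
    Function.Bijective (rotFace n H) := by
  refine (hcut.rotFace_injective hH).bijective_of_nat_card_le ?_
  rw [Finite.card_option, Finite.card_option]
  have := Finset.card_image_le (s := H) (f := rotChord n)
  rw [Nat.card_eq_fintype_card, Nat.card_eq_fintype_card, Fintype.card_coe, Fintype.card_coe]
  exact Nat.succ_le_succ this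

theorem WordCut.isShiftedNest (hH : ∀ c ∈ H, c.1 < c.2 ∧ c.2 ≤ n)
    (hz : ∀ c ∈ H, c.1 ≠ 0) :
    IsShiftedNest n (pos H) (rightEnd n H) (fun v => pos _ (rotFace n H v))
      (fun v => rightEnd n _ (rotFace n H v)) none where
  ne_one v := by
    rcases v with _ | v
    · exact Nat.zero_ne_one
    · exact fun h => hz v.1 v.2 (Nat.succ_injective h)
  lo_root := by rw [rotFace_none_of_ne hz]; rfl
  hi_root := by rw [rotFace_none_of_ne hz]; rfl
  of_ne v hv := by
    rcases v with _ | v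
    · exact (hv rfl).elim
    · have h0 := hz v.1 v.2
      have h1 := hH v.1 v.2
      rw [rotFace_some_of_ne h0]
      simp only [pos, rightEnd, rotChord_of_ne h0]
      omega

theorem WordCut.isRotatedNest (hcut : WordCut l H) (hH : ∀ c ∈ H, c.1 < c.2 ∧ c.2 ≤ n)
    {z : {c // c ∈ H}} (hz : z.1.1 = 0) :
    IsRotatedNest n (pos H) (rightEnd n H) (fun v => pos _ (rotFace n H v))
      (fun v => rightEnd n _ (rotFace n H v)) none (some z) where
  ne := Option.some_ne_none _
  lo_eq := congrArg Nat.succ hz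
  lo_root := by
    have := hH z.1 z.2
    rw [hcut.rotFace_none_of_eq hz]
    simp only [pos, rightEnd, rotChord_of_eq hz]
    omega
  hi_root := by
    rw [hcut.rotFace_none_of_eq hz]
    simp only [rightEnd, rotChord_of_eq hz]
  lo_first := by rw [rotFace_some_of_eq hz]; rfl
  hi_first := by rw [rotFace_some_of_eq hz]; rfl
  of_ne v hv hv' := by
    rcases v with _ | v
    · exact (hv rfl).elim
    · have h0 : v.1.1 ≠ 0 := by
        intro h0
        refine (hcut.distinct _ v.2 _ z.2 fun h => ?_).1 (h0.trans hz.symm)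
        exact hv' (congrArg some (Subtype.ext h))
      have h1 := hH v.1 v.2
      rw [rotFace_some_of_ne h0]
      simp only [pos, rightEnd, rotChord_of_ne h0]
      omega

theorem immInside_comp {V W : Type*} {lo hi : W → ℕ} {f : V → W} (hf : Function.Surjective f)
    (u v : V) : ImmInside lo hi (f u) (f v) ↔ ImmInside (lo ∘ f) (hi ∘ f) u v :=
  and_congr_right fun _ => ⟨fun h w => h (f w), fun h w => by
    obtain ⟨w, rfl⟩ := hf w
    exact h w⟩

theorem inGap_comp {V W : Type*} {lo hi : W → ℕ} {f : V → W} (hf : Function.Surjective f)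
    (u : V) (m : ℕ) : InGap lo hi (f u) m ↔ InGap (lo ∘ f) (hi ∘ f) u m :=
  and_congr_right fun _ => ⟨fun h w => h (f w), fun h w => by
    obtain ⟨w, rfl⟩ := hf w
    exact h w⟩

end Faces

/-! ### The dual trees of rotated chord diagrams -/

section RotatedDual

open QPath

theorem btw_nat_congr {x y z x' y' z' : ℕ} (_ : x' < y' ↔ x < y) (_ : y' < x' ↔ y < x)
    (_ : y' < z' ↔ y < z) (_ : z' < y' ↔ z < y) (_ : z' < x' ↔ z < x) (_ : x' < z' ↔ x < z) :
    (LinearOrder.toCircularOrder ℕ).btw x y z ↔ (LinearOrder.toCircularOrder ℕ).btw x' y' z' := by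
  change (x ≤ y ∧ y ≤ z) ∨ (y ≤ z ∧ z ≤ x) ∨ (z ≤ x ∧ x ≤ y) ↔
    (x' ≤ y' ∧ y' ≤ z') ∨ (y' ≤ z' ∧ z' ≤ x') ∨ (z' ≤ x' ∧ x' ≤ y')
  omega

/-- Moving `0` from the first place of an order to the last one does not change the cyclic order. -/
theorem btw_nat_rotate {x y z x' y' z' : ℕ} (_ : x' < y' ↔ x ≠ 0 ∧ (y = 0 ∨ x < y))
    (_ : y' < x' ↔ y ≠ 0 ∧ (x = 0 ∨ y < x)) (_ : y' < z' ↔ y ≠ 0 ∧ (z = 0 ∨ y < z))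
    (_ : z' < y' ↔ z ≠ 0 ∧ (y = 0 ∨ z < y)) (_ : z' < x' ↔ z ≠ 0 ∧ (x = 0 ∨ z < x))
    (_ : x' < z' ↔ x ≠ 0 ∧ (z = 0 ∨ x < z)) :
    (LinearOrder.toCircularOrder ℕ).btw x y z ↔ (LinearOrder.toCircularOrder ℕ).btw x' y' z' := by
  change (x ≤ y ∧ y ≤ z) ∨ (y ≤ z ∧ z ≤ x) ∨ (z ≤ x ∧ x ≤ y) ↔
    (x' ≤ y' ∧ y' ≤ z') ∨ (y' ≤ z' ∧ z' ≤ x') ∨ (z' ≤ x' ∧ x' ≤ y')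
  omega

variable {I : Type*} [Quiver I] {a : Arrow I} {l : List (Arrow I)} {H : Finset (ℕ × ℕ)}

theorem WordCut.lt_le_append (h : WordCut (l ++ [a]) H) : ∀ c ∈ H, c.1 < c.2 ∧ c.2 ≤ l.length := by
  intro c hc
  have := (h.chord c hc).lt_length
  rw [List.length_append, List.length_singleton] at this
  omega

theorem leftInQ_rotFace {X Y : QPath I} (hX : X.arrows = a :: l) (hY : Y.arrows = l ++ [a])
    (hH : X.IsCut H) {c : {c // c ∈ H}} (hc : c.1.1 ≠ 0) :
    Y.LeftInQ _ (rotFace l.length H (some c)) ↔ X.LeftInQ H (some c) := by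
  rw [rotFace_some_of_ne hc]
  have hcut := isCut_iff.1 hH
  rw [hX] at hcut
  have h1 := hcut.lt_le c.1 c.2
  change (∃ e, Y.arrows[(rotChord l.length c.1).1]? = some (Sum.inl e)) ↔
    (∃ e, X.arrows[c.1.1]? = some (Sum.inl e))
  rw [rotChord_of_ne hc, hX, hY]
  obtain ⟨m, hm⟩ := Nat.exists_eq_succ_of_ne_zero hc
  rw [hm, Nat.succ_eq_add_one, List.getElem?_cons_succ]
  dsimp only
  rw [Nat.add_sub_cancel, List.getElem?_append_left (by omega)]

theorem vert_rotate {X Y : QPath I} (hX : X.arrows = a :: l) (hY : Y.arrows = l ++ [a])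
    (hs : Y.start = Arrow.tgt a) {m : ℕ} (hm : m ≤ l.length) : Y.vert m = X.vert (m + 1) := by
  rw [vert, vert, hX, hY, hs, List.take_append_of_le_length hm, List.take_succ_cons]
  rfl

theorem inFace_rotFace (hcut : WordCut (a :: l) H)
    (hcut' : WordCut (l ++ [a]) (H.image (rotChord l.length))) (u : Face H) :
    (∀ m < l.length, InFace _ (rotFace l.length H u) m ↔ InFace H u (m + 1)) ∧
      (InFace _ (rotFace l.length H u) l.length ↔ InFace H u 0) ∧
      (InFace H u 0 → u = none ∧ rotFace l.length H u = none) := by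
  have hle := hcut.lt_le
  have hle' := hcut'.lt_le_append
  have hsurj := (hcut.rotFace_bijective hle).2
  have hn := hcut.isNest hle
  have hF : ∀ m ≤ l.length, InFace _ (rotFace l.length H u) m ↔
      InGap (fun v => pos _ (rotFace l.length H v)) (fun v => rightEnd l.length _ (rotFace _ H v))
        u m := fun m hm => (inFace_iff_inGap hle' _ hm).trans (inGap_comp hsurj u m)
  by_cases hz : ∃ z : {c // c ∈ H}, z.1.1 = 0
  · obtain ⟨z, hz⟩ := hz
    have hr := hcut.isRotatedNest hle hz
    have h0 : ¬ InFace H u 0 := fun h =>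
      hr.not_inGap_zero hn u ((inFace_iff_inGap hle u (Nat.zero_le _)).1 h)
    refine ⟨fun m hm => ?_, ?_, fun h => (h0 h).elim⟩
    · rw [hF m hm.le, inFace_iff_inGap hle u hm, hr.inGap_iff hn u hm]
    · rw [hF _ le_rfl]
      exact ⟨fun h => (hr.not_inGap_last hn u h).elim, fun h => (h0 h).elim⟩
  · have hz' : ∀ c ∈ H, c.1 ≠ 0 := fun c hc h => hz ⟨⟨c, hc⟩, h⟩
    have hr := WordCut.isShiftedNest hle hz'
    refine ⟨fun m hm => ?_, ?_, fun h => ?_⟩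
    · rw [hF m hm.le, inFace_iff_inGap hle u hm, hr.inGap_iff hn u hm]
    · rw [hF _ le_rfl, inFace_iff_inGap hle u (Nat.zero_le _), hr.inGap_last hn, hr.inGap_zero hn]
    · rw [inFace_iff_inGap hle u (Nat.zero_le _), hr.inGap_zero hn] at h
      subst h
      exact ⟨rfl, rotFace_none_of_ne hz'⟩

/-- Each face keeps its letters. Only an unmatched first letter changes its place in a face word,
moving from the beginning to the end of the word of the unbounded face. -/
theorem faceWord_rotFace {X Y : QPath I} (hX : X.arrows = a :: l) (hY : Y.arrows = l ++ [a])
    (hH : X.IsCut H) (hH' : Y.IsCut (H.image (rotChord l.length))) (u : Face H) :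
    (X.faceWord H u).IsRotated (Y.faceWord _ (rotFace l.length H u)) ∧
      (X.faceWord H u = [] → ¬ InFace H u 0) := by
  classical
  have hcut := isCut_iff.1 hH
  have hcut' := isCut_iff.1 hH'
  rw [hX] at hcut
  rw [hY] at hcut'
  obtain ⟨h1, h2, h3⟩ := inFace_rotFace hcut hcut' u
  have e1 : X.faceWord H u = subword (InFace H u) (a :: l) := by rw [← hX]; rfl
  have e2 : Y.faceWord _ (rotFace l.length H u) =
      subword (InFace _ (rotFace l.length H u)) (l ++ [a]) := by rw [← hY]; rfl
  rw [e1, e2, subword_cons, subword_append, subword_cons, subword_nil, Nat.zero_add, if_congr h2 rfl rfl,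
    subword_congr h1]
  by_cases h : InFace H u 0
  · rw [if_pos h, if_pos h]
    exact ⟨⟨1, by simp⟩, fun h => absurd h (List.cons_ne_nil _ _)⟩
  · rw [if_neg h, if_neg h, List.append_nil]
    exact ⟨.refl _, fun _ => h⟩

/-- Needed for empty face words, because a trivial necklace remembers its vertex. -/
theorem faceStart_rotFace {X Y : QPath I} (hX : X.arrows = a :: l) (hY : Y.arrows = l ++ [a])
    (hs : Y.start = Arrow.tgt a) (hH : X.IsCut H) (u : Face H) (hu : ¬ InFace H u 0) :
    X.faceStart H u = Y.faceStart _ (rotFace l.length H u) := by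
  have hcut := isCut_iff.1 hH
  rw [hX] at hcut
  have hle := hcut.lt_le
  have hv : ∀ {m : ℕ}, m ≤ l.length → Y.vert m = X.vert (m + 1) := fun hm => vert_rotate hX hY hs hm
  rcases u with _ | c
  · by_cases hz : ∃ z : {c // c ∈ H}, z.1.1 = 0
    · obtain ⟨z, hz⟩ := hz
      rw [hcut.rotFace_none_of_eq hz]
      change X.vert 0 = Y.vert ((rotChord l.length z.1).1 + 1)
      have h1 := hle z.1 z.2
      have h2 := (hH.chord z.1 z.2).vert_eq.1
      rw [rotChord_of_eq hz, Nat.sub_add_cancel (by omega), hv h1.2, h2, hz]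
    · have hz' : ∀ c ∈ H, c.1 ≠ 0 := fun c hc h => hz ⟨⟨c, hc⟩, h⟩
      refine (hu ?_).elim
      exact (inFace_iff_inGap hle _ (Nat.zero_le _)).2
        (((WordCut.isShiftedNest hle hz').inGap_zero (hcut.isNest hle) none).2 rfl)
  · have h1 := hle c.1 c.2
    by_cases hc : c.1.1 = 0
    · rw [rotFace_some_of_eq hc]
      change X.vert (c.1.1 + 1) = Y.vert 0
      rw [hc, hv (Nat.zero_le _)]
    · rw [rotFace_some_of_ne hc]
      change X.vert (c.1.1 + 1) = Y.vert ((rotChord l.length c.1).1 + 1)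
      rw [rotChord_of_ne hc, Nat.sub_add_cancel (by omega), hv (by omega)]

theorem omega_star_isLeft (a : Arrow I) : (∃ e, Arrow.star a = Sum.inl e) ↔ ¬ ∃ e, a = Sum.inl e := by
  rcases a with e | e
  · exact ⟨fun ⟨_, h⟩ => (Sum.inr_ne_inl h).elim, fun h => (h ⟨e, rfl⟩).elim⟩
  · exact ⟨fun _ ⟨_, h⟩ => (Sum.inr_ne_inl h).elim, fun _ => ⟨e, rfl⟩⟩

/-- The ends `a` and `a*` of the chord exchange their roles as left and right end, and exactly one
of them lies in the quiver. -/
theorem leftInQ_rotFace_none {X Y : QPath I} (hX : X.arrows = a :: l) (hY : Y.arrows = l ++ [a])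
    (hH : X.IsCut H) {z : {c // c ∈ H}} (hz : z.1.1 = 0) :
    Y.LeftInQ _ (rotFace l.length H none) ↔ ¬ X.LeftInQ H (some z) := by
  have hcut := isCut_iff.1 hH
  rw [hX] at hcut
  rw [hcut.rotFace_none_of_eq hz]
  have h1 := hcut.lt_le z.1 z.2
  obtain ⟨-, b, hb, hb'⟩ := hcut.chord z.1 z.2
  change (∃ e, Y.arrows[(rotChord l.length z.1).1]? = some (Sum.inl e)) ↔
    ¬ (∃ e, X.arrows[z.1.1]? = some (Sum.inl e))
  rw [rotChord_of_eq hz, hX, hY, hb]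
  obtain ⟨m, hm⟩ := Nat.exists_eq_succ_of_ne_zero (show z.1.2 ≠ 0 by omega)
  rw [hm, Nat.succ_eq_add_one, List.getElem?_cons_succ] at hb'
  rw [hm, Nat.succ_eq_add_one]
  dsimp only
  rw [Nat.add_sub_cancel, List.getElem?_append_left (by omega), hb']
  simp only [Option.some_inj]
  exact omega_star_isLeft b

/-- Across the chord of the first letter two things are reversed, which face is the lower one and
whether the left end is in the quiver; the orientation is therefore preserved. All other chords keep
both. -/
theorem arr_rotFace_of_eq {X Y : QPath I} (hX : X.arrows = a :: l) (hY : Y.arrows = l ++ [a])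
    (hH : X.IsCut H) (hH' : Y.IsCut (H.image (rotChord l.length))) {z : {c // c ∈ H}}
    (hz : z.1.1 = 0) (u v : Face H) :
    (Y.dualOrient _).arr (rotFace l.length H u) (rotFace l.length H v) ↔
      (X.dualOrient H).arr u v := by
  have hcut := isCut_iff.1 hH
  have hcut' := isCut_iff.1 hH'
  rw [hX] at hcut
  rw [hY] at hcut'
  have hle := hcut.lt_le
  have hle' := hcut'.lt_le_append
  have hbij := hcut.rotFace_bijective hle
  have hn := hcut.isNest hle
  have hr := hcut.isRotatedNest hle hz
  have hI : ∀ u v : Face H, Imm H u v ↔ ImmInside (pos H) (rightEnd l.length H) u v :=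
    imm_iff_immInside hle
  have hI' : ∀ u v : Face H, Imm _ (rotFace l.length H u) (rotFace l.length H v) ↔
      ImmInside (fun v => pos _ (rotFace l.length H v))
        (fun v => rightEnd l.length _ (rotFace _ H v)) u v := fun u v =>
    (imm_iff_immInside hle' _ _).trans (immInside_comp hbij.2 u v)
  have hz0 : ∀ c : {c // c ∈ H}, some c ≠ some z → c.1.1 ≠ 0 := by
    intro c hc h0
    refine (hcut.distinct _ c.2 _ z.2 fun h => ?_).1 (h0.trans hz.symm)
    exact hc (congrArg some (Subtype.ext h))
  have hrz : Imm H none (some z) := (hI _ _).2 (hr.immInside_root hn)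
  have hzr : Imm _ (rotFace l.length H (some z)) (rotFace l.length H none) :=
    (hI' _ _).2 (hr.immInside_first hn)
  have hfor : ∀ u v, v ≠ none → v ≠ some z → Imm H u v →
      Imm _ (rotFace l.length H u) (rotFace l.length H v) :=
    fun u v hv hv' h => (hI' u v).2 (hr.immInside_of hn hv hv' ((hI u v).1 h))
  have hno : ∀ u : Face H, ¬ Imm H u none := fun u h => by
    rcases u with _ | u <;> exact h.1
  have hno' : ∀ u : Face H, ¬ Imm _ (rotFace l.length H u) (rotFace l.length H (some z)) :=
    fun u h => by
      rw [rotFace_some_of_eq hz] at h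
      generalize rotFace l.length H u = w at h
      rcases w with _ | w <;> exact h.1
  have back : ∀ u v, Imm _ (rotFace l.length H u) (rotFace l.length H v) →
      (Imm H u v ∧ (Y.LeftInQ _ (rotFace l.length H v) ↔ X.LeftInQ H v)) ∨
      (Imm H v u ∧ (Y.LeftInQ _ (rotFace l.length H v) ↔ ¬ X.LeftInQ H u)) := by
    intro u v h
    by_cases hv : v = none
    · subst hv
      obtain rfl : u = some z := hbij.1 (imm_unique hH' h hzr)
      exact Or.inr ⟨hrz, leftInQ_rotFace_none hX hY hH hz⟩
    · by_cases hv' : v = some z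
      · subst hv'
        exact (hno' u h).elim
      · obtain ⟨w, hw⟩ := exists_imm H v hv
        obtain rfl : w = u := hbij.1 (imm_unique hH' (hfor w v hv hv' hw) h)
        obtain ⟨c, rfl⟩ := Option.ne_none_iff_exists'.1 hv
        exact Or.inl ⟨hw, leftInQ_rotFace hX hY hH (hz0 c hv')⟩
  have forth : ∀ u v, Imm H u v → Imm _ (rotFace l.length H u) (rotFace l.length H v) ∨
      Imm _ (rotFace l.length H v) (rotFace l.length H u) := by
    intro u v h
    by_cases hv : v = none
    · subst hv
      exact (hno u h).elim
    · by_cases hv' : v = some z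
      · subst hv'
        obtain rfl : u = none := imm_unique hH h hrz
        exact Or.inr hzr
      · exact Or.inl (hfor u v hv hv' h)
  -- One implication suffices: both relations orient every edge in exactly one direction.
  have main : ∀ u v, (Y.dualOrient _).arr (rotFace l.length H u) (rotFace l.length H v) →
      (X.dualOrient H).arr u v := by
    rintro u v (⟨h, hQ⟩ | ⟨h, hQ⟩)
    · rcases back u v h with ⟨h1, h2⟩ | ⟨h1, h2⟩
      · exact Or.inl ⟨h1, h2.1 hQ⟩
      · exact Or.inr ⟨h1, h2.1 hQ⟩
    · rcases back v u h with ⟨h1, h2⟩ | ⟨h1, h2⟩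
      · exact Or.inr ⟨h1, fun h3 => hQ (h2.2 h3)⟩
      · exact Or.inl ⟨h1, not_not.1 fun h3 => hQ (h2.2 h3)⟩
  refine ⟨main u v, fun h => ?_⟩
  have hadj : (dualGraph _).Adj (rotFace l.length H u) (rotFace l.length H v) := by
    rcases (X.dualOrient H).adj_of_arr h with h1 | h1
    · exact forth u v h1
    · exact (forth v u h1).symm
  exact ((Y.dualOrient _).arr_or_arr hadj).resolve_right fun h1 =>
    (X.dualOrient H).asymm h (main v u h1)

/-- Drawn in a disc, the chord diagram of a closed path does not change under rotation, and neither
does its dual tree once the root is forgotten. If the first letter is unmatched even the parent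
relation is preserved; otherwise the root moves to a neighbour. -/
theorem dualO_rotate {X Y : QPath I} (hX : X.arrows = a :: l) (hY : Y.arrows = l ++ [a])
    (hs : Y.start = Arrow.tgt a) (hXc : X.IsClosed) (hYc : Y.IsClosed) (hH : X.IsCut H)
    (hH' : Y.IsCut (H.image (rotChord l.length))) :
    X.dualO hXc H hH ≈ Y.dualO hYc _ hH' := by
  have hcut := isCut_iff.1 hH
  have hcut' := isCut_iff.1 hH'
  rw [hX] at hcut
  rw [hY] at hcut'
  have hle := hcut.lt_le
  have hle' := hcut'.lt_le_append
  have hbij := hcut.rotFace_bijective hle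
  have hn := hcut.isNest hle
  let E := Equiv.ofBijective _ hbij
  have hI : ∀ u v : Face H, Imm H u v ↔ ImmInside (pos H) (rightEnd l.length H) u v :=
    imm_iff_immInside hle
  have hI' : ∀ u v : Face H, Imm _ (rotFace l.length H u) (rotFace l.length H v) ↔
      ImmInside (fun v => pos _ (rotFace l.length H v))
        (fun v => rightEnd l.length _ (rotFace _ H v)) u v := fun u v =>
    (imm_iff_immInside hle' _ _).trans (immInside_comp hbij.2 u v)
  have hlab : ∀ v, Necklace.of (X.facePath H hH v) (facePath_isClosed hH hXc v) =
      Necklace.of (Y.facePath _ hH' (rotFace l.length H v)) (facePath_isClosed hH' hYc _) := by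
    intro v
    obtain ⟨h1, h2⟩ := faceWord_rotFace hX hY hH hH' v
    exact Quotient.sound ⟨h1, fun h => faceStart_rotFace hX hY hs hH v (h2 h)⟩
  by_cases hz : ∃ z : {c // c ∈ H}, z.1.1 = 0
  · obtain ⟨z, hz⟩ := hz
    have hr := hcut.isRotatedNest hle hz
    have hor := arr_rotFace_of_eq hX hY hH hH' hz
    have hadj : ∀ u v : Face H, (dualGraph _).Adj (rotFace l.length H u) (rotFace l.length H v) ↔
        (dualGraph H).Adj u v := by
      intro u v
      constructor
      · intro h
        rcases (Y.dualOrient _).arr_or_arr h with h | h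
        · exact (X.dualOrient H).adj_of_arr ((hor _ _).1 h)
        · exact ((X.dualOrient H).adj_of_arr ((hor _ _).1 h)).symm
      · intro h
        rcases (X.dualOrient H).arr_or_arr h with h | h
        · exact (Y.dualOrient _).adj_of_arr ((hor _ _).2 h)
        · exact ((Y.dualOrient _).adj_of_arr ((hor _ _).2 h)).symm
    refine ⟨⟨E, fun {u v} => hadj u v⟩, fun u v => (hor u v).symm, fun v x y w => ?_, hlab⟩
    have hx : ∀ x : (dualGraph H).neighborSet v,
        ImmInside (pos H) (rightEnd l.length H) v x.1 ∨
          ImmInside (pos H) (rightEnd l.length H) x.1 v :=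
      fun x => (x.2 : Imm H v x.1 ∨ Imm H x.1 v).imp (hI _ _).1 (hI _ _).1
    by_cases hv : v = some z
    · subst hv
      -- At the face `z` the unbounded face, in position `0`, is the first neighbour before the
      -- rotation and the last one after it.
      have h1 : ∀ x y : (dualGraph H).neighborSet (some z),
          pos _ (rotFace l.length H x.1) < pos _ (rotFace l.length H y.1) ↔
            pos H x.1 ≠ 0 ∧ (pos H y.1 = 0 ∨ pos H x.1 < pos H y.1) := by
        intro x y
        have h2 : ∀ u : Face H, pos H u = 0 ↔ u = none := by
          rintro (_ | u)
          · exact ⟨fun _ => rfl, fun _ => rfl⟩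
          · exact ⟨fun h => (Nat.succ_ne_zero _ h).elim, fun h => (Option.some_ne_none _ h).elim⟩
        refine (hr.lo_lt_iff_first hn (hx x) (hx y)).trans ?_
        rw [ne_eq, ne_eq, h2, h2]
      exact btw_nat_rotate (h1 _ _) (h1 _ _) (h1 _ _) (h1 _ _) (h1 _ _) (h1 _ _)
    · have h1 := fun x y : (dualGraph H).neighborSet v => hr.lo_lt_iff hn hv (hx x) (hx y)
      exact btw_nat_congr (h1 _ _) (h1 _ _) (h1 _ _) (h1 _ _) (h1 _ _) (h1 _ _)
  · have hz' : ∀ c ∈ H, c.1 ≠ 0 := fun c hc h => hz ⟨⟨c, hc⟩, h⟩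
    have hr := WordCut.isShiftedNest hle hz'
    have key : ∀ u v : Face H,
        Imm _ (rotFace l.length H u) (rotFace l.length H v) ↔ Imm H u v := fun u v => by
      rw [hI, hI', hr.immInside_iff hn]
    have hQ : ∀ v : Face H, Y.LeftInQ _ (rotFace l.length H v) ↔ X.LeftInQ H v := by
      rintro (_ | c)
      · rw [rotFace_none_of_ne hz']
        exact Iff.rfl
      · exact leftInQ_rotFace hX hY hH (hz' c.1 c.2)
    refine ⟨⟨E, fun {u v} => or_congr (key u v) (key v u)⟩, fun u v => Iff.symm ?_,
      fun v x y w => ?_, hlab⟩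
    · exact or_congr (and_congr (key u v) (hQ v)) (and_congr (key v u) (not_congr (hQ u)))
    · have h1 := fun x y : Face H => hr.lo_lt_iff hn x y
      exact btw_nat_congr (h1 _ _) (h1 _ _) (h1 _ _) (h1 _ _) (h1 _ _) (h1 _ _)

end RotatedDual

/-! ### The Lie coalgebra of necklaces -/

section Necklace

open QPath

variable (k : Type*) [CommRing k] {I : Type*} [Quiver I]

theorem etaOrFun_rotate {X Y : QPath I} {a : Arrow I} {l : List (Arrow I)} (hX : X.arrows = a :: l)
    (hY : Y.arrows = l ++ [a]) (hs : Y.start = Arrow.tgt a) (hXc : X.IsClosed)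
    (hYc : Y.IsClosed) : etaOrFun k X hXc = etaOrFun k Y hYc := by
  have hw : ∀ {H}, X.IsCut H ↔ WordCut (a :: l) H := fun {H} => by rw [isCut_iff, hX]
  have hw' : ∀ {H}, Y.IsCut H ↔ WordCut (l ++ [a]) H := fun {H} => by rw [isCut_iff, hY]
  have himg : ∀ {H}, H ∈ X.cuts → H.image (rotChord l.length) ∈ Y.cuts := fun {H} hH => by
    have h := hw.1 (mem_cuts.1 hH)
    exact mem_cuts.2 (hw'.2 ((wordCut_image_rotChord h.lt_le).2 h))
  refine Fintype.sum_bijective (fun H => ⟨H.1.image (rotChord l.length), himg H.2⟩) ⟨?_, ?_⟩ _ _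
    fun H => OTree.el_eq_of_equiv k (dualO_rotate hX hY hs hXc hYc _ _)
  · intro H H' h
    exact Subtype.ext (image_rotChord_injective (hw.1 (mem_cuts.1 H.2)) (hw.1 (mem_cuts.1 H'.2))
      (congrArg Subtype.val h))
  · intro H'
    obtain ⟨H, hH, h⟩ := exists_image_rotChord (hw'.1 (mem_cuts.1 H'.2))
    exact ⟨⟨H, mem_cuts.2 (hw.2 hH)⟩, Subtype.ext h⟩

theorem QPath.eq_of_arrows_eq {X Y : QPath I} (h : X.arrows = Y.arrows)
    (h' : X.arrows = [] → X.start = Y.start) : X = Y := by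
  refine QPath.ext ?_ h
  cases hl : X.arrows with
  | nil => exact h' hl
  | cons a l =>
    have h1 := X.isPath
    have h2 := Y.isPath
    rw [← h] at h2
    rw [hl] at h1 h2
    exact h1.1.symm.trans h2.1

/-- Induction on the number of letters moved; after each step the path starts at the target of the
letter just moved. Empty words are equal paths by the condition on their vertices. -/
theorem etaOrFun_congr {X Y : QPath I} (hX : X.IsClosed) (hY : Y.IsClosed)
    (h : Necklace.of X hX = Necklace.of Y hY) : etaOrFun k X hX = etaOrFun k Y hY := by
  obtain ⟨⟨m, hm⟩, h0⟩ : X.arrows.IsRotated Y.arrows ∧ (X.arrows = [] → X.start = Y.start) :=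
    Quotient.exact h
  clear h
  induction m generalizing X with
  | zero =>
    obtain rfl := QPath.eq_of_arrows_eq (by simpa using hm) h0
    rfl
  | succ m ih =>
    cases hl : X.arrows with
    | nil =>
      rw [hl, List.rotate_nil] at hm
      obtain rfl := QPath.eq_of_arrows_eq (hl.trans hm) h0
      rfl
    | cons a l =>
      have hp := X.isPath
      have hc : endVertex X.start X.arrows = X.start := hX
      rw [hl] at hp hc
      have hc' : endVertex (Arrow.tgt a) l = Arrow.src a := hc.trans hp.1.symm
      let Z : QPath I := ⟨Arrow.tgt a, l ++ [a], (isPath_append _ _ _).2 ⟨hp.2, hc'.symm, trivial⟩⟩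
      have hZ : Z.IsClosed := by
        change endVertex (Arrow.tgt a) (l ++ [a]) = Arrow.tgt a
        rw [endVertex_append]
        rfl
      rw [etaOrFun_rotate k (Y := Z) hl rfl rfl hX hZ]
      refine ih hZ
        (fun h => (List.append_ne_nil_of_right_ne_nil l (List.cons_ne_nil a []) h).elim) ?_
      rw [hl, List.rotate_cons_succ] at hm
      exact hm

theorem etaOr_el (X : QPath I) (hX : X.IsClosed) :
    etaOr k I ((Necklace.of X hX).el k) = etaOrFun k X hX := by
  rw [etaOr, Necklace.el, Finsupp.linearCombination_single, one_smul]
  exact etaOrFun_congr k _ _ (Quotient.out_eq _)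

theorem trunkOr_etaOrFun (X : QPath I) (hX : X.IsClosed) :
    trunkOr k I (etaOrFun k X hX) = (Necklace.of X hX).el k := by
  rw [etaOrFun, map_sum, Finset.sum_eq_single ⟨∅, QPath.mem_cuts.2 X.isCut_empty⟩]
  · rw [trunkOr_el]
    refine (if_pos ?_).trans ?_
    · change Nat.card (Face ∅) = 1
      simp
    · have : ∀ v : Face ∅, v = none := by
        rintro (_ | v)
        · rfl
        · exact (Finset.notMem_empty _ v.2).elim
      refine (finsum_eq_single (fun v : Face ∅ => Necklace.el k
        ((X.dualO hX ∅ X.isCut_empty).2.label v)) none fun v hv => (hv (this v)).elim).trans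
        (congrArg (Necklace.el k) ?_)
      exact congrArg (Quotient.mk _) (Subtype.ext X.facePath_empty)
  · intro H _ hne
    rw [trunkOr_el, if_neg]
    intro hc
    change Nat.card (Face H.1) = 1 at hc
    rw [Finite.card_option] at hc
    refine hne (Subtype.ext (Finset.eq_empty_of_forall_notMem fun c hc' => ?_))
    have : Nonempty {c // c ∈ H.1} := ⟨⟨c, hc'⟩⟩
    have := Nat.card_pos (α := {c // c ∈ H.1})
    omega
  · intro h
    exact (h (Finset.mem_univ _)).elim

open Classical in
theorem QPath.neg_om {X : QPath I} {c : ℕ × ℕ} (hc : X.IsChord c) :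
    -X.om c = if ∃ e, X.arrows[c.1]? = some (Sum.inl e) then -1 else 1 := by
  have h1 : c.1 < X.arrows.length ∧ c.2 < X.arrows.length := hc.lt_length
  obtain ⟨-, b, hb, hb'⟩ := hc
  rw [QPath.om, dif_pos h1]
  rw [hb]
  rw [List.getElem?_eq_getElem h1.1] at hb
  rw [List.getElem?_eq_getElem h1.2] at hb'
  rw [Option.some_injective _ hb, Option.some_injective _ hb', omega, star_star, if_pos rfl]
  rcases b with e | e <;> simp

/-- For a chord `(i, j)`, `-ω(a_i, a_j)` is `-1` exactly when `a_i` lies in the quiver, that is,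
when the edge points into the face below, away from the root. Hence the signs of η_rt and of `toOr`
cancel, and η_or has none. -/
theorem QPath.sgn_dualR (X : QPath I) {H : Finset (ℕ × ℕ)} (hH : X.IsCut H) :
    (X.dualR H hH).sgn = X.eps H := by
  classical
  let : Fintype (X.dualR H hH).1.V := (inferInstance : Fintype (Face H))
  rw [RTree.sgn_eq]
  refine (Fintype.prod_option (fun v : Face H =>
    if (X.dualR H hH).data.dn v then (-1 : ℤ) else 1)).trans ?_
  refine (congrArg (· * _) (if_neg (RTree.not_dn_root (X.dualR H hH)))).trans ?_
  rw [one_mul, eps, ← Finset.prod_coe_sort H]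
  refine Finset.prod_congr rfl fun c _ => ?_
  rw [QPath.neg_om (hH.chord c.1 c.2)]
  refine if_congr ?_ rfl rfl
  obtain ⟨u, hu⟩ := exists_imm H (some c) (Option.some_ne_none _)
  exact ((X.isEmb_dualR hH).dn u (some c) hu).symm

theorem toOr_etaRtFun {X : QPath I} (hX : X.IsClosed) :
    toOr k I (etaRtFun k X) = etaOrFun k X hX := by
  rw [etaRtFun, map_sum]
  refine Finset.sum_congr rfl fun H _ => ?_
  have hH := mem_cuts.1 H.2
  have hc : (X.dualR H.1 hH).IsClosed := fun v => facePath_isClosed hH hX v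
  rw [map_smul, toOr_el k hc, X.sgn_dualR hH, smul_smul, ← Int.cast_mul, ← X.sgn_dualR hH,
    RTree.sgn_mul_self, Int.cast_one, one_smul]
  rfl

theorem QPath.isClosed_of_facePath {X : QPath I} {H : Finset (ℕ × ℕ)} (hH : X.IsCut H)
    (h : (X.facePath H hH none).IsClosed) : X.IsClosed := by
  refine Eq.trans ?_ ((faceWord_spec hH none).2.symm.trans h)
  simp [vert, faceHi, length]

theorem toOr_etaRtFun_of_not {X : QPath I} (hX : ¬ X.IsClosed) :
    toOr k I (etaRtFun k X) = 0 := by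
  rw [etaRtFun, map_sum]
  refine Finset.sum_eq_zero fun H _ => ?_
  have hH := mem_cuts.1 H.2
  have hc : ¬ (X.dualR H.1 hH).IsClosed := fun h => hX (QPath.isClosed_of_facePath hH (h none))
  rw [map_smul, toOr_el_of_not k hc, smul_zero]

variable (I)

open Classical in
/-- The projection of paths to cyclic paths; paths which are not closed are mapped to zero. -/
def toNecklace : PathModule k I →ₗ[k] NecklaceModule k I :=
  Finsupp.linearCombination k (fun X : QPath I =>
    if h : X.IsClosed then (Necklace.of X h).el k else 0)

variable {I}

theorem toNecklace_el {X : QPath I} (h : X.IsClosed) :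
    toNecklace k I (X.el k) = (Necklace.of X h).el k := by
  rw [toNecklace, QPath.el, Finsupp.linearCombination_single, one_smul, dif_pos h]

theorem toNecklace_el_of_not {X : QPath I} (h : ¬ X.IsClosed) : toNecklace k I (X.el k) = 0 := by
  rw [toNecklace, QPath.el, Finsupp.linearCombination_single, one_smul, dif_neg h]

variable (I)

theorem toNecklace_surjective : Function.Surjective (toNecklace k I) := by
  rw [← LinearMap.range_eq_top, ← top_le_iff, ← span_basis, Submodule.span_le]
  rintro _ ⟨c, rfl⟩
  induction c using Quotient.ind with
  | _ X => exact ⟨X.1.el k, toNecklace_el k X.2⟩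

variable {I}

/-- The square connecting η_rt and η_or. For a path which is not closed both sides vanish, since the
word of the unbounded face has the same ends as the path. -/
theorem etaOr_toNecklace (x : PathModule k I) :
    etaOr k I (toNecklace k I x) = toOr k I (etaRt k I x) := by
  have : etaOr k I ∘ₗ toNecklace k I = toOr k I ∘ₗ etaRt k I := by
    refine Finsupp.lhom_ext' fun X => LinearMap.ext_ring ?_
    change etaOr k I (toNecklace k I (X.el k)) = toOr k I (etaRt k I (X.el k))
    rw [etaRt_el]
    by_cases h : X.IsClosed
    · rw [toNecklace_el k h, toOr_etaRtFun k h, etaOr_el]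
    · rw [toNecklace_el_of_not k h, toOr_etaRtFun_of_not k h, map_zero]
  exact DFunLike.congr_fun this x

theorem trunkOr_etaOr (x : NecklaceModule k I) : trunkOr k I (etaOr k I x) = x := by
  have : trunkOr k I ∘ₗ etaOr k I = LinearMap.id := by
    refine Finsupp.lhom_ext' fun c => LinearMap.ext_ring ?_
    induction c using Quotient.ind with
    | _ X => exact (congrArg (trunkOr k I) (etaOr_el k X.1 X.2)).trans (trunkOr_etaOrFun k X.1 X.2)
  exact DFunLike.congr_fun this x

variable (I) in
theorem etaOr_injective : Function.Injective (etaOr k I) :=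
  Function.LeftInverse.injective (trunkOr_etaOr k)

theorem QPath.isClosed_of_outer {X : QPath I} {c : ℕ × ℕ} (hc : X.IsChord c)
    (h : (X.outer c hc).IsClosed) : X.IsClosed := by
  rw [← facePath_singleton_none hc] at h
  exact QPath.isClosed_of_facePath _ h

theorem map_toNecklace_deltaRtFun {X : QPath I} (hX : X.IsClosed) :
    TensorProduct.map (toNecklace k I) (toNecklace k I) (antisymm k _ (deltaRtFun k X)) =
      deltaOrFun k X hX := by
  rw [map_antisymm, deltaRtFun, map_sum, map_sum]
  refine Finset.sum_congr rfl fun c _ => ?_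
  have hc := mem_chords.1 c.2
  rw [map_smul, map_smul, TensorProduct.map_tmul, toNecklace_el k (inner_isClosed hc),
    toNecklace_el k (outer_isClosed hc hX), neg_smul_antisymm]
  rfl

theorem map_toNecklace_deltaRtFun_of_not {X : QPath I} (hX : ¬ X.IsClosed) :
    TensorProduct.map (toNecklace k I) (toNecklace k I) (antisymm k _ (deltaRtFun k X)) = 0 := by
  rw [map_antisymm, deltaRtFun, map_sum, map_sum]
  refine Finset.sum_eq_zero fun c _ => ?_
  have hc := mem_chords.1 c.2
  rw [map_smul, TensorProduct.map_tmul,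
    toNecklace_el_of_not k fun h => hX (QPath.isClosed_of_outer hc h), TensorProduct.tmul_zero,
    smul_zero, map_zero]

theorem map_map_apply {M N L : Type*} [AddCommGroup M] [Module k M] [AddCommGroup N] [Module k N]
    [AddCommGroup L] [Module k L] {f : M →ₗ[k] N} {g : N →ₗ[k] L} {h : M →ₗ[k] L}
    (hgf : ∀ x, g (f x) = h x) (z : M ⊗[k] M) :
    TensorProduct.map g g (TensorProduct.map f f z) = TensorProduct.map h h z := by
  induction z with
  | zero => simp
  | add z z' hz hz' => simp only [map_add, hz, hz']
  | tmul x y => simp [hgf]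

/-- Expresses `δ_or` through `ρ` and η_or, using the left inverse `trunkOr`. As η_or is known not to
depend on the initial edge, neither does `δ_or`, and its chords need not be rotated separately. -/
theorem deltaOrFun_eq (X : QPath I) (hX : X.IsClosed) : deltaOrFun k X hX =
    TensorProduct.map (trunkOr k I) (trunkOr k I) (rhoOr k I (etaOrFun k X hX)) := by
  have h1 := DFunLike.congr_fun (isCoalgHom_toOr k I) (etaRt k I (X.el k))
  have h2 := DFunLike.congr_fun (isCoalgHom_etaRt k I).antisymm (X.el k)
  simp only [LinearMap.comp_apply] at h1 h2
  rw [etaRt_el, toOr_etaRtFun k hX] at h1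
  rw [etaRt_el] at h2
  rw [← h1, ← h2, deltaRt_el, ← map_toNecklace_deltaRtFun k hX,
    map_map_apply k (h := etaOr k I ∘ₗ toNecklace k I) (fun x => (etaOr_toNecklace k x).symm),
    map_map_apply k (fun x => trunkOr_etaOr k (toNecklace k I x))]

theorem deltaOr_el (X : QPath I) (hX : X.IsClosed) :
    deltaOr k I ((Necklace.of X hX).el k) = deltaOrFun k X hX := by
  rw [deltaOr, Necklace.el, Finsupp.linearCombination_single, one_smul, deltaOrFun_eq,
    deltaOrFun_eq]
  exact congrArg _ (congrArg _ (etaOrFun_congr k _ hX (Quotient.out_eq _)))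

variable (I)

theorem isCoalgHom_toNecklace :
    IsCoalgHom (antisymm k _ ∘ₗ deltaRt k I) (deltaOr k I) (toNecklace k I) := by
  refine Finsupp.lhom_ext' fun X => LinearMap.ext_ring ?_
  change TensorProduct.map _ _ (antisymm k _ (deltaRt k I (X.el k))) =
    deltaOr k I (toNecklace k I (X.el k))
  rw [deltaRt_el]
  by_cases h : X.IsClosed
  · rw [toNecklace_el k h, deltaOr_el, map_toNecklace_deltaRtFun k h]
  · rw [toNecklace_el_of_not k h, map_zero, map_toNecklace_deltaRtFun_of_not k h]

/-- Necklaces form a Lie coalgebra. -/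
theorem isLieCoalgebra_deltaOr : IsLieCoalgebra (deltaOr k I) where
  skew x := by
    rw [deltaOr, Finsupp.linearCombination_apply]
    exact Submodule.sum_mem _ fun c _ => Submodule.smul_mem _ _
      (Submodule.sum_mem _ fun p _ => Submodule.smul_mem _ _ (mem_span_wedge k _ _))
  coJacobi := coJacobi_of_surjective (toNecklace_surjective k I) (isCoalgHom_toNecklace k I)
    (isPreLieCoalgebra_deltaRt k I).coJacobi

theorem isCoalgHom_etaOr : IsCoalgHom (deltaOr k I) (rhoOr k I) (etaOr k I) :=
  IsCoalgHom.of_surjective (toNecklace_surjective k I) (isCoalgHom_etaRt k I).antisymm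
    (isCoalgHom_toNecklace k I) (isCoalgHom_toOr k I) (etaOr_toNecklace k)

end Necklace

end

end Necklaces

open scoped TensorProduct in
open Necklaces in
theorem theorem3p1 (k : Type*) [CommRing k] (I : Type*) [Quiver I] :
    -- The maps below do not depend on the choice of representatives of the basis elements.
    ((∀ X : RTree I, rhoRt k I (X.el k) = rhoRtFun k X) ∧
      (∀ X : OTree I, rhoOr k I (X.el k) = rhoOrFun k X) ∧
      (∀ X : RTree I, comulRt k I (SymmetricAlgebra.ι k _ (X.el k)) = comulRtFun k X) ∧
      (∀ (X : QPath I) (hX : X.IsClosed),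
        deltaOr k I ((Necklace.of X hX).el k) = deltaOrFun k X hX) ∧
      (∀ (X : QPath I) (hX : X.IsClosed),
        etaOr k I ((Necklace.of X hX).el k) = etaOrFun k X hX)) ∧
    -- `η_rt` is an injective homomorphism of pre-Lie coalgebras.
    (IsPreLieCoalgebra (deltaRt k I) ∧ IsPreLieCoalgebra (rhoRt k I) ∧
      IsCoalgHom (deltaRt k I) (rhoRt k I) (etaRt k I) ∧ Function.Injective (etaRt k I)) ∧
    -- `η_or` is an injective homomorphism of Lie coalgebras.
    (IsLieCoalgebra (deltaOr k I) ∧ IsLieCoalgebra (rhoOr k I) ∧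
      IsCoalgHom (deltaOr k I) (rhoOr k I) (etaOr k I) ∧ Function.Injective (etaOr k I)) ∧
    -- The multiplicative extension of `η_rt` is an injective homomorphism of Hopf algebras.
    (∃ (S : SymmetricAlgebra k (PathModule k I) →ₗ[k] SymmetricAlgebra k (PathModule k I))
        (S' : SymmetricAlgebra k (TRt k I) →ₗ[k] SymmetricAlgebra k (TRt k I)),
      IsHopfAlgebra (comulP k I) (symCounit k (PathModule k I)) S ∧
      IsHopfAlgebra (comulRt k I) (symCounit k (TRt k I)) S' ∧
      IsHopfHom (comulP k I) (symCounit k (PathModule k I)) S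
        (comulRt k I) (symCounit k (TRt k I)) S' (symEtaRt k I) ∧
      Function.Injective (symEtaRt k I)) := by
  exact ⟨⟨rhoRt_el k, rhoOr_el k, comulRt_ι k, deltaOr_el k, etaOr_el k⟩,
    ⟨isPreLieCoalgebra_deltaRt k I, isPreLieCoalgebra_rhoRt k I, isCoalgHom_etaRt k I,
      etaRt_injective k I⟩,
    ⟨isLieCoalgebra_deltaOr k I, isLieCoalgebra_rhoOr k I, isCoalgHom_etaOr k I,
      etaOr_injective k I⟩,
    hopf_main k I⟩
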